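/- **Setting.** Let $\mathcal H\cong\mathcal H'$ be Hilbert spaces of the same finite dimension $D$ with fixed orthonormal bases $|x\rangle$, $|x'\rangle$ ($0\le x<D$). Operators on $\mathcal H$ and $\mathcal H'$ are identified through these bases, and transpose $A^{\mathsf T}$ and complex conjugate $\bar A$ are taken with respect to them. Put $|\Gamma\rangle=\sum_x|xx'\rangle$. A state is a positive semidefinite operator of trace one, and the standard purification of a state $\rho$ is $\psi^{\rm std}_\rho=|\psi\rangle\langle\psi|$ with $|\psi\rangle=(\sqrt\rho\otimes I)|\Gamma\rangle$. Let $\mathcal A\subseteq L(\mathcal H)$ be a unital $*$-algebra with commutant $\mathcal A'$ and unitary group $U(\mathcal A)$. For a linear subspace $\mathcal S$ of operators, $\mathcal E_{\mathcal S}$ is the orthogonal projection onto $\mathcal S$ for the Hilbert–Schmidt inner product; $\mathcal A^{\mathsf T}=\{a^{\mathsf T}:a\in\mathcal A\}$. The $\mathcal A$-symmetric subspace $(\mathcal H\otimes\mathcal H')^{U(\mathcal A)}$ consists of the vectors invariant under $u\otimes\bar u$ for all $u\in U(\mathcal A)$, and $\Pi_{\mathcal A}$ is the orthogonal projection onto it.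 A decomposition of $\mathcal A$ is a unitary $U:\mathcal H\to\bigoplus_{\lambda\in\Lambda}\mathcal L_\lambda\otimes\mathcal R_\lambda$ ($\Lambda$ finite, all $\mathcal L_\lambda,\mathcal R_\lambda$ nonzero) with $U\mathcal AU^\dagger=\bigoplus_\lambda L(\mathcal L_\lambda)\otimes I_{\mathcal R_\lambda}$; let $P_\lambda$ be the orthogonal projection of $\mathcal H$ onto the $\lambda$-th summand and $\Omega=\sum_\lambda\frac{\dim\mathcal L_\lambda}{\dim\mathcal R_\lambda}P_\lambda^{\mathsf T}$. **Circuits.** An elementary gate is an arbitrary unitary on at most three qubits. A unitary circuit is a sequence of gates; a program may also measure qubits in the computational basis and branch on the outcomes. Its cost is the number of qubits plus the number of gates and measurements, both alternatives of every branching being counted. Input is given together with ancillas in state $|0\rangle$; at the end of a program all qubits other than the output qubits are discarded. The space $\mathcal H$ is stored in $n$ qubits ($D\le 2^n$), $|x\rangle$ as the binary expansion of $x$. The space $\mathcal H'$ is stored in $n'$ qubits, $|x'\rangle$ being arbitrary orthonormal states of these qubits. A basis vector $|i\rangle\otimes|j\rangle$ of $\mathcal L_\lambda\otimes\mathcal R_\lambda$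 is stored in three registers holding a code word for $\lambda$ (an arbitrary injective code) and the binary expansions of $i$ and $j$. A unitary circuit implements an isometry with error $\delta$ if it maps every vector $|v\rangle|0\rangle$ to the required output (with ancillas in $|0\rangle$) up to a vector of norm at most $\delta\|v\|$. **Theorem.** There is a polynomial $p$ with coefficients in $\mathbb N$ such that for every $D$ and every unital $*$-algebra $\mathcal A\subseteq L(\mathcal H)$, $\dim \mathcal H=D$, there is a quantum channel (completely positive trace-preserving map) $\mathcal P_{\mathcal A}:L(\mathcal H)\to L(\mathcal H\otimes\mathcal H')$ with the following properties. 1. *Random purification of invariant inputs.* For every state $\rho\in\mathcal A'$, $$\mathcal P_{\mathcal A}[\rho]=(\mathcal I\otimes\mathcal E_{\mathcal A^{\mathsf T}})[\psi^{\rm std}_\rho]=\int_G(I\otimes g^{\mathsf T})\,\psi^{\rm std}_\rho\,(I\otimes\bar g)\,dg$$ for every closed subgroup $G\subseteq U(\mathcal H)$ whose linear span is $\mathcal A'$, where $dg$ is the Haar probability measure. 2. *Symmetry of outputs.* For every state $\rho$ on $\mathcal H$, $\mathcal P_{\mathcal A}[\rho]$ is supported on $(\mathcal H\otimes\mathcal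 H')^{U(\mathcal A)}$, and it commutes with $I\otimes g^{\mathsf T}$ for all $g\in G$, for every $G$ as in 1. 3. *Efficiency.* Suppose that a unitary circuit implements the unitary $U$ of a decomposition of $\mathcal A$ with error $\delta$, that a unitary circuit implements the basis change $|x\rangle\mapsto|x'\rangle$ with error $\delta$, and that the sum of their costs is $s$. Then for every $K\in\mathbb N$ there is a program of cost at most $p(s+K)$ whose channel differs from $\mathcal P_{\mathcal A}$ by at most $p(s+K)\,\delta+2^{-K}$ in half the diamond norm (that is, for every input state, also one entangled with a reference system, and every two-outcome measurement on the output and the reference, the probabilities differ by at most this amount). 4. *Explicit formulas.* A decomposition of $\mathcal A$ exists, and for every decomposition and every state $\rho$ on $\mathcal H$, $$\mathcal P_{\mathcal A}[\rho]=\Pi_{\mathcal A}(\rho\otimes\Omega)\Pi_{\mathcal A}=\sqrt{\mathcal P_{\mathcal A}[I]}\,(\rho\otimes I)\,\sqrt{\mathcal P_{\mathcal A}[I]}.$$ -/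

import Mathlib

open scoped Matrix Kronecker MatrixOrder ComplexOrder

noncomputable section

namespace RandomPurification

/-! ### States, channels, and maps on operators

Operators on a Hilbert space with a fixed orthonormal basis indexed by `m` are matrices over `m`.
Operators on a tensor product are matrices over the product of the index types. -/

/-- Density matrices. -/
def IsState {m : Type*} [Fintype m] (ρ : Matrix m m ℂ) : Prop :=
  ρ.PosSemidef ∧ ρ.trace = 1

/-- The map `id ⊗ Φ` on operators on a tensor product with first factor indexed by `κ`. -/
def idTensor {m n : Type*} (κ : Type*) (Φ : Matrix m m ℂ →ₗ[ℂ] Matrix n n ℂ) :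
    Matrix (κ × m) (κ × m) ℂ →ₗ[ℂ] Matrix (κ × n) (κ × n) ℂ where
  toFun X := Matrix.of fun p q => Φ (Matrix.of fun i j => X (p.1, i) (q.1, j)) p.2 q.2
  map_add' X Y := by
    ext p q
    exact congrFun (congrFun (map_add Φ (Matrix.of fun i j => X (p.1, i) (q.1, j))
      (Matrix.of fun i j => Y (p.1, i) (q.1, j))) p.2) q.2
  map_smul' c X := by
    ext p q
    exact congrFun (congrFun (map_smul Φ c (Matrix.of fun i j => X (p.1, i) (q.1, j))) p.2) q.2

/-- Quantum channels: completely positive and trace-preserving linear maps. -/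
def IsChannel {m n : Type*} [Fintype m] [Fintype n]
    (Φ : Matrix m m ℂ →ₗ[ℂ] Matrix n n ℂ) : Prop :=
  (∀ (k : ℕ) (X : Matrix (Fin k × m) (Fin k × m) ℂ),
      X.PosSemidef → (idTensor (Fin k) Φ X).PosSemidef) ∧
  ∀ X, (Φ X).trace = X.trace

/-- The map `X ↦ K X K†`. -/
def conjMap {m n : Type*} [Fintype m] (K : Matrix n m ℂ) :
    Matrix m m ℂ →ₗ[ℂ] Matrix n n ℂ where
  toFun X := K * X * Kᴴ
  map_add' X Y := by rw [Matrix.mul_add, Matrix.add_mul]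
  map_smul' c X := by simp

/-- `Φ` and `Ψ` are `ε`-close in the completely bounded sense (half the diamond norm of the
difference): even in the presence of a reference system of arbitrary finite dimension, no two-outcome
measurement distinguishes their outputs with bias larger than `ε`. -/
def DiamondClose {m n : Type*} [Fintype m] [Fintype n] [DecidableEq n]
    (Φ Ψ : Matrix m m ℂ →ₗ[ℂ] Matrix n n ℂ) (ε : ℝ) : Prop :=
  ∀ (k : ℕ) (ρ : Matrix (Fin k × m) (Fin k × m) ℂ), IsState ρ →
    ∀ E : Matrix (Fin k × n) (Fin k × n) ℂ, E.PosSemidef → (1 - E).PosSemidef →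
      ‖(E * (idTensor (Fin k) Φ ρ - idTensor (Fin k) Ψ ρ)).trace‖ ≤ ε

/-! ### The standard purification -/

/-- The unnormalized maximally entangled vector `∑ₓ |x x'⟩`. -/
def Gam (D : ℕ) : Fin D × Fin D → ℂ := fun p => if p.1 = p.2 then 1 else 0

/-- The vector `(√ρ ⊗ I) |Γ⟩`. -/
def stdVec {D : ℕ} (ρ : Matrix (Fin D) (Fin D) ℂ) : Fin D × Fin D → ℂ :=
  (CFC.sqrt ρ ⊗ₖ (1 : Matrix (Fin D) (Fin D) ℂ)) *ᵥ Gam D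

/-- The standard purification as a density operator. -/
def stdPurification {D : ℕ} (ρ : Matrix (Fin D) (Fin D) ℂ) :
    Matrix (Fin D × Fin D) (Fin D × Fin D) ℂ :=
  Matrix.vecMulVec (stdVec ρ) (star (stdVec ρ))

/-! ### Algebras, commutants, projections -/

/-- The commutant `A'`. -/
abbrev commutant {D : ℕ} (A : StarSubalgebra ℂ (Matrix (Fin D) (Fin D) ℂ)) :
    StarSubalgebra ℂ (Matrix (Fin D) (Fin D) ℂ) :=
  StarSubalgebra.centralizer ℂ (A : Set (Matrix (Fin D) (Fin D) ℂ))

/-- `A` as a linear subspace. -/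
def asSubspace {D : ℕ} (A : StarSubalgebra ℂ (Matrix (Fin D) (Fin D) ℂ)) :
    Submodule ℂ (Matrix (Fin D) (Fin D) ℂ) :=
  Subalgebra.toSubmodule A.toSubalgebra

/-- The space `Aᵀ` of transposes of elements of `A`. -/
def transposeSubspace {D : ℕ} (A : StarSubalgebra ℂ (Matrix (Fin D) (Fin D) ℂ)) :
    Submodule ℂ (Matrix (Fin D) (Fin D) ℂ) :=
  (asSubspace A).map (Matrix.transposeLinearEquiv (Fin D) (Fin D) ℂ ℂ).toLinearMap

/-- The matrix space, identified with a Euclidean space in such a way that the inner product becomes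
the Hilbert-Schmidt inner product. -/
def hsEquiv (D : ℕ) : Matrix (Fin D) (Fin D) ℂ ≃ₗ[ℂ] EuclideanSpace ℂ (Fin D × Fin D) where
  toFun M := WithLp.toLp 2 fun p => M p.1 p.2
  invFun v := Matrix.of fun i j => v (i, j)
  map_add' _ _ := rfl
  map_smul' _ _ := rfl
  left_inv _ := rfl
  right_inv _ := rfl

/-- The orthogonal projection onto a space of matrices for the Hilbert-Schmidt inner product. -/
def hsProj {D : ℕ} (S : Submodule ℂ (Matrix (Fin D) (Fin D) ℂ)) :
    Matrix (Fin D) (Fin D) ℂ →ₗ[ℂ] Matrix (Fin D) (Fin D) ℂ :=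
  (hsEquiv D).symm.toLinearMap ∘ₗ
    ((S.map (hsEquiv D).toLinearMap).starProjection :
      EuclideanSpace ℂ (Fin D × Fin D) →ₗ[ℂ] EuclideanSpace ℂ (Fin D × Fin D)) ∘ₗ
    (hsEquiv D).toLinearMap

/-- The closed subgroup `G` of the unitary group linearly spans the commutant of `A`. -/
def SpansCommutant {D : ℕ} (A : StarSubalgebra ℂ (Matrix (Fin D) (Fin D) ℂ))
    (G : Subgroup (Matrix.unitaryGroup (Fin D) ℂ)) : Prop :=
  IsClosed (G : Set (Matrix.unitaryGroup (Fin D) ℂ)) ∧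
    Submodule.span ℂ ((fun g : Matrix.unitaryGroup (Fin D) ℂ => (g : Matrix (Fin D) (Fin D) ℂ)) ''
      (G : Set (Matrix.unitaryGroup (Fin D) ℂ))) = asSubspace (commutant A)

/-- The `A`-symmetric subspace: vectors invariant under `u ⊗ ū` for all unitaries `u ∈ A`. -/
def symmSubspace {D : ℕ} (A : StarSubalgebra ℂ (Matrix (Fin D) (Fin D) ℂ)) :
    Submodule ℂ (EuclideanSpace ℂ (Fin D × Fin D)) where
  carrier := {v | ∀ u ∈ A, u ∈ Matrix.unitaryGroup (Fin D) ℂ →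
    (u ⊗ₖ u.map (starRingEnd ℂ)) *ᵥ v.ofLp = v.ofLp}
  add_mem' {v w} hv hw := fun u hA hu => by
    rw [WithLp.ofLp_add, Matrix.mulVec_add, hv u hA hu, hw u hA hu]
  zero_mem' := fun u _ _ => by simp
  smul_mem' c v hv := fun u hA hu => by
    rw [WithLp.ofLp_smul, Matrix.mulVec_smul, hv u hA hu]

/-- The matrix of the orthogonal projection onto the `A`-symmetric subspace. -/
def symmProj {D : ℕ} (A : StarSubalgebra ℂ (Matrix (Fin D) (Fin D) ℂ)) :
    Matrix (Fin D × Fin D) (Fin D × Fin D) ℂ :=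
  (Matrix.toEuclideanCLM (n := Fin D × Fin D) (𝕜 := ℂ)).symm (symmSubspace A).starProjection

/-- A decomposition `U : H ≅ ⨁ₗ Lₗ ⊗ Rₗ` (with nonzero `Lₗ`, `Rₗ`) under which `A` becomes
`⨁ₗ L(Lₗ) ⊗ I`. -/
structure Decomposition {D : ℕ} (A : StarSubalgebra ℂ (Matrix (Fin D) (Fin D) ℂ)) where
  m : ℕ
  dL : Fin m → ℕ
  dR : Fin m → ℕ
  dL_pos : ∀ l, 0 < dL l
  dR_pos : ∀ l, 0 < dR l
  U : Matrix (Σ l : Fin m, Fin (dL l) × Fin (dR l)) (Fin D) ℂ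
  conjTranspose_mul_self : Uᴴ * U = 1
  mul_conjTranspose_self : U * Uᴴ = 1
  mem_iff : ∀ M : Matrix (Fin D) (Fin D) ℂ, M ∈ A ↔
    ∃ a : ∀ l, Matrix (Fin (dL l)) (Fin (dL l)) ℂ,
      U * M * Uᴴ = Matrix.blockDiagonal' fun l => a l ⊗ₖ (1 : Matrix (Fin (dR l)) (Fin (dR l)) ℂ)

/-- The orthogonal projection of `H` onto the `l`-th summand. -/
def Decomposition.proj {D : ℕ} {A : StarSubalgebra ℂ (Matrix (Fin D) (Fin D) ℂ)}
    (𝒟 : Decomposition A) (l : Fin 𝒟.m) : Matrix (Fin D) (Fin D) ℂ :=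
  𝒟.Uᴴ * Matrix.diagonal (fun s : (Σ l : Fin 𝒟.m, Fin (𝒟.dL l) × Fin (𝒟.dR l)) =>
    if s.1 = l then (1 : ℂ) else 0) * 𝒟.U

/-- The operator `Ω = ∑ₗ (dim Lₗ / dim Rₗ) Pₗᵀ` on the purifying space. -/
def Decomposition.Omega {D : ℕ} {A : StarSubalgebra ℂ (Matrix (Fin D) (Fin D) ℂ)}
    (𝒟 : Decomposition A) : Matrix (Fin D) (Fin D) ℂ :=
  ∑ l, ((𝒟.dL l : ℂ) / (𝒟.dR l : ℂ)) • (𝒟.proj l)ᵀ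

/-! ### Quantum circuits

A machine has `N` qubits ("wires"); its computational basis is indexed by `Fin N → Bool`. -/

/-- An elementary gate: an arbitrary unitary acting on at most three of `N` qubits. -/
structure Gate (N : ℕ) where
  arity : ℕ
  arity_le : arity ≤ 3
  wires : Fin arity ↪ Fin N
  mat : Matrix (Fin arity → Bool) (Fin arity → Bool) ℂ
  unitary : mat ∈ Matrix.unitaryGroup (Fin arity → Bool) ℂ

open Classical in
/-- The action of a gate on all `N` qubits. -/
def Gate.toMatrix {N : ℕ} (g : Gate N) : Matrix (Fin N → Bool) (Fin N → Bool) ℂ :=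
  Matrix.of fun y x =>
    if ∀ i, i ∉ Set.range g.wires → y i = x i then g.mat (y ∘ g.wires) (x ∘ g.wires) else 0

/-- The unitary of a circuit, given as the list of its gates in the order of application. -/
def circuitMatrix {N : ℕ} : List (Gate N) → Matrix (Fin N → Bool) (Fin N → Bool) ℂ
  | [] => 1
  | g :: gs => circuitMatrix gs * g.toMatrix

/-- Circuits with measurements and classical control. `branch w P Q` measures the qubit `w` in the
computational basis and proceeds with `P` on outcome `1` and with `Q` on outcome `0`. -/
inductive Prog (N : ℕ) : Type
  | skip : Prog N
  | gate (g : Gate N) : Prog N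
  | seq (P Q : Prog N) : Prog N
  | branch (w : Fin N) (P Q : Prog N) : Prog N

/-- The number of gates and measurements (both alternatives of every branching are counted). -/
def Prog.size {N : ℕ} : Prog N → ℕ
  | .skip => 0
  | .gate _ => 1
  | .seq P Q => P.size + Q.size
  | .branch _ P Q => 1 + P.size + Q.size

/-- The projection onto the states in which the qubit `w` has the value `b`. -/
def wireProj {N : ℕ} (w : Fin N) (b : Bool) : Matrix (Fin N → Bool) (Fin N → Bool) ℂ :=
  Matrix.diagonal fun x => if x w = b then 1 else 0

/-- The channel on `N` qubits that a program performs. -/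
def Prog.eval {N : ℕ} : Prog N →
    (Matrix (Fin N → Bool) (Fin N → Bool) ℂ →ₗ[ℂ] Matrix (Fin N → Bool) (Fin N → Bool) ℂ)
  | .skip => LinearMap.id
  | .gate g => conjMap g.toMatrix
  | .seq P Q => Q.eval ∘ₗ P.eval
  | .branch w P Q =>
      P.eval ∘ₗ conjMap (wireProj w true) + Q.eval ∘ₗ conjMap (wireProj w false)

/-- The first `n` binary digits of `x`. -/
def binary (n x : ℕ) : Fin n → Bool := fun i => x.testBit i

/-- The basis state of `N` qubits with the bits `x` on the wires `e` and zeros elsewhere. -/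
def place {κ : Type*} {N : ℕ} (e : κ ↪ Fin N) (x : κ → Bool) : Fin N → Bool :=
  Function.extend e x fun _ => false

/-- The linear map `|i⟩ ↦ |f i⟩`. -/
def encode {m c : Type*} [DecidableEq c] (f : m → c) : Matrix c m ℂ :=
  Matrix.of fun y i => if y = f i then 1 else 0

open Classical in
/-- The partial trace over all wires outside of the range of `o`. -/
def readOut {κ : Type*} [Fintype κ] {N : ℕ} (o : κ ↪ Fin N) :
    Matrix (Fin N → Bool) (Fin N → Bool) ℂ →ₗ[ℂ] Matrix (κ → Bool) (κ → Bool) ℂ where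
  toFun X := Matrix.of fun y y' => ∑ c : Fin N → Bool, ∑ c' : Fin N → Bool,
    if c ∘ o = y ∧ c' ∘ o = y' ∧ ∀ i, i ∉ Set.range o → c i = c' i then X c c' else 0
  map_add' X Y := by
    ext y y'
    simp only [Matrix.of_apply, Matrix.add_apply, ← Finset.sum_add_distrib]
    refine Finset.sum_congr rfl fun c _ => Finset.sum_congr rfl fun c' _ => ?_
    split_ifs <;> simp
  map_smul' a X := by
    ext y y'
    simp only [Matrix.of_apply, Matrix.smul_apply, Finset.smul_sum, RingHom.id_apply]
    refine Finset.sum_congr rfl fun c _ => Finset.sum_congr rfl fun c' _ => ?_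
    split_ifs <;> simp

/-- The states `W |src v⟩` and `|tgt v⟩` differ by at most `δ ‖v‖`, for every vector `v`. -/
def ApproxMaps {D N : ℕ} (W : List (Gate N)) (src tgt : Matrix (Fin N → Bool) (Fin D) ℂ)
    (δ : ℝ) : Prop :=
  ∀ v : Fin D → ℂ,
    ‖WithLp.toLp 2 ((circuitMatrix W * src - tgt) *ᵥ v)‖ ≤ δ * ‖WithLp.toLp 2 v‖

/-- A circuit (clean ancillas) that implements the unitary of a decomposition up to error `δ`. The
basis vector `|x⟩` of `H` is stored as the binary expansion of `x` in `n` qubits; the basis vector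
`|i⟩ ⊗ |j⟩` of the `l`-th summand is stored in three registers that hold a code word for `l` and the
binary expansions of `i` and `j`. -/
structure DecompositionCircuit {D : ℕ} {A : StarSubalgebra ℂ (Matrix (Fin D) (Fin D) ℂ)}
    (𝒟 : Decomposition A) (n : ℕ) (δ : ℝ) where
  N : ℕ
  W : List (Gate N)
  a : ℕ
  b : ℕ
  c : ℕ
  inp : Fin n ↪ Fin N
  out : Fin a ⊕ (Fin b ⊕ Fin c) ↪ Fin N
  code : Fin 𝒟.m ↪ (Fin a → Bool)
  dL_le : ∀ l, 𝒟.dL l ≤ 2 ^ b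
  dR_le : ∀ l, 𝒟.dR l ≤ 2 ^ c
  approx : ApproxMaps W (encode fun x : Fin D => place inp (binary n x))
    (encode (fun s : (Σ l : Fin 𝒟.m, Fin (𝒟.dL l) × Fin (𝒟.dR l)) =>
      place out (Sum.elim (code s.1) (Sum.elim (binary b s.2.1) (binary c s.2.2)))) * 𝒟.U) δ

/-- The number of qubits and gates of the circuit. -/
def DecompositionCircuit.cost {D : ℕ} {A : StarSubalgebra ℂ (Matrix (Fin D) (Fin D) ℂ)}
    {𝒟 : Decomposition A} {n : ℕ} {δ : ℝ} (C : DecompositionCircuit 𝒟 n δ) : ℕ :=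
  C.N + C.W.length

/-- A circuit that implements the basis change `|x⟩ ↦ |x'⟩` up to error `δ`. The space `H'` is stored
in `n'` qubits in such a way that `|x'⟩` is the `x`-th column of `V`. -/
structure BasisChangeCircuit {D n' : ℕ} (V : Matrix (Fin n' → Bool) (Fin D) ℂ) (n : ℕ)
    (δ : ℝ) where
  N : ℕ
  W : List (Gate N)
  inp : Fin n ↪ Fin N
  out : Fin n' ↪ Fin N
  approx : ApproxMaps W (encode fun x : Fin D => place inp (binary n x))
    (encode (place out) * V) δ

/-- The number of qubits and gates of the circuit. -/
def BasisChangeCircuit.cost {D n' : ℕ} {V : Matrix (Fin n' → Bool) (Fin D) ℂ} {n : ℕ} {δ : ℝ}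
    (C : BasisChangeCircuit V n δ) : ℕ :=
  C.N + C.W.length

/-- The isometry that stores `H ⊗ H'` in `n + n'` qubits: `|x⟩ ⊗ |y'⟩` becomes the binary expansion
of `x`, tensor the `y`-th column of `V`. -/
def storeOut {D n' : ℕ} (n : ℕ) (V : Matrix (Fin n' → Bool) (Fin D) ℂ) :
    Matrix (Fin n ⊕ Fin n' → Bool) (Fin D × Fin D) ℂ :=
  Matrix.of fun z p => (if z ∘ Sum.inl = binary n p.1 then 1 else 0) * V (z ∘ Sum.inr) p.2

/-- The channel performed by a program: store the input state (on `ℂ^D`, in binary) on the wires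
`inp`, with all other wires in state `0`; run the program; discard all wires outside of `out`. -/
def Prog.channel {N D n : ℕ} {κ : Type*} [Fintype κ] (Q : Prog N) (inp : Fin n ↪ Fin N)
    (out : κ ↪ Fin N) :
    Matrix (Fin D) (Fin D) ℂ →ₗ[ℂ] Matrix (κ → Bool) (κ → Bool) ℂ :=
  readOut out ∘ₗ Q.eval ∘ₗ conjMap (encode fun x : Fin D => place inp (binary n x))

end RandomPurification

end

noncomputable section
set_option linter.unusedSectionVars false
namespace RandomPurification

/-! ### Existence of a decomposition -/

/-! The channel. In a basis adapted to a decomposition, `A` is `⨁ L(L_λ) ⊗ I` and its commutant is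
`⨁ I ⊗ L(R_λ)`. A vector of the doubled space, read as a matrix `M`, is fixed by `u ⊗ ū` exactly if
`u M u† = M`, so the symmetric subspace is the commutant (`mem_symmSubspace_iff`). For `t = (λ, i,
j')` the Kraus operator `kraus t` is given by an explicit formula that a circuit can follow.
Comparing inner products with symmetric vectors identifies it as `√(dim L_λ / dim R_λ)` times the
projection `Π` onto the symmetric subspace applied to "tensor with the basis vector `Ū†|t⟩`"
(`kraus_eq`). Summing over `t` yields `Π (ρ ⊗ Ω) Π` at once, and `sum_kraus` yields trace
preservation.

Since `Ωᵀ` is central in `A`, `1 ⊗ Ω` commutes with `Π`. Hence `P(1) = (1 ⊗ Ω) Π`, its square root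
is `Π (1 ⊗ √Ω)`, and the second explicit formula follows. The decisive fact is `hsProj_single`: the
blocks of `P(1)` are the projections of the matrix units onto `Aᵀ`, in other words `P(1)` is `id ⊗
E` applied to the unnormalized maximally entangled operator. It follows from the double commutant
property, the transpose trick `(1 ⊗ aᵀ) Π = (a ⊗ 1) Π` for `a ∈ A`, and trace preservation. It shows
that the channel does not depend on the decomposition (`purify_unique`). For invariant `ρ`, the
operator `√ρ ⊗ 1` commutes with `Π` and can be pulled out of `P(ρ)`, which gives the random
purification. The Haar average is the same projection by invariance and double commutation
(`hsProj_eq_twirl`).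

The circuit. Apply `U` to obtain `|λ, i, j⟩`. Prepare `(dim L_λ · dim R_λ)^(-1/2) ∑ |i', j'⟩` in a
second register and copy `λ` there. Record `(λ, i, j')` in a label register, and replace `i` by `i'`
in the first register. Undo `U` on the first register and the complex conjugate of `U` on the
second, then change basis on the second. The result is `∑ₜ |t⟩ ⊗ K_t`, and discarding the label
gives the channel (`readOut_outState`).

The dimensions are not given to the circuit and the code for `λ` is arbitrary, so the uniform state
is prepared by trial. Code words are recognized by conjugating a comparison with `D` by the circuit
for `U`. Testing words with a single nonzero bit shows which bits may occur. The code words fill at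
least a quarter of the cube on these bits, so Hadamard gates followed by a test succeed with
probability at least `1/4`. Repetition with a controlled swap leaves an error of weight `(3/4)^k`
(`exists_rounds`). The garbage left behind depends on `λ` only, which the label records anyway, so
it does no harm.

Errors are managed by `exists_unitary_near`: a unitary that nearly maps one isometry to another is
close to one that does so exactly. Each imperfect component is replaced by such an ideal unitary,
the circuit is analysed exactly, and `Approx` adds up costs and errors. -/

theorem aeval_real_mem {D : ℕ} (A : StarSubalgebra ℂ (Matrix (Fin D) (Fin D) ℂ))
    {b : Matrix (Fin D) (Fin D) ℂ} (hb : b ∈ A) (q : Polynomial ℝ) : Polynomial.aeval b q ∈ A := by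
  induction q using Polynomial.induction_on' with
  | add p q hp hq => rw [map_add]; exact add_mem hp hq
  | monomial n a =>
    rw [Polynomial.aeval_monomial]
    refine mul_mem ?_ (pow_mem hb n)
    have : algebraMap ℝ (Matrix (Fin D) (Fin D) ℂ) a = algebraMap ℂ _ (a : ℂ) := by
      rw [IsScalarTower.algebraMap_apply ℝ ℂ]; rfl
    rw [this]
    exact algebraMap_mem A _

/-- The spectrum is finite, so on it the function equals a Lagrange interpolation polynomial, and no
closure of the algebra is involved. This keeps spectral projections inside `A` and `√ρ` inside the
commutant. -/
theorem cfc_real_mem {D : ℕ} (A : StarSubalgebra ℂ (Matrix (Fin D) (Fin D) ℂ))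
    {b : Matrix (Fin D) (Fin D) ℂ} (hb : b ∈ A) (hsa : IsSelfAdjoint b) (f : ℝ → ℝ) :
    cfc f b ∈ A := by
  classical
  have hfin : (spectrum ℝ b).Finite := Matrix.finite_real_spectrum
  set s := hfin.toFinset with hs
  let q := Lagrange.interpolate s id f
  have hq : cfc f b = Polynomial.aeval b q := by
    rw [← cfc_polynomial q b hsa]
    refine cfc_congr fun x hx => ?_
    have hxs : x ∈ s := by simpa [hs] using hx
    exact (Lagrange.eval_interpolate_at_node (v := id) f (Function.injective_id.injOn) hxs).symm
  rw [hq]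
  exact aeval_real_mem A hb q

theorem continuousOn_real_spectrum {n : Type*} [Fintype n] [DecidableEq n] (b : Matrix n n ℂ)
    (f : ℝ → ℝ) :
    ContinuousOn f (spectrum ℝ b) :=
  (Matrix.finite_real_spectrum (A := b)).continuousOn f

/-- A self-adjoint element of a corner that is not scalar yields a nontrivial projection there. -/
theorem exists_subprojection {D : ℕ} (A : StarSubalgebra ℂ (Matrix (Fin D) (Fin D) ℂ))
    {b p : Matrix (Fin D) (Fin D) ℂ} (hb : b ∈ A) (hsa : IsSelfAdjoint b)
    (hpb : p * b = b) (hp : IsSelfAdjoint p) (hne : ∀ c : ℂ, b ≠ c • p) :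
    ∃ q ∈ A, IsStarProjection q ∧ q ≠ 0 ∧ q ≠ p ∧ p * q = q ∧ q * p = q := by
  have hb0 : b ≠ 0 := fun h => hne 0 (by simp [h])
  obtain ⟨β, hβ, hβ0⟩ : ∃ β ∈ spectrum ℝ b, β ≠ 0 := by
    by_contra! h
    apply hb0
    rw [← cfc_id' ℝ b hsa, cfc_congr (g := fun _ => (0 : ℝ)) (fun x hx => h x hx)]
    simp
  -- `cfc f b` is the spectral projection for a nonzero eigenvalue `β`. Since `b` acts on it as `β ≠
  -- 0`, it is `β⁻¹ b` times itself and hence lies below `p`. It is not `p`, because then `b = β p`.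
  let f : ℝ → ℝ := fun x => if x = β then 1 else 0
  have hc : ∀ g : ℝ → ℝ, ContinuousOn g (spectrum ℝ b) := continuousOn_real_spectrum b
  have hidem : cfc f b * cfc f b = cfc f b := by
    rw [← cfc_mul f f b (hc _) (hc _)]
    exact cfc_congr fun x _ => by simp [f]
  have hself : IsSelfAdjoint (cfc f b) := cfc_predicate f b
  have hbq : b * cfc f b = (β : ℂ) • cfc f b := by
    have h1 : b * cfc f b = cfc (fun x => x * f x) b := by
      rw [cfc_mul (fun x => x) f b (hc _) (hc _), cfc_id' ℝ b hsa]
    have h2 : cfc (fun x => x * f x) b = β • cfc f b := by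
      rw [← cfc_smul β f b (hc _)]
      refine cfc_congr fun x _ => ?_
      simp only [f, smul_eq_mul]
      split_ifs with h <;> simp [h]
    rw [h1, h2]
    ext i j
    simp
  have hβc : (β : ℂ) ≠ 0 := by exact_mod_cast hβ0
  have hpq : p * cfc f b = cfc f b := by
    have : cfc f b = (β : ℂ)⁻¹ • (b * cfc f b) := by rw [hbq, smul_smul, inv_mul_cancel₀ hβc, one_smul]
    rw [this, Matrix.mul_smul, ← mul_assoc, hpb]
  refine ⟨cfc f b, cfc_real_mem A hb hsa f, ⟨hidem, hself⟩, ?_, ?_, hpq, ?_⟩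
  · intro h0
    have := cfc_map_spectrum (R := ℝ) f b hsa (hc _)
    have h1 : (1 : ℝ) ∈ spectrum ℝ (cfc f b) := by
      rw [this]; exact ⟨β, hβ, by simp [f]⟩
    rw [h0] at h1
    by_cases hD : Nontrivial (Matrix (Fin D) (Fin D) ℂ)
    · simp [spectrum.zero_eq] at h1
    · rw [not_nontrivial_iff_subsingleton] at hD
      exact hb0 (Subsingleton.elim _ _)
  · intro hqp
    apply hne β
    have h1 : b * p = b := by
      have := congrArg star hpb
      rwa [star_mul, hsa.star_eq, hp.star_eq] at this
    rw [← h1, ← hqp, hbq]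
  · have := congrArg star hpq
    rwa [star_mul, hself.star_eq, hp.star_eq] at this

/-- A family of nonzero projections in `A` that are pairwise orthogonal and sum to one. -/
structure IsProjFamily {D : ℕ} (A : StarSubalgebra ℂ (Matrix (Fin D) (Fin D) ℂ)) {ι : Type}
    [Fintype ι] (p : ι → Matrix (Fin D) (Fin D) ℂ) : Prop where
  mem : ∀ k, p k ∈ A
  proj : ∀ k, IsStarProjection (p k)
  ne_zero : ∀ k, p k ≠ 0
  orth : ∀ k l, k ≠ l → p k * p l = 0
  sum : ∑ k, p k = 1

/-- Orthogonal nonzero projections are linearly independent. The bound makes a family of maximal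
size available. -/
theorem IsProjFamily.card_le {D : ℕ} {A : StarSubalgebra ℂ (Matrix (Fin D) (Fin D) ℂ)} {ι : Type}
    [Fintype ι] {p : ι → Matrix (Fin D) (Fin D) ℂ} (h : IsProjFamily A p) :
    Fintype.card ι ≤ D * D := by
  have hli : LinearIndependent ℂ p := by
    classical
    rw [Fintype.linearIndependent_iff]
    intro g hg i
    have h1 := congrArg (p i * ·) hg
    simp only [Finset.mul_sum, Matrix.mul_smul, mul_zero] at h1
    rw [Finset.sum_eq_single i (fun j _ hj => by rw [h.orth i j hj.symm, smul_zero])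
      (by simp), (h.proj i).isIdempotentElem.eq] at h1
    exact (smul_eq_zero.mp h1).resolve_right (h.ne_zero i)
  have := hli.fintype_card_le_finrank
  rwa [Module.finrank_matrix, Module.finrank_self, mul_one, Fintype.card_fin] at this

/-- The member `p k` is replaced by `q`, and the new index `none` carries the remainder `p k - q`.
-/
theorem IsProjFamily.split {D : ℕ} {A : StarSubalgebra ℂ (Matrix (Fin D) (Fin D) ℂ)} {ι : Type}
    [Fintype ι] {p : ι → Matrix (Fin D) (Fin D) ℂ} (h : IsProjFamily A p) (k : ι)
    {q : Matrix (Fin D) (Fin D) ℂ} (hq : q ∈ A) (hqp : IsStarProjection q) (hq0 : q ≠ 0)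
    (hqk : q ≠ p k) (hpq : p k * q = q) (hqp' : q * p k = q) :
    ∃ p' : Option ι → Matrix (Fin D) (Fin D) ℂ, IsProjFamily A p' := by
  classical
  have ho1 : ∀ l, l ≠ k → q * p l = 0 := fun l hl => by
    rw [← hqp', mul_assoc, h.orth k l hl.symm, mul_zero]
  have ho2 : ∀ l, l ≠ k → p l * q = 0 := fun l hl => by
    rw [← hpq, ← mul_assoc, h.orth l k hl, zero_mul]
  have hid := hqp.isIdempotentElem.eq
  have hpk := (h.proj k).isIdempotentElem.eq
  refine ⟨fun o => o.elim (p k - q) (Function.update p k q), ?_, ?_, ?_, ?_, ?_⟩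
  · rintro (_ | l)
    · exact sub_mem (h.mem k) hq
    · by_cases hl : l = k
      · subst hl; simpa using hq
      · simpa [hl] using h.mem l
  · rintro (_ | l)
    · refine ⟨?_, ?_⟩
      · change (p k - q) * (p k - q) = p k - q
        rw [sub_mul, mul_sub, mul_sub, hpk, hpq, hqp', hid]; simp
      · exact (h.proj k).isSelfAdjoint.sub hqp.isSelfAdjoint
    · by_cases hl : l = k
      · subst hl; simpa using hqp
      · simpa [hl] using h.proj l
  · rintro (_ | l)
    · exact sub_ne_zero.mpr hqk.symm
    · by_cases hl : l = k
      · subst hl; simpa using hq0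
      · simpa [hl] using h.ne_zero l
  · rintro (_ | l) (_ | l') hne
    · exact absurd rfl hne
    · by_cases hl : l' = k
      · subst hl; simp [sub_mul, hpq, hid]
      · simp [hl, sub_mul, ho1 l' hl, h.orth k l' (Ne.symm hl)]
    · by_cases hl : l = k
      · subst hl; simp [mul_sub, hqp', hid]
      · simp [hl, mul_sub, ho2 l hl, h.orth l k hl]
    · have hne' : l ≠ l' := fun h => hne (by rw [h])
      by_cases hl : l = k
      · subst hl
        simp [hne'.symm, ho1 l' hne'.symm]
      · by_cases hl' : l' = k
        · subst hl'; simp [hl, ho2 l hl]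
        · simp [hl, hl', h.orth l l' hne']
  · rw [Fintype.sum_option]
    simp only [Option.elim]
    rw [Finset.sum_update_of_mem (Finset.mem_univ k)]
    have := h.sum
    rw [← Finset.add_sum_erase _ _ (Finset.mem_univ k)] at this
    rw [← this, Finset.sdiff_singleton_eq_erase]
    abel

/-- In a family of maximal size no member can be split, so by `exists_subprojection` every
self-adjoint element of a corner `p k A p k` is scalar. This makes the members minimal projections.
-/
theorem exists_maximal_projFamily {D : ℕ} (A : StarSubalgebra ℂ (Matrix (Fin D) (Fin D) ℂ)) :
    ∃ (m : ℕ) (p : Fin m → Matrix (Fin D) (Fin D) ℂ), IsProjFamily A p ∧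
      ∀ k, ∀ x ∈ A, ∃ c : ℂ, p k * x * p k = c • p k := by
  classical
  let S : Set ℕ := {m | ∃ p : Fin m → Matrix (Fin D) (Fin D) ℂ, IsProjFamily A p}
  have hne : S.Nonempty := by
    rcases subsingleton_or_nontrivial (Matrix (Fin D) (Fin D) ℂ) with h | h
    · exact ⟨0, fun _ => 0, ⟨fun k => k.elim0, fun k => k.elim0, fun k => k.elim0,
        fun k => k.elim0, Subsingleton.elim _ _⟩⟩
    · exact ⟨1, fun _ => 1, ⟨fun _ => one_mem A, fun _ => ⟨mul_one 1, star_one _⟩,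
        fun _ => one_ne_zero, fun k l hkl => absurd (Subsingleton.elim k l) hkl, by simp⟩⟩
  have hbdd : BddAbove S := ⟨D * D, fun m ⟨p, hp⟩ => by simpa using hp.card_le⟩
  obtain ⟨p, hp⟩ := Nat.sSup_mem hne hbdd
  refine ⟨sSup S, p, hp, fun k => ?_⟩
  have hpk := (hp.proj k).isIdempotentElem.eq
  have hps := (hp.proj k).isSelfAdjoint
  have hsa : ∀ b ∈ A, IsSelfAdjoint b → p k * b = b → ∃ c : ℂ, b = c • p k := by
    intro b hb hbs hpb
    by_contra! hcon
    obtain ⟨q, hqA, hqp, hq0, hqk, h1, h2⟩ := exists_subprojection A hb hbs hpb hps hcon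
    obtain ⟨p', hp'⟩ := hp.split k hqA hqp hq0 hqk h1 h2
    have hmem : sSup S + 1 ∈ S := by
      let e : Fin (sSup S + 1) ≃ Option (Fin (sSup S)) := finSuccEquiv _
      refine ⟨p' ∘ e, fun k => hp'.mem _, fun k => hp'.proj _, fun k => hp'.ne_zero _,
        fun k l hkl => hp'.orth _ _ (e.injective.ne hkl), ?_⟩
      rw [← hp'.sum]
      exact Equiv.sum_comp e p'
    exact absurd (le_csSup hbdd hmem) (by omega)
  intro x hx
  set y := p k * x * p k with hy
  have hyA : y ∈ A := mul_mem (mul_mem (hp.mem k) hx) (hp.mem k)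
  have hpy : p k * y = y := by rw [hy, ← mul_assoc, ← mul_assoc, hpk]
  have hpy' : p k * star y = star y := by
    rw [hy, star_mul, star_mul, hps.star_eq, ← mul_assoc, hpk]
  -- The real and the imaginary part of `y` are self-adjoint elements of the corner, hence scalar,
  -- and therefore so is `y`.
  obtain ⟨c₁, h₁⟩ := hsa (y + star y) (add_mem hyA (star_mem hyA)) (IsSelfAdjoint.add_star_self y)
    (by rw [mul_add, hpy, hpy'])
  obtain ⟨c₂, h₂⟩ := hsa (Complex.I • (y - star y))
    (SMulMemClass.smul_mem _ (sub_mem hyA (star_mem hyA)))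
    (by
      rw [IsSelfAdjoint, star_smul, star_sub, star_star, Complex.star_def, Complex.conj_I,
        neg_smul, ← smul_neg, neg_sub])
    (by rw [Matrix.mul_smul, mul_sub, hpy, hpy'])
  refine ⟨(c₁ - Complex.I * c₂) / 2, ?_⟩
  have h₃ : y - star y = (-(Complex.I * c₂)) • p k := by
    have := congrArg (fun z => (-Complex.I) • z) h₂
    simp only [smul_smul] at this
    rw [neg_mul, Complex.I_mul_I, neg_neg, one_smul] at this
    rw [this, neg_mul]
  have h₄ : (2 : ℂ) • y = (c₁ - Complex.I * c₂) • p k := by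
    rw [sub_eq_add_neg, add_smul, ← h₁, ← h₃, two_smul]; abel
  rw [div_eq_inv_mul, mul_smul, ← h₄, smul_smul]; norm_num

/-- Minimal projections are connected by a partial isometry or do not interact. -/
theorem exists_partialIsometry {D : ℕ} {A : StarSubalgebra ℂ (Matrix (Fin D) (Fin D) ℂ)}
    {p q x : Matrix (Fin D) (Fin D) ℂ}
    (hp : p ∈ A) (hq : q ∈ A) (hpp : IsStarProjection p) (hqp : IsStarProjection q)
    (hpA : ∀ x ∈ A, ∃ c : ℂ, p * x * p = c • p)
    (hqA : ∀ x ∈ A, ∃ c : ℂ, q * x * q = c • q) (hx : x ∈ A) (h0 : p * x * q ≠ 0) :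
    ∃ v ∈ A, v * vᴴ = p ∧ vᴴ * v = q := by
  set y := p * x * q with hy
  have hyA : y ∈ A := mul_mem (mul_mem hp hx) hq
  have hps : pᴴ = p := hpp.isSelfAdjoint.star_eq
  have hqs : qᴴ = q := hqp.isSelfAdjoint.star_eq
  have hpi := hpp.isIdempotentElem.eq
  have hqi := hqp.isIdempotentElem.eq
  have hpy : p * y = y := by rw [hy, ← mul_assoc, ← mul_assoc, hpi]
  have hyq : y * q = y := by rw [hy, mul_assoc, hqi]
  have hp0 : p ≠ 0 := fun h => h0 (by rw [hy, h]; simp)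
  clear_value y
  have hyp : yᴴ * p = yᴴ := by rw [← hps, ← Matrix.conjTranspose_mul, hpy]
  have hqy : q * yᴴ = yᴴ := by rw [← hqs, ← Matrix.conjTranspose_mul, hyq]
  obtain ⟨c, hc⟩ := hpA (y * yᴴ) (mul_mem hyA (star_mem hyA))
  obtain ⟨d, hd⟩ := hqA (yᴴ * y) (mul_mem (star_mem hyA) hyA)
  have hc' : y * yᴴ = c • p := by rw [← hc, ← mul_assoc, hpy, mul_assoc, hyp]
  have hd' : yᴴ * y = d • q := by rw [← hd, ← mul_assoc, hqy, mul_assoc, hyq]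
  -- Both constants are obtained by evaluating `y yᴴ y`, once from each side. Dividing `y` by the
  -- square root of the common value, which is positive, gives the partial isometry.
  have hcd : c = d := by
    have h1 : c • y = d • y := by
      rw [← hpy, ← Matrix.smul_mul, ← hc', mul_assoc, hpy, hd', Matrix.mul_smul, hyq]
    exact smul_left_injective ℂ h0 h1
  have hc0 : c ≠ 0 := fun h => h0 (by
    rw [h, zero_smul] at hc'
    exact Matrix.self_mul_conjTranspose_eq_zero.mp hc')
  have hpsd : p.PosSemidef := by
    rw [← hpi]; nth_rewrite 1 [← hps]; exact Matrix.posSemidef_conjTranspose_mul_self p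
  have htr : 0 < p.trace := lt_of_le_of_ne hpsd.trace_nonneg
    (fun h => hp0 (hpsd.trace_eq_zero_iff.mp h.symm))
  have htr2 : 0 ≤ c * p.trace := by
    rw [← smul_eq_mul, ← Matrix.trace_smul, ← hc']
    exact (Matrix.posSemidef_self_mul_conjTranspose y).trace_nonneg
  have hcpos : 0 ≤ c := by
    have h2 : 0 ≤ c * p.trace * (p.trace)⁻¹ := mul_nonneg htr2 (inv_nonneg.mpr htr.le)
    rwa [mul_assoc, mul_inv_cancel₀ htr.ne', mul_one] at h2
  obtain ⟨r, hr⟩ : ∃ r : ℝ, c = r := ⟨c.re, by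
    apply Complex.ext <;> simp [← (Complex.nonneg_iff.mp hcpos).2]⟩
  have hr0 : 0 < r := by
    have : (0 : ℂ) < r := hr ▸ lt_of_le_of_ne hcpos (Ne.symm hc0)
    exact_mod_cast this
  have hsq : ((Real.sqrt r)⁻¹ : ℂ) * ((Real.sqrt r)⁻¹ : ℂ) * (r : ℂ) = 1 := by
    rw [← mul_inv, ← Complex.ofReal_mul, Real.mul_self_sqrt hr0.le]
    exact inv_mul_cancel₀ (by exact_mod_cast hr0.ne')
  refine ⟨((Real.sqrt r)⁻¹ : ℂ) • y, SMulMemClass.smul_mem _ hyA, ?_, ?_⟩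
  · rw [Matrix.conjTranspose_smul, Matrix.smul_mul, Matrix.mul_smul, hc', smul_smul, smul_smul, hr]
    simp only [star_inv₀, Complex.star_def, Complex.conj_ofReal]
    rw [hsq, one_smul]
  · rw [Matrix.conjTranspose_smul, Matrix.smul_mul, Matrix.mul_smul, hd', ← hcd, smul_smul,
      smul_smul, hr]
    simp only [star_inv₀, Complex.star_def, Complex.conj_ofReal]
    rw [hsq, one_smul]

/-- The defect `v - p v` times its own adjoint expands to `p - p - p + p = 0`. -/
theorem mul_eq_self_of_mul_conjTranspose {D : ℕ} {p v : Matrix (Fin D) (Fin D) ℂ}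
    (hp : IsStarProjection p) (hv : v * vᴴ = p) : p * v = v := by
  have hps : pᴴ = p := hp.isSelfAdjoint.star_eq
  have hpi := hp.isIdempotentElem.eq
  have h : (v - p * v) * (v - p * v)ᴴ = 0 := by
    have h1 : v * (vᴴ * p) = p := by rw [← Matrix.mul_assoc, hv, hpi]
    rw [Matrix.conjTranspose_sub, Matrix.conjTranspose_mul, hps, Matrix.sub_mul, Matrix.mul_sub,
      Matrix.mul_sub, hv, Matrix.mul_assoc, hv, Matrix.mul_assoc p v, h1, hpi]
    simp
  exact (sub_eq_zero.mp (Matrix.self_mul_conjTranspose_eq_zero.mp h)).symm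

/-- The columns of `B` are the eigenvectors of `p` with eigenvalue one in an orthonormal eigenbasis.
-/
theorem exists_isometry_of_projection {D : ℕ} {p : Matrix (Fin D) (Fin D) ℂ}
    (hp : IsStarProjection p) (h0 : p ≠ 0) :
    ∃ (d : ℕ) (B : Matrix (Fin D) (Fin d) ℂ), 0 < d ∧ Bᴴ * B = 1 ∧ B * Bᴴ = p := by
  classical
  have hH : p.IsHermitian := hp.isSelfAdjoint
  let V : Matrix (Fin D) (Fin D) ℂ := hH.eigenvectorUnitary
  have hV1 : Vᴴ * V = 1 := (Matrix.mem_unitaryGroup_iff').mp hH.eigenvectorUnitary.2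
  let μ := hH.eigenvalues
  have hspec : p = V * Matrix.diagonal (fun i => (μ i : ℂ)) * Vᴴ := by
    have := hH.spectral_theorem
    rw [Unitary.conjStarAlgAut_apply] at this
    exact this
  have hdiag : Vᴴ * p * V = Matrix.diagonal (fun i => (μ i : ℂ)) := by
    rw [hspec]
    calc _ = (Vᴴ * V) * Matrix.diagonal (fun i => (μ i : ℂ)) * (Vᴴ * V) := by
          simp only [mul_assoc]
      _ = _ := by rw [hV1]; simp
  have hV2 : V * Vᴴ = 1 := mul_eq_one_comm.mp hV1
  have hμ : ∀ i, μ i * μ i = μ i := by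
    have h1 : Matrix.diagonal (fun i => (μ i : ℂ)) * Matrix.diagonal (fun i => (μ i : ℂ)) =
        Matrix.diagonal (fun i => (μ i : ℂ)) := by
      rw [← hdiag]
      calc _ = Vᴴ * p * (V * Vᴴ) * p * V := by simp only [mul_assoc]
        _ = Vᴴ * (p * p) * V := by rw [hV2]; simp [mul_assoc]
        _ = _ := by rw [hp.isIdempotentElem.eq]
    intro i
    rw [Matrix.diagonal_mul_diagonal] at h1
    have := congrFun (Matrix.diagonal_injective h1) i
    exact_mod_cast this
  have hμ' : ∀ i, (μ i : ℂ) = if μ i = 1 then 1 else 0 := by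
    intro i
    have h : μ i * (μ i - 1) = 0 := by rw [mul_sub, hμ i]; ring
    rcases mul_eq_zero.mp h with h | h
    · simp [h]
    · simp [sub_eq_zero.mp h]
  let I := {i // μ i = 1}
  let e : I ≃ Fin (Fintype.card I) := Fintype.equivFin I
  let B : Matrix (Fin D) (Fin (Fintype.card I)) ℂ := Matrix.of fun x j => V x (e.symm j)
  have hB1 : Bᴴ * B = 1 := by
    ext j j'
    have := congrFun (congrFun hV1 (e.symm j)) (e.symm j')
    rw [Matrix.mul_apply] at this ⊢
    simp only [Matrix.conjTranspose_apply, B, Matrix.of_apply] at this ⊢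
    rw [this, Matrix.one_apply, Matrix.one_apply]
    simp [Subtype.ext_iff.symm]
  have hB2 : B * Bᴴ = p := by
    ext x y
    rw [hspec, Matrix.mul_apply, Matrix.mul_apply]
    simp only [Matrix.mul_diagonal, Matrix.conjTranspose_apply, B, Matrix.of_apply]
    rw [Equiv.sum_comp e.symm (fun i : I => V x i * star (V y i))]
    simp_rw [hμ']
    simp only [mul_ite, mul_one, mul_zero, ite_mul, zero_mul]
    rw [← Finset.sum_filter, Finset.sum_subtype (p := fun i => μ i = 1) _ (by simp)]
  refine ⟨_, B, ?_, hB1, hB2⟩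
  rw [Nat.pos_iff_ne_zero]
  intro hd
  apply h0
  rw [← hB2]
  ext x y
  rw [Matrix.mul_apply]
  have : IsEmpty (Fin (Fintype.card I)) := by rw [hd]; infer_instance
  simp

/-- Minimal projections in `A` fall into classes connected by partial isometries from `A`. A class
becomes a summand: its members index a basis of `L_λ`, and the range of a representative serves as
`R_λ`. The partial isometries transport this range to the ranges of the other members, and products
`v vᴴ` of two of them act as matrix units of `L(L_λ)`. -/
theorem nonempty_decomposition {D : ℕ} (A : StarSubalgebra ℂ (Matrix (Fin D) (Fin D) ℂ)) :
    Nonempty (Decomposition A) := by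
  classical
  obtain ⟨m, p, hp, hmin⟩ := exists_maximal_projFamily A
  -- Murray–von Neumann equivalence of projections inside `A`.
  let S : Setoid (Fin m) :=
    { r := fun k l => ∃ v ∈ A, v * vᴴ = p k ∧ vᴴ * v = p l
      iseqv := by
        refine ⟨fun k => ⟨p k, hp.mem k, ?_, ?_⟩, ?_, ?_⟩
        · have h1 : (p k)ᴴ = p k := (hp.proj k).isSelfAdjoint.star_eq
          rw [h1, (hp.proj k).isIdempotentElem.eq]
        · have h1 : (p k)ᴴ = p k := (hp.proj k).isSelfAdjoint.star_eq
          rw [h1, (hp.proj k).isIdempotentElem.eq]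
        · rintro k l ⟨v, hv, h1, h2⟩
          exact ⟨vᴴ, star_mem hv, by rwa [Matrix.conjTranspose_conjTranspose],
            by rwa [Matrix.conjTranspose_conjTranspose]⟩
        · rintro k l n ⟨v, hv, h1, h2⟩ ⟨w, hw, h3, h4⟩
          have hl := (hp.proj l).isIdempotentElem.eq
          have hk := (hp.proj k).isIdempotentElem.eq
          refine ⟨v * w, mul_mem hv hw, ?_, ?_⟩
          · calc v * w * (v * w)ᴴ = v * (w * wᴴ) * vᴴ := by
                  simp only [Matrix.conjTranspose_mul, mul_assoc]
              _ = (v * vᴴ) * (v * vᴴ) := by rw [h3, ← h2]; simp only [mul_assoc]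
              _ = p k := by rw [h1, hk]
          · calc (v * w)ᴴ * (v * w) = wᴴ * (vᴴ * v) * w := by
                  simp only [Matrix.conjTranspose_mul, mul_assoc]
              _ = (wᴴ * w) * (wᴴ * w) := by rw [h2, ← h3]; simp only [mul_assoc]
              _ = p n := by rw [h4, (hp.proj n).isIdempotentElem.eq] }
  let Λ := Quotient S
  let e : Λ ≃ Fin (Fintype.card Λ) := Fintype.equivFin Λ
  let r : Fin (Fintype.card Λ) → Fin m := fun l => (e.symm l).out
  let cls : Fin m → Fin (Fintype.card Λ) := fun k => e (Quotient.mk S k)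
  have hcls : ∀ k, ∃ v ∈ A, v * vᴴ = p k ∧ vᴴ * v = p (r (cls k)) := by
    intro k
    have h1 : S.r k (r (cls k)) := by
      apply Quotient.exact (s := S)
      simp [r, cls]
    exact h1
  choose v hvA hv1 hv2 using hcls
  choose dR B hdR hB1 hB2 using fun l : Fin (Fintype.card Λ) =>
    exists_isometry_of_projection (hp.proj (r l)) (hp.ne_zero (r l))
  let dL : Fin (Fintype.card Λ) → ℕ := fun l => Fintype.card {k // cls k = l}
  let E : ∀ l, {k // cls k = l} ≃ Fin (dL l) := fun l => Fintype.equivFin _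
  let κ : ∀ l, Fin (dL l) → Fin m := fun l i => ((E l).symm i).1
  have hκ : ∀ l i, cls (κ l i) = l := fun l i => ((E l).symm i).2
  have hκinj : ∀ l i i', κ l i = κ l i' → i = i' := fun l i i' h =>
    (E l).symm.injective (Subtype.ext h)
  have hr : ∀ l, cls (r l) = l := fun l => by simp [r, cls]
  have hvp : ∀ l i, (v (κ l i))ᴴ * v (κ l i) = p (r l) := fun l i => by rw [hv2, hκ]
  have hpi : ∀ k, p k * p k = p k := fun k => (hp.proj k).isIdempotentElem.eq
  have hps : ∀ k, (p k)ᴴ = p k := fun k => (hp.proj k).isSelfAdjoint.star_eq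
  have hBp : ∀ l, p (r l) * B l = B l := fun l => by
    rw [← hB2, Matrix.mul_assoc, hB1, Matrix.mul_one]
  have hBp' : ∀ l, (B l)ᴴ * p (r l) = (B l)ᴴ := fun l => by
    rw [← hB2, ← Matrix.mul_assoc, hB1, Matrix.one_mul]
  -- `W l i` embeds `R_l` isometrically onto the range of the `i`-th projection of class `l`. The
  -- adjoint of `U` has the columns of all `W l i` as its columns.
  let W : ∀ l, Fin (dL l) → Matrix (Fin D) (Fin (dR l)) ℂ := fun l i => v (κ l i) * B l
  let U : Matrix (Σ l : Fin (Fintype.card Λ), Fin (dL l) × Fin (dR l)) (Fin D) ℂ :=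
    Matrix.of fun s x => star (W s.1 s.2.1 x s.2.2)
  have hUM : ∀ (M : Matrix (Fin D) (Fin D) ℂ) s t, (U * M * Uᴴ) s t =
      ((W s.1 s.2.1)ᴴ * M * W t.1 t.2.1) s.2.2 t.2.2 := by
    intro M s t
    simp [U, Matrix.mul_apply]
  have hvv : ∀ l i M l' i', (W l i)ᴴ * M * W l' i' =
      (B l)ᴴ * (p (r l) * ((v (κ l i))ᴴ * M * v (κ l' i')) * p (r l')) * B l' := by
    intro l i M l' i'
    calc (W l i)ᴴ * M * W l' i' = (B l)ᴴ * (v (κ l i))ᴴ * M * v (κ l' i') * B l' := by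
          simp only [W, Matrix.conjTranspose_mul, Matrix.mul_assoc]
      _ = ((B l)ᴴ * p (r l)) * (v (κ l i))ᴴ * M * v (κ l' i') * (p (r l') * B l') := by
          rw [hBp, hBp']
      _ = _ := by simp only [Matrix.mul_assoc]
  have hpv : ∀ k, p k * v k = v k := fun k => mul_eq_self_of_mul_conjTranspose (hp.proj k) (hv1 k)
  have hUU : U * Uᴴ = 1 := by
    ext ⟨l, i, j⟩ ⟨l', i', j'⟩
    have h1 := hUM 1 ⟨l, i, j⟩ ⟨l', i', j'⟩
    rw [Matrix.mul_one] at h1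
    rw [h1, Matrix.mul_one]
    by_cases h : κ l i = κ l' i'
    · obtain rfl : l = l' := by rw [← hκ l i, h, hκ]
      obtain rfl := hκinj l _ _ h
      have : (W l i)ᴴ * W l i = 1 := by
        calc (W l i)ᴴ * W l i = (B l)ᴴ * ((v (κ l i))ᴴ * v (κ l i)) * B l := by
              simp only [W, Matrix.conjTranspose_mul, Matrix.mul_assoc]
          _ = 1 := by rw [hvp, hBp', hB1]
      rw [this, Matrix.one_apply, Matrix.one_apply]
      simp
    · have h0 : (W l i)ᴴ * W l' i' = 0 := by
        have hz : (v (κ l i))ᴴ * v (κ l' i') = 0 := by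
          rw [← hpv (κ l i), ← hpv (κ l' i'), Matrix.conjTranspose_mul, hps, Matrix.mul_assoc,
            ← Matrix.mul_assoc (p _), hp.orth _ _ h]
          simp
        calc (W l i)ᴴ * W l' i' = (B l)ᴴ * ((v (κ l i))ᴴ * v (κ l' i')) * B l' := by
              simp only [W, Matrix.conjTranspose_mul, Matrix.mul_assoc]
          _ = 0 := by rw [hz]; simp
      rw [h0, Matrix.one_apply, if_neg]
      · rfl
      · rintro h'
        apply h
        cases h'
        rfl
  have hUX : ∀ (X : Matrix (Σ l : Fin (Fintype.card Λ), Fin (dL l) × Fin (dR l))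
      (Σ l : Fin (Fintype.card Λ), Fin (dL l) × Fin (dR l)) ℂ) x y,
      (Uᴴ * X * U) x y = ∑ s, ∑ t, X s t * (W s.1 s.2.1 x s.2.2 * star (W t.1 t.2.1 y t.2.2)) := by
    intro X x y
    rw [Finset.sum_comm]
    simp only [U, Matrix.mul_apply, Matrix.conjTranspose_apply, Matrix.of_apply, star_star,
      Finset.sum_mul]
    refine Finset.sum_congr rfl fun s _ => Finset.sum_congr rfl fun t _ => by ring
  have hWW : ∀ l i i', W l i * (W l i')ᴴ = v (κ l i) * (v (κ l i'))ᴴ := by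
    intro l i i'
    calc W l i * (W l i')ᴴ = v (κ l i) * (B l * (B l)ᴴ) * (v (κ l i'))ᴴ := by
          simp only [W, Matrix.conjTranspose_mul, Matrix.mul_assoc]
      _ = v (κ l i) * ((v (κ l i'))ᴴ * v (κ l i')) * (v (κ l i'))ᴴ := by rw [hB2, hvp]
      _ = v (κ l i) * (v (κ l i' ) * (v (κ l i'))ᴴ * v (κ l i'))ᴴ := by
          simp only [Matrix.conjTranspose_mul, Matrix.conjTranspose_conjTranspose, Matrix.mul_assoc]
      _ = _ := by rw [hv1, hpv]
  have hUU' : Uᴴ * U = 1 := by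
    have h1 : ∑ l, ∑ i, W l i * (W l i)ᴴ = 1 := by
      simp only [hWW, hv1]
      rw [← hp.sum, ← Fintype.sum_sigma' (f := fun l i => p (κ l i))]
      let F : (Σ l, Fin (dL l)) ≃ Fin m :=
        (Equiv.sigmaCongrRight fun l => (E l).symm).trans (Equiv.sigmaFiberEquiv cls)
      exact Equiv.sum_comp F p
    rw [← h1]
    ext x y
    have h2 := hUX 1 x y
    rw [Matrix.mul_one] at h2
    rw [h2]
    simp only [Matrix.one_apply, ite_mul, one_mul, zero_mul, Finset.sum_ite_eq, Finset.mem_univ,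
      if_true, Matrix.sum_apply, Matrix.mul_apply, Matrix.conjTranspose_apply,
      Fintype.sum_sigma, Fintype.sum_prod_type]
  refine ⟨⟨Fintype.card Λ, dL, dR, fun l => Fintype.card_pos_iff.mpr ⟨⟨r l, hr l⟩⟩, hdR, U, hUU',
    hUU, fun M => ⟨fun hM => ?_, ?_⟩⟩⟩
  · have h1 : ∀ l i i', ∃ c : ℂ, p (r l) * ((v (κ l i))ᴴ * M * v (κ l i')) * p (r l) =
        c • p (r l) := fun l i i' =>
      hmin _ _ (mul_mem (mul_mem (star_mem (hvA _)) hM) (hvA _))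
    choose a ha using h1
    refine ⟨fun l => Matrix.of (a l), ?_⟩
    ext ⟨l, i, j⟩ ⟨l', i', j'⟩
    rw [hUM, hvv]
    by_cases hl : l = l'
    · subst hl
      rw [ha, Matrix.blockDiagonal'_apply_eq, Matrix.mul_smul, Matrix.smul_mul, hBp', hB1]
      simp
    · rw [Matrix.blockDiagonal'_apply_ne _ _ _ hl]
      -- A nonzero corner between two representatives would yield a partial isometry, so their
      -- classes would coincide.
      have h0 : p (r l) * ((v (κ l i))ᴴ * M * v (κ l' i')) * p (r l') = 0 := by
        by_contra hne
        obtain ⟨w, hw, hw1, hw2⟩ := exists_partialIsometry (hp.mem _) (hp.mem _) (hp.proj _)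
          (hp.proj _) (hmin _) (hmin _)
          (mul_mem (mul_mem (star_mem (hvA (κ l i))) hM) (hvA (κ l' i'))) hne
        have h3 : cls (r l) = cls (r l') := congrArg e (Quotient.sound (s := S) ⟨w, hw, hw1, hw2⟩)
        exact hl (by rwa [hr, hr] at h3)
      rw [h0]
      simp
  · rintro ⟨a, ha⟩
    -- For the converse, `M` is expanded in the operators `W l i (W l i')ᴴ = v vᴴ`, which lie in
    -- `A`.
    have h1 : M = ∑ l, ∑ i, ∑ i', a l i i' • (W l i * (W l i')ᴴ) := by
      have h2 : M = Uᴴ * (U * M * Uᴴ) * U := by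
        calc M = (Uᴴ * U) * M * (Uᴴ * U) := by rw [hUU']; simp
          _ = _ := by simp only [Matrix.mul_assoc]
      rw [h2, ha]
      ext x y
      rw [hUX]
      simp only [Fintype.sum_sigma, Fintype.sum_prod_type, Matrix.sum_apply, Matrix.smul_apply,
        Matrix.mul_apply, Matrix.conjTranspose_apply, smul_eq_mul]
      refine Finset.sum_congr rfl fun l _ => Finset.sum_congr rfl fun i _ => ?_
      have h4 : ∀ j, ∑ l', ∑ i', ∑ j', (Matrix.blockDiagonal' fun l =>
          a l ⊗ₖ (1 : Matrix (Fin (dR l)) (Fin (dR l)) ℂ)) ⟨l, (i, j)⟩ ⟨l', (i', j')⟩ *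
            (W l i x j * star (W l' i' y j')) =
          ∑ i', a l i i' * (W l i x j * star (W l i' y j)) := by
        intro j
        rw [Finset.sum_eq_single l]
        · simp [Matrix.blockDiagonal'_apply_eq, Matrix.one_apply]
        · intro l' _ hl'
          simp [Matrix.blockDiagonal'_apply_ne _ _ _ hl'.symm]
        · simp
      simp only [h4]
      rw [Finset.sum_comm]
      simp only [Finset.mul_sum]
    rw [h1]
    refine sum_mem fun l _ => sum_mem fun i _ => sum_mem fun i' _ => ?_
    rw [hWW]
    exact SMulMemClass.smul_mem _ (mul_mem (hvA _) (star_mem (hvA _)))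

/-! ### Commutants and the symmetric subspace -/

theorem mem_commutant_iff {D : ℕ} {A : StarSubalgebra ℂ (Matrix (Fin D) (Fin D) ℂ)}
    {M : Matrix (Fin D) (Fin D) ℂ} : M ∈ commutant A ↔ ∀ a ∈ A, a * M = M * a := by
  rw [commutant, StarSubalgebra.mem_centralizer_iff]
  exact ⟨fun h a ha => (h a ha).1, fun h a ha => ⟨h a ha, h _ (star_mem ha)⟩⟩

open scoped Matrix.Norms.L2Operator in
-- Finite dimension makes the subalgebra closed, hence a C*-algebra, and such an algebra is spanned
-- by its unitaries. This upgrades commutation with unitaries to commutation with all of `A`.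
theorem span_unitary_mem {D : ℕ} (A : StarSubalgebra ℂ (Matrix (Fin D) (Fin D) ℂ))
    {a : Matrix (Fin D) (Fin D) ℂ} (ha : a ∈ A) :
    a ∈ Submodule.span ℂ {u | u ∈ A ∧ u ∈ Matrix.unitaryGroup (Fin D) ℂ} := by
  have hcl : IsClosed (A : Set (Matrix (Fin D) (Fin D) ℂ)) :=
    Submodule.closed_of_finiteDimensional (asSubspace A)
  let _ : CStarAlgebra A := StarSubalgebra.cstarAlgebra A (h_closed := hcl)
  have h1 : (⟨a, ha⟩ : A) ∈ Submodule.span ℂ (unitary A : Set A) := by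
    rw [CStarAlgebra.span_unitary]; trivial
  have h2 := Submodule.mem_map_of_mem (f := A.subtype.toLinearMap) h1
  rw [Submodule.map_span] at h2
  refine Submodule.span_mono ?_ h2
  rintro _ ⟨u, hu, rfl⟩
  refine ⟨u.2, ?_⟩
  have := Unitary.mem_iff.mp hu
  exact Unitary.mem_iff.mpr ⟨congrArg Subtype.val this.1, congrArg Subtype.val this.2⟩

theorem kronecker_mulVec_apply {m n : Type*} [Fintype m] [Fintype n]
    (X : Matrix m m ℂ) (Y : Matrix n n ℂ) (v : m × n → ℂ) (p : m × n) :
    ((X ⊗ₖ Y) *ᵥ v) p = (X * Matrix.of (fun x y => v (x, y)) * Yᵀ) p.1 p.2 := by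
  rw [Matrix.mul_assoc]
  simp only [Matrix.mulVec, dotProduct, Fintype.sum_prod_type, Matrix.kroneckerMap_apply,
    Matrix.mul_apply, Matrix.of_apply, Matrix.transpose_apply, Finset.mul_sum]
  exact Finset.sum_congr rfl fun _ _ => Finset.sum_congr rfl fun _ _ => by ring

theorem map_conj_transpose {m n : Type*} (u : Matrix m n ℂ) :
    (u.map (starRingEnd ℂ))ᵀ = uᴴ := rfl

/-- A vector on the doubled space, as a matrix. -/
def toMat {D : ℕ} (v : Fin D × Fin D → ℂ) : Matrix (Fin D) (Fin D) ℂ :=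
  Matrix.of fun x y => v (x, y)

theorem toMat_injective {D : ℕ} : Function.Injective (toMat (D := D)) := by
  intro v w h
  ext ⟨x, y⟩
  exact congrFun (congrFun h x) y

theorem toMat_kronecker {D : ℕ} (X Y : Matrix (Fin D) (Fin D) ℂ) (v : Fin D × Fin D → ℂ) :
    toMat ((X ⊗ₖ Y) *ᵥ v) = X * toMat v * Yᵀ := by
  ext x y
  exact kronecker_mulVec_apply X Y v (x, y)

/-- On matrices, `u ⊗ ū` acts by `M ↦ u M u†`, so invariance means commuting with `u`. The unitaries
span `A`. -/
theorem mem_symmSubspace_iff {D : ℕ} {A : StarSubalgebra ℂ (Matrix (Fin D) (Fin D) ℂ)}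
    {v : EuclideanSpace ℂ (Fin D × Fin D)} :
    v ∈ symmSubspace A ↔ toMat v.ofLp ∈ commutant A := by
  have key : ∀ u ∈ Matrix.unitaryGroup (Fin D) ℂ,
      ((u ⊗ₖ u.map (starRingEnd ℂ)) *ᵥ v.ofLp = v.ofLp ↔ u * toMat v.ofLp = toMat v.ofLp * u) := by
    intro u hu
    have h1 : u * uᴴ = 1 := (Matrix.mem_unitaryGroup_iff).mp hu
    have h2 : uᴴ * u = 1 := (Matrix.mem_unitaryGroup_iff').mp hu
    rw [← toMat_injective.eq_iff, toMat_kronecker, map_conj_transpose]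
    constructor
    · intro h
      nth_rewrite 2 [← h]
      rw [Matrix.mul_assoc _ uᴴ, h2, Matrix.mul_one]
    · intro h
      rw [h, Matrix.mul_assoc, h1, Matrix.mul_one]
  rw [mem_commutant_iff]
  constructor
  · intro h a ha
    refine Submodule.span_induction (p := fun a _ => a * toMat v.ofLp = toMat v.ofLp * a)
      ?_ ?_ ?_ ?_ (span_unitary_mem A ha)
    · rintro u ⟨hu, hu'⟩
      exact (key u hu').mp (h u hu hu')
    · simp
    · intro x y _ _ hx hy
      rw [add_mul, mul_add, hx, hy]
    · intro c x _ hx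
      rw [Matrix.smul_mul, Matrix.mul_smul, hx]
  · intro h u hu hu'
    exact (key u hu').mpr (h u hu)

/-! ### The projection onto the symmetric subspace -/

section Proj
variable {D : ℕ} (A : StarSubalgebra ℂ (Matrix (Fin D) (Fin D) ℂ))

theorem symmProj_mulVec (v : Fin D × Fin D → ℂ) :
    WithLp.toLp 2 (symmProj A *ᵥ v) = (symmSubspace A).starProjection (WithLp.toLp 2 v) := by
  have h := (Matrix.toEuclideanCLM (n := Fin D × Fin D) (𝕜 := ℂ)).apply_symm_apply
    (symmSubspace A).starProjection
  conv_rhs => rw [← h]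
  rfl

theorem symmProj_mulVec_mem (v : Fin D × Fin D → ℂ) :
    WithLp.toLp 2 (symmProj A *ᵥ v) ∈ symmSubspace A := by
  rw [symmProj_mulVec]
  exact Submodule.starProjection_apply_mem _ _

theorem symmProj_mulVec_of_mem {v : Fin D × Fin D → ℂ} (hv : WithLp.toLp 2 v ∈ symmSubspace A) :
    symmProj A *ᵥ v = v := by
  have := symmProj_mulVec A v
  rw [Submodule.starProjection_eq_self_iff.mpr hv] at this
  exact WithLp.toLp_injective 2 this

theorem symmProj_isStarProjection : IsStarProjection (symmProj A) := by
  have h : IsStarProjection (symmSubspace A).starProjection := isStarProjection_starProjection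
  exact h.map (Matrix.toEuclideanCLM (n := Fin D × Fin D) (𝕜 := ℂ)).symm

theorem symmProj_mul_self : symmProj A * symmProj A = symmProj A :=
  (symmProj_isStarProjection A).isIdempotentElem.eq

theorem symmProj_conjTranspose : (symmProj A)ᴴ = symmProj A :=
  (symmProj_isStarProjection A).isSelfAdjoint.star_eq

theorem symmProj_mul_eq {κ : Type*} {X : Matrix (Fin D × Fin D) κ ℂ}
    (hX : ∀ k, WithLp.toLp 2 (fun p => X p k) ∈ symmSubspace A) : symmProj A * X = X := by
  ext p k
  exact congrFun (symmProj_mulVec_of_mem A (hX k)) p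

theorem symmProj_col_mem (k : Fin D × Fin D) :
    WithLp.toLp 2 (fun p => symmProj A p k) ∈ symmSubspace A := by
  have := symmProj_mulVec_mem A (Pi.single k 1)
  rw [Matrix.mulVec_single_one] at this
  exact this

/-- A subspace that is invariant under `X` and `Xᴴ` reduces `X`: `ΠXΠ = XΠ`, and the adjoint
statement gives `ΠXΠ = ΠX`. -/
theorem commute_symmProj {X : Matrix (Fin D × Fin D) (Fin D × Fin D) ℂ}
    (h1 : ∀ v, WithLp.toLp 2 v ∈ symmSubspace A → WithLp.toLp 2 (X *ᵥ v) ∈ symmSubspace A)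
    (h2 : ∀ v, WithLp.toLp 2 v ∈ symmSubspace A → WithLp.toLp 2 (Xᴴ *ᵥ v) ∈ symmSubspace A) :
    Commute (symmProj A) X := by
  have key : ∀ Y : Matrix (Fin D × Fin D) (Fin D × Fin D) ℂ,
      (∀ v, WithLp.toLp 2 v ∈ symmSubspace A → WithLp.toLp 2 (Y *ᵥ v) ∈ symmSubspace A) →
      symmProj A * (Y * symmProj A) = Y * symmProj A := fun Y hY =>
    symmProj_mul_eq A fun k => hY _ (symmProj_col_mem A k)
  have e1 := key X h1
  have e2 := congrArg Matrix.conjTranspose (key Xᴴ h2)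
  simp only [Matrix.conjTranspose_mul, Matrix.conjTranspose_conjTranspose,
    symmProj_conjTranspose] at e2
  rw [Commute, SemiconjBy, ← e1, ← e2, Matrix.mul_assoc]

theorem commute_symmProj_left {s : Matrix (Fin D) (Fin D) ℂ} (hs : s ∈ commutant A) :
    Commute (symmProj A) (s ⊗ₖ 1) := by
  refine commute_symmProj A ?_ ?_ <;> intro v hv <;> rw [mem_symmSubspace_iff] at hv ⊢
  · rw [toMat_kronecker, Matrix.transpose_one, Matrix.mul_one]
    exact mul_mem hs hv
  · rw [Matrix.conjTranspose_kronecker, Matrix.conjTranspose_one, toMat_kronecker,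
      Matrix.transpose_one, Matrix.mul_one]
    exact mul_mem (star_mem hs) hv

theorem commute_symmProj_right {s : Matrix (Fin D) (Fin D) ℂ} (hs : s ∈ commutant A) :
    Commute (symmProj A) (1 ⊗ₖ sᵀ) := by
  refine commute_symmProj A ?_ ?_ <;> intro v hv <;> rw [mem_symmSubspace_iff] at hv ⊢
  · rw [toMat_kronecker, Matrix.transpose_transpose, Matrix.one_mul]
    exact mul_mem hv hs
  · rw [Matrix.conjTranspose_kronecker, Matrix.conjTranspose_one, toMat_kronecker,
      Matrix.one_mul]
    exact mul_mem hv (star_mem hs)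

/-- On the symmetric subspace, `1 ⊗ aᵀ` and `a ⊗ 1` agree for `a ∈ A`. -/
theorem right_mul_symmProj {a : Matrix (Fin D) (Fin D) ℂ} (ha : a ∈ A) :
    (1 ⊗ₖ aᵀ) * symmProj A = (a ⊗ₖ 1) * symmProj A := by
  ext p k
  have h := symmProj_col_mem A k
  rw [mem_symmSubspace_iff, mem_commutant_iff] at h
  have h1 := toMat_kronecker 1 aᵀ (fun p => symmProj A p k)
  have h2 := toMat_kronecker a 1 (fun p => symmProj A p k)
  rw [Matrix.transpose_transpose, Matrix.one_mul] at h1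
  rw [Matrix.transpose_one, Matrix.mul_one, h a ha, ← h1] at h2
  exact (congrFun (toMat_injective h2) p).symm

end Proj

/-! ### Block structure -/

section Block

theorem mul_blockDiagonal'_apply {ι : Type*} {σ : ι → Type*} {τ : Type*} [Fintype ι]
    [DecidableEq ι] [∀ i, Fintype (σ i)] (N : Matrix τ (Σ i, σ i) ℂ)
    (f : ∀ i, Matrix (σ i) (σ i) ℂ) (s : τ) (l : ι) (q : σ l) :
    (N * Matrix.blockDiagonal' f) s ⟨l, q⟩ = ∑ q', N s ⟨l, q'⟩ * f l q' q := by
  rw [Matrix.mul_apply, Fintype.sum_sigma, Finset.sum_eq_single l]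
  · simp only [Matrix.blockDiagonal'_apply_eq]
  · intro l' _ hl'
    simp [Matrix.blockDiagonal'_apply_ne _ _ _ hl']
  · simp

theorem blockDiagonal'_mul_apply {ι : Type*} {σ : ι → Type*} {τ : Type*} [Fintype ι]
    [DecidableEq ι] [∀ i, Fintype (σ i)] (N : Matrix (Σ i, σ i) τ ℂ)
    (f : ∀ i, Matrix (σ i) (σ i) ℂ) (l : ι) (q : σ l) (s : τ) :
    (Matrix.blockDiagonal' f * N) ⟨l, q⟩ s = ∑ q', f l q q' * N ⟨l, q'⟩ s := by
  rw [Matrix.mul_apply, Fintype.sum_sigma, Finset.sum_eq_single l]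
  · simp only [Matrix.blockDiagonal'_apply_eq]
  · intro l' _ hl'
    simp [Matrix.blockDiagonal'_apply_ne _ _ _ hl'.symm]
  · simp

variable {ι : Type*} [Fintype ι] [DecidableEq ι] {dL dR : ι → ℕ}

/-- Commutation is tested on matrix units supported in a single block: diagonal units remove the
off-diagonal blocks, and the others force each block into the form `a ⊗ I`. `apply_of_commute_left`
is the mirror image. -/
theorem apply_of_commute_right
    {N : Matrix (Σ l, Fin (dL l) × Fin (dR l)) (Σ l, Fin (dL l) × Fin (dR l)) ℂ}
    (h : ∀ b : ∀ l, Matrix (Fin (dR l)) (Fin (dR l)) ℂ,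
      N * Matrix.blockDiagonal' (fun l => (1 : Matrix (Fin (dL l)) (Fin (dL l)) ℂ) ⊗ₖ b l) =
      Matrix.blockDiagonal' (fun l => (1 : Matrix (Fin (dL l)) (Fin (dL l)) ℂ) ⊗ₖ b l) * N) :
    (∀ l l' q q', l ≠ l' → N ⟨l, q⟩ ⟨l', q'⟩ = 0) ∧
    ∀ l i i' j₁ j j', N ⟨l, (i, j₁)⟩ ⟨l, (i', j)⟩ =
      if j₁ = j then N ⟨l, (i, j')⟩ ⟨l, (i', j')⟩ else 0 := by
  constructor
  · rintro l l' q ⟨i', j'⟩ hl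
    have h1 := congrFun (congrFun (h (Pi.single l' (Matrix.single j' j' 1))) ⟨l, q⟩) ⟨l', (i', j')⟩
    rw [mul_blockDiagonal'_apply, blockDiagonal'_mul_apply] at h1
    simpa [Fintype.sum_prod_type, Matrix.one_apply, Matrix.single_apply, hl] using h1
  · intro l i i' j₁ j j'
    have h1 := congrFun (congrFun (h (Pi.single l (Matrix.single j j' 1))) ⟨l, (i, j₁)⟩)
      ⟨l, (i', j')⟩
    rw [mul_blockDiagonal'_apply, blockDiagonal'_mul_apply] at h1
    simp only [Pi.single_eq_same, Matrix.kroneckerMap_apply, Matrix.one_apply,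
      Matrix.single_apply, Fintype.sum_prod_type] at h1
    simpa [eq_comm, ite_and] using h1

theorem apply_of_commute_left
    {N : Matrix (Σ l, Fin (dL l) × Fin (dR l)) (Σ l, Fin (dL l) × Fin (dR l)) ℂ}
    (h : ∀ a : ∀ l, Matrix (Fin (dL l)) (Fin (dL l)) ℂ,
      N * Matrix.blockDiagonal' (fun l => a l ⊗ₖ (1 : Matrix (Fin (dR l)) (Fin (dR l)) ℂ)) =
      Matrix.blockDiagonal' (fun l => a l ⊗ₖ (1 : Matrix (Fin (dR l)) (Fin (dR l)) ℂ)) * N) :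
    (∀ l l' q q', l ≠ l' → N ⟨l, q⟩ ⟨l', q'⟩ = 0) ∧
    ∀ l i₁ i i' j j', N ⟨l, (i₁, j)⟩ ⟨l, (i, j')⟩ =
      if i₁ = i then N ⟨l, (i', j)⟩ ⟨l, (i', j')⟩ else 0 := by
  constructor
  · rintro l l' q ⟨i', j'⟩ hl
    have h1 := congrFun (congrFun (h (Pi.single l' (Matrix.single i' i' 1))) ⟨l, q⟩) ⟨l', (i', j')⟩
    rw [mul_blockDiagonal'_apply, blockDiagonal'_mul_apply] at h1
    simpa [Fintype.sum_prod_type, Matrix.one_apply, Matrix.single_apply, hl] using h1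
  · intro l i₁ i i' j j'
    have h1 := congrFun (congrFun (h (Pi.single l (Matrix.single i i' 1))) ⟨l, (i₁, j)⟩)
      ⟨l, (i', j')⟩
    rw [mul_blockDiagonal'_apply, blockDiagonal'_mul_apply] at h1
    simp only [Pi.single_eq_same, Matrix.kroneckerMap_apply, Matrix.one_apply,
      Matrix.single_apply, Fintype.sum_prod_type] at h1
    simpa [eq_comm, ite_and] using h1

end Block

/-! ### Operators in a basis adapted to the decomposition -/

namespace Decomposition
variable {D : ℕ} {A : StarSubalgebra ℂ (Matrix (Fin D) (Fin D) ℂ)} (𝒟 : Decomposition A)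

/-- The index set of the basis adapted to a decomposition. -/
abbrev Idx : Type := Σ l : Fin 𝒟.m, Fin (𝒟.dL l) × Fin (𝒟.dR l)

theorem conj_conj (M : Matrix (Fin D) (Fin D) ℂ) : 𝒟.Uᴴ * (𝒟.U * M * 𝒟.Uᴴ) * 𝒟.U = M := by
  calc _ = (𝒟.Uᴴ * 𝒟.U) * M * (𝒟.Uᴴ * 𝒟.U) := by simp only [Matrix.mul_assoc]
    _ = M := by rw [𝒟.conjTranspose_mul_self]; simp

theorem conj_conj' (N : Matrix 𝒟.Idx 𝒟.Idx ℂ) : 𝒟.U * (𝒟.Uᴴ * N * 𝒟.U) * 𝒟.Uᴴ = N := by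
  calc _ = (𝒟.U * 𝒟.Uᴴ) * N * (𝒟.U * 𝒟.Uᴴ) := by simp only [Matrix.mul_assoc]
    _ = N := by rw [𝒟.mul_conjTranspose_self]; simp

theorem conj_mul (M N : Matrix (Fin D) (Fin D) ℂ) :
    𝒟.U * (M * N) * 𝒟.Uᴴ = (𝒟.U * M * 𝒟.Uᴴ) * (𝒟.U * N * 𝒟.Uᴴ) := by
  calc _ = 𝒟.U * M * (1 : Matrix (Fin D) (Fin D) ℂ) * N * 𝒟.Uᴴ := by
        rw [Matrix.mul_one]; simp only [Matrix.mul_assoc]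
    _ = _ := by rw [← 𝒟.conjTranspose_mul_self]; simp only [Matrix.mul_assoc]

theorem conj_eq_iff {M N : Matrix (Fin D) (Fin D) ℂ} :
    𝒟.U * M * 𝒟.Uᴴ = 𝒟.U * N * 𝒟.Uᴴ ↔ M = N :=
  ⟨fun h => by rw [← 𝒟.conj_conj M, h, 𝒟.conj_conj], fun h => by rw [h]⟩

theorem conj_blockDiagonal_mem (a : ∀ l, Matrix (Fin (𝒟.dL l)) (Fin (𝒟.dL l)) ℂ) :
    𝒟.Uᴴ * (Matrix.blockDiagonal' fun l => a l ⊗ₖ (1 : Matrix (Fin (𝒟.dR l)) (Fin (𝒟.dR l)) ℂ))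
      * 𝒟.U ∈ A :=
  (𝒟.mem_iff _).mpr ⟨a, 𝒟.conj_conj' _⟩

/-- Matrix elements of an operator in the commutant. -/
theorem apply_of_mem_commutant {M : Matrix (Fin D) (Fin D) ℂ} (hM : M ∈ commutant A) :
    (∀ l l' q q', l ≠ l' → (𝒟.U * M * 𝒟.Uᴴ) ⟨l, q⟩ ⟨l', q'⟩ = 0) ∧
    ∀ l i₁ i i' j j', (𝒟.U * M * 𝒟.Uᴴ) ⟨l, (i₁, j)⟩ ⟨l, (i, j')⟩ =
      if i₁ = i then (𝒟.U * M * 𝒟.Uᴴ) ⟨l, (i', j)⟩ ⟨l, (i', j')⟩ else 0 := by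
  refine apply_of_commute_left fun a => ?_
  have h := (mem_commutant_iff.mp hM) _ (𝒟.conj_blockDiagonal_mem a)
  rw [← 𝒟.conj_eq_iff, conj_mul, conj_mul, 𝒟.conj_conj'] at h
  exact h.symm

theorem conj_blockDiagonal_mem_commutant (b : ∀ l, Matrix (Fin (𝒟.dR l)) (Fin (𝒟.dR l)) ℂ) :
    𝒟.Uᴴ * (Matrix.blockDiagonal' fun l => (1 : Matrix (Fin (𝒟.dL l)) (Fin (𝒟.dL l)) ℂ) ⊗ₖ b l)
      * 𝒟.U ∈ commutant A := by
  rw [mem_commutant_iff]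
  intro a ha
  obtain ⟨a', ha'⟩ := (𝒟.mem_iff a).mp ha
  rw [← 𝒟.conj_eq_iff, conj_mul, conj_mul, 𝒟.conj_conj', ha', ← Matrix.blockDiagonal'_mul,
    ← Matrix.blockDiagonal'_mul]
  simp only [← Matrix.mul_kronecker_mul, Matrix.mul_one, Matrix.one_mul]

/-- The nontrivial half of the double commutant theorem, read off from the block form: commuting
with all `I ⊗ b_l` leaves only `a_l ⊗ I`. -/
theorem mem_of_commute_commutant {A : StarSubalgebra ℂ (Matrix (Fin D) (Fin D) ℂ)}
    (𝒟 : Decomposition A) {M : Matrix (Fin D) (Fin D) ℂ}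
    (h : ∀ g ∈ commutant A, M * g = g * M) : M ∈ A := by
  have h1 := apply_of_commute_right (N := 𝒟.U * M * 𝒟.Uᴴ) fun b => by
    have h2 := h _ (𝒟.conj_blockDiagonal_mem_commutant b)
    rw [← 𝒟.conj_eq_iff, conj_mul, conj_mul, 𝒟.conj_conj'] at h2
    exact h2
  rw [𝒟.mem_iff]
  refine ⟨fun l => Matrix.of fun i i' =>
    (𝒟.U * M * 𝒟.Uᴴ) ⟨l, (i, ⟨0, 𝒟.dR_pos l⟩)⟩ ⟨l, (i', ⟨0, 𝒟.dR_pos l⟩)⟩, ?_⟩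
  ext ⟨l, i, j⟩ ⟨l', i', j'⟩
  by_cases hl : l = l'
  · subst hl
    rw [Matrix.blockDiagonal'_apply_eq, h1.2 l i i' j j' ⟨0, 𝒟.dR_pos l⟩]
    simp [Matrix.one_apply]
  · rw [h1.1 _ _ _ _ hl, Matrix.blockDiagonal'_apply_ne _ _ _ hl]

/-- The operator that is the scalar `f l` on the `l`-th summand. -/
def blockScalar (f : Fin 𝒟.m → ℂ) : Matrix (Fin D) (Fin D) ℂ :=
  𝒟.Uᴴ * Matrix.diagonal (fun s : 𝒟.Idx => f s.1) * 𝒟.U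

theorem blockScalar_eq (f : Fin 𝒟.m → ℂ) : 𝒟.blockScalar f = 𝒟.Uᴴ *
    (Matrix.blockDiagonal' fun l => (f l • (1 : Matrix (Fin (𝒟.dL l)) (Fin (𝒟.dL l)) ℂ)) ⊗ₖ
      (1 : Matrix (Fin (𝒟.dR l)) (Fin (𝒟.dR l)) ℂ)) * 𝒟.U := by
  rw [blockScalar]
  congr 2
  ext ⟨l, i, j⟩ ⟨l', i', j'⟩
  by_cases hl : l = l'
  · subst hl
    rw [Matrix.blockDiagonal'_apply_eq, Matrix.diagonal_apply]
    simp [Matrix.one_apply, ← ite_and, and_comm]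
  · rw [Matrix.blockDiagonal'_apply_ne _ _ _ hl, Matrix.diagonal_apply_ne]
    intro h
    exact hl (congrArg Sigma.fst h)

theorem blockScalar_mem (f : Fin 𝒟.m → ℂ) : 𝒟.blockScalar f ∈ A := by
  rw [blockScalar_eq]
  exact 𝒟.conj_blockDiagonal_mem _

/-- Together with `blockScalar_mem`, block scalars are central in `A`. This is why `1 ⊗ Ω` commutes
both with `Π` and with `1 ⊗ gᵀ` for `g` in the commutant. -/
theorem blockScalar_mem_commutant (f : Fin 𝒟.m → ℂ) : 𝒟.blockScalar f ∈ commutant A := by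
  rw [blockScalar_eq]
  have := 𝒟.conj_blockDiagonal_mem_commutant fun l => f l • 1
  simpa only [Matrix.smul_kronecker, Matrix.kronecker_smul] using this

theorem blockScalar_mul (f g : Fin 𝒟.m → ℂ) :
    𝒟.blockScalar f * 𝒟.blockScalar g = 𝒟.blockScalar fun l => f l * g l := by
  rw [← 𝒟.conj_eq_iff, conj_mul]
  simp only [blockScalar, conj_conj', Matrix.diagonal_mul_diagonal]

theorem blockScalar_conjTranspose (f : Fin 𝒟.m → ℂ) :
    (𝒟.blockScalar f)ᴴ = 𝒟.blockScalar fun l => star (f l) := by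
  simp only [blockScalar, Matrix.conjTranspose_mul, Matrix.conjTranspose_conjTranspose,
    Matrix.diagonal_conjTranspose, Matrix.mul_assoc]
  rfl

theorem blockScalar_apply (f : Fin 𝒟.m → ℂ) (x y : Fin D) :
    𝒟.blockScalar f x y = ∑ s, f s.1 * (star (𝒟.U s x) * 𝒟.U s y) := by
  simp only [blockScalar, Matrix.mul_apply (N := 𝒟.U), Matrix.mul_diagonal,
    Matrix.conjTranspose_apply]
  exact Finset.sum_congr rfl fun s _ => by ring

theorem Omega_eq : 𝒟.Omega = (𝒟.blockScalar fun l => (𝒟.dL l : ℂ) / (𝒟.dR l : ℂ))ᵀ := by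
  ext x y
  have h : ∀ l, 𝒟.proj l = 𝒟.blockScalar fun l' => if l' = l then 1 else 0 := fun l => rfl
  simp only [Omega, h, Matrix.sum_apply, Matrix.smul_apply, Matrix.transpose_apply,
    blockScalar_apply, smul_eq_mul, Finset.mul_sum]
  rw [Finset.sum_comm]
  refine Finset.sum_congr rfl fun s _ => ?_
  simp

/-! ### Kraus operators -/

/-- The vector `Ū† |t⟩` of the purifying space, tensored to a vector of the original space. -/
def tensorBasis (t : 𝒟.Idx) : Matrix (Fin D × Fin D) (Fin D) ℂ :=
  Matrix.of fun p q => if p.1 = q then 𝒟.U t p.2 else 0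

/-- The Kraus operators of the random purification channel. -/
def kraus (t : 𝒟.Idx) : Matrix (Fin D × Fin D) (Fin D) ℂ :=
  Matrix.of fun p q => ((Real.sqrt (𝒟.dL t.1 * 𝒟.dR t.1))⁻¹ : ℂ) *
    ∑ i' : Fin (𝒟.dL t.1), ∑ j : Fin (𝒟.dR t.1),
      star (𝒟.U ⟨t.1, (i', j)⟩ p.1) * 𝒟.U ⟨t.1, (i', t.2.2)⟩ p.2 * 𝒟.U ⟨t.1, (t.2.1, j)⟩ q

theorem sum_U_mul_star (s t : 𝒟.Idx) :
    ∑ y, 𝒟.U s y * star (𝒟.U t y) = if s = t then 1 else 0 := by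
  have h := congrFun (congrFun 𝒟.mul_conjTranspose_self s) t
  rwa [Matrix.mul_apply, Matrix.one_apply] at h

/-- As a matrix, a column is `Uᴴ (I ⊗ b) U` with `b` supported in the block of `t`: the sum over
`i'` in the definition produces the factor `I`. -/
theorem kraus_col_mem (t : 𝒟.Idx) (q : Fin D) :
    WithLp.toLp 2 (fun p => 𝒟.kraus t p q) ∈ symmSubspace A := by
  obtain ⟨l, i, j'⟩ := t
  rw [mem_symmSubspace_iff]
  set c : ℂ := ((Real.sqrt (𝒟.dL l * 𝒟.dR l))⁻¹ : ℂ)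
  have : toMat (fun p => 𝒟.kraus ⟨l, (i, j')⟩ p q) = 𝒟.Uᴴ * (Matrix.blockDiagonal' fun l' =>
      (1 : Matrix (Fin (𝒟.dL l')) (Fin (𝒟.dL l')) ℂ) ⊗ₖ
        (Pi.single (M := fun l' => Matrix (Fin (𝒟.dR l')) (Fin (𝒟.dR l')) ℂ) l
          (Matrix.of fun j j₂ => if j₂ = j' then c * 𝒟.U ⟨l, (i, j)⟩ q else 0) l')) * 𝒟.U := by
    ext x y
    rw [Matrix.mul_assoc, Matrix.mul_apply, Fintype.sum_sigma, Finset.sum_eq_single l]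
    · simp only [blockDiagonal'_mul_apply, Fintype.sum_prod_type, Pi.single_eq_same,
        Matrix.kroneckerMap_apply, Matrix.one_apply, Matrix.of_apply, toMat, kraus,
        Matrix.conjTranspose_apply, ite_mul, one_mul, zero_mul, mul_ite, mul_zero,
        Finset.sum_ite_eq, Finset.sum_ite_eq', Finset.mem_univ, if_true, Finset.mul_sum]
      refine Finset.sum_congr rfl fun i' _ => Finset.sum_congr rfl fun j _ => ?_
      simp only [c]
      ring
    · intro l' _ hl'
      simp [blockDiagonal'_mul_apply, hl']
    · simp
  change toMat (fun p => 𝒟.kraus ⟨l, (i, j')⟩ p q) ∈ _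
  rw [this]
  exact 𝒟.conj_blockDiagonal_mem_commutant _

theorem inv_sqrt_mul (l : Fin 𝒟.m) : ((Real.sqrt (𝒟.dL l * 𝒟.dR l))⁻¹ : ℂ) * (𝒟.dL l : ℂ) =
    (Real.sqrt (𝒟.dL l / 𝒟.dR l) : ℂ) := by
  have hL : (0 : ℝ) < 𝒟.dL l := by exact_mod_cast 𝒟.dL_pos l
  have hR : (0 : ℝ) < 𝒟.dR l := by exact_mod_cast 𝒟.dR_pos l
  have h : (Real.sqrt (𝒟.dL l * 𝒟.dR l))⁻¹ * (𝒟.dL l : ℝ) = Real.sqrt (𝒟.dL l / 𝒟.dR l) := by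
    rw [Real.sqrt_mul hL.le, Real.sqrt_div hL.le]
    have h1 : 0 < Real.sqrt (𝒟.dL l) := Real.sqrt_pos.mpr hL
    have h2 : 0 < Real.sqrt (𝒟.dR l) := Real.sqrt_pos.mpr hR
    field_simp
    exact (Real.sq_sqrt hL.le).symm
  exact_mod_cast h

/-- For symmetric `v` the matrix `N = U v Uᴴ` is `⨁ I ⊗ b_l`. The sum over `i'` in `kraus` therefore
consists of `dL` equal terms, while `tensorBasis` sees one of them. The ratio is `dL / √(dL dR) =
√(dL / dR)`. -/
theorem inner_kraus (t : 𝒟.Idx) (q : Fin D) {v : Fin D × Fin D → ℂ}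
    (hv : WithLp.toLp 2 v ∈ symmSubspace A) :
    ∑ p, v p * star (𝒟.kraus t p q) =
      (Real.sqrt (𝒟.dL t.1 / 𝒟.dR t.1) : ℂ) * ∑ p, v p * star (𝒟.tensorBasis t p q) := by
  obtain ⟨l, i, j'⟩ := t
  rw [mem_symmSubspace_iff] at hv
  obtain ⟨h1, h2⟩ := 𝒟.apply_of_mem_commutant hv
  change ∀ l l' q q', l ≠ l' → (𝒟.U * toMat v * 𝒟.Uᴴ) ⟨l, q⟩ ⟨l', q'⟩ = 0 at h1
  change ∀ l i₁ i i' j j', (𝒟.U * toMat v * 𝒟.Uᴴ) ⟨l, (i₁, j)⟩ ⟨l, (i, j')⟩ =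
      if i₁ = i then (𝒟.U * toMat v * 𝒟.Uᴴ) ⟨l, (i', j)⟩ ⟨l, (i', j')⟩ else 0 at h2
  set N := 𝒟.U * toMat v * 𝒟.Uᴴ with hN
  have hN' : ∀ s t, N s t = ∑ x, ∑ y, v (x, y) * (𝒟.U s x * star (𝒟.U t y)) := by
    intro s t
    rw [hN, Matrix.mul_apply, Finset.sum_comm]
    refine Finset.sum_congr rfl fun y _ => ?_
    rw [Matrix.mul_apply, Finset.sum_mul]
    refine Finset.sum_congr rfl fun x _ => ?_
    simp only [toMat, Matrix.of_apply, Matrix.conjTranspose_apply]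
    ring
  have hR : ∑ p, v p * star (𝒟.tensorBasis ⟨l, (i, j')⟩ p q) =
      ∑ j, star (𝒟.U ⟨l, (i, j)⟩ q) * N ⟨l, (i, j)⟩ ⟨l, (i, j')⟩ := by
    have e1 : ∑ p, v p * star (𝒟.tensorBasis ⟨l, (i, j')⟩ p q) =
        (toMat v * 𝒟.Uᴴ) q ⟨l, (i, j')⟩ := by
      rw [Matrix.mul_apply, Fintype.sum_prod_type, Finset.sum_eq_single q]
      · simp [tensorBasis, toMat]
      · intro x _ hx
        simp [tensorBasis, hx]
      · simp
    have e2 : toMat v * 𝒟.Uᴴ = 𝒟.Uᴴ * N := by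
      rw [hN, Matrix.mul_assoc 𝒟.U, ← Matrix.mul_assoc 𝒟.Uᴴ, 𝒟.conjTranspose_mul_self,
        Matrix.one_mul]
    rw [e1, e2, Matrix.mul_apply, Fintype.sum_sigma, Finset.sum_eq_single l]
    · rw [Fintype.sum_prod_type, Finset.sum_eq_single i]
      · simp only [Matrix.conjTranspose_apply]
      · intro i₁ _ hi
        refine Finset.sum_eq_zero fun j _ => ?_
        rw [h2 l i₁ i i j j', if_neg hi, mul_zero]
      · simp
    · intro l' _ hl
      refine Finset.sum_eq_zero fun q' _ => ?_
      rw [h1 _ _ _ _ hl, mul_zero]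
    · simp
  rw [hR, ← inv_sqrt_mul]
  have hc : star ((Real.sqrt (𝒟.dL l * 𝒟.dR l))⁻¹ : ℂ) = ((Real.sqrt (𝒟.dL l * 𝒟.dR l))⁻¹ : ℂ) := by
    rw [← Complex.ofReal_inv, Complex.star_def, Complex.conj_ofReal]
  have hL : ∑ p, v p * star (𝒟.kraus ⟨l, (i, j')⟩ p q) =
      ((Real.sqrt (𝒟.dL l * 𝒟.dR l))⁻¹ : ℂ) * ∑ i' : Fin (𝒟.dL l), ∑ j : Fin (𝒟.dR l),
        star (𝒟.U ⟨l, (i, j)⟩ q) * N ⟨l, (i', j)⟩ ⟨l, (i', j')⟩ := by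
    simp only [kraus, Matrix.of_apply, star_mul', star_sum, hc, star_star, hN', Finset.mul_sum,
      Fintype.sum_prod_type]
    rw [← Fintype.sum_prod_type', Finset.sum_comm]
    refine Finset.sum_congr rfl fun i' _ => ?_
    rw [Finset.sum_comm]
    refine Finset.sum_congr rfl fun j _ => ?_
    rw [Fintype.sum_prod_type]
    exact Finset.sum_congr rfl fun x _ => Finset.sum_congr rfl fun y _ => by ring
  rw [hL, mul_assoc]
  congr 1
  rw [Finset.sum_congr rfl fun i' _ => Finset.sum_congr rfl fun j _ => by
    rw [h2 l i' i' i j j', if_pos rfl]]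
  simp

/-- Both sides have symmetric columns, and by `inner_kraus` these have equal inner products with all
symmetric vectors. It suffices to test on the columns of `Π`. -/
theorem kraus_eq (t : 𝒟.Idx) : 𝒟.kraus t =
    (Real.sqrt (𝒟.dL t.1 / 𝒟.dR t.1) : ℂ) • (symmProj A * 𝒟.tensorBasis t) := by
  rw [← symmProj_mul_eq A (𝒟.kraus_col_mem t)]
  ext p q
  rw [Matrix.smul_apply, Matrix.mul_apply, Matrix.mul_apply, smul_eq_mul]
  have h := congrArg star (𝒟.inner_kraus t q (symmProj_col_mem A p))
  simp only [star_sum, star_mul', star_star] at h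
  have hs : ∀ k, star (symmProj A k p) = symmProj A p k := fun k =>
    congrFun (congrFun (symmProj_conjTranspose A) p) k
  simp only [hs] at h
  rw [h, Complex.star_def, Complex.conj_ofReal]

/-- The random purification channel in terms of a decomposition. -/
def purify : Matrix (Fin D) (Fin D) ℂ →ₗ[ℂ] Matrix (Fin D × Fin D) (Fin D × Fin D) ℂ :=
  ∑ t, conjMap (𝒟.kraus t)

theorem purify_apply (X : Matrix (Fin D) (Fin D) ℂ) :
    𝒟.purify X = ∑ t, 𝒟.kraus t * X * (𝒟.kraus t)ᴴ := by
  rw [purify, LinearMap.sum_apply]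
  rfl

theorem sum_tensorBasis (X : Matrix (Fin D) (Fin D) ℂ) :
    ∑ t : 𝒟.Idx, ((𝒟.dL t.1 : ℂ) / (𝒟.dR t.1 : ℂ)) •
      (𝒟.tensorBasis t * X * (𝒟.tensorBasis t)ᴴ) = X ⊗ₖ 𝒟.Omega := by
  ext ⟨x, y⟩ ⟨x', y'⟩
  rw [Matrix.kroneckerMap_apply, Omega_eq, Matrix.transpose_apply, blockScalar_apply,
    Matrix.sum_apply, Finset.mul_sum]
  refine Finset.sum_congr rfl fun t _ => ?_
  rw [Matrix.smul_apply, Matrix.mul_apply]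
  simp only [Matrix.mul_apply, tensorBasis, Matrix.of_apply, Matrix.conjTranspose_apply, ite_mul,
    zero_mul, apply_ite star, star_zero, mul_ite, mul_zero, Finset.sum_ite_eq, Finset.mem_univ,
    if_true, smul_eq_mul]
  ring

theorem purify_eq (X : Matrix (Fin D) (Fin D) ℂ) :
    𝒟.purify X = symmProj A * (X ⊗ₖ 𝒟.Omega) * symmProj A := by
  rw [purify_apply, ← sum_tensorBasis, Finset.mul_sum, Finset.sum_mul]
  refine Finset.sum_congr rfl fun t _ => ?_
  have h0 : (0 : ℝ) ≤ (𝒟.dL t.1 : ℝ) / (𝒟.dR t.1 : ℝ) := by positivity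
  have h1 : (Real.sqrt (𝒟.dL t.1 / 𝒟.dR t.1) : ℂ) * star (Real.sqrt (𝒟.dL t.1 / 𝒟.dR t.1) : ℂ) =
      (𝒟.dL t.1 : ℂ) / (𝒟.dR t.1 : ℂ) := by
    rw [Complex.star_def, Complex.conj_ofReal, ← Complex.ofReal_mul, Real.mul_self_sqrt h0]
    push_cast; rfl
  rw [kraus_eq, Matrix.conjTranspose_smul, Matrix.conjTranspose_mul, symmProj_conjTranspose,
    Matrix.smul_mul, Matrix.smul_mul, Matrix.mul_smul, smul_smul, h1, Matrix.mul_smul,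
    Matrix.smul_mul]
  simp only [Matrix.mul_assoc]

/-- By `kraus_eq`, one of the two factors in `KᴴK` may be replaced by a multiple of the simple
operator `tensorBasis`. Unitarity of `U` then leaves only `i' = i`. The result is `1/dR` times a
quantity independent of `j'`, and the `dR` values of `j'` restore the factor. -/
theorem sum_kraus : ∑ t, (𝒟.kraus t)ᴴ * 𝒟.kraus t = 1 := by
  have h1 : ∀ l i j' q q', ((𝒟.kraus ⟨l, (i, j')⟩)ᴴ * 𝒟.kraus ⟨l, (i, j')⟩) q q' =
      (𝒟.dR l : ℂ)⁻¹ *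
        ∑ j : Fin (𝒟.dR l), star (𝒟.U ⟨l, (i, j)⟩ q) * 𝒟.U ⟨l, (i, j)⟩ q' := by
    intro l i j' q q'
    have h2 : (𝒟.kraus ⟨l, (i, j')⟩)ᴴ * 𝒟.kraus ⟨l, (i, j')⟩ =
        (Real.sqrt (𝒟.dL l / 𝒟.dR l) : ℂ) •
          ((𝒟.tensorBasis ⟨l, (i, j')⟩)ᴴ * 𝒟.kraus ⟨l, (i, j')⟩) := by
      nth_rewrite 1 [kraus_eq]
      rw [Matrix.conjTranspose_smul, Matrix.conjTranspose_mul, symmProj_conjTranspose,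
        Matrix.smul_mul, Matrix.mul_assoc, symmProj_mul_eq A (𝒟.kraus_col_mem _),
        Complex.star_def, Complex.conj_ofReal]
    rw [h2, Matrix.smul_apply, Matrix.mul_apply, Fintype.sum_prod_type, Finset.sum_eq_single q]
    · simp only [tensorBasis, kraus, Matrix.conjTranspose_apply, Matrix.of_apply, if_true]
      have h3 : ∀ y, star (𝒟.U ⟨l, (i, j')⟩ y) * (((Real.sqrt (𝒟.dL l * 𝒟.dR l))⁻¹ : ℂ) *
          ∑ i' : Fin (𝒟.dL l), ∑ j : Fin (𝒟.dR l),
          star (𝒟.U ⟨l, (i', j)⟩ q) * 𝒟.U ⟨l, (i', j')⟩ y * 𝒟.U ⟨l, (i, j)⟩ q') =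
          ((Real.sqrt (𝒟.dL l * 𝒟.dR l))⁻¹ : ℂ) * ∑ i' : Fin (𝒟.dL l), ∑ j : Fin (𝒟.dR l),
          star (𝒟.U ⟨l, (i', j)⟩ q) * 𝒟.U ⟨l, (i, j)⟩ q' *
            (𝒟.U ⟨l, (i', j')⟩ y * star (𝒟.U ⟨l, (i, j')⟩ y)) := by
        intro y
        simp only [Finset.mul_sum]
        exact Finset.sum_congr rfl fun _ _ => Finset.sum_congr rfl fun _ _ => by ring
      simp only [h3]
      rw [← Finset.mul_sum, Finset.sum_comm]
      have h4 : ∀ i' : Fin (𝒟.dL l), (∑ y, ∑ j : Fin (𝒟.dR l),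
          star (𝒟.U ⟨l, (i', j)⟩ q) * 𝒟.U ⟨l, (i, j)⟩ q' *
            (𝒟.U ⟨l, (i', j')⟩ y * star (𝒟.U ⟨l, (i, j')⟩ y))) =
          if i' = i then ∑ j : Fin (𝒟.dR l), star (𝒟.U ⟨l, (i, j)⟩ q) * 𝒟.U ⟨l, (i, j)⟩ q'
          else 0 := by
        intro i'
        rw [Finset.sum_comm]
        simp only [← Finset.mul_sum, sum_U_mul_star]
        by_cases h : i' = i
        · subst h; simp
        · have h' : (⟨l, (i', j')⟩ : 𝒟.Idx) ≠ ⟨l, (i, j')⟩ := fun e => h (by simpa using e)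
          simp only [if_neg h', if_neg h, mul_zero, Finset.sum_const_zero]
      simp only [h4, Finset.sum_ite_eq', Finset.mem_univ, if_true, smul_eq_mul]
      rw [← mul_assoc]
      congr 1
      rw [← inv_sqrt_mul]
      have hL : (0 : ℝ) < 𝒟.dL l := by exact_mod_cast 𝒟.dL_pos l
      have hR : (0 : ℝ) < 𝒟.dR l := by exact_mod_cast 𝒟.dR_pos l
      have h5 : (Real.sqrt (𝒟.dL l * 𝒟.dR l))⁻¹ * (𝒟.dL l : ℝ) *
          (Real.sqrt (𝒟.dL l * 𝒟.dR l))⁻¹ = (𝒟.dR l : ℝ)⁻¹ := by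
        have h6 : Real.sqrt (𝒟.dL l * 𝒟.dR l) * Real.sqrt (𝒟.dL l * 𝒟.dR l) = 𝒟.dL l * 𝒟.dR l :=
          Real.mul_self_sqrt (by positivity)
        have h7 : 0 < Real.sqrt (𝒟.dL l * 𝒟.dR l) := Real.sqrt_pos.mpr (by positivity)
        field_simp
        nlinarith [h6]
      have h8 := congrArg Complex.ofReal h5
      push_cast at h8 ⊢
      exact h8
    · intro x _ hx
      simp [tensorBasis, hx]
    · simp
  ext q q'
  rw [Matrix.sum_apply, ← 𝒟.conjTranspose_mul_self, Matrix.mul_apply]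
  simp only [Fintype.sum_sigma, Fintype.sum_prod_type, Matrix.conjTranspose_apply, h1]
  refine Finset.sum_congr rfl fun l _ => Finset.sum_congr rfl fun i _ => ?_
  have hR : (𝒟.dR l : ℂ) ≠ 0 := by exact_mod_cast (𝒟.dR_pos l).ne'
  have h2 : ∀ z : ℂ, ∑ _j : Fin (𝒟.dR l), (𝒟.dR l : ℂ)⁻¹ * z = z := fun z => by
    rw [Finset.sum_const, Finset.card_univ, Fintype.card_fin, nsmul_eq_mul,
      mul_inv_cancel_left₀ hR]
  convert h2 (∑ j : Fin (𝒟.dR l), star (𝒟.U ⟨l, (i, j)⟩ q) * 𝒟.U ⟨l, (i, j)⟩ q') using 1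

end Decomposition

/-! ### Channels given by Kraus operators, and a criterion for Hilbert–Schmidt projections -/

theorem idTensor_conjMap {m n κ : Type*} [Fintype m] [Fintype κ] [DecidableEq κ]
    (K : Matrix n m ℂ) (X : Matrix (κ × m) (κ × m) ℂ) :
    idTensor κ (conjMap K) X =
      ((1 : Matrix κ κ ℂ) ⊗ₖ K) * X * ((1 : Matrix κ κ ℂ) ⊗ₖ K)ᴴ := by
  ext ⟨k, a⟩ ⟨k', b⟩
  simp only [idTensor, conjMap, LinearMap.coe_mk, AddHom.coe_mk, Matrix.of_apply,
    Matrix.mul_apply, Matrix.kroneckerMap_apply, Matrix.conjTranspose_apply,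
    Fintype.sum_prod_type, Matrix.one_apply, ite_mul, one_mul, zero_mul, apply_ite star, star_zero,
    mul_ite, mul_zero]
  rw [Finset.sum_comm]
  simp [Finset.sum_ite_irrel]

theorem idTensor_sum {m n κ ι : Type*} [Fintype ι] (Φ : ι → Matrix m m ℂ →ₗ[ℂ] Matrix n n ℂ)
    (X : Matrix (κ × m) (κ × m) ℂ) :
    idTensor κ (∑ t, Φ t) X = ∑ t, idTensor κ (Φ t) X := by
  ext p q
  simp [idTensor, Matrix.sum_apply]

theorem isChannel_sum_conjMap {m n ι : Type*} [Fintype m] [DecidableEq m] [Fintype n] [Fintype ι]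
    (K : ι → Matrix n m ℂ) (hK : ∑ t, (K t)ᴴ * K t = 1) : IsChannel (∑ t, conjMap (K t)) := by
  constructor
  · intro k X hX
    rw [idTensor_sum]
    refine Matrix.posSemidef_sum _ fun t _ => ?_
    rw [idTensor_conjMap]
    exact hX.mul_mul_conjTranspose_same _
  · intro X
    have : ∀ t, (K t * X * (K t)ᴴ).trace = ((K t)ᴴ * K t * X).trace := fun t => by
      rw [Matrix.trace_mul_comm, Matrix.mul_assoc]
    rw [LinearMap.sum_apply, Matrix.trace_sum]
    simp only [conjMap, LinearMap.coe_mk, AddHom.coe_mk, this]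
    rw [← Matrix.trace_sum, ← Matrix.sum_mul, hK, Matrix.one_mul]

theorem hsProj_eq_of {D : ℕ} {S : Submodule ℂ (Matrix (Fin D) (Fin D) ℂ)}
    {X Z : Matrix (Fin D) (Fin D) ℂ} (hZ : Z ∈ S)
    (h : ∀ s ∈ S, (sᴴ * (X - Z)).trace = 0) : hsProj S X = Z := by
  have : (S.map (hsEquiv D).toLinearMap).starProjection (hsEquiv D X) = hsEquiv D Z := by
    refine Submodule.eq_starProjection_of_mem_of_inner_eq_zero ?_ ?_
    · exact Submodule.mem_map_of_mem hZ
    · rintro _ ⟨s, hs, rfl⟩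
      rw [← inner_conj_symm, map_eq_zero, ← map_sub]
      rw [← h s hs, EuclideanSpace.inner_eq_star_dotProduct, dotProduct, Fintype.sum_prod_type,
        Matrix.trace, Finset.sum_comm]
      refine Finset.sum_congr rfl fun y _ => ?_
      rw [Matrix.diag_apply, Matrix.mul_apply]
      refine Finset.sum_congr rfl fun x _ => ?_
      exact mul_comm _ _
  change (hsEquiv D).symm (_) = Z
  rw [LinearEquiv.symm_apply_eq]
  exact this

theorem transpose_mem_transposeSubspace {D : ℕ}
    {A : StarSubalgebra ℂ (Matrix (Fin D) (Fin D) ℂ)} {a : Matrix (Fin D) (Fin D) ℂ}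
    (ha : a ∈ A) : aᵀ ∈ transposeSubspace A :=
  Submodule.mem_map_of_mem (f := (Matrix.transposeLinearEquiv (Fin D) (Fin D) ℂ ℂ).toLinearMap) ha

/-- The projection of a product vector basis element, read off as a block of an operator. -/
theorem posSemidef_kronecker_sandwich {m : Type*} [Fintype m]
    {Q Y : Matrix m m ℂ} (h : Q = Yᴴ * Y) : Q.PosSemidef :=
  h ▸ Matrix.posSemidef_conjTranspose_mul_self Y

/-! ### The image of the identity and the explicit formulas -/

namespace Decomposition
variable {D : ℕ} {A : StarSubalgebra ℂ (Matrix (Fin D) (Fin D) ℂ)} (𝒟 : Decomposition A)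

theorem isChannel_purify : IsChannel 𝒟.purify := isChannel_sum_conjMap _ 𝒟.sum_kraus

theorem commute_symmProj_blockScalar (f : Fin 𝒟.m → ℂ) :
    symmProj A * (1 ⊗ₖ (𝒟.blockScalar f)ᵀ) = (1 ⊗ₖ (𝒟.blockScalar f)ᵀ) * symmProj A :=
  commute_symmProj_right A (𝒟.blockScalar_mem_commutant f)

theorem one_kron_blockScalar_mul (f g : Fin 𝒟.m → ℂ) :
    ((1 : Matrix (Fin D) (Fin D) ℂ) ⊗ₖ (𝒟.blockScalar f)ᵀ) * (1 ⊗ₖ (𝒟.blockScalar g)ᵀ) =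
      1 ⊗ₖ (𝒟.blockScalar fun l => f l * g l)ᵀ := by
  rw [← Matrix.mul_kronecker_mul, ← Matrix.transpose_mul, blockScalar_mul, Matrix.one_mul]
  simp only [mul_comm]

theorem purify_one : 𝒟.purify 1 = (1 ⊗ₖ 𝒟.Omega) * symmProj A := by
  rw [purify_eq, Omega_eq, commute_symmProj_blockScalar, Matrix.mul_assoc, symmProj_mul_self]

/-- The projection commutes with `1 ⊗ √Ω`, so the product squares to `P(1)`. By uniqueness of the
positive square root only positivity remains. -/
theorem sqrt_purify_one : CFC.sqrt (𝒟.purify 1) = symmProj A * (1 ⊗ₖ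
    (𝒟.blockScalar fun l => (Real.sqrt (𝒟.dL l / 𝒟.dR l) : ℂ))ᵀ) := by
  refine CFC.sqrt_unique ?_ ?_
  · nth_rewrite 2 [commute_symmProj_blockScalar]
    rw [Matrix.mul_assoc, ← Matrix.mul_assoc (1 ⊗ₖ _) (1 ⊗ₖ _), one_kron_blockScalar_mul,
      purify_eq, Omega_eq, ← Matrix.mul_assoc]
    congr 5
    ext l
    have h0 : (0 : ℝ) ≤ (𝒟.dL l : ℝ) / (𝒟.dR l : ℝ) := by positivity
    rw [← Complex.ofReal_mul, Real.mul_self_sqrt h0]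
    push_cast; rfl
  · rw [Matrix.nonneg_iff_posSemidef]
    -- The fourth root of the weights, so that the candidate has the form `Yᴴ Y`.
    let f : Fin 𝒟.m → ℂ := fun l => (Real.sqrt (Real.sqrt (𝒟.dL l / 𝒟.dR l)) : ℂ)
    have hf : (𝒟.blockScalar f)ᴴ = 𝒟.blockScalar f := by
      rw [blockScalar_conjTranspose]
      congr 1; ext l
      simp only [f, Complex.star_def, Complex.conj_ofReal]
    have hff : ∀ l, f l * f l = (Real.sqrt (𝒟.dL l / 𝒟.dR l) : ℂ) := fun l => by
      simp only [f]
      rw [← Complex.ofReal_mul, Real.mul_self_sqrt (Real.sqrt_nonneg _)]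
    refine posSemidef_kronecker_sandwich (Y := (1 ⊗ₖ (𝒟.blockScalar f)ᵀ) * symmProj A) ?_
    have hT : ((𝒟.blockScalar f)ᵀ)ᴴ = (𝒟.blockScalar f)ᵀ := by
      change ((𝒟.blockScalar f)ᴴ)ᵀ = _
      rw [hf]
    rw [Matrix.conjTranspose_mul, symmProj_conjTranspose, Matrix.conjTranspose_kronecker,
      Matrix.conjTranspose_one, hT, Matrix.mul_assoc, ← Matrix.mul_assoc (1 ⊗ₖ _) (1 ⊗ₖ _),
      one_kron_blockScalar_mul, ← commute_symmProj_blockScalar, ← Matrix.mul_assoc,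
      symmProj_mul_self]
    simp only [hff]

theorem purify_eq_sqrt (X : Matrix (Fin D) (Fin D) ℂ) :
    𝒟.purify X = CFC.sqrt (𝒟.purify 1) * (X ⊗ₖ (1 : Matrix (Fin D) (Fin D) ℂ)) *
      CFC.sqrt (𝒟.purify 1) := by
  rw [sqrt_purify_one]
  nth_rewrite 2 [commute_symmProj_blockScalar]
  rw [purify_eq]
  simp only [Matrix.mul_assoc]
  congr 1
  simp only [← Matrix.mul_assoc]
  congr 1
  rw [← Matrix.mul_kronecker_mul, ← Matrix.mul_kronecker_mul, Matrix.one_mul, Matrix.mul_one,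
    Matrix.mul_one, ← Matrix.transpose_mul, blockScalar_mul, Omega_eq]
  congr 4
  ext l
  have h0 : (0 : ℝ) ≤ (𝒟.dL l : ℝ) / (𝒟.dR l : ℝ) := by positivity
  rw [← Complex.ofReal_mul, Real.mul_self_sqrt h0]
  push_cast; rfl

/-- The image of the identity commutes with `1 ⊗ gᵀ` for `g` in the commutant. -/
theorem commute_purify (X : Matrix (Fin D) (Fin D) ℂ) {g : Matrix (Fin D) (Fin D) ℂ}
    (hg : g ∈ commutant A) : Commute (𝒟.purify X) (1 ⊗ₖ gᵀ) := by
  have h1 : Commute (symmProj A) (1 ⊗ₖ gᵀ) := commute_symmProj_right A hg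
  have h2 : Commute (X ⊗ₖ 𝒟.Omega) (1 ⊗ₖ gᵀ) := by
    rw [Commute, SemiconjBy, ← Matrix.mul_kronecker_mul, ← Matrix.mul_kronecker_mul, Omega_eq,
      ← Matrix.transpose_mul, ← Matrix.transpose_mul,
      (mem_commutant_iff.mp hg) _ (𝒟.blockScalar_mem _), Matrix.one_mul, Matrix.mul_one]
  rw [purify_eq]
  exact (h1.mul_left h2).mul_left h1

/-- Trace preservation in dual form: the partial trace of `P(1)` over the purifying space is the
identity. Cyclicity moves both projections to one side. -/
theorem trace_purify_mul (X : Matrix (Fin D) (Fin D) ℂ) :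
    ((X ⊗ₖ 1) * 𝒟.purify 1).trace = X.trace := by
  rw [← 𝒟.isChannel_purify.2 X, purify_one, purify_eq, Matrix.trace_mul_cycle, symmProj_mul_self,
    Matrix.trace_mul_comm (symmProj A), ← Matrix.mul_assoc, ← Matrix.mul_kronecker_mul,
    Matrix.mul_one, Matrix.one_mul]

theorem trace_kron_mul {D : ℕ} (a : Matrix (Fin D) (Fin D) ℂ)
    (Q : Matrix (Fin D × Fin D) (Fin D × Fin D) ℂ) (x y : Fin D) :
    ((Matrix.single y x 1 ⊗ₖ a) * Q).trace =
      (a * Matrix.of fun b c => Q (x, b) (y, c)).trace := by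
  simp only [Matrix.trace, Matrix.diag_apply, Matrix.mul_apply, Fintype.sum_prod_type,
    Matrix.kroneckerMap_apply, Matrix.single_apply, Matrix.of_apply, ite_mul, one_mul, zero_mul,
    ite_and]
  simp [Finset.sum_ite_irrel]

/-- The blocks of the image of the identity are the projections of the matrix units. -/
theorem hsProj_single (x y : Fin D) :
    hsProj (transposeSubspace A) (Matrix.single x y 1) =
      Matrix.of fun b c => 𝒟.purify 1 (x, b) (y, c) := by
  set Z : Matrix (Fin D) (Fin D) ℂ := Matrix.of fun b c => 𝒟.purify 1 (x, b) (y, c) with hZ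
  refine hsProj_eq_of ?_ ?_
  -- `P(1)` commutes with `1 ⊗ gᵀ`, hence so does each block with `gᵀ`, and the double commutant
  -- property applies.
  · have hmem : Zᵀ ∈ A := by
      refine 𝒟.mem_of_commute_commutant fun g hg => ?_
      have h := 𝒟.commute_purify 1 hg
      rw [← Matrix.transpose_inj, Matrix.transpose_mul, Matrix.transpose_mul,
        Matrix.transpose_transpose]
      ext b c
      have h1 := congrFun (congrFun h (x, b)) (y, c)
      simp only [Matrix.mul_apply, Matrix.kroneckerMap_apply, Fintype.sum_prod_type,
        Matrix.one_apply, ite_mul, one_mul, zero_mul, mul_ite, mul_zero,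
        Finset.sum_ite_irrel, Finset.sum_const_zero, Finset.sum_ite_eq, Finset.sum_ite_eq',
        Finset.mem_univ, if_true] at h1
      simp only [Matrix.mul_apply, hZ, Matrix.of_apply]
      exact h1.symm
    have := transpose_mem_transposeSubspace hmem
    rwa [Matrix.transpose_transpose] at this
  · rintro _ ⟨a, ha, rfl⟩
    change ((aᵀ)ᴴ * (Matrix.single x y 1 - Z)).trace = 0
    have ha' : aᴴ ∈ A := star_mem (show a ∈ A from ha)
    have h1 : ((aᵀ)ᴴ * Z).trace = (aᴴ) x y := by
      have e1 : (aᵀ)ᴴ = (aᴴ)ᵀ := rfl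
      rw [e1, hZ, ← trace_kron_mul, purify_one, ← Matrix.mul_assoc]
      -- The transpose trick moves the element of `A` from the purifying space to the original one,
      -- where `trace_purify_mul` evaluates the trace.
      have e2 : (Matrix.single y x 1 ⊗ₖ (aᴴ)ᵀ) * (1 ⊗ₖ 𝒟.Omega) * symmProj A =
          ((Matrix.single y x 1 * aᴴ) ⊗ₖ (1 : Matrix (Fin D) (Fin D) ℂ)) * ((1 ⊗ₖ 𝒟.Omega) * symmProj A) := by
        have e3 : (Matrix.single y x 1 : Matrix (Fin D) (Fin D) ℂ) ⊗ₖ (aᴴ)ᵀ =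
          (Matrix.single y x 1 ⊗ₖ 1) * (1 ⊗ₖ (aᴴ)ᵀ) := by
          rw [← Matrix.mul_kronecker_mul, Matrix.mul_one, Matrix.one_mul]
        have e4 : ((Matrix.single y x 1 : Matrix (Fin D) (Fin D) ℂ) * aᴴ) ⊗ₖ
            (1 : Matrix (Fin D) (Fin D) ℂ) = (Matrix.single y x 1 ⊗ₖ 1) * (aᴴ ⊗ₖ 1) := by
          rw [← Matrix.mul_kronecker_mul, Matrix.mul_one]
        rw [Omega_eq, Matrix.mul_assoc, ← commute_symmProj_blockScalar, e3, e4, Matrix.mul_assoc,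
          Matrix.mul_assoc, ← Matrix.mul_assoc (1 ⊗ₖ _) (symmProj A), right_mul_symmProj A ha',
          Matrix.mul_assoc]
      rw [e2, ← purify_one, trace_purify_mul, Matrix.trace_mul_comm, Matrix.trace_mul_single]
      simp
    rw [Matrix.mul_sub, Matrix.trace_sub, h1, Matrix.trace_mul_single]
    simp

end Decomposition

/-! ### Twirling -/

section Twirl
open MeasureTheory
variable {D : ℕ}

instance : CompactSpace (Matrix.unitaryGroup (Fin D) ℂ) := by
  refine isCompact_iff_compactSpace.mp ?_
  have hK : IsCompact (Set.univ.pi fun _ : Fin D => Set.univ.pi fun _ : Fin D =>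
      Metric.closedBall (0 : ℂ) 1) :=
    isCompact_univ_pi fun _ => isCompact_univ_pi fun _ => isCompact_closedBall 0 1
  refine hK.of_isClosed_subset ?_ ?_
  · have : ((Matrix.unitaryGroup (Fin D) ℂ : Submonoid _) : Set (Matrix (Fin D) (Fin D) ℂ)) =
        {M | star M * M = 1} ∩ {M | M * star M = 1} := by
      ext M
      exact Unitary.mem_iff
    rw [this]
    exact (isClosed_eq (by fun_prop) (by fun_prop)).inter (isClosed_eq (by fun_prop) (by fun_prop))
  · intro M hM i _ j _
    simpa using entry_norm_bound_of_unitary hM i j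

variable {A : StarSubalgebra ℂ (Matrix (Fin D) (Fin D) ℂ)}
  {G : Subgroup (Matrix.unitaryGroup (Fin D) ℂ)} [MeasurableSpace G] [BorelSpace G]

/-- An entry of `gᵀ X ḡ`, as a function of the group element. -/
theorem integrable_twirl (μ : Measure G) [IsProbabilityMeasure μ] (X : Matrix (Fin D) (Fin D) ℂ)
    (b c : Fin D) : Integrable (fun g : G => ((g.1 : Matrix (Fin D) (Fin D) ℂ)ᵀ * X *
      (g.1 : Matrix (Fin D) (Fin D) ℂ).map (starRingEnd ℂ)) b c) μ := by
  have hent : ∀ i j, Continuous fun g : G => (g.1 : Matrix (Fin D) (Fin D) ℂ) i j := fun i j => by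
    have h1 : Continuous fun g : G => g.1 := continuous_subtype_val
    have h2 : Continuous fun u : Matrix.unitaryGroup (Fin D) ℂ => (u : Matrix (Fin D) (Fin D) ℂ) :=
      continuous_subtype_val
    exact (h2.comp h1).matrix_elem i j
  simp only [Matrix.mul_apply, Matrix.transpose_apply, Matrix.map_apply, Finset.sum_mul]
  refine integrable_finsetSum _ fun i _ => integrable_finsetSum _ fun j _ => ?_
  have hc : Continuous fun g : G => (g.1 : Matrix (Fin D) (Fin D) ℂ) j b * X j i *
      starRingEnd ℂ ((g.1 : Matrix (Fin D) (Fin D) ℂ) i c) := by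
    exact ((hent j b).mul continuous_const).mul (Complex.continuous_conj.comp (hent i c))
  refine Integrable.of_bound hc.aestronglyMeasurable (‖X j i‖) (Filter.Eventually.of_forall ?_)
  intro g
  rw [norm_mul, norm_mul, RCLike.norm_conj]
  have h1 := entry_norm_bound_of_unitary g.1.2 j b
  have h2 := entry_norm_bound_of_unitary g.1.2 i c
  calc _ ≤ 1 * ‖X j i‖ * 1 := by gcongr
    _ = _ := by ring

/-- A compact group is unimodular: a right translate is again a Haar probability measure, and these
are unique. -/
theorem isMulRightInvariant_of_isHaarMeasure (hG : IsClosed (G : Set (Matrix.unitaryGroup (Fin D) ℂ)))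
    (μ : Measure G) [μ.IsHaarMeasure] [IsProbabilityMeasure μ] : μ.IsMulRightInvariant := by
  have : CompactSpace G := hG.isClosedEmbedding_subtypeVal.compactSpace
  refine ⟨fun g => ?_⟩
  have : IsProbabilityMeasure (μ.map (· * g)) :=
    Measure.isProbabilityMeasure_map (by fun_prop)
  exact Measure.isHaarMeasure_eq_of_isProbabilityMeasure _ _

/-- The average is invariant under `G`, hence commutes with the span of the transposes of `G`, and
by double commutation lies in `Aᵀ`. Pairing with an element of `Aᵀ` does not see the conjugation,
because such elements commute with every `gᵀ`. -/
theorem hsProj_eq_twirl (𝒟 : Decomposition A) (hG : SpansCommutant A G) (μ : Measure G)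
    [μ.IsHaarMeasure] [IsProbabilityMeasure μ] (X : Matrix (Fin D) (Fin D) ℂ) :
    hsProj (transposeSubspace A) X = Matrix.of fun b c => ∫ g : G,
      ((g.1 : Matrix (Fin D) (Fin D) ℂ)ᵀ * X *
        (g.1 : Matrix (Fin D) (Fin D) ℂ).map (starRingEnd ℂ)) b c ∂μ := by
  have := isMulRightInvariant_of_isHaarMeasure hG.1 μ
  set Z : Matrix (Fin D) (Fin D) ℂ := Matrix.of fun b c => ∫ g : G,
      ((g.1 : Matrix (Fin D) (Fin D) ℂ)ᵀ * X *
        (g.1 : Matrix (Fin D) (Fin D) ℂ).map (starRingEnd ℂ)) b c ∂μ with hZ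
  have hconj : ∀ g : Matrix.unitaryGroup (Fin D) ℂ, (g : Matrix (Fin D) (Fin D) ℂ).map
      (starRingEnd ℂ) * (g : Matrix (Fin D) (Fin D) ℂ)ᵀ = 1 := fun g => by
    have h1 : (g : Matrix (Fin D) (Fin D) ℂ) * (g : Matrix (Fin D) (Fin D) ℂ)ᴴ = 1 :=
      Matrix.mem_unitaryGroup_iff.mp g.2
    rw [← Matrix.transpose_inj, Matrix.transpose_mul, Matrix.transpose_transpose,
      map_conj_transpose, h1, Matrix.transpose_one]
  have hmul : ∀ (L R : Matrix (Fin D) (Fin D) ℂ) b c, (L * Z * R) b c = ∫ g : G,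
      (L * ((g.1 : Matrix (Fin D) (Fin D) ℂ)ᵀ * X *
        (g.1 : Matrix (Fin D) (Fin D) ℂ).map (starRingEnd ℂ)) * R) b c ∂μ := by
    intro L R b c
    simp only [Matrix.mul_apply (M := L * _), Matrix.mul_apply (M := L), Finset.sum_mul]
    rw [integral_finsetSum]
    · refine Finset.sum_congr rfl fun i _ => ?_
      rw [integral_finsetSum]
      · refine Finset.sum_congr rfl fun j _ => ?_
        rw [integral_mul_const, integral_const_mul]
        rfl
      · exact fun j _ => ((integrable_twirl μ X j i).const_mul _).mul_const _
    · exact fun i _ => integrable_finsetSum _ fun j _ =>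
        ((integrable_twirl μ X j i).const_mul _).mul_const _
  refine hsProj_eq_of ?_ ?_
  -- Transposition reverses products, so conjugating by `h` amounts to the right translation `g ↦ g
  -- h`.
  · have hinv : ∀ h ∈ G, (h : Matrix (Fin D) (Fin D) ℂ)ᵀ * Z *
        (h : Matrix (Fin D) (Fin D) ℂ).map (starRingEnd ℂ) = Z := by
      intro h hh
      ext b c
      rw [hmul]
      refine Eq.trans ?_ (integral_mul_right_eq_self (μ := μ) (fun g : G =>
        ((g.1 : Matrix (Fin D) (Fin D) ℂ)ᵀ * X *
          (g.1 : Matrix (Fin D) (Fin D) ℂ).map (starRingEnd ℂ)) b c) (⟨h, hh⟩ : G))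
      refine integral_congr_ae (Filter.Eventually.of_forall fun g => ?_)
      simp only [Subgroup.coe_mul, Submonoid.coe_mul, Matrix.transpose_mul, Matrix.map_mul,
        Matrix.mul_assoc]
    have hmem : Zᵀ ∈ A := by
      refine 𝒟.mem_of_commute_commutant fun g hg => ?_
      have hg' : g ∈ Submodule.span ℂ ((fun g : Matrix.unitaryGroup (Fin D) ℂ =>
          (g : Matrix (Fin D) (Fin D) ℂ)) '' (G : Set (Matrix.unitaryGroup (Fin D) ℂ))) := by
        rw [hG.2]; exact hg
      refine Submodule.span_induction (p := fun g _ => Zᵀ * g = g * Zᵀ) ?_ ?_ ?_ ?_ hg'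
      · rintro _ ⟨h, hh, rfl⟩
        have h1 := hinv h hh
        have h2 : (h : Matrix (Fin D) (Fin D) ℂ)ᵀ * Z = Z * (h : Matrix (Fin D) (Fin D) ℂ)ᵀ := by
          nth_rewrite 2 [← h1]
          rw [Matrix.mul_assoc _ _ (_ᵀ), hconj, Matrix.mul_one]
        have h3 := congrArg Matrix.transpose h2
        simpa [Matrix.transpose_mul] using h3
      · simp
      · intro x y _ _ hx hy
        rw [mul_add, add_mul, hx, hy]
      · intro c x _ hx
        rw [Matrix.smul_mul, Matrix.mul_smul, hx]
    have := transpose_mem_transposeSubspace hmem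
    rwa [Matrix.transpose_transpose] at this
  · rintro _ ⟨a, ha, rfl⟩
    change ((aᵀ)ᴴ * (X - Z)).trace = 0
    have ha' : aᴴ ∈ A := star_mem (show a ∈ A from ha)
    have e1 : (aᵀ)ᴴ = (aᴴ)ᵀ := rfl
    rw [e1, Matrix.mul_sub, Matrix.trace_sub, sub_eq_zero, ← Matrix.mul_one ((aᴴ)ᵀ * Z)]
    conv_rhs => rw [Matrix.trace]
    simp only [Matrix.diag_apply, hmul]
    rw [← integral_finsetSum]
    -- After pairing with an element of `Aᵀ` the integrand is constant.
    · have : ∀ g : G, ∑ i, ((aᴴ)ᵀ * ((g.1 : Matrix (Fin D) (Fin D) ℂ)ᵀ * X *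
          (g.1 : Matrix (Fin D) (Fin D) ℂ).map (starRingEnd ℂ)) * 1 :
            Matrix (Fin D) (Fin D) ℂ) i i = ((aᴴ)ᵀ * X).trace := by
        intro g
        have hgc : (g.1 : Matrix (Fin D) (Fin D) ℂ) ∈ commutant A := by
          have : (g.1 : Matrix (Fin D) (Fin D) ℂ) ∈ asSubspace (commutant A) := by
            rw [← hG.2]
            exact Submodule.subset_span ⟨g.1, g.2, rfl⟩
          exact this
        have h1 := (mem_commutant_iff.mp hgc) _ ha'
        have h2 : (aᴴ)ᵀ * (g.1 : Matrix (Fin D) (Fin D) ℂ)ᵀ =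
            (g.1 : Matrix (Fin D) (Fin D) ℂ)ᵀ * (aᴴ)ᵀ := by
          rw [← Matrix.transpose_mul, ← h1, Matrix.transpose_mul]
        change Matrix.trace _ = _
        rw [Matrix.mul_one, Matrix.mul_assoc, ← Matrix.mul_assoc, h2, Matrix.mul_assoc,
          Matrix.trace_mul_comm, ← Matrix.mul_assoc, Matrix.mul_assoc, hconj, Matrix.mul_one]
      simp only [this, integral_const, probReal_univ, one_smul]
    · intro i _
      simp only [Matrix.mul_one]
      simp only [Matrix.mul_apply (M := (aᴴ)ᵀ)]
      exact integrable_finsetSum _ fun j _ => (integrable_twirl μ X j i).const_mul _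

end Twirl

/-! ### Properties of the channel -/

theorem hsProj_expand {D : ℕ} (S : Submodule ℂ (Matrix (Fin D) (Fin D) ℂ))
    (X : Matrix (Fin D) (Fin D) ℂ) :
    hsProj S X = ∑ x, ∑ y, X x y • hsProj S (Matrix.single x y 1) := by
  conv_lhs => rw [Matrix.matrix_eq_sum_single X]
  simp only [map_sum, ← map_smul, Matrix.smul_single, smul_eq_mul, mul_one]

theorem stdVec_apply {D : ℕ} (ρ : Matrix (Fin D) (Fin D) ℂ) (p : Fin D × Fin D) :
    stdVec ρ p = CFC.sqrt ρ p.1 p.2 := by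
  rw [stdVec, kronecker_mulVec_apply]
  have : (Matrix.of fun x y => Gam D (x, y)) = (1 : Matrix (Fin D) (Fin D) ℂ) := by
    ext x y
    simp [Gam, Matrix.one_apply]
  rw [this]
  simp

theorem sqrt_conjTranspose {D : ℕ} (ρ : Matrix (Fin D) (Fin D) ℂ) :
    (CFC.sqrt ρ)ᴴ = CFC.sqrt ρ :=
  (Matrix.nonneg_iff_posSemidef.mp (CFC.sqrt_nonneg ρ)).1

theorem stdPurification_apply {D : ℕ} (ρ : Matrix (Fin D) (Fin D) ℂ) (x b y c : Fin D) :
    stdPurification ρ (x, b) (y, c) = CFC.sqrt ρ x b * CFC.sqrt ρ c y := by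
  rw [stdPurification, Matrix.vecMulVec_apply, Pi.star_apply, stdVec_apply, stdVec_apply]
  congr 1
  exact congrFun (congrFun (sqrt_conjTranspose ρ) c) y

theorem sqrt_mem_commutant {D : ℕ} {A : StarSubalgebra ℂ (Matrix (Fin D) (Fin D) ℂ)}
    {ρ : Matrix (Fin D) (Fin D) ℂ} (hρ : ρ.PosSemidef) (h : ρ ∈ commutant A) :
    CFC.sqrt ρ ∈ commutant A := by
  rw [CFC.sqrt_eq_real_sqrt ρ (Matrix.nonneg_iff_posSemidef.mpr hρ),
    cfcₙ_eq_cfc (hf := Real.continuous_sqrt.continuousOn)]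
  exact cfc_real_mem (commutant A) h hρ.1.isSelfAdjoint _

/-! ### Invariant inputs and independence of the decomposition -/

namespace Decomposition
variable {D : ℕ} {A : StarSubalgebra ℂ (Matrix (Fin D) (Fin D) ℂ)} (𝒟 : Decomposition A)

/-- The root `s = √ρ` stays in the commutant, so `s ⊗ 1` commutes with `Π` and `P(ρ) = (s ⊗ 1) P(1)
(s ⊗ 1)`. The blocks of `P(1)` are projected matrix units by `hsProj_single`, and linearity
assembles them into the projected purification. -/
theorem purify_of_mem_commutant {ρ : Matrix (Fin D) (Fin D) ℂ} (hρ : ρ.PosSemidef)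
    (h : ρ ∈ commutant A) :
    𝒟.purify ρ = idTensor (Fin D) (hsProj (transposeSubspace A)) (stdPurification ρ) := by
  set s := CFC.sqrt ρ with hs
  have hsA : s ∈ commutant A := sqrt_mem_commutant hρ h
  have hss : s * s = ρ := CFC.sqrt_mul_sqrt_self ρ (Matrix.nonneg_iff_posSemidef.mpr hρ)
  have h1 : 𝒟.purify ρ = (s ⊗ₖ 1) * 𝒟.purify 1 * (s ⊗ₖ 1) := by
    have hc := commute_symmProj_left A hsA
    rw [purify_eq, purify_eq, ← hss]
    have e : (s * s) ⊗ₖ 𝒟.Omega = (s ⊗ₖ 1) * (1 ⊗ₖ 𝒟.Omega) * (s ⊗ₖ 1) := by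
      rw [← Matrix.mul_kronecker_mul, ← Matrix.mul_kronecker_mul]; simp
    rw [e]
    simp only [Matrix.mul_assoc]
    rw [← hc.eq]
    simp only [← Matrix.mul_assoc]
    rw [hc.eq]
  rw [h1]
  ext ⟨x, b⟩ ⟨y, c⟩
  simp only [idTensor, LinearMap.coe_mk, AddHom.coe_mk, Matrix.of_apply]
  rw [hsProj_expand]
  simp only [𝒟.hsProj_single, Matrix.sum_apply, Matrix.smul_apply, Matrix.of_apply,
    stdPurification_apply, smul_eq_mul, Matrix.mul_apply, Matrix.kroneckerMap_apply,
    Fintype.sum_prod_type, Matrix.one_apply, mul_ite, mul_one, mul_zero, ite_mul, zero_mul,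
    Finset.sum_ite_eq, Finset.sum_ite_eq', Finset.mem_univ, if_true, Finset.sum_mul]
  rw [Finset.sum_comm]
  exact Finset.sum_congr rfl fun i _ => Finset.sum_congr rfl fun j _ => by ring

/-- The blocks of `P(1)` are projections onto `Aᵀ`, which do not refer to a decomposition, and `P`
is determined by `P(1)` through `purify_eq_sqrt`. -/
theorem purify_unique (𝒟' : Decomposition A) : 𝒟.purify = 𝒟'.purify := by
  have h1 : 𝒟.purify 1 = 𝒟'.purify 1 := by
    ext ⟨x, b⟩ ⟨y, c⟩
    have h := (𝒟.hsProj_single x y).symm.trans (𝒟'.hsProj_single x y)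
    exact congrFun (congrFun h b) c
  ext1 X
  rw [𝒟.purify_eq_sqrt, 𝒟'.purify_eq_sqrt, h1]

theorem purify_mulVec_mem (X : Matrix (Fin D) (Fin D) ℂ) (v : Fin D × Fin D → ℂ) :
    WithLp.toLp 2 (𝒟.purify X *ᵥ v) ∈ symmSubspace A := by
  rw [purify_eq, Matrix.mul_assoc, ← Matrix.mulVec_mulVec]
  exact symmProj_mulVec_mem A _

open MeasureTheory in
theorem idTensor_hsProj_eq_integral {A : StarSubalgebra ℂ (Matrix (Fin D) (Fin D) ℂ)}
    (𝒟 : Decomposition A) (ρ : Matrix (Fin D) (Fin D) ℂ)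
    (G : Subgroup (Matrix.unitaryGroup (Fin D) ℂ)) (hG : SpansCommutant A G)
    [MeasurableSpace G] [BorelSpace G] (μ : Measure G) [μ.IsHaarMeasure] [IsProbabilityMeasure μ] :
    idTensor (Fin D) (hsProj (transposeSubspace A)) (stdPurification ρ) =
      Matrix.of fun i j => ∫ g : G,
        ((1 ⊗ₖ (g.1 : Matrix (Fin D) (Fin D) ℂ)ᵀ) * stdPurification ρ *
          (1 ⊗ₖ (g.1 : Matrix (Fin D) (Fin D) ℂ).map (starRingEnd ℂ)) :
          Matrix (Fin D × Fin D) (Fin D × Fin D) ℂ) i j ∂μ := by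
  ext ⟨x, b⟩ ⟨y, c⟩
  simp only [idTensor, LinearMap.coe_mk, AddHom.coe_mk, Matrix.of_apply]
  rw [hsProj_eq_twirl 𝒟 hG μ]
  simp only [Matrix.of_apply]
  congr 1
  ext g
  simp only [Matrix.mul_apply, Matrix.of_apply, Fintype.sum_prod_type, Matrix.kroneckerMap_apply,
    Matrix.one_apply, ite_mul, mul_ite, one_mul, zero_mul, mul_zero, Finset.sum_ite_irrel,
    Finset.sum_const_zero, Finset.sum_ite_eq, Finset.sum_ite_eq', Finset.mem_univ, if_true]

end Decomposition

/-! ### Operators on a subset of the wires -/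

section Lift
variable {κ ω : Type} [Fintype κ] [DecidableEq κ] [Fintype ω] [DecidableEq ω]

/-- Overwriting the wires in the range of `e`. -/
theorem extend_comp (e : κ ↪ ω) (w : κ → Bool) (x : ω → Bool) :
    Function.extend e w x ∘ e = w := by
  ext i; exact e.injective.extend_apply _ _ _

theorem extend_off (e : κ ↪ ω) (w : κ → Bool) (x : ω → Bool) {i : ω} (hi : i ∉ Set.range e) :
    Function.extend e w x i = x i :=
  Function.extend_apply' _ _ _ (fun ⟨a, ha⟩ => hi ⟨a, ha⟩)

theorem eq_extend_iff {e : κ ↪ ω} {w : κ → Bool} {x z : ω → Bool} :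
    z = Function.extend e w x ↔ z ∘ e = w ∧ ∀ i, i ∉ Set.range e → z i = x i := by
  constructor
  · rintro rfl
    exact ⟨extend_comp e w x, fun i hi => extend_off e w x hi⟩
  · rintro ⟨h1, h2⟩
    ext i
    by_cases hi : i ∈ Set.range e
    · obtain ⟨a, rfl⟩ := hi
      rw [e.injective.extend_apply, ← h1, Function.comp_apply]
    · rw [extend_off e w x hi, h2 i hi]

open Classical in
theorem sum_agree {β : Type*} [AddCommMonoid β] (e : κ ↪ ω) (x : ω → Bool)
    (f : (ω → Bool) → β) :
    (∑ z, if ∀ i, i ∉ Set.range e → z i = x i then f z else 0) =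
      ∑ w, f (Function.extend e w x) := by
  rw [← Finset.sum_filter]
  symm
  refine Finset.sum_bij (fun w _ => Function.extend e w x) ?_ ?_ ?_ ?_
  · intro w _
    simp only [Finset.mem_filter, Finset.mem_univ, true_and]
    exact fun i hi => extend_off e w x hi
  · intro w _ w' _ h
    rw [← extend_comp e w x, h, extend_comp]
  · intro z hz
    simp only [Finset.mem_filter, Finset.mem_univ, true_and] at hz
    exact ⟨z ∘ e, Finset.mem_univ _, (eq_extend_iff.mpr ⟨rfl, hz⟩).symm⟩
  · intros; rfl

open Classical in
/-- The operator `M` applied to the wires in the range of `e`. -/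
def liftOp (e : κ ↪ ω) (M : Matrix (κ → Bool) (κ → Bool) ℂ) :
    Matrix (ω → Bool) (ω → Bool) ℂ :=
  Matrix.of fun y x => if ∀ i, i ∉ Set.range e → y i = x i then M (y ∘ e) (x ∘ e) else 0

/-- The basis state `|x⟩`. -/
abbrev ket {m : Type*} [DecidableEq m] (x : m) : m → ℂ := Pi.single x 1

theorem ext_ket {m n : Type*} [Fintype n] [DecidableEq n] {M N : Matrix m n ℂ}
    (h : ∀ x, M *ᵥ ket x = N *ᵥ ket x) : M = N := by
  ext y x
  simpa using congrFun (h x) y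

theorem liftOp_mulVec (e : κ ↪ ω) (M : Matrix (κ → Bool) (κ → Bool) ℂ) (v : (ω → Bool) → ℂ)
    (y : ω → Bool) :
    (liftOp e M *ᵥ v) y = ∑ w, M (y ∘ e) w * v (Function.extend e w y) := by
  have h := sum_agree e y (fun x => M (y ∘ e) (x ∘ e) * v x)
  simp only [extend_comp] at h
  rw [← h]
  simp only [liftOp, Matrix.mulVec, dotProduct, Matrix.of_apply, ite_mul, zero_mul]
  refine Finset.sum_congr rfl fun x _ => ?_
  simp only [eq_comm]

theorem liftOp_ket (e : κ ↪ ω) (M : Matrix (κ → Bool) (κ → Bool) ℂ) (x : ω → Bool) :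
    liftOp e M *ᵥ ket x = ∑ w, M w (x ∘ e) • ket (Function.extend e w x) := by
  ext y
  rw [Matrix.mulVec_single_one, Finset.sum_apply]
  simp only [Pi.smul_apply, Pi.single_apply, smul_eq_mul, mul_ite, mul_one, mul_zero,
    eq_extend_iff]
  by_cases h : ∀ i, i ∉ Set.range e → y i = x i
  · have h1 : ∀ w, (y ∘ e = w ∧ ∀ i, i ∉ Set.range e → y i = x i) ↔ w = y ∘ e := fun w =>
      ⟨fun h => h.1.symm, fun h' => ⟨h'.symm, h⟩⟩
    simp only [h1, Finset.sum_ite_eq', Finset.mem_univ, if_true]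
    change (if _ then _ else _) = _
    rw [if_pos h]
  · simp only [h, and_false, if_false, Finset.sum_const_zero]
    change (if _ then _ else _) = _
    rw [if_neg h]

theorem liftOp_add (e : κ ↪ ω) (M N : Matrix (κ → Bool) (κ → Bool) ℂ) :
    liftOp e (M + N) = liftOp e M + liftOp e N := by
  ext y x
  simp only [liftOp, Matrix.of_apply, Matrix.add_apply]
  split_ifs <;> simp

theorem liftOp_smul (e : κ ↪ ω) (c : ℂ) (M : Matrix (κ → Bool) (κ → Bool) ℂ) :
    liftOp e (c • M) = c • liftOp e M := by
  ext y x
  simp only [liftOp, Matrix.of_apply, Matrix.smul_apply]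
  split_ifs <;> simp

theorem liftOp_one (e : κ ↪ ω) : liftOp e (1 : Matrix (κ → Bool) (κ → Bool) ℂ) = 1 := by
  refine ext_ket fun x => ?_
  rw [liftOp_ket, Matrix.one_mulVec, Finset.sum_eq_single (x ∘ e)]
  · rw [Matrix.one_apply_eq, one_smul, eq_comm]
    congr 1
    exact eq_extend_iff.mpr ⟨rfl, fun _ _ => rfl⟩
  · intro w _ hw
    rw [Matrix.one_apply_ne hw, zero_smul]
  · simp

theorem extend_extend (e : κ ↪ ω) (w w' : κ → Bool) (x : ω → Bool) :
    Function.extend e w (Function.extend e w' x) = Function.extend e w x :=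
  eq_extend_iff.mpr ⟨extend_comp _ _ _, fun i hi => by
    rw [extend_off _ _ _ hi, extend_off _ _ _ hi]⟩

theorem liftOp_mul (e : κ ↪ ω) (M N : Matrix (κ → Bool) (κ → Bool) ℂ) :
    liftOp e (M * N) = liftOp e M * liftOp e N := by
  refine ext_ket fun x => ?_
  rw [← Matrix.mulVec_mulVec, liftOp_ket, liftOp_ket, Matrix.mulVec_sum]
  simp only [Matrix.mulVec_smul, liftOp_ket, extend_comp, extend_extend, Finset.smul_sum,
    Matrix.mul_apply, Finset.sum_smul, smul_smul]
  rw [Finset.sum_comm]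
  exact Finset.sum_congr rfl fun w _ => Finset.sum_congr rfl fun w' _ => by rw [mul_comm]

theorem liftOp_conjTranspose (e : κ ↪ ω) (M : Matrix (κ → Bool) (κ → Bool) ℂ) :
    liftOp e Mᴴ = (liftOp e M)ᴴ := by
  ext y x
  simp only [liftOp, Matrix.of_apply, Matrix.conjTranspose_apply, apply_ite star, star_zero]
  simp only [eq_comm]

theorem liftOp_map_conj (e : κ ↪ ω) (M : Matrix (κ → Bool) (κ → Bool) ℂ) :
    liftOp e (M.map (starRingEnd ℂ)) = (liftOp e M).map (starRingEnd ℂ) := by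
  ext y x
  simp only [liftOp, Matrix.of_apply, Matrix.map_apply, apply_ite (starRingEnd ℂ), map_zero]

/-- Operators on a subset of the wires, as a homomorphism of star algebras. -/
def liftHom (e : κ ↪ ω) :
    Matrix (κ → Bool) (κ → Bool) ℂ →⋆ₐ[ℂ] Matrix (ω → Bool) (ω → Bool) ℂ where
  toFun := liftOp e
  map_one' := liftOp_one e
  map_mul' := liftOp_mul e
  map_zero' := by simpa using liftOp_smul e 0 0
  map_add' := liftOp_add e
  commutes' c := by
    rw [Algebra.algebraMap_eq_smul_one, liftOp_smul, liftOp_one, Algebra.algebraMap_eq_smul_one]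
  map_star' M := liftOp_conjTranspose e M

theorem liftOp_sub (e : κ ↪ ω) (M N : Matrix (κ → Bool) (κ → Bool) ℂ) :
    liftOp e (M - N) = liftOp e M - liftOp e N := map_sub (liftHom e) M N

theorem liftOp_mem_unitary (e : κ ↪ ω) {M : Matrix (κ → Bool) (κ → Bool) ℂ}
    (hM : M ∈ Matrix.unitaryGroup (κ → Bool) ℂ) :
    liftOp e M ∈ Matrix.unitaryGroup (ω → Bool) ℂ :=
  Unitary.map_mem (liftHom e) hM

open scoped Matrix.Norms.L2Operator in
theorem norm_liftOp_le (e : κ ↪ ω) (M : Matrix (κ → Bool) (κ → Bool) ℂ) : ‖liftOp e M‖ ≤ ‖M‖ :=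
  NonUnitalStarAlgHom.norm_apply_le (liftHom e) M

theorem liftOp_liftOp {α : Type} [Fintype α] [DecidableEq α] (f : α ↪ κ) (e : κ ↪ ω)
    (M : Matrix (α → Bool) (α → Bool) ℂ) : liftOp e (liftOp f M) = liftOp (f.trans e) M := by
  ext y x
  simp only [liftOp, Matrix.of_apply]
  have h : (∀ i, i ∉ Set.range (f.trans e) → y i = x i) ↔
      (∀ i, i ∉ Set.range e → y i = x i) ∧ ∀ i, i ∉ Set.range f → (y ∘ e) i = (x ∘ e) i := by
    constructor
    · refine fun h => ⟨fun i hi => h i ?_, fun i hi => h _ ?_⟩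
      · rintro ⟨a, rfl⟩; exact hi ⟨f a, rfl⟩
      · rintro ⟨a, ha⟩; exact hi ⟨a, e.injective ha⟩
    · rintro ⟨h1, h2⟩ i hi
      by_cases hi' : i ∈ Set.range e
      · obtain ⟨j, rfl⟩ := hi'
        exact h2 j (by rintro ⟨a, rfl⟩; exact hi ⟨a, rfl⟩)
      · exact h1 i hi'
  by_cases h1 : ∀ i, i ∉ Set.range e → y i = x i
  · by_cases h2 : ∀ i, i ∉ Set.range f → (y ∘ e) i = (x ∘ e) i
    · rw [if_pos h1, if_pos h2, if_pos (h.mpr ⟨h1, h2⟩)]; rfl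
    · rw [if_pos h1, if_neg h2, if_neg (fun h' => h2 (h.mp h').2)]
  · rw [if_neg h1, if_neg (fun h' => h1 (h.mp h').1)]

theorem liftOp_commute {κ' : Type} [Fintype κ'] [DecidableEq κ'] (e : κ ↪ ω) (f : κ' ↪ ω)
    (hd : ∀ a b, e a ≠ f b) (M : Matrix (κ → Bool) (κ → Bool) ℂ)
    (N : Matrix (κ' → Bool) (κ' → Bool) ℂ) : liftOp e M * liftOp f N = liftOp f N * liftOp e M := by
  have hc : ∀ (w : κ → Bool) (u : κ' → Bool) (x : ω → Bool),
      Function.extend e w (Function.extend f u x) = Function.extend f u (Function.extend e w x) := by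
    intro w u x
    ext i
    by_cases h1 : i ∈ Set.range e
    · obtain ⟨a, rfl⟩ := h1
      rw [e.injective.extend_apply, extend_off f _ _ (fun ⟨b, hb⟩ => hd a b hb.symm),
        e.injective.extend_apply]
    · rw [extend_off e _ _ h1]
      by_cases h2 : i ∈ Set.range f
      · obtain ⟨b, rfl⟩ := h2
        rw [f.injective.extend_apply, f.injective.extend_apply]
      · rw [extend_off f _ _ h2, extend_off f _ _ h2, extend_off e _ _ h1]
  have h1 : ∀ (u : κ' → Bool) (x : ω → Bool), Function.extend f u x ∘ e = x ∘ e := fun u x => by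
    ext a; exact extend_off f _ _ (fun ⟨b, hb⟩ => hd a b hb.symm)
  have h2 : ∀ (w : κ → Bool) (x : ω → Bool), Function.extend e w x ∘ f = x ∘ f := fun w x => by
    ext b; exact extend_off e _ _ (fun ⟨a, ha⟩ => hd a b ha)
  refine ext_ket fun x => ?_
  rw [← Matrix.mulVec_mulVec, ← Matrix.mulVec_mulVec, liftOp_ket, liftOp_ket, Matrix.mulVec_sum,
    Matrix.mulVec_sum]
  simp only [Matrix.mulVec_smul, liftOp_ket, h1, h2, Finset.smul_sum, smul_smul, hc]
  rw [Finset.sum_comm]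
  exact Finset.sum_congr rfl fun w _ => Finset.sum_congr rfl fun w' _ => by rw [mul_comm]

end Lift

/-! ### Classical maps -/

section Encode
variable {l m n : Type*} [DecidableEq m] [DecidableEq n]

theorem encode_ket [Fintype m] (f : m → n) (x : m) : encode f *ᵥ ket x = ket (f x) := by
  ext y
  rw [Matrix.mulVec_single_one]
  simp [encode, Pi.single_apply]

theorem encode_mul_encode [Fintype m] [Fintype n] {c : Type*} [DecidableEq c] (g : n → c)
    (f : m → n) : encode g * encode f = encode (g ∘ f) := by
  refine ext_ket fun x => ?_
  rw [← Matrix.mulVec_mulVec, encode_ket, encode_ket, encode_ket]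
  rfl

theorem encode_id [Fintype m] : encode (id : m → m) = 1 := by
  refine ext_ket fun x => ?_
  rw [encode_ket, Matrix.one_mulVec]
  rfl

theorem encode_conjTranspose_mul [Fintype m] [Fintype n] {f : m → n} (hf : Function.Injective f) :
    (encode f)ᴴ * encode f = 1 := by
  ext x x'
  rw [Matrix.mul_apply, Finset.sum_eq_single (f x)]
  · simp [encode, Matrix.one_apply, hf.eq_iff]
  · intro y _ hy
    simp [encode, hy]
  · simp

theorem encode_mem_unitary [Fintype m] {f : m → m} (hf : Function.Injective f) :
    encode f ∈ Matrix.unitaryGroup m ℂ :=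
  Matrix.mem_unitaryGroup_iff'.mpr (encode_conjTranspose_mul hf)

theorem encode_map_conj (f : m → n) : (encode f).map (starRingEnd ℂ) = encode f := by
  ext y x
  simp only [encode, Matrix.map_apply, Matrix.of_apply, apply_ite (starRingEnd ℂ), map_one,
    map_zero]

variable {κ ω : Type} [Fintype κ] [DecidableEq κ] [Fintype ω] [DecidableEq ω]

theorem liftOp_encode (e : κ ↪ ω) (F : (κ → Bool) → κ → Bool) :
    liftOp e (encode F) = encode fun x => Function.extend e (F (x ∘ e)) x := by
  refine ext_ket fun x => ?_
  rw [liftOp_ket, encode_ket, Finset.sum_eq_single (F (x ∘ e))]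
  · simp [encode]
  · intro w _ hw
    simp [encode, hw]
  · simp

/-- The bits `x` on the wires `e`, zeros elsewhere. -/
def pad (e : κ ↪ ω) (x : κ → Bool) : ω → Bool := Function.extend e x fun _ => false

theorem pad_apply (e : κ ↪ ω) (x : κ → Bool) (t : κ) : pad e x (e t) = x t :=
  e.injective.extend_apply _ _ _

theorem pad_off (e : κ ↪ ω) (x : κ → Bool) {i : ω} (hi : i ∉ Set.range e) : pad e x i = false :=
  extend_off e _ _ hi

theorem pad_comp (e : κ ↪ ω) (x : κ → Bool) : pad e x ∘ e = x := extend_comp e _ _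

theorem pad_injective (e : κ ↪ ω) : Function.Injective (pad e) := fun x y h => by
  rw [← pad_comp e x, h, pad_comp]

theorem pad_trans {α : Type} [Fintype α] [DecidableEq α] (f : α ↪ κ) (e : κ ↪ ω) (x : α → Bool) :
    pad (f.trans e) x = pad e (pad f x) := by
  symm
  refine eq_extend_iff.mpr ⟨?_, fun i hi => ?_⟩
  · ext a
    change pad e (pad f x) (e (f a)) = _
    rw [pad_apply, pad_apply]
  · by_cases h : i ∈ Set.range e
    · obtain ⟨a, rfl⟩ := h
      rw [pad_apply, pad_off]
      rintro ⟨b, rfl⟩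
      exact hi ⟨b, rfl⟩
    · exact pad_off _ _ h

theorem liftOp_mul_encode_pad (e : κ ↪ ω) (M : Matrix (κ → Bool) (κ → Bool) ℂ) :
    liftOp e M * encode (pad e) = encode (pad e) * M := by
  refine ext_ket fun x => ?_
  rw [← Matrix.mulVec_mulVec, ← Matrix.mulVec_mulVec, encode_ket, liftOp_ket]
  ext y
  rw [Finset.sum_apply]
  simp only [pad_comp, Matrix.mulVec, dotProduct, encode, Matrix.of_apply, Pi.smul_apply,
    smul_eq_mul, ite_mul, one_mul, zero_mul, Pi.single_apply, mul_ite, mul_one, mul_zero,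
    Finset.sum_ite_eq', Finset.mem_univ, if_true]
  refine Finset.sum_congr rfl fun w _ => ?_
  rw [pad, extend_extend]
  rfl

end Encode

/-! ### Implementable operators -/

/-- `M` is the product of `c` elementary gates on the wires `ω`. -/
inductive Impl {ω : Type} [Fintype ω] [DecidableEq ω] :
    ℕ → Matrix (ω → Bool) (ω → Bool) ℂ → Prop
  | one : Impl 0 1
  | gate {k : ℕ} (hk : k ≤ 3) (e : Fin k ↪ ω) (g : Matrix (Fin k → Bool) (Fin k → Bool) ℂ)
      (hg : g ∈ Matrix.unitaryGroup (Fin k → Bool) ℂ) : Impl 1 (liftOp e g)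
  | mul {c c' : ℕ} {M M' : Matrix (ω → Bool) (ω → Bool) ℂ} :
      Impl c M → Impl c' M' → Impl (c + c') (M' * M)

section Impl
variable {κ ω : Type} [Fintype κ] [DecidableEq κ] [Fintype ω] [DecidableEq ω]

theorem Impl.mem_unitary {c : ℕ} {M : Matrix (ω → Bool) (ω → Bool) ℂ} (h : Impl c M) :
    M ∈ Matrix.unitaryGroup (ω → Bool) ℂ := by
  induction h with
  | one => exact one_mem _
  | gate hk e g hg => exact liftOp_mem_unitary e hg
  | mul _ _ h1 h2 => exact mul_mem h2 h1

theorem Impl.lift (e : κ ↪ ω) {c : ℕ} {M : Matrix (κ → Bool) (κ → Bool) ℂ} (h : Impl c M) :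
    Impl c (liftOp e M) := by
  induction h with
  | one => rw [liftOp_one]; exact Impl.one
  | gate hk f g hg => rw [liftOp_liftOp]; exact Impl.gate hk _ g hg
  | mul _ _ h1 h2 => rw [liftOp_mul]; exact Impl.mul h1 h2

theorem Impl.conjTranspose {c : ℕ} {M : Matrix (ω → Bool) (ω → Bool) ℂ} (h : Impl c M) :
    Impl c Mᴴ := by
  induction h with
  | one => rw [Matrix.conjTranspose_one]; exact Impl.one
  | gate hk f g hg =>
    rw [← liftOp_conjTranspose]
    exact Impl.gate hk _ _ (Unitary.star_mem hg : star g ∈ Matrix.unitaryGroup _ ℂ)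
  | mul _ _ h1 h2 => rw [Matrix.conjTranspose_mul, add_comm]; exact Impl.mul h2 h1

theorem map_conj_mem_unitary {m : Type*} [Fintype m] [DecidableEq m] {g : Matrix m m ℂ}
    (hg : g ∈ Matrix.unitaryGroup m ℂ) : g.map (starRingEnd ℂ) ∈ Matrix.unitaryGroup m ℂ := by
  rw [Matrix.mem_unitaryGroup_iff] at hg ⊢
  have := congrArg (fun M : Matrix m m ℂ => M.map (starRingEnd ℂ)) hg
  simp only [Matrix.map_mul] at this
  rw [Matrix.map_one _ (map_zero _) (map_one _)] at this
  exact this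

/-- Conjugation acts gate by gate. It is needed because the purifying register must undergo the
complex conjugate of `U†`. -/
theorem Impl.map_conj {c : ℕ} {M : Matrix (ω → Bool) (ω → Bool) ℂ} (h : Impl c M) :
    Impl c (M.map (starRingEnd ℂ)) := by
  induction h with
  | one => rw [Matrix.map_one _ (map_zero _) (map_one _)]; exact Impl.one
  | gate hk f g hg =>
    rw [← liftOp_map_conj]
    exact Impl.gate hk _ _ (map_conj_mem_unitary hg)
  | mul _ _ h1 h2 => rw [Matrix.map_mul]; exact Impl.mul h1 h2

theorem Impl.of_card_le (h : Fintype.card κ ≤ 3) (e : κ ↪ ω)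
    {g : Matrix (κ → Bool) (κ → Bool) ℂ} (hg : g ∈ Matrix.unitaryGroup (κ → Bool) ℂ) :
    Impl 1 (liftOp e g) := by
  let q := Fintype.equivFin κ
  have h1 : liftOp e g = liftOp (q.symm.toEmbedding.trans e) (liftOp q.toEmbedding g) := by
    rw [liftOp_liftOp]
    congr 1
    ext t
    simp
  rw [h1]
  exact Impl.gate h _ _ (liftOp_mem_unitary _ hg)

theorem circuitMatrix_append {N : ℕ} (W W' : List (Gate N)) :
    circuitMatrix (W ++ W') = circuitMatrix W' * circuitMatrix W := by
  induction W with
  | nil => simp [circuitMatrix]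
  | cons g gs ih => rw [List.cons_append, circuitMatrix, circuitMatrix, ih, Matrix.mul_assoc]

theorem Gate.toMatrix_eq {N : ℕ} (g : Gate N) : g.toMatrix = liftOp g.wires g.mat := by
  ext y x
  simp only [Gate.toMatrix, liftOp, Matrix.of_apply]
  congr

theorem Impl.of_circuit {N : ℕ} (W : List (Gate N)) : Impl W.length (circuitMatrix W) := by
  induction W with
  | nil => exact Impl.one
  | cons g gs ih =>
    rw [List.length_cons, add_comm, circuitMatrix, Gate.toMatrix_eq]
    exact Impl.mul (Impl.gate g.arity_le g.wires g.mat g.unitary) ih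

theorem Impl.exists_circuit {N c : ℕ} {M : Matrix (Fin N → Bool) (Fin N → Bool) ℂ}
    (h : Impl c M) : ∃ W : List (Gate N), W.length = c ∧ circuitMatrix W = M := by
  induction h with
  | one => exact ⟨[], rfl, rfl⟩
  | gate hk e g hg =>
    refine ⟨[⟨_, hk, e, g, hg⟩], rfl, ?_⟩
    rw [circuitMatrix, circuitMatrix, Matrix.one_mul, Gate.toMatrix_eq]
  | mul _ _ h1 h2 =>
    obtain ⟨W, hW, rfl⟩ := h1
    obtain ⟨W', hW', rfl⟩ := h2
    exact ⟨W ++ W', by rw [List.length_append, hW, hW'], circuitMatrix_append W W'⟩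

end Impl

open scoped Matrix.Norms.L2Operator

section Norm

theorem norm_le_one_of_conjTranspose_mul {m n : Type*} [Fintype m] [Fintype n]
    [DecidableEq m] [DecidableEq n] {M : Matrix m n ℂ} (h : Mᴴ * M = 1) : ‖M‖ ≤ 1 := by
  have h1 := Matrix.l2_opNorm_conjTranspose_mul_self M
  rw [h] at h1
  have h2 : ‖(1 : Matrix n n ℂ)‖ ≤ 1 := by
    cases isEmpty_or_nonempty n
    · rw [Subsingleton.elim (1 : Matrix n n ℂ) 0, norm_zero]
      exact zero_le_one
    · exact CStarRing.norm_one.le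
  nlinarith [norm_nonneg M]

theorem norm_le_one_of_mem_unitary {m : Type*} [Fintype m] [DecidableEq m] {M : Matrix m m ℂ}
    (h : M ∈ Matrix.unitaryGroup m ℂ) : ‖M‖ ≤ 1 :=
  norm_le_one_of_conjTranspose_mul (Matrix.mem_unitaryGroup_iff'.mp h)

end Norm

section Approx
variable {κ ω : Type} [Fintype κ] [DecidableEq κ] [Fintype ω] [DecidableEq ω]

/-- The isometry that adds ancillas in state zero. -/
def anc (ω κ : Type) [Fintype ω] [DecidableEq ω] [Fintype κ] [DecidableEq κ] :
    Matrix (ω ⊕ κ → Bool) (ω → Bool) ℂ :=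
  encode (pad (Function.Embedding.inl : ω ↪ ω ⊕ κ))

theorem anc_isometry : (anc ω κ)ᴴ * anc ω κ = 1 := encode_conjTranspose_mul (pad_injective _)

theorem norm_anc_le : ‖anc ω κ‖ ≤ 1 := norm_le_one_of_conjTranspose_mul anc_isometry

/-- The unitary `M` is implemented with clean ancillas up to an error `ε` in operator norm, with
`c` bounding both the number of ancillas and the number of gates. -/
def Approx (c : ℕ) (ε : ℝ) (M : Matrix (ω → Bool) (ω → Bool) ℂ) : Prop :=
  M ∈ Matrix.unitaryGroup (ω → Bool) ℂ ∧
  ∃ (κ : Type) (_ : Fintype κ) (_ : DecidableEq κ) (c' : ℕ)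
    (M' : Matrix (ω ⊕ κ → Bool) (ω ⊕ κ → Bool) ℂ),
    Fintype.card κ ≤ c ∧ c' ≤ c ∧ Impl c' M' ∧ ‖M' * anc ω κ - anc ω κ * M‖ ≤ ε

theorem Approx.of_exact {c c' : ℕ} {M : Matrix (ω → Bool) (ω → Bool) ℂ}
    {M' : Matrix (ω ⊕ κ → Bool) (ω ⊕ κ → Bool) ℂ} (hM : M ∈ Matrix.unitaryGroup (ω → Bool) ℂ)
    (hκ : Fintype.card κ ≤ c) (hc : c' ≤ c) (h : Impl c' M') (he : M' * anc ω κ = anc ω κ * M) :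
    Approx c 0 M :=
  ⟨hM, κ, inferInstance, inferInstance, c', M', hκ, hc, h, by rw [he, sub_self, norm_zero]⟩

theorem Approx.of_impl {c : ℕ} {M : Matrix (ω → Bool) (ω → Bool) ℂ} (h : Impl c M) :
    Approx c 0 M :=
  Approx.of_exact (κ := Empty) h.mem_unitary (by simp) le_rfl
    (h.lift (Function.Embedding.inl : ω ↪ ω ⊕ Empty)) (liftOp_mul_encode_pad _ _)

theorem Approx.mono {c d : ℕ} {ε η : ℝ} {M : Matrix (ω → Bool) (ω → Bool) ℂ} (h : Approx c ε M)
    (hc : c ≤ d) (hε : ε ≤ η) : Approx d η M := by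
  obtain ⟨hM, κ, _, _, c', M', h1, h2, h3, h4⟩ := h
  exact ⟨hM, κ, _, _, c', M', h1.trans hc, h2.trans hc, h3, h4.trans hε⟩

theorem Approx.norm_le {c : ℕ} {ε : ℝ} {M : Matrix (ω → Bool) (ω → Bool) ℂ} (h : Approx c ε M) :
    ‖M‖ ≤ 1 := norm_le_one_of_mem_unitary h.1

/-- This allows an ideal unitary to stand for the one a circuit really performs, the distance being
charged to the error. -/
theorem Approx.perturb {c : ℕ} {ε η : ℝ} {M N : Matrix (ω → Bool) (ω → Bool) ℂ}
    (h : Approx c ε M) (hN : N ∈ Matrix.unitaryGroup (ω → Bool) ℂ) (hMN : ‖M - N‖ ≤ η) :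
    Approx c (ε + η) N := by
  obtain ⟨hM, κ, _, _, c', M', h1, h2, h3, h4⟩ := h
  refine ⟨hN, κ, _, _, c', M', h1, h2, h3, ?_⟩
  have h5 : M' * anc ω κ - anc ω κ * N =
      (M' * anc ω κ - anc ω κ * M) + anc ω κ * (M - N) := by
    rw [Matrix.mul_sub]; abel
  rw [h5]
  refine (norm_add_le _ _).trans (add_le_add h4 ?_)
  refine (Matrix.l2_opNorm_mul _ _).trans ?_
  calc ‖anc ω κ‖ * ‖M - N‖ ≤ 1 * η :=
        mul_le_mul norm_anc_le hMN (norm_nonneg _) zero_le_one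
    _ = η := one_mul η

/-- Adding further ancillas. -/
theorem liftOp_mul_anc {κ' : Type} [Fintype κ'] [DecidableEq κ'] (f : κ ↪ κ')
    (M' : Matrix (ω ⊕ κ → Bool) (ω ⊕ κ → Bool) ℂ) (M : Matrix (ω → Bool) (ω → Bool) ℂ) :
    liftOp ((Function.Embedding.refl ω).sumMap f) M' * anc ω κ' - anc ω κ' * M =
      encode (pad ((Function.Embedding.refl ω).sumMap f)) * (M' * anc ω κ - anc ω κ * M) := by
  have h1 : anc ω κ' = encode (pad ((Function.Embedding.refl ω).sumMap f)) * anc ω κ := by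
    rw [anc, anc, encode_mul_encode]
    congr 1
    ext1 x
    rw [Function.comp_apply, ← pad_trans]
    rfl
  rw [h1, ← Matrix.mul_assoc, liftOp_mul_encode_pad, Matrix.mul_assoc, Matrix.mul_assoc,
    ← Matrix.mul_sub]

theorem norm_liftOp_mul_anc_le {κ' : Type} [Fintype κ'] [DecidableEq κ'] (f : κ ↪ κ')
    (M' : Matrix (ω ⊕ κ → Bool) (ω ⊕ κ → Bool) ℂ) (M : Matrix (ω → Bool) (ω → Bool) ℂ) :
    ‖liftOp ((Function.Embedding.refl ω).sumMap f) M' * anc ω κ' - anc ω κ' * M‖ ≤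
      ‖M' * anc ω κ - anc ω κ * M‖ := by
  rw [liftOp_mul_anc]
  refine (Matrix.l2_opNorm_mul _ _).trans ?_
  exact mul_le_of_le_one_left (norm_nonneg _)
    (norm_le_one_of_conjTranspose_mul (encode_conjTranspose_mul (pad_injective _)))

/-- The two parts get disjoint ancillas. All operators involved are contractions, so a telescoping
sum shows that errors add. -/
theorem Approx.mul {c₁ c₂ : ℕ} {ε₁ ε₂ : ℝ} {M₁ M₂ : Matrix (ω → Bool) (ω → Bool) ℂ}
    (h₁ : Approx c₁ ε₁ M₁) (h₂ : Approx c₂ ε₂ M₂) :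
    Approx (c₁ + c₂) (ε₁ + ε₂) (M₂ * M₁) := by
  have hn := h₁.norm_le
  obtain ⟨hM₁, κ₁, _, _, d₁, M₁', a₁, b₁, i₁, e₁⟩ := h₁
  obtain ⟨hM₂, κ₂, _, _, d₂, M₂', a₂, b₂, i₂, e₂⟩ := h₂
  refine ⟨mul_mem hM₂ hM₁, κ₁ ⊕ κ₂, inferInstance, inferInstance, d₁ + d₂, _, ?_, by omega,
    Impl.mul (i₁.lift ((Function.Embedding.refl ω).sumMap Function.Embedding.inl))
      (i₂.lift ((Function.Embedding.refl ω).sumMap Function.Embedding.inr)), ?_⟩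
  · rw [Fintype.card_sum]; omega
  · set L₁ := liftOp ((Function.Embedding.refl ω).sumMap
      (Function.Embedding.inl : κ₁ ↪ κ₁ ⊕ κ₂)) M₁'
    set L₂ := liftOp ((Function.Embedding.refl ω).sumMap
      (Function.Embedding.inr : κ₂ ↪ κ₁ ⊕ κ₂)) M₂'
    have h5 : L₂ * L₁ * anc ω (κ₁ ⊕ κ₂) - anc ω (κ₁ ⊕ κ₂) * (M₂ * M₁) =
        L₂ * (L₁ * anc ω (κ₁ ⊕ κ₂) - anc ω (κ₁ ⊕ κ₂) * M₁) +
          (L₂ * anc ω (κ₁ ⊕ κ₂) - anc ω (κ₁ ⊕ κ₂) * M₂) * M₁ := by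
      rw [Matrix.mul_sub, Matrix.sub_mul]
      simp only [Matrix.mul_assoc]
      abel
    have hL₂ : ‖L₂‖ ≤ 1 := norm_le_one_of_mem_unitary (i₂.lift _).mem_unitary
    rw [h5]
    refine (norm_add_le _ _).trans (add_le_add ?_ ?_)
    · refine (Matrix.l2_opNorm_mul _ _).trans ?_
      exact (mul_le_of_le_one_left (norm_nonneg _) hL₂).trans
        ((norm_liftOp_mul_anc_le _ _ _).trans e₁)
    · refine (Matrix.l2_opNorm_mul _ _).trans ?_
      exact (mul_le_of_le_one_right (norm_nonneg _) hn).trans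
        ((norm_liftOp_mul_anc_le _ _ _).trans e₂)

/-- Compressing to ancillas in state zero commutes with adding idle wires. It serves the comparison
in `Approx.lift`. -/
theorem anc_conj_liftOp {α : Type} [Fintype α] [DecidableEq α] (f : α ↪ ω)
    (N : Matrix (α ⊕ κ → Bool) (α ⊕ κ → Bool) ℂ) :
    (anc ω κ)ᴴ * liftOp (f.sumMap (Function.Embedding.refl κ)) N * anc ω κ =
      liftOp f ((anc α κ)ᴴ * N * anc α κ) := by
  have hent : ∀ {ω : Type} [Fintype ω] [DecidableEq ω]
      (L : Matrix (ω ⊕ κ → Bool) (ω ⊕ κ → Bool) ℂ) y x, ((anc ω κ)ᴴ * L * anc ω κ) y x =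
      L (pad Function.Embedding.inl y) (pad Function.Embedding.inl x) := by
    intro ω _ _ L y x
    simp [Matrix.mul_apply, anc, encode]
  ext y x
  rw [hent]
  have hpad : ∀ y : ω → Bool, pad (Function.Embedding.inl : ω ↪ ω ⊕ κ) y ∘
      (f.sumMap (Function.Embedding.refl κ)) = pad Function.Embedding.inl (y ∘ f) := by
    intro y
    refine eq_extend_iff.mpr ⟨?_, ?_⟩
    · ext a
      exact pad_apply _ y (f a)
    · rintro (a | b) hi
      · exact absurd ⟨a, rfl⟩ hi
      · exact pad_off _ _ (by rintro ⟨a, ha⟩; cases ha)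
  have hag : (∀ i, i ∉ Set.range (f.sumMap (Function.Embedding.refl κ)) →
      pad (Function.Embedding.inl : ω ↪ ω ⊕ κ) y i = pad Function.Embedding.inl x i) ↔
      ∀ i, i ∉ Set.range f → y i = x i := by
    constructor
    · intro h i hi
      have := h (Sum.inl i) (by
        rintro ⟨a | b, ha⟩
        · exact hi ⟨a, by simpa using ha⟩
        · simp at ha)
      rwa [show (Sum.inl i : ω ⊕ κ) = Function.Embedding.inl i from rfl, pad_apply,
        pad_apply] at this
    · rintro h (i | b) hi
      · rw [show (Sum.inl i : ω ⊕ κ) = Function.Embedding.inl i from rfl, pad_apply, pad_apply]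
        exact h i (by rintro ⟨a, rfl⟩; exact hi ⟨Sum.inl a, rfl⟩)
      · exact absurd ⟨Sum.inr b, rfl⟩ hi
  simp only [liftOp, Matrix.of_apply, hpad, hag]
  split_ifs
  · rw [hent]
  · rfl

/-- The error operators `X` (with idle wires) and `Y` (without) are not square, so `liftOp` cannot
relate them directly. Their squares satisfy `Xᴴ X = liftOp f (Yᴴ Y)`, and `liftOp` is
norm-decreasing as a homomorphism of star algebras. -/
theorem Approx.lift {α : Type} [Fintype α] [DecidableEq α] (f : α ↪ ω) {c : ℕ} {ε : ℝ}
    {M : Matrix (α → Bool) (α → Bool) ℂ} (h : Approx c ε M) : Approx c ε (liftOp f M) := by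
  obtain ⟨hM, κ, _, _, c', M', h1, h2, h3, h4⟩ := h
  refine ⟨liftOp_mem_unitary f hM, κ, _, _, c', _, h1, h2,
    h3.lift (f.sumMap (Function.Embedding.refl κ)), ?_⟩
  set e := f.sumMap (Function.Embedding.refl κ)
  set X := liftOp e M' * anc ω κ - anc ω κ * liftOp f M with hX
  set Y := M' * anc α κ - anc α κ * M with hY
  have expand : ∀ {β : Type} [Fintype β] [DecidableEq β] (L : Matrix (β ⊕ κ → Bool)
      (β ⊕ κ → Bool) ℂ) (l : Matrix (β → Bool) (β → Bool) ℂ),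
      (L * anc β κ - anc β κ * l)ᴴ * (L * anc β κ - anc β κ * l) =
      (anc β κ)ᴴ * (Lᴴ * L) * anc β κ - (anc β κ)ᴴ * Lᴴ * anc β κ * l
        - lᴴ * ((anc β κ)ᴴ * L * anc β κ) + lᴴ * l := by
    intro β _ _ L l
    rw [Matrix.conjTranspose_sub, Matrix.conjTranspose_mul, Matrix.conjTranspose_mul,
      Matrix.sub_mul, Matrix.mul_sub, Matrix.mul_sub]
    have : lᴴ * (anc β κ)ᴴ * (anc β κ * l) = lᴴ * l := by
      rw [Matrix.mul_assoc, ← Matrix.mul_assoc (anc β κ)ᴴ, anc_isometry, Matrix.one_mul]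
    rw [this]
    simp only [Matrix.mul_assoc]
    abel
  have key : Xᴴ * X = liftOp f (Yᴴ * Y) := by
    rw [hX, hY, expand, expand, liftOp_add, liftOp_sub, liftOp_sub, liftOp_mul f _ M,
      liftOp_mul f Mᴴ, liftOp_mul f Mᴴ, ← anc_conj_liftOp, ← anc_conj_liftOp, ← anc_conj_liftOp,
      liftOp_mul, liftOp_conjTranspose, liftOp_conjTranspose]
  have h5 : ‖X‖ * ‖X‖ ≤ ‖Y‖ * ‖Y‖ := by
    rw [← Matrix.l2_opNorm_conjTranspose_mul_self, ← Matrix.l2_opNorm_conjTranspose_mul_self, key]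
    exact norm_liftOp_le f _
  exact (abs_le_of_sq_le_sq' (by rw [sq, sq]; exact h5) (norm_nonneg Y)).2.trans h4

end Approx

/-! ### Classical reversible circuits -/

section Xor
variable {κ ω : Type} [Fintype κ] [DecidableEq κ] [Fintype ω] [DecidableEq ω]

/-- Adding the bits `h x` to the bits `x`. -/
def xorMap (h : (ω → Bool) → ω → Bool) (x : ω → Bool) : ω → Bool := fun v => xor (x v) (h x v)

theorem xorMap_involutive {h : (ω → Bool) → ω → Bool}
    (hh : ∀ x, h (xorMap h x) = h x) : Function.Involutive (xorMap h) := by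
  intro x
  ext v
  change xor (xor (x v) (h x v)) (h (xorMap h x) v) = x v
  rw [hh]
  simp

theorem xorMap_pad_off (w : κ ↪ ω) (g : (ω → Bool) → κ → Bool) (x : ω → Bool) {v : ω}
    (hv : v ∉ Set.range w) : xorMap (fun x => pad w (g x)) x v = x v := by
  simp [xorMap, pad_off w _ hv]

theorem xorMap_pad_apply (w : κ ↪ ω) (g : (ω → Bool) → κ → Bool) (x : ω → Bool) (t : κ) :
    xorMap (fun x => pad w (g x)) x (w t) = xor (x (w t)) (g x t) := by
  simp [xorMap, pad_apply]

theorem xorMap_pad_involutive (w : κ ↪ ω) {g : (ω → Bool) → κ → Bool}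
    (hg : ∀ x y, (∀ v, v ∉ Set.range w → x v = y v) → g x = g y) :
    Function.Involutive (xorMap fun x => pad w (g x)) :=
  xorMap_involutive fun x => by rw [hg _ x fun v hv => xorMap_pad_off w g x hv]

/-- Adding a bit that depends on two further wires at most takes one gate. -/
theorem Impl.xor (S : Finset ω) (hS : S.card ≤ 3) (w : ω) (hw : w ∈ S) (g : (ω → Bool) → Bool)
    (hg : ∀ x y, (∀ v ∈ S, v ≠ w → x v = y v) → g x = g y) :
    Impl 1 (encode (xorMap fun x => Function.update (fun _ => false) w (g x))) := by
  let e : S ↪ ω := Function.Embedding.subtype _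
  let w' : S := ⟨w, hw⟩
  let F : (S → Bool) → S → Bool :=
    xorMap fun z => Function.update (fun _ => false) w' (g (pad e z))
  have hinv : Function.Involutive F := xorMap_involutive fun z => by
    congr 1
    refine hg _ _ fun v hv hvw => ?_
    rw [show v = e ⟨v, hv⟩ from rfl, pad_apply, pad_apply]
    have : (⟨v, hv⟩ : S) ≠ w' := fun h => hvw (congrArg Subtype.val h)
    simp [xorMap, this]
  have h1 : encode (xorMap fun x => Function.update (fun _ => false) w (g x)) =
      liftOp e (encode F) := by
    rw [liftOp_encode]
    congr 1
    ext1 x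
    refine eq_extend_iff.mpr ⟨?_, ?_⟩
    · ext ⟨v, hv⟩
      have h2 : g x = g (pad e (x ∘ e)) := hg _ _ fun v hv _ => by
        rw [show v = e ⟨v, hv⟩ from rfl, pad_apply]; rfl
      simp only [Function.comp_apply, F, xorMap, ← h2]
      congr 1
      rw [Function.update_apply, Function.update_apply]
      exact if_congr Subtype.mk_eq_mk.symm rfl rfl
    · intro v hv
      have : v ≠ w := by rintro rfl; exact hv ⟨⟨v, hw⟩, rfl⟩
      simp [xorMap, this]
  rw [h1]
  exact Impl.of_card_le (by simpa using hS) e (encode_mem_unitary hinv.injective)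

/-- Adding several bits at the wires `w`, one after another. -/
theorem Approx.xor_batch (w : κ ↪ ω) (g : (ω → Bool) → κ → Bool)
    (hg : ∀ x y, (∀ v, v ∉ Set.range w → x v = y v) → g x = g y) {c : ℕ} {ε : ℝ}
    (h : ∀ t, Approx c ε (encode (xorMap fun x => Function.update (fun _ => false) (w t) (g x t)))) :
    Approx (Fintype.card κ * c) (Fintype.card κ * ε) (encode (xorMap fun x => pad w (g x))) := by
  have key : ∀ s : Finset κ, Approx (s.card * c) (s.card * ε)
      (encode (xorMap fun x => pad w (fun t => if t ∈ s then g x t else false))) := by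
    intro s
    induction s using Finset.induction_on with
    | empty =>
      have : (xorMap fun x => pad w (fun t => if t ∈ (∅ : Finset κ) then g x t else false)) = id := by
        ext x v
        by_cases hv : v ∈ Set.range w
        · obtain ⟨t, rfl⟩ := hv
          rw [xorMap_pad_apply w (fun x t => if t ∈ (∅ : Finset κ) then g x t else false)]
          simp
        · rw [xorMap_pad_off w (fun x t => if t ∈ (∅ : Finset κ) then g x t else false) _ hv]
          rfl
      rw [this, encode_id]
      simpa using Approx.of_impl (Impl.one (ω := ω))
    | insert t s hts ih =>
      have h1 := ih.mul (h t)
      rw [encode_mul_encode] at h1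
      have h2 : (xorMap fun x => Function.update (fun _ => false) (w t) (g x t)) ∘
          (xorMap fun x => pad w (fun t => if t ∈ s then g x t else false)) =
          xorMap fun x => pad w (fun t' => if t' ∈ insert t s then g x t' else false) := by
        ext x v
        set y := xorMap (fun x => pad w (fun t => if t ∈ s then g x t else false)) x with hy
        have hgy : g y = g x := hg _ _ fun v hv =>
          xorMap_pad_off w (fun x t => if t ∈ s then g x t else false) x hv
        change xor (y v) (Function.update (fun _ => false) (w t) (g y t) v) = _
        rw [hgy, hy]
        by_cases hv : v ∈ Set.range w
        · obtain ⟨t', rfl⟩ := hv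
          rw [xorMap_pad_apply w (fun x t => if t ∈ s then g x t else false),
            xorMap_pad_apply w (fun x t' => if t' ∈ insert t s then g x t' else false)]
          by_cases htt : t' = t
          · subst htt; simp [hts]
          · simp [htt]
        · rw [xorMap_pad_off w (fun x t => if t ∈ s then g x t else false) _ hv,
            xorMap_pad_off w (fun x t' => if t' ∈ insert t s then g x t' else false) _ hv]
          have : v ≠ w t := by rintro rfl; exact hv ⟨t, rfl⟩
          simp [this]
      rw [h2] at h1
      refine h1.mono ?_ ?_
      · rw [Finset.card_insert_of_notMem hts]; ring_nf; exact le_rfl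
      · rw [Finset.card_insert_of_notMem hts]; push_cast; linarith
  have := key Finset.univ
  simpa using this

/-- Adding bits that depend on two further wires at most. -/
theorem Approx.xor_local (w : κ ↪ ω) (g : (ω → Bool) → κ → Bool)
    (hg : ∀ x y, (∀ v, v ∉ Set.range w → x v = y v) → g x = g y) (u u' : κ → ω)
    (hu : ∀ t, u t ≠ w t) (hu' : ∀ t, u' t ≠ w t)
    (h : ∀ t x y, x (u t) = y (u t) → x (u' t) = y (u' t) → g x t = g y t) :
    Approx (Fintype.card κ) 0 (encode (xorMap fun x => pad w (g x))) := by
  have := Approx.xor_batch w g hg (c := 1) (ε := 0) fun t => by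
    refine Approx.of_impl (Impl.xor {w t, u t, u' t} Finset.card_le_three (w t) (by simp)
      (fun x => g x t) fun x y hxy => h t x y ?_ ?_)
    · exact hxy _ (by simp) (hu t)
    · exact hxy _ (by simp) (hu' t)
  simpa using this

end Xor

section Anc
open scoped Matrix.Norms.L2Operator
variable {κ ω : Type} [Fintype κ] [DecidableEq κ] [Fintype ω] [DecidableEq ω]

/-- Wires that begin and end in state zero count as ancillas. -/
theorem Approx.of_anc {c d : ℕ} {ε : ℝ} {M : Matrix (ω ⊕ κ → Bool) (ω ⊕ κ → Bool) ℂ}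
    {L : Matrix (ω → Bool) (ω → Bool) ℂ} (h : Approx c ε M)
    (hL : L ∈ Matrix.unitaryGroup (ω → Bool) ℂ) (he : M * anc ω κ = anc ω κ * L)
    (hκ : Fintype.card κ ≤ d) : Approx (c + d) ε L := by
  obtain ⟨hM, κ', _, _, c', M', h1, h2, h3, h4⟩ := h
  let a : (ω ⊕ κ) ⊕ κ' ↪ ω ⊕ (κ ⊕ κ') := (Equiv.sumAssoc ω κ κ').toEmbedding
  refine ⟨hL, κ ⊕ κ', inferInstance, inferInstance, c', liftOp a M', ?_, by omega, h3.lift a, ?_⟩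
  · rw [Fintype.card_sum]; omega
  have h5 : anc ω (κ ⊕ κ') = encode (pad a) * anc (ω ⊕ κ) κ' * anc ω κ := by
    rw [anc, anc, anc, encode_mul_encode, encode_mul_encode]
    congr 1
    ext1 x
    simp only [Function.comp_apply]
    rw [← pad_trans, ← pad_trans]
    congr 1
  have h6 : liftOp a M' * anc ω (κ ⊕ κ') - anc ω (κ ⊕ κ') * L =
      encode (pad a) * (M' * anc (ω ⊕ κ) κ' - anc (ω ⊕ κ) κ' * M) * anc ω κ := by
    have h7 := liftOp_mul_encode_pad a M'
    calc _ = (liftOp a M' * encode (pad a)) * anc (ω ⊕ κ) κ' * anc ω κ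
          - encode (pad a) * anc (ω ⊕ κ) κ' * (anc ω κ * L) := by
          rw [h5]; simp only [Matrix.mul_assoc]
      _ = _ := by
          rw [h7, ← he, Matrix.mul_sub, Matrix.sub_mul]; simp only [Matrix.mul_assoc]
  rw [h6]
  refine (Matrix.l2_opNorm_mul _ _).trans ?_
  refine (mul_le_of_le_one_right (norm_nonneg _) norm_anc_le).trans ?_
  refine (Matrix.l2_opNorm_mul _ _).trans ?_
  exact (mul_le_of_le_one_left (norm_nonneg _)
    (norm_le_one_of_conjTranspose_mul (encode_conjTranspose_mul (pad_injective _)))).trans h4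

end Anc

/-! ### Computing predicates -/

section Flip
variable {κ ω : Type} [Fintype κ] [DecidableEq κ] [Fintype ω] [DecidableEq ω]

theorem pad_inl (z : ω → Bool) :
    pad (Function.Embedding.inl : ω ↪ ω ⊕ κ) z = Sum.elim z fun _ => false := by
  symm
  refine eq_extend_iff.mpr ⟨rfl, ?_⟩
  rintro (v | v) hv
  · exact absurd ⟨v, rfl⟩ hv
  · rfl

/-- Adding the bit `g x` to the wire `w`. -/
def bitXor (w : ω) (g : (ω → Bool) → Bool) : (ω → Bool) → ω → Bool :=
  xorMap fun x => Function.update (fun _ => false) w (g x)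

theorem bitXor_self (w : ω) (g : (ω → Bool) → Bool) (x : ω → Bool) :
    bitXor w g x w = xor (x w) (g x) := by
  simp [bitXor, xorMap]

theorem bitXor_of_ne (w : ω) (g : (ω → Bool) → Bool) (x : ω → Bool) {v : ω} (h : v ≠ w) :
    bitXor w g x v = x v := by
  simp [bitXor, xorMap, h]

theorem bitXor_involutive (w : ω) {g : (ω → Bool) → Bool}
    (hg : ∀ x y, (∀ v, v ≠ w → x v = y v) → g x = g y) : Function.Involutive (bitXor w g) :=
  xorMap_involutive fun x => by
    have h : g (bitXor w g x) = g x := hg _ x fun v hv => bitXor_of_ne w g x hv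
    exact congrArg (Function.update (fun _ => false) w) h

theorem liftOp_bitXor (e : κ ↪ ω) (w : κ) (g : (κ → Bool) → Bool) :
    liftOp e (encode (bitXor w g)) = encode (bitXor (e w) fun x => g (x ∘ e)) := by
  rw [liftOp_encode]
  congr 1
  ext1 x
  symm
  refine eq_extend_iff.mpr ⟨?_, fun i hi => ?_⟩
  · ext v
    by_cases h : v = w
    · subst h
      rw [Function.comp_apply, bitXor_self, bitXor_self]
      rfl
    · rw [Function.comp_apply, bitXor_of_ne _ _ _ h, bitXor_of_ne _ _ _ (e.injective.ne h)]
      rfl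
  · exact bitXor_of_ne _ _ _ (by rintro rfl; exact hi ⟨w, rfl⟩)

/-- Adding the value of the predicate `P` on the wires `ω` to an additional wire. -/
def flipMap (P : (ω → Bool) → Bool) : (ω ⊕ Unit → Bool) → ω ⊕ Unit → Bool :=
  bitXor (Sum.inr ()) fun x => P (x ∘ Sum.inl)

theorem flipMap_involutive (P : (ω → Bool) → Bool) : Function.Involutive (flipMap P) :=
  bitXor_involutive _ fun x y h => by
    congr 1; ext v; exact h _ (by simp)

theorem flipMap_mem_unitary (P : (ω → Bool) → Bool) :
    encode (flipMap P) ∈ Matrix.unitaryGroup (ω ⊕ Unit → Bool) ℂ :=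
  encode_mem_unitary (flipMap_involutive P).injective

/-- The value of a predicate that is computed by a one-bit automaton. -/
def chainVal : List (ω × (Bool → Bool → Bool)) → (ω → Bool) → Bool
  | [], _ => true
  | p :: l, y => p.2 (chainVal l y) (y p.1)

theorem encode_bitXor_not (w : ω) : Impl 1 (encode (bitXor w fun _ => true)) :=
  Impl.xor {w} (by simp) w (by simp) (fun _ => true) fun _ _ _ => rfl

/-- Computing all intermediate values of the automaton. -/
theorem exists_history (l : List (ω × (Bool → Bool → Bool))) :
    ∃ (κ : Type) (_ : Fintype κ) (_ : DecidableEq κ) (M : Matrix (ω ⊕ κ → Bool) (ω ⊕ κ → Bool) ℂ)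
      (h : (ω → Bool) → κ → Bool) (k : κ), Fintype.card κ = l.length + 1 ∧
      Impl (l.length + 1) M ∧ (∀ y, h y k = chainVal l y) ∧
      M * anc ω κ = encode fun y => Sum.elim y (h y) := by
  induction l with
  | nil =>
    refine ⟨Unit, inferInstance, inferInstance, encode (bitXor (Sum.inr ()) fun _ => true),
      fun _ _ => true, (), by simp, encode_bitXor_not _, fun _ => rfl, ?_⟩
    rw [anc, encode_mul_encode]
    congr 1
    ext y (v | v)
    · rw [Function.comp_apply, bitXor_of_ne _ _ _ (by simp)]
      exact pad_apply _ y v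
    · rw [Function.comp_apply, bitXor_self, pad_off _ _ (by simp)]
      rfl
  | cons p l ih =>
    obtain ⟨κ, _, _, M, h, k, h1, h2, h3, h4⟩ := ih
    let e : ω ⊕ κ ↪ ω ⊕ (κ ⊕ Unit) :=
      (Function.Embedding.refl ω).sumMap Function.Embedding.inl
    -- One gate on three wires writes the next state of the automaton to a fresh wire.
    let X : Matrix (ω ⊕ (κ ⊕ Unit) → Bool) (ω ⊕ (κ ⊕ Unit) → Bool) ℂ :=
      encode (bitXor (Sum.inr (Sum.inr ())) fun x => p.2 (x (Sum.inr (Sum.inl k))) (x (Sum.inl p.1)))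
    have hX : Impl 1 X := by
      refine Impl.xor {Sum.inr (Sum.inr ()), Sum.inr (Sum.inl k), Sum.inl p.1}
        Finset.card_le_three _ (by simp) _ fun x y hxy => ?_
      rw [hxy (Sum.inr (Sum.inl k)) (by simp) (by simp), hxy (Sum.inl p.1) (by simp) (by simp)]
    refine ⟨κ ⊕ Unit, inferInstance, inferInstance, X * liftOp e M,
      fun y => Sum.elim (h y) fun _ => chainVal (p :: l) y, Sum.inr (), ?_, ?_, fun _ => rfl, ?_⟩
    · simp [h1]
    · exact Impl.mul (h2.lift e) hX
    · have h5 : anc ω (κ ⊕ Unit) = encode (pad e) * anc ω κ := by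
        rw [anc, anc, encode_mul_encode]
        congr 1
        ext1 x
        rw [Function.comp_apply, ← pad_trans]
        rfl
      rw [h5, Matrix.mul_assoc, ← Matrix.mul_assoc (liftOp e M), liftOp_mul_encode_pad,
        Matrix.mul_assoc, h4, encode_mul_encode, encode_mul_encode]
      congr 1
      ext1 y
      rw [Function.comp_apply, Function.comp_apply]
      have h6 : pad e (Sum.elim y (h y)) = Sum.elim y (Sum.elim (h y) fun _ => false) := by
        symm
        refine eq_extend_iff.mpr ⟨?_, ?_⟩
        · ext (v | v) <;> rfl
        · rintro (v | v | v) hv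
          · exact absurd ⟨Sum.inl v, rfl⟩ hv
          · exact absurd ⟨Sum.inr v, rfl⟩ hv
          · rfl
      rw [h6]
      ext (v | v | v)
      · rw [bitXor_of_ne _ _ _ (by simp)]; rfl
      · rw [bitXor_of_ne _ _ _ (by simp)]; rfl
      · rw [bitXor_self]
        simp only [Sum.elim_inr, Sum.elim_inl, h3, Bool.false_xor]
        rfl

/-- Compute the history, add its last bit to the target, and uncompute the history. This takes twice
`l.length + 1` gates plus one, and leaves the ancillas clean. -/
theorem Approx.flip_chain (l : List (ω × (Bool → Bool → Bool))) :
    Approx (2 * l.length + 3) 0 (encode (flipMap (chainVal l))) := by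
  obtain ⟨κ, _, _, M, h, k, h1, h2, h3, h4⟩ := exists_history l
  let e : ω ⊕ κ ↪ (ω ⊕ Unit) ⊕ κ := Function.Embedding.inl.sumMap (Function.Embedding.refl κ)
  let X : Matrix ((ω ⊕ Unit) ⊕ κ → Bool) ((ω ⊕ Unit) ⊕ κ → Bool) ℂ :=
    encode (bitXor (Sum.inl (Sum.inr ())) fun x => x (Sum.inr k))
  have hX : Impl 1 X := by
    refine Impl.xor {Sum.inl (Sum.inr ()), Sum.inr k}
      (Finset.card_le_two.trans (by norm_num)) _ (by simp) _ fun x y hxy => ?_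
    exact hxy (Sum.inr k) (by simp) (by simp)
  have hM := h2.mem_unitary
  refine Approx.of_exact (κ := κ) (flipMap_mem_unitary _) (by omega) (c' := 2 * l.length + 3)
    le_rfl ?_ ?_ (M' := liftOp e Mᴴ * (X * liftOp e M))
  · have := Impl.mul (Impl.mul (h2.lift e) hX) (h2.conjTranspose.lift e)
    convert this using 1
    ring
  have key : ∀ (y : ω → Bool) (b : Bool) (u : κ → Bool),
      liftOp e M *ᵥ ket (Sum.elim (Sum.elim y fun _ => b) u) =
        ∑ w, M w (Sum.elim y u) • ket (Function.extend e w (Sum.elim (Sum.elim y fun _ => b) u)) := by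
    intro y b u
    rw [liftOp_ket]
    have : (Sum.elim (Sum.elim y fun _ => b) u) ∘ e = Sum.elim y u := by
      ext (v | v) <;> rfl
    rw [this]
  have h5 : ∀ y, M *ᵥ ket (Sum.elim y fun _ => false) = ket (Sum.elim y (h y)) := by
    intro y
    have := congrArg (fun A => A *ᵥ ket y) h4
    simp only [← Matrix.mulVec_mulVec, anc, encode_ket] at this
    rw [← this]
    rw [pad_inl]
  have h6 : ∀ y (b : Bool), liftOp e M *ᵥ ket (Sum.elim (Sum.elim y fun _ => b) fun _ => false) =
      ket (Sum.elim (Sum.elim y fun _ => b) (h y)) := by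
    intro y b
    have h7 : ∀ w, M w (Sum.elim y fun _ => false) = if w = Sum.elim y (h y) then 1 else 0 := by
      intro w
      have := congrFun (h5 y) w
      simpa [Pi.single_apply] using this
    rw [key]
    simp only [h7, ite_smul, one_smul, zero_smul, Finset.sum_ite_eq', Finset.mem_univ, if_true]
    congr 1
    symm
    refine eq_extend_iff.mpr ⟨?_, ?_⟩
    · ext (v | v) <;> rfl
    · rintro ((v | v) | v) hv
      · rfl
      · rfl
      · exact absurd ⟨Sum.inr v, rfl⟩ hv
  have h7 : ∀ y (b : Bool), liftOp e Mᴴ *ᵥ ket (Sum.elim (Sum.elim y fun _ => b) (h y)) =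
      ket (Sum.elim (Sum.elim y fun _ => b) fun _ => false) := by
    intro y b
    rw [← h6, Matrix.mulVec_mulVec, ← liftOp_mul, ← Matrix.star_eq_conjTranspose,
      Matrix.mem_unitaryGroup_iff'.mp hM, liftOp_one, Matrix.one_mulVec]
  have hz : ∀ z : ω ⊕ Unit → Bool, z = Sum.elim (z ∘ Sum.inl) fun _ => z (Sum.inr ()) := by
    intro z; ext (v | v) <;> rfl
  refine ext_ket fun z => ?_
  rw [anc]
  simp only [← Matrix.mulVec_mulVec, encode_ket, pad_inl]
  have hs : bitXor (Sum.inl (Sum.inr ())) (fun x => x (Sum.inr k))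
      (Sum.elim (Sum.elim (z ∘ Sum.inl) fun _ => z (Sum.inr ())) (h (z ∘ Sum.inl))) =
      (Sum.elim (Sum.elim (z ∘ Sum.inl) fun _ => xor (z (Sum.inr ())) (chainVal l (z ∘ Sum.inl)))
        (h (z ∘ Sum.inl))) := by
    ext ((v | v) | v)
    · rw [bitXor_of_ne _ _ _ (by simp)]; rfl
    · rw [bitXor_self]; simp [h3]
    · rw [bitXor_of_ne _ _ _ (by simp)]; rfl
  conv_lhs => rw [hz z, h6, encode_ket, hs, h7]
  congr 2
  ext (v | v)
  · rw [flipMap, bitXor_of_ne _ _ _ (by simp)]; rfl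
  · rw [flipMap, bitXor_self]; rfl

end Flip

section Compare
variable {ω : Type} [Fintype ω] [DecidableEq ω]

/-- Numbers are compared from the lowest bit upwards: each higher bit decides the comparison if it
differs from the bit of `m`, and otherwise keeps the verdict so far. The list is evaluated from its
end, so the newest bit is its head. -/
theorem exists_chain_le {n : ℕ} (inp : Fin n → ω) (m : ℕ) : ∀ k ≤ n,
    ∃ l : List (ω × (Bool → Bool → Bool)), l.length = k ∧ ∀ y,
      chainVal l y = decide (Nat.ofBits (y ∘ inp) % 2 ^ k ≤ m % 2 ^ k) := by
  intro k
  induction k with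
  | zero => exact fun _ => ⟨[], rfl, fun y => by simp [chainVal, Nat.mod_one]⟩
  | succ k ih =>
    intro hk
    obtain ⟨l, hl, h⟩ := ih (by omega)
    refine ⟨(inp ⟨k, hk⟩, fun c b => if m.testBit k then !b || c else !b && c) :: l,
      by rw [List.length_cons, hl], fun y => ?_⟩
    have hb : (Nat.ofBits (y ∘ inp)).testBit k = y (inp ⟨k, hk⟩) := Nat.testBit_ofBits_lt _ _ hk
    rw [chainVal, h, Nat.mod_pow_succ, Nat.mod_pow_succ, ← Nat.toNat_testBit, ← Nat.toNat_testBit, hb]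
    have h1 : Nat.ofBits (y ∘ inp) % 2 ^ k < 2 ^ k := Nat.mod_lt _ (by positivity)
    have h2 : m % 2 ^ k < 2 ^ k := Nat.mod_lt _ (by positivity)
    rw [Bool.eq_iff_iff]
    rcases m.testBit k <;> rcases y (inp ⟨k, hk⟩) <;> simp <;> omega

/-- The comparison is prolonged by one step for each wire in `s`, which must hold zero. -/
theorem exists_chain_src {n : ℕ} (inp : Fin n → ω) (m : ℕ) (hm : m < 2 ^ n) (s : Finset ω) :
    ∃ l : List (ω × (Bool → Bool → Bool)), l.length = n + s.card ∧ ∀ y,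
      chainVal l y = decide (Nat.ofBits (y ∘ inp) ≤ m ∧ ∀ v ∈ s, y v = false) := by
  induction s using Finset.induction_on with
  | empty =>
    obtain ⟨l, hl, h⟩ := exists_chain_le inp m n le_rfl
    refine ⟨l, by simpa using hl, fun y => ?_⟩
    rw [h, Nat.mod_eq_of_lt hm, Nat.mod_eq_of_lt (Nat.ofBits_lt_two_pow _)]
    simp
  | insert v s hv ih =>
    obtain ⟨l, hl, h⟩ := ih
    refine ⟨(v, fun c b => !b && c) :: l, ?_, fun y => ?_⟩
    · rw [List.length_cons, hl, Finset.card_insert_of_notMem hv, add_assoc]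
    · rw [chainVal, h, Bool.eq_iff_iff]
      simp
      tauto

theorem eq_pad_binary_iff {n D : ℕ} (hD : D ≤ 2 ^ n) (inp : Fin n ↪ ω) (y : ω → Bool) :
    (∃ x : Fin D, y = pad inp (binary n x)) ↔
      Nat.ofBits (y ∘ inp) < D ∧ ∀ v, v ∉ Set.range inp → y v = false := by
  constructor
  · rintro ⟨x, rfl⟩
    refine ⟨?_, fun v hv => pad_off _ _ hv⟩
    rw [pad_comp]
    have : Nat.ofBits (binary n x) = x % 2 ^ n := Nat.ofBits_testBit _ _
    rw [this, Nat.mod_eq_of_lt (x.2.trans_le hD)]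
    exact x.2
  · rintro ⟨h1, h2⟩
    refine ⟨⟨_, h1⟩, eq_extend_iff.mpr ⟨?_, h2⟩⟩
    ext i
    exact (Nat.testBit_ofBits_lt _ _ i.2).symm

open Classical in
/-- Recognizing the states in which `x < D` is stored in binary and all other wires are zero. -/
theorem Approx.flip_src {n D : ℕ} (h0 : 0 < D) (hD : D ≤ 2 ^ n) (inp : Fin n ↪ ω) :
    Approx (4 * Fintype.card ω + 3) 0
      (encode (flipMap fun y : ω → Bool => decide (∃ x : Fin D, y = pad inp (binary n x)))) := by
  -- The automaton tests `≤`, hence `D - 1`. This is where `0 < D` is needed.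
  obtain ⟨l, hl, h⟩ := exists_chain_src inp (D - 1) (by omega)
    (Finset.univ.filter fun v => v ∉ Set.range inp)
  have hP : chainVal l = fun y => decide (∃ x : Fin D, y = pad inp (binary n x)) := by
    ext1 y
    rw [h]
    refine decide_eq_decide.mpr ?_
    rw [eq_pad_binary_iff hD]
    simp only [Finset.mem_filter, Finset.mem_univ, true_and]
    refine and_congr_left fun _ => ?_
    omega
  rw [← hP]
  refine (Approx.flip_chain l).mono ?_ le_rfl
  have h1 : n ≤ Fintype.card ω := by simpa using Fintype.card_le_of_embedding inp
  have h2 := Finset.card_le_univ (Finset.univ.filter fun v => v ∉ Set.range inp)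
  omega

end Compare

/-! ### Correcting a unitary -/

section Near
open scoped Matrix.Norms.L2Operator
variable {m n : Type*} [Fintype m] [DecidableEq m] [Fintype n] [DecidableEq n]

theorem norm_le_one_of_isProj {X : Matrix n n ℂ} (h1 : Xᴴ = X) (h2 : X * X = X) : ‖X‖ ≤ 1 := by
  have h := Matrix.l2_opNorm_conjTranspose_mul_self X
  rw [h1, h2] at h
  nlinarith [norm_nonneg X]

theorem norm_one_matrix_le : ‖(1 : Matrix n n ℂ)‖ ≤ 1 :=
  norm_le_one_of_conjTranspose_mul (by rw [Matrix.conjTranspose_one, Matrix.mul_one])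

theorem mul_mul_le_of_le_one {a b c : ℝ} (ha : a ≤ c) (hb : b ≤ 1) (hb0 : 0 ≤ a) : a * b ≤ c :=
  (mul_le_of_le_one_right hb0 hb).trans ha

/-- If two isometries are close to each other then a unitary close to the identity maps one to the
other. -/
theorem exists_unitary_near_one {A B : Matrix n m ℂ} (hA : Aᴴ * A = 1) (hB : Bᴴ * B = 1) {ε : ℝ}
    (h : ‖A - B‖ ≤ ε) (hε : ε < 1) :
    ∃ Z ∈ Matrix.unitaryGroup n ℂ, Z * A = B ∧ ‖1 - Z‖ ≤ 3 * ε := by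
  have hε0 : 0 ≤ ε := (norm_nonneg _).trans h
  -- The projection onto the orthogonal complement of the range of `A`. The operator `E = Bᴴ P`
  -- below measures how far `B` leaks into this complement, and is small since `Aᴴ P = 0`.
  set P : Matrix n n ℂ := 1 - A * Aᴴ with hP
  have hPh : Pᴴ = P := by simp [hP, Matrix.conjTranspose_sub, Matrix.conjTranspose_mul]
  have hPA : P * A = 0 := by
    rw [hP, Matrix.sub_mul, Matrix.mul_assoc, hA, Matrix.mul_one, Matrix.one_mul, sub_self]
  have hAP : Aᴴ * P = 0 := by
    rw [hP, Matrix.mul_sub, ← Matrix.mul_assoc, hA, Matrix.mul_one, Matrix.one_mul, sub_self]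
  have hPP : P * P = P := by
    conv_lhs => rw [hP, Matrix.sub_mul, Matrix.one_mul, Matrix.mul_assoc, ← hP, hAP,
      Matrix.mul_zero, sub_zero]
  set E : Matrix m n ℂ := Bᴴ * P with hE
  have hEA : E * A = 0 := by rw [hE, Matrix.mul_assoc, hPA, Matrix.mul_zero]
  have hEn : ‖E‖ ≤ ε := by
    have : E = (B - A)ᴴ * P := by
      rw [Matrix.conjTranspose_sub, Matrix.sub_mul, hAP, sub_zero]
    rw [this]
    refine (Matrix.l2_opNorm_mul _ _).trans (mul_mul_le_of_le_one ?_
      (norm_le_one_of_isProj hPh hPP) (norm_nonneg _))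
    rwa [Matrix.l2_opNorm_conjTranspose, norm_sub_rev]
  set X : Matrix n n ℂ := Eᴴ * E with hX
  have hXn : ‖X‖ ≤ ε * ε := by
    rw [hX, Matrix.l2_opNorm_conjTranspose_mul_self]
    exact mul_le_mul hEn hEn (norm_nonneg _) hε0
  have hXsa : IsSelfAdjoint X := Matrix.isHermitian_conjTranspose_mul_self E
  have hspec : ∀ x ∈ spectrum ℝ X, x < 1 := by
    intro x hx
    have h1 := spectrum.norm_le_norm_mul_of_mem hx
    have h2 : ‖X‖ * ‖(1 : Matrix n n ℂ)‖ ≤ ε * ε :=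
      mul_mul_le_of_le_one hXn norm_one_matrix_le (norm_nonneg _)
    have h3 := le_abs_self x
    rw [Real.norm_eq_abs] at h1
    nlinarith
  have hc := fun f : ℝ → ℝ => continuousOn_real_spectrum X f
  -- `J`, `T` and `V` are `(1 - X)^(-1/2)`, `(1 - X)^(1/2)` and `(1 + T)⁻¹`. The last serves to
  -- write `1 - T = V X`, which bounds `1 - T` by `ε²` without estimating square roots.
  set J : Matrix n n ℂ := cfc (fun x : ℝ => (√(1 - x))⁻¹) X with hJ
  set T : Matrix n n ℂ := cfc (fun x : ℝ => √(1 - x)) X with hT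
  set V : Matrix n n ℂ := cfc (fun x : ℝ => (1 + √(1 - x))⁻¹) X with hV
  have hJh : Jᴴ = J := cfc_predicate (p := IsSelfAdjoint) (R := ℝ) _ X
  have hJT : J * T = 1 := by
    rw [hJ, hT, ← cfc_mul _ _ X (hc _) (hc _), ← cfc_one ℝ X]
    refine cfc_congr fun x hx => ?_
    have := Real.sqrt_pos.mpr (sub_pos.mpr (hspec x hx))
    exact inv_mul_cancel₀ this.ne'
  have hTT : T * T = 1 - X := by
    have h1 : cfc (fun x : ℝ => 1 - x) X = 1 - X := by
      rw [cfc_sub (fun _ => (1 : ℝ)) (fun x => x) X (hc _) (hc _), cfc_const_one ℝ X,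
        cfc_id' ℝ X]
    rw [hT, ← cfc_mul _ _ X (hc _) (hc _), ← h1]
    refine cfc_congr fun x hx => ?_
    exact Real.mul_self_sqrt (sub_nonneg.mpr (hspec x hx).le)
  have hVX : V * X = 1 - T := by
    have h1 : cfc (fun x : ℝ => 1 - √(1 - x)) X = 1 - T := by
      rw [cfc_sub (fun _ => (1 : ℝ)) (fun x => √(1 - x)) X (hc _) (hc _), cfc_const_one ℝ X]
    have h2 : V * X = cfc (fun x : ℝ => (1 + √(1 - x))⁻¹ * x) X := by
      rw [cfc_mul _ _ X (hc _) (hc _), cfc_id' ℝ X]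
    rw [h2, ← h1]
    refine cfc_congr fun x hx => ?_
    have h3 := Real.mul_self_sqrt (sub_nonneg.mpr (hspec x hx).le)
    have h4 := Real.sqrt_nonneg (1 - x)
    have h5 : 1 + √(1 - x) ≠ 0 := by positivity
    change (1 + √(1 - x))⁻¹ * x = 1 - √(1 - x)
    rw [inv_mul_eq_iff_eq_mul₀ h5]
    nlinarith
  have hVn : ‖V‖ ≤ 1 := by
    refine norm_cfc_le zero_le_one fun x _ => ?_
    have h4 := Real.sqrt_nonneg (1 - x)
    rw [Real.norm_of_nonneg (by positivity)]
    exact inv_le_one_of_one_le₀ (by linarith)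
  -- The first approximation maps `A` to `B` and sends the complement of `A` into that of `B`. It
  -- satisfies `Yᴴ Y = 1 - X`, so the polar correction `Y J` is unitary, and `J` fixes `A` since `X
  -- A = 0`.
  set Y : Matrix n n ℂ := B * Aᴴ + (P - B * E) with hY
  have hYY : Yᴴ * Y = T * T := by
    have h1 : Bᴴ * (P - B * E) = 0 := by
      rw [Matrix.mul_sub, ← Matrix.mul_assoc, hB, Matrix.one_mul, ← hE, sub_self]
    have h2 : (P - B * E)ᴴ * B = 0 := by
      rw [← Matrix.conjTranspose_conjTranspose B, ← Matrix.conjTranspose_mul,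
        Matrix.conjTranspose_conjTranspose, h1, Matrix.conjTranspose_zero]
    have h3 : (P - B * E)ᴴ * (P - B * E) = P - X := by
      have h4 : (P - B * E)ᴴ * (P - B * E) = (P - B * E)ᴴ * P - (P - B * E)ᴴ * B * E := by
        rw [Matrix.mul_sub, Matrix.mul_assoc]
      rw [h4, h2, Matrix.zero_mul, sub_zero, Matrix.conjTranspose_sub, hPh, Matrix.sub_mul, hPP,
        Matrix.conjTranspose_mul, Matrix.mul_assoc, ← hE]
    rw [hTT, hY, Matrix.conjTranspose_add, Matrix.add_mul, Matrix.mul_add, Matrix.mul_add, h3,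
      Matrix.conjTranspose_mul, Matrix.conjTranspose_conjTranspose, Matrix.mul_assoc A,
      ← Matrix.mul_assoc Bᴴ, hB, Matrix.one_mul, Matrix.mul_assoc A, h1, Matrix.mul_zero,
      ← Matrix.mul_assoc, h2, Matrix.zero_mul, hP]
    abel
  have hYA : Y * A = B := by
    rw [hY, Matrix.add_mul, Matrix.sub_mul, Matrix.mul_assoc, hA, Matrix.mul_one, hPA,
      Matrix.mul_assoc, hEA, Matrix.mul_zero, sub_zero, add_zero]
  have hTJ : T * J = 1 := mul_eq_one_comm.mp hJT
  have hTA : T * A = A := by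
    have h1 : (1 - T) * A = 0 := by
      rw [← hVX, Matrix.mul_assoc, hX, Matrix.mul_assoc, hEA, Matrix.mul_zero, Matrix.mul_zero]
    rw [Matrix.sub_mul, Matrix.one_mul, sub_eq_zero] at h1
    exact h1.symm
  have hZ : Y * J ∈ Matrix.unitaryGroup n ℂ := by
    rw [Matrix.mem_unitaryGroup_iff', Matrix.star_eq_conjTranspose, Matrix.conjTranspose_mul, hJh,
      Matrix.mul_assoc, ← Matrix.mul_assoc Yᴴ, hYY, Matrix.mul_assoc, hTJ, Matrix.mul_one, hJT]
  refine ⟨Y * J, hZ, ?_, ?_⟩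
  · rw [Matrix.mul_assoc]
    conv_lhs => rw [← hTA, ← Matrix.mul_assoc J, hJT, Matrix.one_mul]
    exact hYA
  -- The three terms are bounded by `ε`, `ε` and `ε²`, which gives the constant `3`.
  · have h1 : 1 - Y * J = (A - B) * Aᴴ + B * E - Y * J * (V * X) := by
      rw [hVX, Matrix.mul_sub, Matrix.mul_one, Matrix.mul_assoc Y, hJT, Matrix.mul_one, hY,
        Matrix.sub_mul, hP]
      abel
    have hAn : ‖Aᴴ‖ ≤ 1 := by
      rw [Matrix.l2_opNorm_conjTranspose]; exact norm_le_one_of_conjTranspose_mul hA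
    have hBn := norm_le_one_of_conjTranspose_mul hB
    rw [h1]
    refine (norm_sub_le _ _).trans ?_
    have a1 : ‖(A - B) * Aᴴ‖ ≤ ε := (Matrix.l2_opNorm_mul _ _).trans
      (mul_mul_le_of_le_one h hAn (norm_nonneg _))
    have a2 : ‖B * E‖ ≤ ε := (Matrix.l2_opNorm_mul _ _).trans
      ((mul_le_of_le_one_left (norm_nonneg _) hBn).trans hEn)
    have a3 : ‖Y * J * (V * X)‖ ≤ ε * ε := (Matrix.l2_opNorm_mul _ _).trans
      ((mul_le_of_le_one_left (norm_nonneg _) (norm_le_one_of_mem_unitary hZ)).trans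
        ((Matrix.l2_opNorm_mul _ _).trans
          ((mul_le_of_le_one_left (norm_nonneg _) hVn).trans hXn)))
    have a4 := norm_add_le ((A - B) * Aᴴ) (B * E)
    nlinarith

/-- A unitary that approximately maps one isometry to another is close to a unitary that does so
exactly. -/
theorem exists_unitary_near {M : Matrix n n ℂ} (hM : M ∈ Matrix.unitaryGroup n ℂ)
    {A B : Matrix n m ℂ} (hA : Aᴴ * A = 1) (hB : Bᴴ * B = 1) {ε : ℝ} (h : ‖M * A - B‖ ≤ ε)
    (hε : ε < 1) : ∃ Z ∈ Matrix.unitaryGroup n ℂ, Z * A = B ∧ ‖M - Z‖ ≤ 3 * ε := by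
  have hM' : Mᴴ * M = 1 := Matrix.mem_unitaryGroup_iff'.mp hM
  obtain ⟨Z, hZ, h1, h2⟩ := exists_unitary_near_one (A := M * A) (by
    rw [Matrix.conjTranspose_mul, Matrix.mul_assoc, ← Matrix.mul_assoc Mᴴ, hM', Matrix.one_mul, hA])
    hB h hε
  refine ⟨Z * M, mul_mem hZ hM, by rw [Matrix.mul_assoc, h1], ?_⟩
  rw [show M - Z * M = (1 - Z) * M by rw [Matrix.sub_mul, Matrix.one_mul]]
  exact (Matrix.l2_opNorm_mul _ _).trans
    (mul_mul_le_of_le_one h2 (norm_le_one_of_mem_unitary hM) (norm_nonneg _))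

end Near

section Products
variable {κ ω : Type} [Fintype κ] [DecidableEq κ] [Fintype ω] [DecidableEq ω]

/-- An operator on the wires `e` acts on the first factor of a product vector. -/
theorem liftOp_mulVec_prod (e : κ ↪ ω) (M : Matrix (κ → Bool) (κ → Bool) ℂ)
    (p : (κ → Bool) → ℂ) (q : (ω → Bool) → ℂ) (hq : ∀ w x, q (Function.extend e w x) = q x) :
    liftOp e M *ᵥ (fun x => p (x ∘ e) * q x) = fun y => (M *ᵥ p) (y ∘ e) * q y := by
  ext y
  rw [liftOp_mulVec]
  simp only [extend_comp, hq, ← mul_assoc]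
  rw [← Finset.sum_mul]
  rfl

theorem encode_mulVec {m : Type*} [Fintype m] [DecidableEq m] {F : m → m}
    (hF : Function.Involutive F) (v : m → ℂ) : encode F *ᵥ v = v ∘ F := by
  ext y
  have h : ∀ x, y = F x ↔ x = F y := fun x => by
    constructor
    · rintro rfl; exact (hF x).symm
    · rintro rfl; exact (hF y).symm
  simp [Matrix.mulVec, dotProduct, encode, h]

theorem liftOp_diagonal_ket (e : κ ↪ ω) (d : (κ → Bool) → ℂ) (x : ω → Bool) :
    liftOp e (Matrix.diagonal d) *ᵥ ket x = d (x ∘ e) • ket x := by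
  rw [liftOp_ket, Finset.sum_eq_single (x ∘ e)]
  · rw [Matrix.diagonal_apply_eq, ← eq_extend_iff.mpr ⟨rfl, fun _ _ => rfl⟩]
  · intro w _ hw
    rw [Matrix.diagonal_apply_ne _ hw, zero_smul]
  · simp

end Products

section Test
variable {κ ω : Type} [Fintype κ] [DecidableEq κ] [Fintype ω] [DecidableEq ω]

/-- The projection onto the basis states that satisfy a predicate. -/
def diagProj (P : (ω → Bool) → Bool) : Matrix (ω → Bool) (ω → Bool) ℂ :=
  Matrix.diagonal fun y => if P y then 1 else 0

open Classical in
theorem encode_mul_conjTranspose {m : Type*} [Fintype m] {f : m → ω → Bool}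
    (hf : Function.Injective f) :
    encode f * (encode f)ᴴ = diagProj fun y => decide (∃ s, y = f s) := by
  ext y y'
  rw [Matrix.mul_apply, diagProj, Matrix.diagonal_apply]
  simp only [encode, Matrix.of_apply, Matrix.conjTranspose_apply, apply_ite star, star_one,
    star_zero, mul_ite, mul_one, mul_zero]
  by_cases h : ∃ s, y = f s
  · obtain ⟨s, rfl⟩ := h
    rw [Finset.sum_eq_single s]
    · simp [eq_comm]
    · intro t _ hts
      rw [if_neg (hf.ne hts.symm), ite_self]
    · simp
  · have h' : ∀ s, y ≠ f s := fun s hs => h ⟨s, hs⟩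
    simp [h']

/-- In the form `1 + Π_P ⊗ (NOT - 1)` the flip can be conjugated by an operator on the data wires,
which acts on `Π_P` only. -/
theorem encode_flipMap (P : (ω → Bool) → Bool) :
    encode (flipMap P) = 1 + liftOp (Function.Embedding.inl : ω ↪ ω ⊕ Unit) (diagProj P) *
      (liftOp (Function.Embedding.inr : Unit ↪ ω ⊕ Unit) (encode (bitXor () fun _ => true)) - 1) := by
  refine ext_ket fun x => ?_
  rw [encode_ket, Matrix.add_mulVec, ← Matrix.mulVec_mulVec, Matrix.sub_mulVec, liftOp_bitXor,
    encode_ket, Matrix.one_mulVec, Matrix.mulVec_sub, diagProj, liftOp_diagonal_ket,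
    liftOp_diagonal_ket]
  have h1 : bitXor (Function.Embedding.inr () : ω ⊕ Unit) (fun _ => true) x ∘
      (Function.Embedding.inl : ω ↪ ω ⊕ Unit) = x ∘ Sum.inl := by
    ext v; exact bitXor_of_ne _ _ _ (by simp)
  rw [h1]
  change ket (bitXor (Sum.inr ()) (fun x => P (x ∘ Sum.inl)) x) =
    ket x + ((if P (x ∘ Sum.inl) then (1 : ℂ) else 0) • _ -
      (if P (x ∘ Sum.inl) then (1 : ℂ) else 0) • ket x)
  have h2 : bitXor (Sum.inr ()) (fun x => P (x ∘ Sum.inl)) x =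
      if P (x ∘ Sum.inl) then bitXor (Sum.inr ()) (fun _ => true) x else x := by
    ext v
    by_cases hv : v = Sum.inr ()
    · subst hv
      rw [bitXor_self]
      split_ifs with h
      · rw [bitXor_self, h]
      · simp [h]
    · rw [bitXor_of_ne _ _ _ hv]
      split_ifs
      · rw [bitXor_of_ne _ _ _ hv]
      · rfl
  rw [h2]
  split_ifs with h
  · simp
  · simp

/-- Recognizing a subspace spanned by basis states by means of another one. -/
theorem Approx.flip_conj {P Q : (ω → Bool) → Bool} {W : Matrix (ω → Bool) (ω → Bool) ℂ}
    {c d : ℕ} {ε η : ℝ} (h : Approx c ε (encode (flipMap P))) (hW : Approx d η W)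
    (hW' : Approx d η Wᴴ) (hPQ : W * diagProj P * Wᴴ = diagProj Q) :
    Approx (c + 2 * d) (ε + 2 * η) (encode (flipMap Q)) := by
  have hWW : W * Wᴴ = 1 := Matrix.mem_unitaryGroup_iff.mp hW.1
  have h1 := ((hW'.lift (Function.Embedding.inl : ω ↪ ω ⊕ Unit)).mul h).mul
    (hW.lift (Function.Embedding.inl : ω ↪ ω ⊕ Unit))
  have h2 : liftOp (Function.Embedding.inl : ω ↪ ω ⊕ Unit) W * (encode (flipMap P) *
      liftOp (Function.Embedding.inl : ω ↪ ω ⊕ Unit) Wᴴ) = encode (flipMap Q) := by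
    rw [encode_flipMap, encode_flipMap, Matrix.add_mul, Matrix.mul_add, Matrix.one_mul,
      ← liftOp_mul, hWW, liftOp_one, ← hPQ, liftOp_mul, liftOp_mul]
    congr 1
    have h3 := liftOp_commute (Function.Embedding.inr : Unit ↪ ω ⊕ Unit)
      (Function.Embedding.inl : ω ↪ ω ⊕ Unit) (fun _ _ => by simp)
      (encode (bitXor () fun _ => true)) Wᴴ
    simp only [Matrix.mul_assoc, Matrix.sub_mul, Matrix.mul_sub, Matrix.mul_one, h3]
  rw [h2] at h1
  refine h1.mono ?_ ?_
  · omega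
  · linarith

open Classical in
/-- Recognizing code words, given a device that recognizes them in a larger register. -/
theorem Approx.flip_code {χ ν m : Type} [Fintype χ] [DecidableEq χ] [Fintype ν] [DecidableEq ν]
    (out : χ ↪ ν) (w : m → χ → Bool) {c : ℕ} {ε : ℝ}
    (h : Approx c ε (encode (flipMap fun y : ν → Bool => decide (∃ s, y = pad out (w s))))) :
    Approx (c + 2 * Fintype.card χ + Fintype.card ν) ε
      (encode (flipMap fun z : χ → Bool => decide (∃ s, z = w s))) := by
  set Q : (ν → Bool) → Bool := fun y => decide (∃ s, y = pad out (w s)) with hQ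
  set P : (χ → Bool) → Bool := fun z => decide (∃ s, z = w s) with hP
  let e : ν ⊕ Unit ↪ (χ ⊕ Unit) ⊕ ν :=
    ⟨Sum.elim Sum.inr fun _ => Sum.inl (Sum.inr ()), by
      rintro (v | v) (w | w) hvw
      · simpa using hvw
      · simp at hvw
      · simp at hvw
      · rfl⟩
  have he : e (Sum.inr ()) = Sum.inl (Sum.inr ()) := rfl
  let f : χ ↪ (χ ⊕ Unit) ⊕ ν := out.trans Function.Embedding.inr
  let g : ((χ ⊕ Unit) ⊕ ν → Bool) → χ → Bool := fun x t => x (Sum.inl (Sum.inl t))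
  have hf : ∀ t, (Sum.inl (Sum.inl t) : (χ ⊕ Unit) ⊕ ν) ∉ Set.range f := by
    rintro t ⟨s, hs⟩
    simp [f] at hs
  have hg : ∀ x y, (∀ v, v ∉ Set.range f → x v = y v) → g x = g y := fun x y hxy => by
    ext t; exact hxy _ (hf t)
  have h1 : Approx (Fintype.card χ) 0 (encode (xorMap fun x => pad f (g x))) :=
    Approx.xor_local f g hg (fun t => Sum.inl (Sum.inl t)) (fun t => Sum.inl (Sum.inl t))
      (fun t => by simp [f]) (fun t => by simp [f]) fun t x y hxy _ => hxy
  -- The word is copied into the larger register, tested there, and erased by copying once more. The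
  -- larger register thus counts as ancillas.
  have h2 := (h1.mul (h.lift e)).mul h1
  have h3 := Approx.of_anc (L := encode (flipMap P)) h2 (flipMap_mem_unitary _) ?_ le_rfl
  · refine h3.mono (by omega) (by linarith)
  rw [flipMap, liftOp_bitXor, anc, encode_mul_encode, encode_mul_encode, encode_mul_encode,
    encode_mul_encode]
  congr 1
  ext1 z
  simp only [Function.comp_apply, pad_inl]
  have h4 : ∀ z : χ ⊕ Unit → Bool, xorMap (fun x => pad f (g x)) (Sum.elim z fun _ => false) =
      Sum.elim z (pad out (z ∘ Sum.inl)) := by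
    intro z
    ext (v | v)
    · rw [xorMap_pad_off _ _ _ (by rintro ⟨s, hs⟩; simp [f] at hs)]
      rfl
    · by_cases hv : v ∈ Set.range out
      · obtain ⟨t, rfl⟩ := hv
        rw [show (Sum.inr (out t) : (χ ⊕ Unit) ⊕ ν) = f t from rfl, xorMap_pad_apply]
        simp [f, g, pad_apply]
      · rw [xorMap_pad_off _ _ _ (by rintro ⟨s, hs⟩; simp [f] at hs; exact hv ⟨s, hs⟩)]
        simp [pad_off out _ hv]
  have h5 : bitXor (e (Sum.inr ())) (fun x => Q ((x ∘ e) ∘ Sum.inl))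
      (Sum.elim z (pad out (z ∘ Sum.inl))) = Sum.elim (flipMap P z) (pad out (z ∘ Sum.inl)) := by
    have h6 : Q (pad out (z ∘ Sum.inl)) = P (z ∘ Sum.inl) := by
      simp only [hQ, hP, (pad_injective out).eq_iff]
    ext ((v | v) | v)
    · rw [bitXor_of_ne _ _ _ (by rw [he]; simp)]
      change z (Sum.inl v) = flipMap P z (Sum.inl v)
      rw [flipMap, bitXor_of_ne _ _ _ Sum.inl_ne_inr]
    · change bitXor (e (Sum.inr ())) _ _ (e (Sum.inr ())) = flipMap P z (Sum.inr ())
      rw [bitXor_self, flipMap, bitXor_self]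
      change xor (z (Sum.inr ())) (Q (pad out (z ∘ Sum.inl))) = _
      rw [h6]
    · rw [bitXor_of_ne _ _ _ (by rw [he]; simp)]
      rfl
  have h7 : (flipMap P z) ∘ Sum.inl = z ∘ Sum.inl := by
    ext v
    change flipMap P z (Sum.inl v) = z (Sum.inl v)
    rw [flipMap, bitXor_of_ne _ _ _ Sum.inl_ne_inr]
  have h8 := xorMap_pad_involutive f hg (Sum.elim (flipMap P z) fun _ => false)
  rw [h4, h5, ← h8, h4, h7]

end Test

/-! ### Controlled Hadamard gates -/

section ControlledHadamard
variable {κ ω : Type} [Fintype κ] [DecidableEq κ] [Fintype ω] [DecidableEq ω]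

/-- The number `1/√2`. -/
def invSqrtTwo : ℂ := ((√2 : ℝ) : ℂ)⁻¹

theorem star_invSqrtTwo : star invSqrtTwo = invSqrtTwo := by
  rw [invSqrtTwo, star_inv₀]
  congr 1
  exact Complex.conj_ofReal _

theorem invSqrtTwo_mul_self : invSqrtTwo * invSqrtTwo = 1 / 2 := by
  rw [invSqrtTwo, ← mul_inv, ← Complex.ofReal_mul, Real.mul_self_sqrt (by norm_num)]
  norm_num

/-- The Hadamard gate on the second wire, controlled by the first wire. -/
def cHad : Matrix (Fin 2 → Bool) (Fin 2 → Bool) ℂ :=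
  Matrix.of fun y x => if y 0 = x 0 then
    if x 0 then (if y 1 && x 1 then -invSqrtTwo else invSqrtTwo) else if y 1 = x 1 then 1 else 0
    else 0

theorem cHad_mem_unitary : cHad ∈ Matrix.unitaryGroup (Fin 2 → Bool) ℂ := by
  rw [Matrix.mem_unitaryGroup_iff', Matrix.star_eq_conjTranspose]
  have h := invSqrtTwo_mul_self
  have h' : invSqrtTwo * invSqrtTwo + invSqrtTwo * invSqrtTwo = 1 := by rw [h]; norm_num
  ext x y
  obtain ⟨⟨a, b⟩, rfl⟩ := (finTwoArrowEquiv Bool).symm.surjective x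
  obtain ⟨⟨c, d⟩, rfl⟩ := (finTwoArrowEquiv Bool).symm.surjective y
  rw [Matrix.mul_apply, ← (finTwoArrowEquiv Bool).symm.sum_comp, Fintype.sum_prod_type,
    Matrix.one_apply]
  simp only [Fintype.sum_bool, Matrix.conjTranspose_apply, cHad, Matrix.of_apply,
    (finTwoArrowEquiv Bool).symm.apply_eq_iff_eq]
  have e0 : ∀ p, (finTwoArrowEquiv Bool).symm p 0 = p.1 := fun _ => rfl
  have e1 : ∀ p, (finTwoArrowEquiv Bool).symm p 1 = p.2 := fun _ => rfl
  simp only [e0, e1]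
  rcases a <;> rcases b <;> rcases c <;> rcases d <;>
    simp [star_invSqrtTwo, h', -RCLike.star_def]

theorem cHad_ket_off (e : Fin 2 ↪ ω) {x : ω → Bool} (h : x (e 0) = false) :
    liftOp e cHad *ᵥ ket x = ket x := by
  rw [liftOp_ket, Finset.sum_eq_single (x ∘ e)]
  · rw [← eq_extend_iff.mpr ⟨rfl, fun _ _ => rfl⟩]
    simp [cHad, h]
  · intro w _ hw
    have : cHad w (x ∘ e) = 0 := by
      simp only [cHad, Matrix.of_apply, Function.comp_apply, h]
      by_cases h1 : w 0 = false
      · have h2 : w 1 ≠ x (e 1) := fun h2 => hw (by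
          ext i
          fin_cases i
          · exact h1.trans h.symm
          · exact h2)
        simp [h1, h2]
      · simp [h1]
    rw [this, zero_smul]
  · simp

theorem cHad_ket_on (e : Fin 2 ↪ ω) {x : ω → Bool} (h : x (e 0) = true) (h' : x (e 1) = false) :
    liftOp e cHad *ᵥ ket x = invSqrtTwo • (ket x + ket (Function.update x (e 1) true)) := by
  have h01 : e 0 ≠ e 1 := e.injective.ne (by decide)
  have hext : ∀ b, Function.extend e ((finTwoArrowEquiv Bool).symm (true, b)) x =
      Function.update x (e 1) b := by
    intro b
    symm
    refine eq_extend_iff.mpr ⟨?_, fun i hi => ?_⟩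
    · ext i
      fin_cases i
      · change Function.update x (e 1) b (e 0) = true
        rw [Function.update_of_ne h01, h]
      · change Function.update x (e 1) b (e 1) = b
        rw [Function.update_self]
    · rw [Function.update_of_ne]
      rintro rfl
      exact hi ⟨1, rfl⟩
  have hx : Function.update x (e 1) false = x := by rw [← h', Function.update_eq_self]
  rw [liftOp_ket, ← (finTwoArrowEquiv Bool).symm.sum_comp, Fintype.sum_prod_type]
  simp only [Fintype.sum_bool, hext, hx]
  simp [cHad, h, h', add_comm]

end ControlledHadamard

/-! ### One attempt at preparing a superposition of code words -/

section Attempt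
variable {α μ : Type} [Fintype α] [DecidableEq α] [Fintype μ] [DecidableEq μ]

/-- The indicator function of a finite set. -/
def ind (R : Finset μ) : μ → Bool := fun t => decide (t ∈ R)

theorem ket_elim {κ κ' : Type} [Fintype κ] [DecidableEq κ] [Fintype κ'] [DecidableEq κ']
    (a : κ → Bool) (b : κ' → Bool) :
    ket (Sum.elim a b) = fun x => ket a (x ∘ Sum.inl) * ket b (x ∘ Sum.inr) := by
  ext x
  have h : x = Sum.elim a b ↔ x ∘ Sum.inl = a ∧ x ∘ Sum.inr = b := by
    constructor
    · rintro rfl; exact ⟨rfl, rfl⟩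
    · rintro ⟨rfl, rfl⟩; ext (v | v) <;> rfl
  simp only [Pi.single_apply, h]
  split_ifs with h1 h2 h3 h2 h3 <;> simp_all

/-- A register, a mask for it, and a flag. -/
abbrev Reg (μ : Type) := μ ⊕ (μ ⊕ Unit)

/-- The wires of a register, its mask, and a flag, with given contents. -/
def regState (r u : μ → Bool) (f : Bool) : Reg μ → Bool := Sum.elim r (Sum.elim u fun _ => f)

/-- One Hadamard gate per register bit in `s`, controlled by the mask bit. Only the bits in `s ∩ U`
are put into superposition, so the basis states that occur correspond to subsets of `s ∩ U`. -/
theorem exists_hadamards (s : Finset μ) :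
    ∃ M : Matrix (α ⊕ Reg μ → Bool) (α ⊕ Reg μ → Bool) ℂ, Impl s.card M ∧
      ∀ (a : α → Bool) (U : Finset μ),
        M *ᵥ ket (Sum.elim a (regState (fun _ => false) (ind U) false)) =
          ∑ R ∈ (s ∩ U).powerset, invSqrtTwo ^ (s ∩ U).card •
            ket (Sum.elim a (regState (ind R) (ind U) false)) := by
  induction s using Finset.induction_on with
  | empty =>
    refine ⟨1, Impl.one, fun a U => ?_⟩
    have : (ind (∅ : Finset μ)) = fun _ => false := by ext; simp [ind]
    simp [this, -Matrix.mulVec_single, Matrix.one_mulVec]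
  | insert t s ht ih =>
    obtain ⟨M, hM, h⟩ := ih
    let e : Fin 2 ↪ α ⊕ Reg μ := ⟨![Sum.inr (Sum.inr (Sum.inl t)), Sum.inr (Sum.inl t)], by
      intro i j hij
      fin_cases i <;> fin_cases j <;> simp at hij ⊢⟩
    have e0 : e 0 = Sum.inr (Sum.inr (Sum.inl t)) := rfl
    have e1 : e 1 = Sum.inr (Sum.inl t) := rfl
    refine ⟨liftOp e cHad * M, ?_, fun a U => ?_⟩
    · rw [Finset.card_insert_of_notMem ht]
      exact Impl.mul hM (Impl.gate (by norm_num) e cHad cHad_mem_unitary)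
    · rw [← Matrix.mulVec_mulVec, h, Matrix.mulVec_sum]
      simp only [Matrix.mulVec_smul]
      by_cases htU : t ∈ U
      · have hts : t ∉ s ∩ U := fun h => ht (Finset.mem_inter.mp h).1
        rw [Finset.insert_inter_of_mem htU, Finset.sum_powerset_insert hts,
          Finset.card_insert_of_notMem hts, ← Finset.sum_add_distrib]
        refine Finset.sum_congr rfl fun R hR => ?_
        have htR : t ∉ R := fun h => hts (Finset.mem_powerset.mp hR h)
        have h1 : Function.update (Sum.elim a (regState (ind R) (ind U) false)) (e 1) true =
            Sum.elim a (regState (ind (insert t R)) (ind U) false) := by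
          rw [e1]
          ext (v | v | v | v)
          · rw [Function.update_of_ne (by simp)]; rfl
          · by_cases hv : v = t
            · subst hv
              rw [Function.update_self]
              simp [regState, ind]
            · rw [Function.update_of_ne (by simpa using hv)]
              simp [regState, ind, hv]
          · rw [Function.update_of_ne (by simp)]; rfl
          · rw [Function.update_of_ne (by simp)]; rfl
        rw [cHad_ket_on e (by simp [e0, regState, ind, htU]) (by simp [e1, regState, ind, htR]), h1,
          smul_smul, smul_add, pow_succ]
      · rw [Finset.insert_inter_of_notMem htU]
        refine Finset.sum_congr rfl fun R hR => ?_
        rw [cHad_ket_off e (by simp [e0, regState, ind, htU])]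

/-- The bits that may be equal to one in a code word that contains `a`. -/
def support (P : (α ⊕ μ → Bool) → Bool) (a : α → Bool) : Finset μ :=
  Finset.univ.filter fun t => P (Sum.elim a (ind {t}))

/-- The state produced by an attempt. -/
def attState (P : (α ⊕ μ → Bool) → Bool) (a : α → Bool) : (Reg μ → Bool) → ℂ :=
  ∑ R ∈ (support P a).powerset, invSqrtTwo ^ (support P a).card •
    ket (regState (ind R) (ind (support P a)) (P (Sum.elim a (ind R))))

/-- The mask is obtained by testing, for each bit, the word in which only this bit is set. Hadamard
gates on the masked bits give a uniform superposition over a cube, and a final test writes to the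
flag whether the content is a code word. -/
theorem exists_attempt {P : (α ⊕ μ → Bool) → Bool} {c : ℕ} {ε : ℝ}
    (hP : Approx c ε (encode (flipMap P))) :
    ∃ M : Matrix (α ⊕ Reg μ → Bool) (α ⊕ Reg μ → Bool) ℂ,
      Approx (Fintype.card μ * (c + 3) + c) ((Fintype.card μ + 1) * ε) M ∧
      ∀ a : α → Bool, M *ᵥ ket (Sum.elim a fun _ => false) =
        fun x => ket a (x ∘ Sum.inl) * attState P a (x ∘ Sum.inr) := by
  let e : ∀ w : μ ⊕ Unit, (α ⊕ μ) ⊕ Unit ↪ α ⊕ Reg μ := fun w =>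
    ⟨Sum.elim (Sum.map id Sum.inl) fun _ => Sum.inr (Sum.inr w), by
      rintro ((v | v) | v) ((v' | v') | v') h <;> simp at h ⊢ <;> exact h⟩
  have he : ∀ w, e w (Sum.inr ()) = Sum.inr (Sum.inr w) := fun _ => rfl
  let w : μ ↪ α ⊕ Reg μ := (Function.Embedding.inl.trans Function.Embedding.inr).trans
    Function.Embedding.inr
  let g : (α ⊕ Reg μ → Bool) → μ → Bool := fun x t =>
    P (Sum.elim (x ∘ Sum.inl) fun v => xor (x (Sum.inr (Sum.inl v))) (decide (v = t)))
  have hw : ∀ t, w t = Sum.inr (Sum.inr (Sum.inl t)) := fun _ => rfl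
  have hg : ∀ x y, (∀ v, v ∉ Set.range w → x v = y v) → g x = g y := fun x y hxy => by
    have h1 : x ∘ Sum.inl = y ∘ Sum.inl := by
      ext v; exact hxy _ (by rintro ⟨t, ht⟩; simp [hw] at ht)
    have h2 : ∀ v, x (Sum.inr (Sum.inl v)) = y (Sum.inr (Sum.inl v)) := fun v =>
      hxy _ (by rintro ⟨t, ht⟩; simp [hw] at ht)
    ext t
    simp only [g, h1, h2]
  -- Setting bit `t` of the register before the test and resetting it afterwards accounts for the
  -- two additional gates per bit.
  have hA := Approx.xor_batch w g hg (c := c + 2) (ε := ε) fun t => by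
    have h1 : Approx 1 0 (encode (bitXor (Sum.inr (Sum.inl t) : α ⊕ Reg μ) fun _ => true)) :=
      Approx.of_impl (encode_bitXor_not _)
    have h2 := (h1.mul (hP.lift (e (Sum.inl t)))).mul h1
    rw [flipMap, liftOp_bitXor, encode_mul_encode, encode_mul_encode] at h2
    have h3 : (bitXor (Sum.inr (Sum.inl t) : α ⊕ Reg μ) fun _ => true) ∘
        (bitXor (e (Sum.inl t) (Sum.inr ())) fun x => P ((x ∘ e (Sum.inl t)) ∘ Sum.inl)) ∘
        (bitXor (Sum.inr (Sum.inl t) : α ⊕ Reg μ) fun _ => true) =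
        bitXor (w t) fun x => g x t := by
      ext x v
      rw [he, hw, Function.comp_apply, Function.comp_apply]
      by_cases h : v = Sum.inr (Sum.inl t)
      · subst h
        rw [bitXor_self, bitXor_of_ne _ _ _ (by simp), bitXor_self, bitXor_of_ne _ _ _ (by simp)]
        simp
      · rw [bitXor_of_ne _ _ _ h]
        by_cases h' : v = Sum.inr (Sum.inr (Sum.inl t))
        · subst h'
          rw [bitXor_self, bitXor_self, bitXor_of_ne _ _ _ h]
          congr 2
          ext (v | v)
          · change bitXor (Sum.inr (Sum.inl t)) (fun _ => true) x (Sum.inl v) = x (Sum.inl v)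
            rw [bitXor_of_ne _ _ _ (by simp)]
          · change bitXor (Sum.inr (Sum.inl t)) (fun _ => true) x (Sum.inr (Sum.inl v)) = xor (x (Sum.inr (Sum.inl v))) _
            by_cases hv : v = t
            · subst hv; rw [bitXor_self]; simp
            · rw [bitXor_of_ne _ _ _ (by simpa using hv)]; simp [hv]
        · rw [bitXor_of_ne _ _ _ h', bitXor_of_ne _ _ _ h', bitXor_of_ne _ _ _ h]
    rw [h3] at h2
    exact h2.mono (by omega) (by linarith)
  obtain ⟨H, hH, hH'⟩ := exists_hadamards (α := α) (Finset.univ : Finset μ)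
  refine ⟨liftOp (e (Sum.inr ())) (encode (flipMap P)) *
    (H * encode (xorMap fun x => pad w (g x))), ?_, fun a => ?_⟩
  · refine ((hA.mul (Approx.of_impl hH)).mul (hP.lift (e (Sum.inr ())))).mono ?_ ?_
    · rw [Finset.card_univ]; ring_nf; exact le_rfl
    · linarith
  · have h1 : xorMap (fun x => pad w (g x)) (Sum.elim a fun _ => false) =
        Sum.elim a (regState (fun _ => false) (ind (support P a)) false) := by
      ext (v | v | v | v)
      · rw [xorMap_pad_off _ _ _ (by rintro ⟨t, ht⟩; simp [hw] at ht)]; rfl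
      · rw [xorMap_pad_off _ _ _ (by rintro ⟨t, ht⟩; simp [hw] at ht)]; rfl
      · rw [← hw, xorMap_pad_apply]
        simp only [hw, Sum.elim_inr, Bool.false_xor, g, regState, ind, Sum.elim_inl, support,
          Finset.mem_filter, Finset.mem_univ, true_and, Bool.decide_eq_true]
        congr 1
        ext (u | u)
        · rfl
        · simp [ind]
      · rw [xorMap_pad_off _ _ _ (by rintro ⟨t, ht⟩; simp [hw] at ht)]; rfl
    have h2 : ∀ R, bitXor (e (Sum.inr ()) (Sum.inr ()))
        (fun x => P ((x ∘ e (Sum.inr ())) ∘ Sum.inl))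
        (Sum.elim a (regState (ind R) (ind (support P a)) false)) =
        Sum.elim a (regState (ind R) (ind (support P a)) (P (Sum.elim a (ind R)))) := by
      intro R
      rw [he]
      ext (v | v | v | v)
      · rw [bitXor_of_ne _ _ _ (by simp)]; rfl
      · rw [bitXor_of_ne _ _ _ (by simp)]; rfl
      · rw [bitXor_of_ne _ _ _ (by simp)]; rfl
      · rw [bitXor_self]
        simp only [regState, Sum.elim_inr, Bool.false_xor]
        congr 1
        ext (v | v) <;> rfl
    rw [← Matrix.mulVec_mulVec, ← Matrix.mulVec_mulVec, encode_ket, h1, hH', Matrix.mulVec_sum]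
    simp only [Matrix.mulVec_smul, flipMap, liftOp_bitXor, encode_ket, h2, Finset.univ_inter]
    ext x
    simp only [attState, Finset.sum_apply, Finset.mul_sum, Pi.smul_apply, ket_elim, smul_eq_mul]
    exact Finset.sum_congr rfl fun R _ => by ring

end Attempt

/-! ### Squared norms and product vectors -/

section NormSq

/-- The square of the Euclidean norm. -/
def nsq {ι : Type*} [Fintype ι] (v : ι → ℂ) : ℝ := ∑ i, ‖v i‖ ^ 2

theorem nsq_eq {ι : Type*} [Fintype ι] (v : ι → ℂ) : nsq v = ‖WithLp.toLp 2 v‖ ^ 2 :=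
  (EuclideanSpace.norm_sq_eq _).symm

theorem nsq_eq_dotProduct {ι : Type*} [Fintype ι] (v : ι → ℂ) : (nsq v : ℂ) = star v ⬝ᵥ v := by
  rw [nsq, dotProduct, Complex.ofReal_sum]
  refine Finset.sum_congr rfl fun i _ => ?_
  rw [Pi.star_apply, RCLike.star_def, Complex.conj_mul', Complex.ofReal_pow]

theorem nsq_mulVec {m n : Type*} [Fintype m] [Fintype n] [DecidableEq n] {M : Matrix m n ℂ}
    (hM : Mᴴ * M = 1) (v : n → ℂ) : nsq (M *ᵥ v) = nsq v := by
  have h : (nsq (M *ᵥ v) : ℂ) = nsq v := by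
    rw [nsq_eq_dotProduct, nsq_eq_dotProduct, Matrix.star_mulVec, ← Matrix.dotProduct_mulVec,
      Matrix.mulVec_mulVec, hM, Matrix.one_mulVec]
  exact_mod_cast h

theorem nsq_ket {ι : Type*} [Fintype ι] [DecidableEq ι] (x : ι) : nsq (ket x) = 1 := by
  rw [nsq, Finset.sum_eq_single x]
  · simp
  · intro y _ hy; simp [hy]
  · simp

variable {κ κ' : Type} [Fintype κ] [DecidableEq κ] [Fintype κ'] [DecidableEq κ']

theorem sum_arrow_sum {β : Type*} [AddCommMonoid β] (f : (κ ⊕ κ' → Bool) → β) :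
    ∑ x, f x = ∑ y, ∑ z, f (Sum.elim y z) := by
  rw [← Fintype.sum_prod_type', ← (Equiv.sumArrowEquivProdArrow κ κ' Bool).symm.sum_comp]
  rfl

theorem nsq_mul (f : (κ → Bool) → ℂ) (g : (κ' → Bool) → ℂ) :
    nsq (fun x : κ ⊕ κ' → Bool => f (x ∘ Sum.inl) * g (x ∘ Sum.inr)) = nsq f * nsq g := by
  rw [nsq, sum_arrow_sum, nsq, nsq, Finset.sum_mul_sum]
  refine Finset.sum_congr rfl fun y _ => Finset.sum_congr rfl fun z _ => ?_
  rw [norm_mul, mul_pow]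
  rfl

end NormSq

/-! ### Controlled exchange of registers -/

section Swap
variable {κ ω : Type} [Fintype κ] [DecidableEq κ] [Fintype ω] [DecidableEq ω]

/-- Exchanging the contents of two registers if the wire `f` is set. -/
def cswapMap (f : ω) (w w' : κ ↪ ω) (x : ω → Bool) : ω → Bool :=
  if x f then Function.extend w (x ∘ w') (Function.extend w' (x ∘ w) x) else x

/-- An exchange is three rounds of bitwise addition, here each conditioned on the flag `f`. -/
theorem exists_cswap (f : ω) (w w' : κ ↪ ω) (h : ∀ s t, w s ≠ w' t) (hf : ∀ t, w t ≠ f)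
    (hf' : ∀ t, w' t ≠ f) :
    Function.Involutive (cswapMap f w w') ∧
      Approx (3 * Fintype.card κ) 0 (encode (cswapMap f w w')) := by
  let g : (ω → Bool) → κ → Bool := fun x t => x f && x (w' t)
  let g' : (ω → Bool) → κ → Bool := fun x t => x f && x (w t)
  have hg : ∀ x y, (∀ v, v ∉ Set.range w → x v = y v) → g x = g y := fun x y hxy => by
    ext t
    simp only [g]
    rw [hxy f (by rintro ⟨s, hs⟩; exact hf s hs), hxy (w' t) (by rintro ⟨s, hs⟩; exact h s t hs)]
  have hg' : ∀ x y, (∀ v, v ∉ Set.range w' → x v = y v) → g' x = g' y := fun x y hxy => by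
    ext t
    simp only [g']
    rw [hxy f (by rintro ⟨s, hs⟩; exact hf' s hs),
      hxy (w t) (by rintro ⟨s, hs⟩; exact h t s hs.symm)]
  have h1 := Approx.xor_local w g hg (fun _ => f) w' (fun t => (hf t).symm)
    (fun t => (h t t).symm) fun t x y e1 e2 => by simp only [g, e1, e2]
  have h2 := Approx.xor_local w' g' hg' (fun _ => f) w (fun t => (hf' t).symm)
    (fun t => h t t) fun t x y e1 e2 => by simp only [g', e1, e2]
  set X := xorMap fun x => pad w (g x) with hX
  set X' := xorMap fun x => pad w' (g' x) with hX'
  have i1 : Function.Involutive X := xorMap_pad_involutive w hg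
  have i2 : Function.Involutive X' := xorMap_pad_involutive w' hg'
  have a1 : ∀ x t, X x (w t) = xor (x (w t)) (x f && x (w' t)) := fun x t =>
    xorMap_pad_apply w g x t
  have a2 : ∀ x t, X' x (w' t) = xor (x (w' t)) (x f && x (w t)) := fun x t =>
    xorMap_pad_apply w' g' x t
  have b1 : ∀ x v, v ∉ Set.range w → X x v = x v := fun x v hv => xorMap_pad_off w g x hv
  have b2 : ∀ x v, v ∉ Set.range w' → X' x v = x v := fun x v hv => xorMap_pad_off w' g' x hv
  have c1 : ∀ x t, X x (w' t) = x (w' t) := fun x t => b1 x _ fun ⟨s, hs⟩ => h s t hs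
  have c2 : ∀ x t, X' x (w t) = x (w t) := fun x t => b2 x _ fun ⟨s, hs⟩ => h t s hs.symm
  have d1 : ∀ x, X x f = x f := fun x => b1 x _ fun ⟨s, hs⟩ => hf s hs
  have d2 : ∀ x, X' x f = x f := fun x => b2 x _ fun ⟨s, hs⟩ => hf' s hs
  have key : X ∘ X' ∘ X = cswapMap f w w' := by
    ext x v
    rw [Function.comp_apply, Function.comp_apply, cswapMap]
    by_cases hv : v ∈ Set.range w
    · obtain ⟨t, rfl⟩ := hv
      rw [a1, c2, d2, a2, c1, a1, d1]
      cases hxf : x f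
      · simp
      · simp only [Bool.true_and, if_true]
        rw [w.injective.extend_apply]
        simp only [Function.comp_apply]
        cases x (w t) <;> cases x (w' t) <;> rfl
    · rw [b1 _ _ hv]
      by_cases hv' : v ∈ Set.range w'
      · obtain ⟨t, rfl⟩ := hv'
        rw [a2, c1, a1, d1]
        cases hxf : x f
        · simp
        · simp only [Bool.true_and, if_true]
          rw [extend_off w _ _ hv, w'.injective.extend_apply]
          simp only [Function.comp_apply]
          cases x (w t) <;> cases x (w' t) <;> rfl
      · rw [b2 _ _ hv', b1 _ _ hv]
        split_ifs
        · rw [extend_off w _ _ hv, extend_off w' _ _ hv']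
        · rfl
  constructor
  · rw [← key]
    intro x
    simp only [Function.comp_apply]
    rw [i1, i2, i1]
  · have := (h1.mul h2).mul h1
    rw [encode_mul_encode, encode_mul_encode, key] at this
    exact this.mono (by omega) (by linarith)

end Swap

/-! ### Repeated attempts -/

section Rounds
variable {α μ : Type} [Fintype α] [DecidableEq α] [Fintype μ] [DecidableEq μ]

/-- The code words that contain `a`. -/
def words (P : (α ⊕ μ → Bool) → Bool) (a : α → Bool) : Finset (μ → Bool) :=
  Finset.univ.filter fun z => P (Sum.elim a z)

/-- The code words that contain `a` make up a sizable part of a cube. -/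
def IsDense (P : (α ⊕ μ → Bool) → Bool) (a : α → Bool) : Prop :=
  (∀ z t, P (Sum.elim a z) = true → z t = true → P (Sum.elim a (ind {t})) = true) ∧
    2 ^ (support P a).card ≤ 4 * (words P a).card

/-- The uniform superposition of the code words that contain `a`. -/
def unif (P : (α ⊕ μ → Bool) → Bool) (a : α → Bool) : (μ → Bool) → ℂ :=
  fun z => if P (Sum.elim a z) then ((√((words P a).card : ℝ) : ℝ) : ℂ)⁻¹ else 0

variable {P : (α ⊕ μ → Bool) → Bool} {a : α → Bool}

theorem IsDense.card_pos (h : IsDense P a) : 0 < (words P a).card := by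
  have := h.2
  have h2 : 0 < 2 ^ (support P a).card := by positivity
  omega

theorem nsq_unif (h : IsDense P a) : nsq (unif P a) = 1 := by
  have h1 : (0 : ℝ) < (words P a).card := by exact_mod_cast h.card_pos
  have h2 : ∀ z, ‖unif P a z‖ ^ 2 = if P (Sum.elim a z) then ((words P a).card : ℝ)⁻¹ else 0 := by
    intro z
    rw [unif]
    split_ifs
    · rw [norm_inv, Complex.norm_real, Real.norm_of_nonneg (Real.sqrt_nonneg _), inv_pow,
        Real.sq_sqrt h1.le]
    · simp
  rw [nsq]
  simp only [h2]
  rw [← Finset.sum_filter, Finset.sum_const, nsmul_eq_mul]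
  exact mul_inv_cancel₀ h1.ne'

theorem regState_injective {r r' u u' : μ → Bool} {f f' : Bool} :
    regState r u f = regState r' u' f' ↔ r = r' ∧ u = u' ∧ f = f' := by
  constructor
  · intro h
    refine ⟨?_, ?_, congrFun h (Sum.inr (Sum.inr ()))⟩
    · ext t; exact congrFun h (Sum.inl t)
    · ext t; exact congrFun h (Sum.inr (Sum.inl t))
  · rintro ⟨rfl, rfl, rfl⟩; rfl

theorem ind_injective {R R' : Finset μ} (h : ind R = ind R') : R = R' := by
  ext t
  simpa [ind] using congrFun h t

theorem attState_apply (P : (α ⊕ μ → Bool) → Bool) (a : α → Bool) (r u : μ → Bool) (f : Bool) :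
    attState P a (regState r u f) =
      if u = ind (support P a) ∧ (∀ t, r t = true → t ∈ support P a) ∧ f = P (Sum.elim a r) then
        invSqrtTwo ^ (support P a).card else 0 := by
  let R₀ : Finset μ := Finset.univ.filter fun t => r t = true
  have hR₀ : ind R₀ = r := by ext t; simp [ind, R₀]
  have hsub : R₀ ∈ (support P a).powerset ↔ ∀ t, r t = true → t ∈ support P a := by
    rw [Finset.mem_powerset, Finset.subset_iff]
    simp [R₀]
  rw [attState, Finset.sum_apply]
  simp only [Pi.smul_apply, Pi.single_apply, regState_injective, smul_eq_mul, mul_ite, mul_one,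
    mul_zero]
  have h3 : ∀ R, (r = ind R ∧ u = ind (support P a) ∧ f = P (Sum.elim a (ind R))) ↔
      R = R₀ ∧ (u = ind (support P a) ∧ f = P (Sum.elim a r)) := by
    intro R
    constructor
    · rintro ⟨rfl, h1, h2⟩
      exact ⟨ind_injective hR₀.symm, h1, h2⟩
    · rintro ⟨rfl, h1, h2⟩
      rw [hR₀]
      exact ⟨rfl, h1, h2⟩
  simp only [h3, ite_and, Finset.sum_ite_eq', hsub]
  split_ifs <;> rfl

/-- The part of the state of a failed attempt. -/
def attFail (P : (α ⊕ μ → Bool) → Bool) (a : α → Bool) : (Reg μ → Bool) → ℂ :=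
  fun x => if x (Sum.inr (Sum.inr ())) then 0 else attState P a x

/-- The state of the mask after a successful attempt. -/
def maskState (P : (α ⊕ μ → Bool) → Bool) (a : α → Bool) : (μ → Bool) → ℂ :=
  fun u => if u = ind (support P a) then invSqrtTwo ^ (support P a).card else 0

/-- After success the restriction to the cube is automatic, since code words use only bits of the
support. The register is then uniform over code words and in product with the mask. -/
theorem attState_true (h : IsDense P a) (r u : μ → Bool) :
    attState P a (regState r u true) = (if P (Sum.elim a r) then 1 else 0) * maskState P a u := by
  rw [attState_apply, maskState]
  cases hP : P (Sum.elim a r)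
  · simp
  · have : ∀ t, r t = true → t ∈ support P a := fun t ht => by
      simpa [support] using h.1 r t hP ht
    simp only [if_true, one_mul]
    exact if_congr ⟨fun h => h.1, fun h => ⟨h, this, trivial⟩⟩ rfl rfl

theorem sum_unit (f : (Unit → Bool) → ℝ) : ∑ x, f x = f (fun _ => true) + f fun _ => false := by
  rw [← (Equiv.funUnique Unit Bool).symm.sum_comp, Fintype.sum_bool]
  rfl

theorem norm_invSqrtTwo_sq : ‖invSqrtTwo‖ ^ 2 = 1 / 2 := by
  rw [invSqrtTwo, norm_inv, Complex.norm_real, Real.norm_of_nonneg (Real.sqrt_nonneg _), inv_pow,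
    Real.sq_sqrt (by norm_num)]
  norm_num

/-- The successful part has weight `|words| / 2^|support|`, at least `1/4` by density. -/
theorem nsq_attFail_le (h : IsDense P a) (h1 : nsq (attState P a) = 1) :
    nsq (attFail P a) ≤ 3 / 4 := by
  have e1 : nsq (attState P a) = nsq (attFail P a) +
      ∑ r : μ → Bool, ∑ u : μ → Bool, ‖attState P a (regState r u true)‖ ^ 2 := by
    rw [nsq, nsq, sum_arrow_sum, sum_arrow_sum, ← Finset.sum_add_distrib]
    refine Finset.sum_congr rfl fun r _ => ?_
    rw [sum_arrow_sum, sum_arrow_sum, ← Finset.sum_add_distrib]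
    refine Finset.sum_congr rfl fun u _ => ?_
    rw [sum_unit, sum_unit, add_comm]
    simp only [attFail, Sum.elim_inr, if_true, Bool.false_eq_true, if_false, norm_zero]
    rw [zero_pow two_ne_zero, zero_add]
    rfl
  have e2 : ∑ r : μ → Bool, ∑ u : μ → Bool, ‖attState P a (regState r u true)‖ ^ 2 =
      (words P a).card * (1 / 2 : ℝ) ^ (support P a).card := by
    have : ∀ r u, ‖attState P a (regState r u true)‖ ^ 2 =
        if u = ind (support P a) then
          (if P (Sum.elim a r) then (1 / 2 : ℝ) ^ (support P a).card else 0) else 0 := by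
      intro r u
      rw [attState_true h, maskState, norm_mul, mul_pow]
      split_ifs
      · rw [norm_one, one_pow, one_mul, norm_pow, ← pow_mul, mul_comm, pow_mul, norm_invSqrtTwo_sq]
      · simp
      · simp
      · simp
    simp only [this, Finset.sum_ite_eq', Finset.mem_univ, if_true]
    rw [← Finset.sum_filter, Finset.sum_const, nsmul_eq_mul]
    rfl
  have e3 : (1 : ℝ) ≤ 4 * ((words P a).card * (1 / 2 : ℝ) ^ (support P a).card) := by
    have h2 : (2 : ℝ) ^ (support P a).card ≤ 4 * (words P a).card := by exact_mod_cast h.2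
    have h3 : (0 : ℝ) < (1 / 2 : ℝ) ^ (support P a).card := by positivity
    have h4 : (2 : ℝ) ^ (support P a).card * (1 / 2 : ℝ) ^ (support P a).card = 1 := by
      rw [← mul_pow]; norm_num
    nlinarith
  linarith

theorem ket_elim_apply {κ κ' : Type} [Fintype κ] [DecidableEq κ] [Fintype κ'] [DecidableEq κ']
    (a : κ → Bool) (b : κ' → Bool) (x : κ ⊕ κ' → Bool) :
    ket (Sum.elim a b) x = ket a (x ∘ Sum.inl) * ket b (x ∘ Sum.inr) := by rw [ket_elim]

theorem ket_false_apply {κ κ' : Type} [Fintype κ] [DecidableEq κ] [Fintype κ'] [DecidableEq κ']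
    (x : κ ⊕ κ' → Bool) : ket (fun _ => false) x =
      ket (fun _ => false) (x ∘ Sum.inl) * ket (fun _ => false) (x ∘ Sum.inr) := by
  rw [← ket_elim_apply]
  congr 1
  ext (v | v) <;> rfl

/-- Each round makes a fresh attempt and, if it succeeds, swaps the result into the main register.
The invariant is that this register holds the uniform state in product with some garbage `τ`, up to
an error. Only the component in which every attempt failed remains in the error, and its weight
shrinks by a factor `3/4` per round. The garbage may depend on `a`. -/
theorem exists_rounds {c : ℕ} {ε : ℝ} (hP : Approx c ε (encode (flipMap P))) (k : ℕ) :
    ∃ (κ : Type) (_ : Fintype κ) (_ : DecidableEq κ)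
      (M : Matrix (α ⊕ (μ ⊕ κ) → Bool) (α ⊕ (μ ⊕ κ) → Bool) ℂ),
      Fintype.card κ = k * (2 * Fintype.card μ + 1) ∧
      Approx (k * (Fintype.card μ * (c + 6) + c)) (k * ((Fintype.card μ + 1) * ε)) M ∧
      ∀ a : α → Bool, IsDense P a → ∃ (τ : (κ → Bool) → ℂ) (err : (μ ⊕ κ → Bool) → ℂ),
        nsq err ≤ (3 / 4) ^ k ∧ M *ᵥ ket (Sum.elim a fun _ => false) = fun x =>
          ket a (x ∘ Sum.inl) * (unif P a (x ∘ Sum.inr ∘ Sum.inl) * τ (x ∘ Sum.inr ∘ Sum.inr) +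
            err (x ∘ Sum.inr)) := by
  induction k with
  | zero =>
    refine ⟨Empty, inferInstance, inferInstance, 1, by simp, ?_, fun a _ =>
      ⟨0, ket fun _ => false, by rw [nsq_ket]; simp, ?_⟩⟩
    · simpa using Approx.of_impl (Impl.one (ω := α ⊕ (μ ⊕ Empty)))
    · rw [Matrix.one_mulVec, ket_elim]
      simp
  | succ k ih =>
    obtain ⟨κ, _, _, M, hκ, hM, h⟩ := ih
    obtain ⟨A, hA, hA'⟩ := exists_attempt hP
    let e₁ : α ⊕ (μ ⊕ κ) ↪ α ⊕ (μ ⊕ (κ ⊕ Reg μ)) := (Function.Embedding.refl α).sumMap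
      ((Function.Embedding.refl μ).sumMap Function.Embedding.inl)
    let e₂ : α ⊕ Reg μ ↪ α ⊕ (μ ⊕ (κ ⊕ Reg μ)) := (Function.Embedding.refl α).sumMap
      (Function.Embedding.inr.trans Function.Embedding.inr)
    let f : α ⊕ (μ ⊕ (κ ⊕ Reg μ)) := Sum.inr (Sum.inr (Sum.inr (Sum.inr (Sum.inr ()))))
    let w : μ ↪ α ⊕ (μ ⊕ (κ ⊕ Reg μ)) := Function.Embedding.inl.trans Function.Embedding.inr
    let w' : μ ↪ α ⊕ (μ ⊕ (κ ⊕ Reg μ)) :=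
      ((Function.Embedding.inl.trans Function.Embedding.inr).trans Function.Embedding.inr).trans
        Function.Embedding.inr
    obtain ⟨hF, hF'⟩ := exists_cswap f w w' (fun s t => by simp [w, w']) (fun t => by simp [w, f])
      fun t => by simp [w', f]
    refine ⟨κ ⊕ Reg μ, inferInstance, inferInstance,
      encode (cswapMap f w w') * (liftOp e₂ A * liftOp e₁ M), ?_, ?_, fun a ha => ?_⟩
    · simp only [Fintype.card_sum, hκ, Fintype.card_unit]; ring
    · refine (((hM.lift e₁).mul (hA.lift e₂)).mul hF').mono ?_ ?_
      · ring_nf; omega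
      · push_cast; linarith
    obtain ⟨τ, err, herr, hτ⟩ := h a ha
    set ψ : (μ ⊕ κ → Bool) → ℂ := fun y => unif P a (y ∘ Sum.inl) * τ (y ∘ Sum.inr) + err y with hψ
    have hatt : nsq (attState P a) = 1 := by
      have h1 := nsq_mulVec (Matrix.mem_unitaryGroup_iff'.mp hA.1) (ket (Sum.elim a fun _ => false))
      rw [hA', nsq_mul (ket a) (attState P a), nsq_ket, nsq_ket, one_mul] at h1
      exact h1
    -- The new garbage. If the attempt succeeded it contains the former content `ψ` of the main
    -- register, which was swapped out, and the mask; the factor `√|words|` compensates the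
    -- normalization of `unif`. Otherwise it is the old garbage with the state of the failed
    -- attempt. The new error is the old one times the failed attempt.
    refine ⟨fun z => if z (Sum.inr (Sum.inr (Sum.inr ()))) then
        ((√((words P a).card : ℝ) : ℝ) : ℂ) * maskState P a (z ∘ Sum.inr ∘ Sum.inr ∘ Sum.inl) *
          ψ (Sum.elim (z ∘ Sum.inr ∘ Sum.inl) (z ∘ Sum.inl))
        else τ (z ∘ Sum.inl) * attState P a (z ∘ Sum.inr),
      fun x => err (Sum.elim (x ∘ Sum.inl) (x ∘ Sum.inr ∘ Sum.inl)) *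
        attFail P a (x ∘ Sum.inr ∘ Sum.inr), ?_, ?_⟩
    · have h1 : nsq (fun x : μ ⊕ (κ ⊕ Reg μ) → Bool =>
          err (Sum.elim (x ∘ Sum.inl) (x ∘ Sum.inr ∘ Sum.inl)) *
            attFail P a (x ∘ Sum.inr ∘ Sum.inr)) = nsq err * nsq (attFail P a) := by
        rw [nsq, sum_arrow_sum, nsq, sum_arrow_sum, nsq, Finset.sum_mul]
        refine Finset.sum_congr rfl fun r _ => ?_
        rw [sum_arrow_sum, Finset.sum_mul_sum]
        refine Finset.sum_congr rfl fun y _ => Finset.sum_congr rfl fun z _ => ?_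
        rw [norm_mul, mul_pow]
        rfl
      rw [h1, pow_succ]
      exact mul_le_mul herr (nsq_attFail_le ha hatt) (Finset.sum_nonneg fun _ _ => by positivity)
        (by positivity)
    · have s1 : ket (Sum.elim a fun _ => false) = fun x : α ⊕ (μ ⊕ (κ ⊕ Reg μ)) → Bool =>
          ket (Sum.elim a fun _ => false) (x ∘ e₁) *
            ket (fun _ => false) (x ∘ Sum.inr ∘ Sum.inr ∘ Sum.inr) := by
        ext x
        rw [ket_elim_apply, ket_elim_apply, ket_false_apply (x ∘ Sum.inr),
          ket_false_apply ((x ∘ Sum.inr) ∘ Sum.inr), ket_false_apply ((x ∘ e₁) ∘ Sum.inr)]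
        simp only [mul_assoc]
        rfl
      have s2 : (fun x : α ⊕ (μ ⊕ (κ ⊕ Reg μ)) → Bool =>
          (ket a ((x ∘ e₁) ∘ Sum.inl) * ψ ((x ∘ e₁) ∘ Sum.inr)) *
            ket (fun _ => false) (x ∘ Sum.inr ∘ Sum.inr ∘ Sum.inr)) =
          fun x => ket (Sum.elim a fun _ => false) (x ∘ e₂) * ψ ((x ∘ e₁) ∘ Sum.inr) := by
        ext x
        rw [ket_elim_apply, mul_assoc, mul_comm (ψ _), ← mul_assoc]
        rfl
      rw [← Matrix.mulVec_mulVec, ← Matrix.mulVec_mulVec, s1,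
        liftOp_mulVec_prod e₁ M _ _ ?_, hτ]
      · change _ *ᵥ (liftOp e₂ A *ᵥ (fun x : α ⊕ (μ ⊕ (κ ⊕ Reg μ)) → Bool =>
          (ket a ((x ∘ e₁) ∘ Sum.inl) * ψ ((x ∘ e₁) ∘ Sum.inr)) *
            ket (fun _ => false) (x ∘ Sum.inr ∘ Sum.inr ∘ Sum.inr))) = _
        rw [s2, liftOp_mulVec_prod e₂ A _ _ ?_, hA', encode_mulVec hF]
        · ext x
          have hE : Sum.elim ((x ∘ Sum.inr) ∘ Sum.inl) ((x ∘ Sum.inr) ∘ Sum.inr ∘ Sum.inl) =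
              (x ∘ e₁) ∘ Sum.inr := by ext (v | v) <;> rfl
          rw [Function.comp_apply, cswapMap]
          by_cases hf : x f = false
          · rw [if_neg (by rw [hf]; simp)]
            have hf' : x (Sum.inr (Sum.inr (Sum.inr (Sum.inr (Sum.inr ()))))) = false := hf
            simp only [Bool.false_eq_true, if_false, hf', attFail, hE, Function.comp_apply, hψ]
            change ket a (x ∘ Sum.inl) * attState P a (x ∘ Sum.inr ∘ Sum.inr ∘ Sum.inr) *
              (unif P a (x ∘ Sum.inr ∘ Sum.inl) * τ (x ∘ Sum.inr ∘ Sum.inr ∘ Sum.inl) +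
                err ((x ∘ e₁) ∘ Sum.inr)) = ket a (x ∘ Sum.inl) *
              (unif P a (x ∘ Sum.inr ∘ Sum.inl) * (τ (x ∘ Sum.inr ∘ Sum.inr ∘ Sum.inl) *
                attState P a (x ∘ Sum.inr ∘ Sum.inr ∘ Sum.inr)) +
                err ((x ∘ e₁) ∘ Sum.inr) * attState P a (x ∘ Sum.inr ∘ Sum.inr ∘ Sum.inr))
            ring
          · rw [Bool.not_eq_false] at hf
            rw [if_pos hf]
            have hf' : x (Sum.inr (Sum.inr (Sum.inr (Sum.inr (Sum.inr ()))))) = true := hf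
            set y := Function.extend w (x ∘ w') (Function.extend w' (x ∘ w) x) with hy
            have y1 : ∀ t, y (w t) = x (w' t) := fun t => w.injective.extend_apply _ _ _
            have y0 : ∀ v, v ∉ Set.range w → y v = Function.extend w' (x ∘ w) x v := fun v hv =>
              extend_off w _ _ hv
            have y2 : ∀ t, y (w' t) = x (w t) := fun t => by
              rw [y0 _ (by rintro ⟨s, hs⟩; simp [w, w'] at hs), w'.injective.extend_apply]
              rfl
            have y3 : ∀ v, v ∉ Set.range w → v ∉ Set.range w' → y v = x v := fun v hv hv' => by
              rw [y0 _ hv, extend_off w' _ _ hv']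
            have z1 : (y ∘ e₂) ∘ Sum.inl = x ∘ Sum.inl := by
              ext v
              exact y3 _ (by rintro ⟨s, hs⟩; simp [w, e₂] at hs) (by rintro ⟨s, hs⟩; simp [w', e₂] at hs)
            have z2 : (y ∘ e₂) ∘ Sum.inr = regState (x ∘ Sum.inr ∘ Sum.inl)
                (x ∘ Sum.inr ∘ Sum.inr ∘ Sum.inr ∘ Sum.inr ∘ Sum.inl) true := by
              ext (v | v | v)
              · exact y2 v
              · exact y3 _ (by rintro ⟨s, hs⟩; simp [w, e₂] at hs) (by rintro ⟨s, hs⟩; simp [w', e₂] at hs)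
              · exact (y3 f (by rintro ⟨s, hs⟩; simp [w, f] at hs)
                  (by rintro ⟨s, hs⟩; simp [w', f] at hs)).trans hf
            have z3 : (y ∘ e₁) ∘ Sum.inr = Sum.elim (x ∘ w') (x ∘ Sum.inr ∘ Sum.inr ∘ Sum.inl) := by
              ext (v | v)
              · exact y1 v
              · exact y3 _ (by rintro ⟨s, hs⟩; simp [w, e₁] at hs) (by rintro ⟨s, hs⟩; simp [w', e₁] at hs)
            have hcard : ((√((words P a).card : ℝ) : ℝ) : ℂ) ≠ 0 := by
              have : (0 : ℝ) < (words P a).card := by exact_mod_cast ha.card_pos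
              exact_mod_cast (Real.sqrt_pos.mpr this).ne'
            have hun : unif P a (x ∘ Sum.inr ∘ Sum.inl) * ((√((words P a).card : ℝ) : ℝ) : ℂ) =
                if P (Sum.elim a (x ∘ Sum.inr ∘ Sum.inl)) then 1 else 0 := by
              rw [unif]
              split_ifs
              · exact inv_mul_cancel₀ hcard
              · rw [zero_mul]
            simp only [if_true, Function.comp_apply, hf', attFail, mul_zero, add_zero]
            rw [z1, z2, z3, attState_true ha, ← hun]
            simp only [← mul_assoc]
            rfl
        · intro z x
          congr 1
          ext (v | v)
          · exact extend_off e₂ _ _ (by rintro ⟨s | s, hs⟩ <;> simp [e₂, e₁] at hs)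
          · exact extend_off e₂ _ _ (by rintro ⟨s | s, hs⟩ <;> simp [e₂, e₁] at hs)
      · intro z x
        congr 1
        ext v
        exact extend_off e₁ _ _ (by rintro ⟨s | s | s, hs⟩ <;> simp [e₁] at hs)

end Rounds

/-! ### Exact preparation by a nearby unitary -/

section Prep
open scoped Matrix.Norms.L2Operator
variable {κ κ' : Type} [Fintype κ] [DecidableEq κ] [Fintype κ'] [DecidableEq κ']
variable {m : Type} [Fintype m] [DecidableEq m]

/-- The matrix with columns `|f l⟩ ⊗ v l`. -/
def blockCols (f : m → κ → Bool) (v : m → (κ' → Bool) → ℂ) : Matrix (κ ⊕ κ' → Bool) m ℂ :=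
  Matrix.of fun x l => ket (f l) (x ∘ Sum.inl) * v l (x ∘ Sum.inr)

theorem nsq_nonneg {ι : Type*} [Fintype ι] (v : ι → ℂ) : 0 ≤ nsq v :=
  Finset.sum_nonneg fun _ _ => by positivity

theorem blockCols_conjTranspose_mul {f : m → κ → Bool} (hf : Function.Injective f)
    (v : m → (κ' → Bool) → ℂ) :
    (blockCols f v)ᴴ * blockCols f v = Matrix.diagonal fun l => (nsq (v l) : ℂ) := by
  ext l l'
  rw [Matrix.mul_apply, Matrix.diagonal_apply, sum_arrow_sum]
  have h : ∀ (y : κ → Bool) (z : κ' → Bool), (blockCols f v)ᴴ l (Sum.elim y z) *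
      blockCols f v (Sum.elim y z) l' =
      if y = f l then (if f l = f l' then star (v l z) * v l' z else 0) else 0 := by
    intro y z
    have h1 : (Sum.elim y z) ∘ Sum.inl = y := rfl
    have h2 : (Sum.elim y z) ∘ Sum.inr = z := rfl
    simp only [blockCols, Matrix.conjTranspose_apply, Matrix.of_apply, h1, h2, Pi.single_apply]
    split_ifs <;> simp_all
  simp only [h, hf.eq_iff]
  rw [Finset.sum_comm]
  simp only [Finset.sum_ite_eq', Finset.mem_univ, if_true]
  split_ifs with hl
  · subst hl
    rw [nsq_eq_dotProduct]
    rfl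
  · simp

theorem norm_blockCols_le {f : m → κ → Bool} (hf : Function.Injective f)
    {v : m → (κ' → Bool) → ℂ} {η : ℝ} (hη : 0 ≤ η) (h : ∀ l, nsq (v l) ≤ η ^ 2) :
    ‖blockCols f v‖ ≤ η := by
  have h1 := Matrix.l2_opNorm_conjTranspose_mul_self (blockCols f v)
  rw [blockCols_conjTranspose_mul hf, Matrix.l2_opNorm_diagonal] at h1
  have h2 : ‖fun l => (nsq (v l) : ℂ)‖ ≤ η ^ 2 := by
    refine (pi_norm_le_iff_of_nonneg (by positivity)).mpr fun l => ?_
    rw [Complex.norm_real, Real.norm_of_nonneg (nsq_nonneg _)]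
    exact h l
  rw [h1, ← sq] at h2
  exact (abs_le_of_sq_le_sq' h2 hη).2

/-- Since `g ⊗ τ + err` and `g` are unit vectors, `‖τ‖` differs from one by at most `η`. Normalizing
`τ` costs another `η`. -/
theorem exists_unit_tensor {g : (κ → Bool) → ℂ} (hg : nsq g = 1) (τ : (κ' → Bool) → ℂ)
    (err : (κ ⊕ κ' → Bool) → ℂ) {η : ℝ} (hη : 0 ≤ η) (hη1 : η < 1) (herr : nsq err ≤ η ^ 2)
    (h : nsq (fun y => g (y ∘ Sum.inl) * τ (y ∘ Sum.inr) + err y) = 1) :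
    ∃ τ' : (κ' → Bool) → ℂ, nsq τ' = 1 ∧
      nsq (fun y => (g (y ∘ Sum.inl) * τ (y ∘ Sum.inr) + err y) -
        g (y ∘ Sum.inl) * τ' (y ∘ Sum.inr)) ≤ (2 * η) ^ 2 := by
  have hn : ∀ {ι : Type} [Fintype ι] (v : ι → ℂ), ‖WithLp.toLp 2 v‖ = √(nsq v) := fun v => by
    rw [nsq_eq, Real.sqrt_sq (norm_nonneg _)]
  set T : (κ ⊕ κ' → Bool) → ℂ := fun y => g (y ∘ Sum.inl) * τ (y ∘ Sum.inr) with hT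
  set N := ‖WithLp.toLp 2 τ‖ with hN
  have h1 : ‖WithLp.toLp 2 T‖ = N := by
    rw [hn, hT, nsq_mul, hg, one_mul, hN, hn]
  have h2 : ‖WithLp.toLp 2 err‖ ≤ η := by
    rw [hn]
    exact Real.sqrt_le_iff.mpr ⟨hη, herr⟩
  have h3 : ‖WithLp.toLp 2 T + WithLp.toLp 2 err‖ = 1 := by
    rw [← WithLp.toLp_add, hn]
    change √(nsq fun y => T y + err y) = 1
    rw [h, Real.sqrt_one]
  have h4 : |1 - N| ≤ η := by
    have := abs_norm_sub_norm_le (WithLp.toLp 2 T + WithLp.toLp 2 err) (WithLp.toLp 2 T)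
    rw [h3, h1, add_sub_cancel_left] at this
    exact this.trans h2
  have hN0 : 0 < N := by
    have := le_abs_self (1 - N)
    linarith
  have hNc : (N : ℂ) ≠ 0 := by exact_mod_cast hN0.ne'
  refine ⟨fun z => (N : ℂ)⁻¹ * τ z, ?_, ?_⟩
  · rw [nsq_eq]
    change ‖WithLp.toLp 2 ((N : ℂ)⁻¹ • τ)‖ ^ 2 = 1
    rw [WithLp.toLp_smul, norm_smul, norm_inv, Complex.norm_real, Real.norm_of_nonneg hN0.le,
      ← hN, inv_mul_cancel₀ hN0.ne', one_pow]
  · rw [nsq_eq]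
    refine pow_le_pow_left₀ (norm_nonneg _) ?_ 2
    have h5 : (fun y => T y + err y - g (y ∘ Sum.inl) * ((N : ℂ)⁻¹ * τ (y ∘ Sum.inr))) =
        (1 - (N : ℂ)⁻¹) • T + err := by
      ext y
      simp only [Pi.add_apply, Pi.smul_apply, smul_eq_mul, hT]
      ring
    rw [h5, WithLp.toLp_add, WithLp.toLp_smul]
    refine (norm_add_le _ _).trans ?_
    rw [norm_smul, h1]
    have h6 : ‖1 - (N : ℂ)⁻¹‖ * N = |1 - N| := by
      have h7 : (1 - (N : ℂ)⁻¹) * N = ((N - 1 : ℝ) : ℂ) := by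
        rw [sub_mul, one_mul, inv_mul_cancel₀ hNc, Complex.ofReal_sub, Complex.ofReal_one]
      have h8 : ‖(N : ℂ)‖ = N := by rw [Complex.norm_real, Real.norm_of_nonneg hN0.le]
      rw [abs_sub_comm, ← Real.norm_eq_abs, ← Complex.norm_real, ← h7, norm_mul, h8]
    rw [h6]
    linarith

variable {α μ : Type} [Fintype α] [DecidableEq α] [Fintype μ] [DecidableEq μ]

/-- Preparing uniform superpositions of code words. -/
theorem exists_prep {P : (α ⊕ μ → Bool) → Bool} {c : ℕ} {ε : ℝ}
    (hP : Approx c ε (encode (flipMap P))) {code : m → α → Bool} (hcode : Function.Injective code)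
    (hd : ∀ l, IsDense P (code l)) (k : ℕ) {η : ℝ} (hη : 0 ≤ η) (hη1 : 2 * η < 1)
    (hk : (3 / 4) ^ k ≤ η ^ 2) :
    ∃ (κ : Type) (_ : Fintype κ) (_ : DecidableEq κ)
      (Z : Matrix (α ⊕ (μ ⊕ κ) → Bool) (α ⊕ (μ ⊕ κ) → Bool) ℂ) (τ : m → (κ → Bool) → ℂ),
      Fintype.card κ = k * (2 * Fintype.card μ + 1) ∧
      Approx (k * (Fintype.card μ * (c + 6) + c)) (k * ((Fintype.card μ + 1) * ε) + 6 * η) Z ∧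
      (∀ l, nsq (τ l) = 1) ∧ ∀ l, Z *ᵥ ket (Sum.elim (code l) fun _ => false) = fun x =>
        ket (code l) (x ∘ Sum.inl) *
          (unif P (code l) (x ∘ Sum.inr ∘ Sum.inl) * τ l (x ∘ Sum.inr ∘ Sum.inr)) := by
  obtain ⟨κ, _, _, M, hκ, hM, h⟩ := exists_rounds hP k
  have hMM := Matrix.mem_unitaryGroup_iff'.mp hM.1
  have hex : ∀ l, ∃ τ' : (κ → Bool) → ℂ, nsq τ' = 1 ∧ ∃ ψ : (μ ⊕ κ → Bool) → ℂ,
      (M *ᵥ ket (Sum.elim (code l) fun _ => false) = fun x => ket (code l) (x ∘ Sum.inl) *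
        ψ (x ∘ Sum.inr)) ∧ nsq (fun y => ψ y - unif P (code l) (y ∘ Sum.inl) *
          τ' (y ∘ Sum.inr)) ≤ (2 * η) ^ 2 := by
    intro l
    obtain ⟨τ, err, herr, hτ⟩ := h (code l) (hd l)
    set ψ : (μ ⊕ κ → Bool) → ℂ :=
      fun y => unif P (code l) (y ∘ Sum.inl) * τ (y ∘ Sum.inr) + err y with hψ
    have h1 : nsq ψ = 1 := by
      have h2 := nsq_mulVec hMM (ket (Sum.elim (code l) fun _ => false))
      rw [hτ] at h2
      have h3 := nsq_mul (ket (code l)) ψ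
      rw [nsq_ket, one_mul] at h3
      rw [nsq_ket] at h2
      exact h3.symm.trans h2
    obtain ⟨τ', h4, h5⟩ := exists_unit_tensor (nsq_unif (hd l)) τ err hη (by linarith)
      (herr.trans hk) h1
    exact ⟨τ', h4, ψ, hτ, h5⟩
  choose τ' hτ' ψ hψ hψ' using hex
  let A : Matrix (α ⊕ (μ ⊕ κ) → Bool) m ℂ := encode fun l => Sum.elim (code l) fun _ => false
  let V : m → (μ ⊕ κ → Bool) → ℂ := fun l y => unif P (code l) (y ∘ Sum.inl) * τ' l (y ∘ Sum.inr)
  have hA : Aᴴ * A = 1 := encode_conjTranspose_mul fun l l' hl => hcode (by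
    ext v; exact congrFun hl (Sum.inl v))
  have hV : (blockCols code V)ᴴ * blockCols code V = 1 := by
    rw [blockCols_conjTranspose_mul hcode, ← Matrix.diagonal_one]
    congr 1
    ext1 l
    rw [show nsq (V l) = nsq (unif P (code l)) * nsq (τ' l) from nsq_mul _ _, nsq_unif (hd l), hτ']
    simp
  have hdiff : M * A - blockCols code V = blockCols code fun l y => ψ l y - V l y := by
    refine ext_ket fun l => ?_
    rw [Matrix.sub_mulVec, ← Matrix.mulVec_mulVec, encode_ket, hψ]
    ext x
    simp only [Matrix.mulVec_single_one, Pi.sub_apply, Matrix.col_apply, blockCols,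
      Matrix.of_apply]
    ring
  -- The error blocks for different labels are orthogonal, so the bound `2 * η` holds uniformly over
  -- all superpositions of labels. Passing to the exact unitary triples it, which is the term `6 *
  -- η`.
  obtain ⟨Z, hZ, hZA, hZM⟩ := exists_unitary_near hM.1 hA hV (ε := 2 * η) (by
    rw [hdiff]
    exact norm_blockCols_le hcode (by positivity) hψ') hη1
  refine ⟨κ, inferInstance, inferInstance, Z, τ', hκ, ?_, hτ', fun l => ?_⟩
  · exact (hM.perturb hZ hZM).mono le_rfl (by linarith)
  · have h1 := congrArg (fun X => X *ᵥ ket l) hZA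
    simp only [← Matrix.mulVec_mulVec, A, encode_ket] at h1
    rw [h1]
    ext x
    simp only [Matrix.mulVec_single_one, Matrix.col_apply, blockCols, Matrix.of_apply]
    rfl

end Prep

/-! ### Distinguishing channels -/

section Diamond
open scoped Matrix.Norms.L2Operator
variable {m n : Type*} [Fintype m] [DecidableEq m] [Fintype n] [DecidableEq n]

/-- Writing `ρ = Bᴴ B` turns the trace into a sum of expectation values of `Z`, each bounded by
Cauchy–Schwarz. -/
theorem norm_trace_mul_le {ρ : Matrix n n ℂ} (hρ : ρ.PosSemidef) (Z : Matrix n n ℂ) :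
    ‖(Z * ρ).trace‖ ≤ ‖Z‖ * ‖ρ.trace‖ := by
  obtain ⟨B, rfl⟩ := CStarAlgebra.nonneg_iff_eq_star_mul_self.mp
    (Matrix.nonneg_iff_posSemidef.mpr hρ)
  rw [Matrix.star_eq_conjTranspose]
  have h1 : (Z * (Bᴴ * B)).trace = ∑ i, star (star (B i)) ⬝ᵥ (Z *ᵥ star (B i)) := by
    rw [← Matrix.mul_assoc, Matrix.trace_mul_comm, Matrix.trace]
    refine Finset.sum_congr rfl fun i _ => ?_
    rw [star_star, Matrix.diag_apply, Matrix.mul_apply]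
    rfl
  have h2 : (Bᴴ * B).trace = ((∑ i, nsq (star (B i)) : ℝ) : ℂ) := by
    rw [Matrix.trace_mul_comm, Matrix.trace, Complex.ofReal_sum]
    refine Finset.sum_congr rfl fun i _ => ?_
    rw [nsq_eq_dotProduct, star_star]
    rfl
  rw [h1, h2, Complex.norm_real,
    Real.norm_of_nonneg (Finset.sum_nonneg fun _ _ => nsq_nonneg _), Finset.mul_sum]
  refine norm_sum_le_of_le _ fun i _ => ?_
  have h3 : star (star (B i)) ⬝ᵥ (Z *ᵥ star (B i)) =
      inner ℂ (WithLp.toLp 2 (star (B i))) (WithLp.toLp 2 (Z *ᵥ star (B i))) := by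
    rw [EuclideanSpace.inner_toLp_toLp, dotProduct_comm]
  rw [h3]
  refine (norm_inner_le_norm _ _).trans ?_
  have h4 : ‖WithLp.toLp 2 (Z *ᵥ star (B i))‖ ≤ ‖Z‖ * ‖WithLp.toLp 2 (star (B i))‖ :=
    Matrix.l2_opNorm_mulVec Z (WithLp.toLp 2 (star (B i)))
  rw [nsq_eq]
  nlinarith [norm_nonneg (WithLp.toLp 2 (star (B i)))]

/-- Tensoring with the identity, as a homomorphism of star algebras. -/
def oneKronHom (k : ℕ) : Matrix n n ℂ →⋆ₙₐ[ℂ] Matrix (Fin k × n) (Fin k × n) ℂ where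
  toFun X := 1 ⊗ₖ X
  map_smul' c X := Matrix.kronecker_smul _ _ _
  map_zero' := Matrix.kronecker_zero _
  map_add' X Y := Matrix.kronecker_add _ _ _
  map_mul' X Y := by rw [← Matrix.mul_kronecker_mul, Matrix.one_mul]
  map_star' X := by
    rw [Matrix.star_eq_conjTranspose, Matrix.star_eq_conjTranspose, Matrix.conjTranspose_kronecker,
      Matrix.conjTranspose_one]

theorem norm_one_kronecker_le (k : ℕ) (A : Matrix n m ℂ) :
    ‖(1 : Matrix (Fin k) (Fin k) ℂ) ⊗ₖ A‖ ≤ ‖A‖ := by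
  have h1 := Matrix.l2_opNorm_conjTranspose_mul_self ((1 : Matrix (Fin k) (Fin k) ℂ) ⊗ₖ A)
  rw [Matrix.conjTranspose_kronecker, ← Matrix.mul_kronecker_mul, Matrix.conjTranspose_one,
    Matrix.one_mul] at h1
  have h2 : ‖(1 : Matrix (Fin k) (Fin k) ℂ) ⊗ₖ (Aᴴ * A)‖ ≤ ‖Aᴴ * A‖ :=
    NonUnitalStarAlgHom.norm_apply_le (oneKronHom k) (Aᴴ * A)
  rw [Matrix.l2_opNorm_conjTranspose_mul_self, h1] at h2
  exact (abs_le_of_sq_le_sq' (by rw [sq, sq]; exact h2) (norm_nonneg A)).2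

/-- The measurement before a channel that corresponds to a measurement after it. -/
theorem exists_dual {ι : Type*} [Fintype ι] {K : ι → Matrix n m ℂ} (hK : ∑ r, (K r)ᴴ * K r = 1)
    (k : ℕ) {E : Matrix (Fin k × n) (Fin k × n) ℂ} (hE : E.PosSemidef)
    (hE' : (1 - E).PosSemidef) :
    ∃ E' : Matrix (Fin k × m) (Fin k × m) ℂ, ‖E'‖ ≤ 1 ∧ ∀ X,
      (E * idTensor (Fin k) (∑ r, conjMap (K r)) X).trace = (E' * X).trace := by
  let L : ι → Matrix (Fin k × n) (Fin k × m) ℂ := fun r => 1 ⊗ₖ K r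
  have hL : ∑ r, (L r)ᴴ * L r = 1 := by
    simp only [L, Matrix.conjTranspose_kronecker, ← Matrix.mul_kronecker_mul,
      Matrix.conjTranspose_one, Matrix.one_mul]
    have := map_sum (oneKronHom (n := m) k) (fun r => (K r)ᴴ * K r) Finset.univ
    rw [hK] at this
    exact this.symm.trans Matrix.one_kronecker_one
  refine ⟨∑ r, (L r)ᴴ * E * L r, ?_, fun X => ?_⟩
  · have h1 : (∑ r, (L r)ᴴ * E * L r).PosSemidef :=
      Matrix.posSemidef_sum _ fun r _ => hE.conjTranspose_mul_mul_same (L r)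
    have h2 : (1 - ∑ r, (L r)ᴴ * E * L r).PosSemidef := by
      have : 1 - ∑ r, (L r)ᴴ * E * L r = ∑ r, (L r)ᴴ * (1 - E) * L r := by
        simp only [Matrix.mul_sub, Matrix.sub_mul, Matrix.mul_one, Finset.sum_sub_distrib, hL]
      rw [this]
      exact Matrix.posSemidef_sum _ fun r _ => hE'.conjTranspose_mul_mul_same (L r)
    exact (CStarAlgebra.norm_le_one_iff_of_nonneg _ (Matrix.nonneg_iff_posSemidef.mpr h1)).mpr
      (Matrix.le_iff.mpr h2)
  · rw [idTensor_sum, Matrix.mul_sum, Matrix.trace_sum, Finset.sum_mul, Matrix.trace_sum]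
    refine Finset.sum_congr rfl fun r _ => ?_
    rw [idTensor_conjMap]
    change (E * (L r * X * (L r)ᴴ)).trace = _
    rw [← Matrix.mul_assoc, Matrix.trace_mul_comm]
    simp only [Matrix.mul_assoc]

theorem idTensor_comp {l k : Type*} (Φ : Matrix m m ℂ →ₗ[ℂ] Matrix n n ℂ)
    (Ψ : Matrix n n ℂ →ₗ[ℂ] Matrix l l ℂ) (X : Matrix (k × m) (k × m) ℂ) :
    idTensor k (Ψ ∘ₗ Φ) X = idTensor k Ψ (idTensor k Φ X) := rfl

/-- Channels that begin with nearby contractions are close to each other. -/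
theorem diamondClose_of_norm_sub_le {l ι : Type*} [Fintype l] [DecidableEq l] [Fintype ι]
    {K : ι → Matrix l n ℂ} (hK : ∑ r, (K r)ᴴ * K r = 1) {A B : Matrix n m ℂ} (hA : ‖A‖ ≤ 1)
    (hB : ‖B‖ ≤ 1) {ε : ℝ} (h : ‖A - B‖ ≤ ε) :
    DiamondClose ((∑ r, conjMap (K r)) ∘ₗ conjMap A) ((∑ r, conjMap (K r)) ∘ₗ conjMap B)
      (2 * ε) := by
  intro k ρ hρ E hE hE'
  obtain ⟨E', hn, hE''⟩ := exists_dual hK k hE hE'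
  set A' : Matrix (Fin k × n) (Fin k × m) ℂ := 1 ⊗ₖ A with hA'
  set B' : Matrix (Fin k × n) (Fin k × m) ℂ := 1 ⊗ₖ B with hB'
  have hAn : ‖A'‖ ≤ 1 := (norm_one_kronecker_le k A).trans hA
  have hBn : ‖B'ᴴ‖ ≤ 1 := by
    rw [Matrix.l2_opNorm_conjTranspose]; exact (norm_one_kronecker_le k B).trans hB
  have hAB : ‖A' - B'‖ ≤ ε := by
    have : A' - B' = 1 ⊗ₖ (A - B) := by
      ext p q
      simp [hA', hB', Matrix.kroneckerMap_apply, mul_sub]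
    rw [this]
    exact (norm_one_kronecker_le k _).trans h
  -- In the Heisenberg picture the difference is `A'ᴴ E' A' - B'ᴴ E' B'`, which splits into two
  -- terms that each contain `A' - B'` once. Hence the factor `2`.
  have h1 : (E * (idTensor (Fin k) ((∑ r, conjMap (K r)) ∘ₗ conjMap A) ρ -
      idTensor (Fin k) ((∑ r, conjMap (K r)) ∘ₗ conjMap B) ρ)).trace =
      (((A' - B')ᴴ * (E' * A') + B'ᴴ * E' * (A' - B')) * ρ).trace := by
    rw [idTensor_comp, idTensor_comp, Matrix.mul_sub, Matrix.trace_sub, hE'', hE'',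
      idTensor_conjMap, idTensor_conjMap, ← Matrix.mul_assoc, Matrix.trace_mul_comm,
      ← Matrix.mul_assoc E' (_ * ρ) _, Matrix.trace_mul_comm (E' * _) _, ← Matrix.trace_sub]
    congr 1
    rw [← hA', ← hB']
    simp only [Matrix.conjTranspose_sub, Matrix.mul_sub, Matrix.sub_mul, Matrix.add_mul,
      Matrix.mul_assoc]
    abel
  rw [h1]
  refine (norm_trace_mul_le hρ.1 _).trans ?_
  rw [hρ.2, norm_one, mul_one]
  refine (norm_add_le _ _).trans ?_
  have h2 : ‖(A' - B')ᴴ * (E' * A')‖ ≤ ε := by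
    refine (Matrix.l2_opNorm_mul _ _).trans (mul_mul_le_of_le_one ?_ ?_ (norm_nonneg _))
    · rw [Matrix.l2_opNorm_conjTranspose]; exact hAB
    · exact (Matrix.l2_opNorm_mul _ _).trans (mul_mul_le_of_le_one hn hAn (norm_nonneg _))
  have h3 : ‖B'ᴴ * E' * (A' - B')‖ ≤ ε := by
    refine (Matrix.l2_opNorm_mul _ _).trans ((mul_le_of_le_one_left (norm_nonneg _) ?_).trans hAB)
    exact (Matrix.l2_opNorm_mul _ _).trans (mul_mul_le_of_le_one hBn hn (norm_nonneg _))
  linarith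

/-- The trivial bound. It is what remains to be used when the permitted error is so large that any
program will do. -/
theorem diamondClose_two {l ι ι' : Type*} [Fintype l] [DecidableEq l] [Fintype ι] [Fintype ι']
    {K : ι → Matrix l m ℂ} (hK : ∑ r, (K r)ᴴ * K r = 1) {K' : ι' → Matrix l m ℂ}
    (hK' : ∑ r, (K' r)ᴴ * K' r = 1) :
    DiamondClose (∑ r, conjMap (K r)) (∑ r, conjMap (K' r)) 2 := by
  intro k ρ hρ E hE hE'
  obtain ⟨E₁, hn₁, h₁⟩ := exists_dual hK k hE hE'
  obtain ⟨E₂, hn₂, h₂⟩ := exists_dual hK' k hE hE'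
  rw [Matrix.mul_sub, Matrix.trace_sub, h₁, h₂]
  have a₁ := norm_trace_mul_le hρ.1 E₁
  have a₂ := norm_trace_mul_le hρ.1 E₂
  rw [hρ.2, norm_one, mul_one] at a₁ a₂
  refine (norm_sub_le _ _).trans ?_
  linarith

end Diamond

/-! ### Discarding wires -/

section ReadOut
variable {κ : Type} [Fintype κ] [DecidableEq κ] {N : ℕ}

/-- The possible contents of the wires that are discarded. -/
abbrev Rest (o : κ ↪ Fin N) : Type := {c : Fin N → Bool // ∀ t, c (o t) = false}

/-- The contents of all wires, given those of the output wires and of the discarded ones. -/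
def fill (o : κ ↪ Fin N) (r : Rest o) (y : κ → Bool) : Fin N → Bool := Function.extend o y r.1

theorem fill_injective (o : κ ↪ Fin N) (r : Rest o) : Function.Injective (fill o r) :=
  fun y y' h => by rw [← extend_comp o y r.1]; exact (congrArg (· ∘ o) h).trans (extend_comp _ _ _)

/-- Splitting the wires into output wires and discarded ones. -/
def fillEquiv (o : κ ↪ Fin N) : (κ → Bool) × Rest o ≃ (Fin N → Bool) where
  toFun p := fill o p.2 p.1
  invFun c := (c ∘ o, ⟨Function.extend o (fun _ => false) c, fun t => o.injective.extend_apply _ _ _⟩)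
  left_inv p := by
    refine Prod.ext (extend_comp _ _ _) (Subtype.ext ?_)
    change Function.extend o (fun _ => false) (Function.extend o p.1 p.2.1) = p.2.1
    rw [extend_extend]
    exact (eq_extend_iff.mpr ⟨funext p.2.2, fun _ _ => rfl⟩).symm
  right_inv c := by
    change Function.extend o (c ∘ o) (Function.extend o (fun _ => false) c) = c
    rw [extend_extend]
    exact (eq_extend_iff.mpr ⟨rfl, fun _ _ => rfl⟩).symm

theorem fill_eq_iff (o : κ ↪ Fin N) {r r' : Rest o} {y y' : κ → Bool} :
    fill o r y = fill o r' y' ↔ y = y' ∧ r = r' := by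
  have := (fillEquiv o).apply_eq_iff_eq (x := (y, r)) (y := (y', r'))
  rw [Prod.mk.injEq] at this
  exact this

/-- The partial trace in Kraus form: one operator for each content `r` of the discarded wires,
projecting onto it. -/
theorem readOut_eq (o : κ ↪ Fin N) :
    readOut o = ∑ r : Rest o, conjMap (encode (fill o r))ᴴ := by
  refine LinearMap.ext fun X => ?_
  ext y y'
  have h1 : ∀ p q : (κ → Bool) × Rest o, ((fillEquiv o p) ∘ o = y ∧ (fillEquiv o q) ∘ o = y' ∧
      ∀ i, i ∉ Set.range o → fillEquiv o p i = fillEquiv o q i) ↔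
      p.1 = y ∧ q.1 = y' ∧ p.2 = q.2 := by
    intro p q
    have e1 : ∀ p, (fillEquiv o p) ∘ o = p.1 := fun p => extend_comp _ _ _
    rw [e1, e1]
    refine and_congr_right fun _ => and_congr_right fun _ => ?_
    have e2 : ∀ (p : (κ → Bool) × Rest o) i, i ∉ Set.range o → fillEquiv o p i = p.2.1 i :=
      fun p i hi => extend_off _ _ _ hi
    constructor
    · intro h
      refine Subtype.ext (funext fun i => ?_)
      by_cases hi : i ∈ Set.range o
      · obtain ⟨t, rfl⟩ := hi
        rw [p.2.2, q.2.2]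
      · rw [← e2 p i hi, ← e2 q i hi, h i hi]
    · intro h i hi
      rw [e2 p i hi, e2 q i hi, h]
  have h2 : readOut o X y y' = ∑ c : Fin N → Bool, ∑ c' : Fin N → Bool,
      if c ∘ o = y ∧ c' ∘ o = y' ∧ ∀ i, i ∉ Set.range o → c i = c' i then X c c' else 0 := by
    simp only [readOut, LinearMap.coe_mk, AddHom.coe_mk, Matrix.of_apply]
  classical
  rw [h2, ← (fillEquiv o).sum_comp]
  simp only [← (fillEquiv o).sum_comp (fun c' => ite _ _ _), h1]
  rw [LinearMap.sum_apply, Matrix.sum_apply, Fintype.sum_prod_type, Finset.sum_comm]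
  refine Finset.sum_congr rfl fun r _ => ?_
  rw [Finset.sum_eq_single y]
  · rw [Fintype.sum_prod_type, Finset.sum_eq_single y']
    · rw [Finset.sum_eq_single r]
      · rw [if_pos ⟨rfl, rfl, rfl⟩]
        simp [conjMap, Matrix.mul_apply, encode]
        rfl
      · intro r' _ hr'
        rw [if_neg fun h => hr' h.2.2.symm]
      · simp
    · intro z _ hz
      exact Finset.sum_eq_zero fun r' _ => if_neg fun h => hz h.2.1
    · simp
  · intro z _ hz
    exact Finset.sum_eq_zero fun p _ => if_neg fun h => hz h.1
  · simp

theorem sum_fill (o : κ ↪ Fin N) :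
    ∑ r : Rest o, (encode (fill o r))ᴴᴴ * (encode (fill o r))ᴴ = 1 := by
  ext c c'
  obtain ⟨p, rfl⟩ := (fillEquiv o).surjective c
  obtain ⟨q, rfl⟩ := (fillEquiv o).surjective c'
  have h : ∀ (p : (κ → Bool) × Rest o) r y, (encode (fill o r)) (fillEquiv o p) y =
      if p.1 = y ∧ p.2 = r then 1 else 0 := by
    intro p r y
    have : fillEquiv o p = fill o r y ↔ p.1 = y ∧ p.2 = r := fill_eq_iff o
    simp only [encode, Matrix.of_apply, this]
  rw [Matrix.sum_apply, Matrix.one_apply]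
  simp only [Matrix.mul_apply, Matrix.conjTranspose_conjTranspose, Matrix.conjTranspose_apply, h,
    (fillEquiv o).apply_eq_iff_eq]
  rw [Finset.sum_eq_single p.2]
  · rw [Finset.sum_eq_single p.1]
    · by_cases hpq : p = q
      · simp [hpq]
      · have : ¬(q.1 = p.1 ∧ q.2 = p.2) := fun h => hpq (Prod.ext h.1.symm h.2.symm)
        simp [hpq, this]
    · intro y _ hy
      simp [hy.symm]
    · simp
  · intro r _ hr
    simp [hr.symm]
  · simp

/-- Discarding wires in states that are labelled by `r`. -/
theorem readOut_conjMap_sum {m ι : Type*} [Fintype m] [Fintype ι] [DecidableEq ι] (o : κ ↪ Fin N)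
    {ρ : ι → Rest o} (hρ : Function.Injective ρ) (A : ι → Matrix (κ → Bool) m ℂ) :
    readOut o ∘ₗ conjMap (∑ r, encode (fill o (ρ r)) * A r) = ∑ r, conjMap (A r) := by
  have h1 : ∀ T r, (encode (fill o T))ᴴ * encode (fill o (ρ r)) =
      if T = ρ r then (1 : Matrix (κ → Bool) (κ → Bool) ℂ) else 0 := by
    intro T r
    split_ifs with h
    · rw [h, encode_conjTranspose_mul (fill_injective _ _)]
    · ext y y'
      rw [Matrix.mul_apply]
      refine Finset.sum_eq_zero fun c _ => ?_
      simp only [encode, Matrix.conjTranspose_apply, Matrix.of_apply]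
      split_ifs with h2 h3
      · exact absurd ((fill_eq_iff o).mp (h3.symm.trans h2)).2.symm h
      all_goals simp
  have h2 : ∀ T, (encode (fill o T))ᴴ * ∑ r, encode (fill o (ρ r)) * A r =
      ∑ r, if T = ρ r then A r else 0 := by
    intro T
    rw [Matrix.mul_sum]
    refine Finset.sum_congr rfl fun r _ => ?_
    rw [← Matrix.mul_assoc, h1]
    split_ifs <;> simp
  refine LinearMap.ext fun X => ?_
  rw [readOut_eq, LinearMap.comp_apply, LinearMap.sum_apply, LinearMap.sum_apply]
  have h3 : ∀ T, conjMap (encode (fill o T))ᴴ (conjMap (∑ r, encode (fill o (ρ r)) * A r) X) =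
      ∑ r, if T = ρ r then conjMap (A r) X else 0 := by
    intro T
    change (encode (fill o T))ᴴ * ((∑ r, encode (fill o (ρ r)) * A r) * X *
      (∑ r, encode (fill o (ρ r)) * A r)ᴴ) * ((encode (fill o T))ᴴ)ᴴ = _
    have h4 : (encode (fill o T))ᴴ * ((∑ r, encode (fill o (ρ r)) * A r) * X *
        (∑ r, encode (fill o (ρ r)) * A r)ᴴ) * ((encode (fill o T))ᴴ)ᴴ =
        ((encode (fill o T))ᴴ * ∑ r, encode (fill o (ρ r)) * A r) * X *
        ((encode (fill o T))ᴴ * ∑ r, encode (fill o (ρ r)) * A r)ᴴ := by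
      rw [Matrix.conjTranspose_mul (encode (fill o T))ᴴ]
      simp only [Matrix.mul_assoc]
    rw [h4, h2]
    by_cases hT : ∃ r, T = ρ r
    · obtain ⟨r₀, rfl⟩ := hT
      simp only [hρ.eq_iff, Finset.sum_ite_eq, Finset.mem_univ, if_true]
      rfl
    · have : ∀ r, ¬T = ρ r := fun r hr => hT ⟨r, hr⟩
      simp [this]
  simp only [h3]
  rw [Finset.sum_comm]
  refine Finset.sum_congr rfl fun r _ => ?_
  simp

end ReadOut

/-! ### Unitaries that exactly map the encoded states -/

section Surrogate
open scoped Matrix.Norms.L2Operator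

theorem norm_le_of_mulVec_le {m n : Type*} [Fintype m] [Fintype n] [DecidableEq n]
    {X : Matrix m n ℂ} {δ : ℝ} (hδ : 0 ≤ δ)
    (h : ∀ v : n → ℂ, ‖WithLp.toLp 2 (X *ᵥ v)‖ ≤ δ * ‖WithLp.toLp 2 v‖) : ‖X‖ ≤ δ := by
  rw [Matrix.l2_opNorm_def]
  exact ContinuousLinearMap.opNorm_le_bound _ hδ fun v => h v.ofLp

theorem norm_toLp_star {ι : Type*} [Fintype ι] (u : ι → ℂ) :
    ‖WithLp.toLp 2 (star u)‖ = ‖WithLp.toLp 2 u‖ := by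
  simp [EuclideanSpace.norm_eq]

theorem norm_map_conj_le {m n : Type*} [Fintype m] [Fintype n] [DecidableEq n]
    (X : Matrix m n ℂ) : ‖X.map (starRingEnd ℂ)‖ ≤ ‖X‖ := by
  refine norm_le_of_mulVec_le (norm_nonneg _) fun v => ?_
  have h1 : X.map (starRingEnd ℂ) *ᵥ v = star (X *ᵥ star v) := by
    ext i
    simp [Matrix.mulVec, dotProduct]
  have h3 := Matrix.l2_opNorm_mulVec X (WithLp.toLp 2 (star v))
  rw [norm_toLp_star] at h3
  rw [h1, norm_toLp_star]
  exact h3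

theorem ApproxMaps.nonneg {D N : ℕ} (h0 : 0 < D) {W : List (Gate N)}
    {S T : Matrix (Fin N → Bool) (Fin D) ℂ} {δ : ℝ} (h : ApproxMaps W S T δ) : 0 ≤ δ := by
  have h1 := (norm_nonneg _).trans (h (ket ⟨0, h0⟩))
  have h2 : ‖WithLp.toLp 2 (ket (⟨0, h0⟩ : Fin D))‖ = 1 := by simp [ket]
  rwa [h2, mul_one] at h1

/-- The ideal unitary `Z` lies within `3 * δ` of the circuit. The reversed circuit and its complex
conjugate are equally close to `Zᴴ` and to the conjugate of `Zᴴ`, so these come with the same cost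
and error. -/
theorem ApproxMaps.exists_unitary {D N : ℕ} {W : List (Gate N)}
    {S T : Matrix (Fin N → Bool) (Fin D) ℂ} {δ : ℝ} (h : ApproxMaps W S T δ)
    (hS : Sᴴ * S = 1) (hT : Tᴴ * T = 1) (hδ : 0 ≤ δ) (hδ1 : δ < 1) :
    ∃ Z : Matrix (Fin N → Bool) (Fin N → Bool) ℂ, Z * S = T ∧ Approx W.length (3 * δ) Z ∧ Approx W.length (3 * δ) Zᴴ ∧
      Approx W.length (3 * δ) (Zᴴ.map (starRingEnd ℂ)) := by
  have hi := Impl.of_circuit W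
  obtain ⟨Z, hZ, hZS, hn⟩ := exists_unitary_near hi.mem_unitary hS hT
    (norm_le_of_mulVec_le hδ h) hδ1
  have hZ' : Zᴴ ∈ Matrix.unitaryGroup (Fin N → Bool) ℂ := Unitary.star_mem hZ
  have hn' : ‖(circuitMatrix W)ᴴ - Zᴴ‖ ≤ 3 * δ := by
    rw [← Matrix.conjTranspose_sub, Matrix.l2_opNorm_conjTranspose]; exact hn
  have hn'' : ‖(circuitMatrix W)ᴴ.map (starRingEnd ℂ) - Zᴴ.map (starRingEnd ℂ)‖ ≤ 3 * δ := by
    rw [← Matrix.map_sub _ (map_sub _)]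
    exact (norm_map_conj_le _).trans hn'
  have h1 := (Approx.of_impl hi).perturb hZ hn
  have h2 := (Approx.of_impl hi.conjTranspose).perturb hZ' hn'
  have h3 := (Approx.of_impl hi.conjTranspose.map_conj).perturb (map_conj_mem_unitary hZ') hn''
  rw [zero_add] at h1 h2 h3
  exact ⟨Z, hZS, h1, h2, h3⟩

end Surrogate

/-! ### Code words -/

theorem binary_inj {n x y : ℕ} (hx : x < 2 ^ n) (hy : y < 2 ^ n) (h : binary n x = binary n y) :
    x = y := by
  refine Nat.eq_of_testBit_eq fun i => ?_
  by_cases hi : i < n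
  · exact congrFun h ⟨i, hi⟩
  · have := Nat.pow_le_pow_right (n := 2) (by norm_num) (not_lt.mp hi)
    rw [Nat.testBit_lt_two_pow (hx.trans_le this), Nat.testBit_lt_two_pow (hy.trans_le this)]

theorem binary_two_pow {n : ℕ} (t : Fin n) : binary n (2 ^ (t : ℕ)) = ind {t} := by
  ext i
  simp [binary, ind, Nat.testBit_two_pow, Fin.ext_iff, eq_comm]

theorem binary_zero (n : ℕ) : binary n 0 = fun _ => false := by
  ext i
  simp [binary]

/-- The words of a two-part code. -/
def prodWord (b c : ℕ) (i j : ℕ) : Fin b ⊕ Fin c → Bool := Sum.elim (binary b i) (binary c j)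

theorem prodWord_inj {b c i j i' j' : ℕ} (hi : i < 2 ^ b) (hj : j < 2 ^ c) (hi' : i' < 2 ^ b)
    (hj' : j' < 2 ^ c) (h : prodWord b c i j = prodWord b c i' j') : i = i' ∧ j = j' :=
  ⟨binary_inj hi hi' (congrArg (· ∘ Sum.inl) h), binary_inj hj hj' (congrArg (· ∘ Sum.inr) h)⟩

/-- At most `clog d` powers of two lie below `d`, and `2 ^ clog d < 2 * d`. -/
theorem two_pow_card_support_le {n d : ℕ} (hd : 0 < d) :
    2 ^ (Finset.univ.filter fun t : Fin n => 2 ^ (t : ℕ) < d).card ≤ 2 * d := by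
  have h1 : (Finset.univ.filter fun t : Fin n => 2 ^ (t : ℕ) < d).card ≤ Nat.clog 2 d := by
    rw [← Finset.card_range (Nat.clog 2 d)]
    refine Finset.card_le_card_of_injOn (fun t => (t : ℕ)) (fun t ht => ?_)
      fun _ _ _ _ h => Fin.ext h
    rw [Finset.mem_coe, Finset.mem_filter] at ht
    rw [Finset.mem_coe, Finset.mem_range]
    exact (Nat.lt_clog_iff_pow_lt (by norm_num)).mpr ht.2
  refine (Nat.pow_le_pow_right (by norm_num) h1).trans ?_
  rcases Nat.lt_or_ge 1 d with h | h
  · have h2 := Nat.pow_pred_clog_lt_self (b := 2) (by norm_num) h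
    have h3 := Nat.clog_pos (b := 2) (by norm_num) h
    obtain ⟨k, hk⟩ := Nat.exists_eq_succ_of_ne_zero h3.ne'
    rw [hk] at h2 ⊢
    rw [Nat.pred_succ] at h2
    rw [pow_succ]
    omega
  · have : d = 1 := by omega
    subst this
    simp

section Words
variable {α : Type} [Fintype α] [DecidableEq α] {b c p q : ℕ}
  {P : (α ⊕ (Fin b ⊕ Fin c) → Bool) → Bool} {a : α → Bool}

theorem words_eq (hP : ∀ z, P (Sum.elim a z) = true ↔
      ∃ (i : Fin p) (j : Fin q), z = prodWord b c i j) :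
    words P a = (Finset.univ : Finset (Fin p × Fin q)).image fun s => prodWord b c s.1 s.2 := by
  ext z
  simp [words, hP, eq_comm]

theorem card_words (hp : p ≤ 2 ^ b) (hq : q ≤ 2 ^ c) (hP : ∀ z, P (Sum.elim a z) = true ↔
      ∃ (i : Fin p) (j : Fin q), z = prodWord b c i j) : (words P a).card = p * q := by
  rw [words_eq hP, Finset.card_image_of_injective, Finset.card_univ, Fintype.card_prod,
    Fintype.card_fin, Fintype.card_fin]
  intro s t h
  obtain ⟨h1, h2⟩ := prodWord_inj (s.1.2.trans_le hp) (s.2.2.trans_le hq) (t.1.2.trans_le hp)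
    (t.2.2.trans_le hq) h
  exact Prod.ext (Fin.ext h1) (Fin.ext h2)

theorem prodWord_two_pow_left (t : Fin b) : prodWord b c (2 ^ (t : ℕ)) 0 = ind {Sum.inl t} := by
  rw [prodWord, binary_two_pow, binary_zero]
  ext (v | v) <;> simp [ind]

theorem prodWord_two_pow_right (t : Fin c) : prodWord b c 0 (2 ^ (t : ℕ)) = ind {Sum.inr t} := by
  rw [prodWord, binary_two_pow, binary_zero]
  ext (v | v) <;> simp [ind]

/-- If bit `t` is set in `i < p` then `2 ^ t ≤ i < p`, so the word with this single bit is also a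
code word. The supports of the two parts span cubes of size at most `2 p` and `2 q`, whence the
factor `4` against `p q` words. -/
theorem isDense_prodWord (hp0 : 0 < p) (hq0 : 0 < q) (hp : p ≤ 2 ^ b) (hq : q ≤ 2 ^ c)
    (hP : ∀ z, P (Sum.elim a z) = true ↔ ∃ (i : Fin p) (j : Fin q), z = prodWord b c i j) :
    IsDense P a := by
  refine ⟨fun z t hz ht => ?_, ?_⟩
  · obtain ⟨i, j, rfl⟩ := (hP z).mp hz
    rw [hP]
    rcases t with t | t
    · exact ⟨⟨2 ^ (t : ℕ), (Nat.ge_two_pow_of_testBit ht).trans_lt i.2⟩, ⟨0, hq0⟩,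
        (prodWord_two_pow_left t).symm⟩
    · exact ⟨⟨0, hp0⟩, ⟨2 ^ (t : ℕ), (Nat.ge_two_pow_of_testBit ht).trans_lt j.2⟩,
        (prodWord_two_pow_right t).symm⟩
  · rw [card_words hp hq hP]
    have hsub : support P a ⊆ ((Finset.univ.filter fun t : Fin b => 2 ^ (t : ℕ) < p).disjSum
        (Finset.univ.filter fun t : Fin c => 2 ^ (t : ℕ) < q)) := by
      intro t ht
      rw [support, Finset.mem_filter] at ht
      obtain ⟨i, j, hij⟩ := (hP _).mp ht.2
      rcases t with t | t
      · have h1 : (i : ℕ).testBit t = true := by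
          have := congrFun hij (Sum.inl t)
          simpa [ind, prodWord, binary] using this.symm
        simpa using (Nat.ge_two_pow_of_testBit h1).trans_lt i.2
      · have h1 : (j : ℕ).testBit t = true := by
          have := congrFun hij (Sum.inr t)
          simpa [ind, prodWord, binary] using this.symm
        simpa using (Nat.ge_two_pow_of_testBit h1).trans_lt j.2
    refine (Nat.pow_le_pow_right (by norm_num) (Finset.card_le_card hsub)).trans ?_
    rw [Finset.card_disjSum, pow_add]
    have h1 := two_pow_card_support_le (n := b) hp0
    have h2 := two_pow_card_support_le (n := c) hq0
    calc _ ≤ 2 * p * (2 * q) := Nat.mul_le_mul h1 h2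
      _ = _ := by ring

/-- A superposition over a two-part code. -/
theorem unif_apply (hp : p ≤ 2 ^ b) (hq : q ≤ 2 ^ c)
    (hP : ∀ z, P (Sum.elim a z) = true ↔ ∃ (i : Fin p) (j : Fin q), z = prodWord b c i j) :
    unif P a = ∑ i : Fin p, ∑ j : Fin q,
      ((Real.sqrt (p * q))⁻¹ : ℂ) • ket (prodWord b c i j) := by
  ext z
  rw [unif, card_words hp hq hP]
  simp only [Finset.sum_apply, Pi.smul_apply, Pi.single_apply, smul_eq_mul, mul_ite, mul_one,
    mul_zero]
  split_ifs with h
  · obtain ⟨i, j, rfl⟩ := (hP z).mp h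
    rw [Finset.sum_eq_single i, Finset.sum_eq_single j]
    · simp
    · intro j' _ hj'
      rw [if_neg]
      intro he
      exact hj' (Fin.ext (prodWord_inj (i.2.trans_le hp) (j.2.trans_le hq) (i.2.trans_le hp)
        (j'.2.trans_le hq) he).2.symm)
    · simp
    · intro i' _ hi'
      refine Finset.sum_eq_zero fun j' _ => ?_
      rw [if_neg]
      intro he
      exact hi' (Fin.ext (prodWord_inj (i.2.trans_le hp) (j.2.trans_le hq) (i'.2.trans_le hp)
        (j'.2.trans_le hq) he).1.symm)
    · simp
  · symm
    refine Finset.sum_eq_zero fun i _ => Finset.sum_eq_zero fun j _ => if_neg fun he => ?_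
    exact h ((hP z).mpr ⟨i, j, he⟩)

end Words

theorem encode_mul_mulVec_ket {ι m n : Type*} [Fintype m] [DecidableEq m] [Fintype n]
    [DecidableEq n] [DecidableEq ι] (f : m → ι) (M : Matrix m n ℂ) (q : n) :
    (encode f * M) *ᵥ ket q = ∑ s, M s q • ket (f s) := by
  ext y
  rw [Matrix.mulVec_single_one]
  simp only [Matrix.col_apply, Matrix.mul_apply, encode, Matrix.of_apply, Finset.sum_apply,
    Pi.smul_apply, Pi.single_apply, smul_eq_mul]
  exact Finset.sum_congr rfl fun s _ => mul_comm _ _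

namespace DecompositionCircuit
variable {D : ℕ} {A : StarSubalgebra ℂ (Matrix (Fin D) (Fin D) ℂ)} {𝒟 : Decomposition A} {n : ℕ}
  {δ : ℝ} (C : DecompositionCircuit 𝒟 n δ)

/-- The state that encodes a basis vector of the input space. -/
def src (x : Fin D) : Fin C.N → Bool := pad C.inp (binary n x)

/-- The content of the three registers that encodes a basis vector of the direct sum. -/
def word (s : 𝒟.Idx) : Fin C.a ⊕ (Fin C.b ⊕ Fin C.c) → Bool :=
  Sum.elim (C.code s.1) (prodWord C.b C.c s.2.1 s.2.2)

theorem src_injective (hD : D ≤ 2 ^ n) : Function.Injective C.src := fun x y h =>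
  Fin.ext (binary_inj (x.2.trans_le hD) (y.2.trans_le hD) (pad_injective C.inp h))

theorem word_injective : Function.Injective C.word := by
  rintro ⟨l, i, j⟩ ⟨l', i', j'⟩ h
  have h1 : l = l' := C.code.injective (congrArg (· ∘ Sum.inl) h)
  subst h1
  obtain ⟨h2, h3⟩ := prodWord_inj (i.2.trans_le (C.dL_le l)) (j.2.trans_le (C.dR_le l))
    (i'.2.trans_le (C.dL_le l)) (j'.2.trans_le (C.dR_le l)) (congrArg (· ∘ Sum.inr) h)
  rw [Fin.ext h2, Fin.ext h3]

/-- The predicate that recognizes code words. -/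
def isWord (z : Fin C.a ⊕ (Fin C.b ⊕ Fin C.c) → Bool) : Bool :=
  @decide (∃ s, z = C.word s) (Classical.propDecidable _)

theorem isWord_iff (l : Fin 𝒟.m) (z : Fin C.b ⊕ Fin C.c → Bool) :
    C.isWord (Sum.elim (C.code l) z) = true ↔
      ∃ (i : Fin (𝒟.dL l)) (j : Fin (𝒟.dR l)), z = prodWord C.b C.c i j := by
  refine (@decide_eq_true_iff _ (Classical.propDecidable _)).trans ?_
  constructor
  · rintro ⟨⟨l', i, j⟩, h⟩
    have h1 : l = l' := C.code.injective (congrArg (· ∘ Sum.inl) h)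
    subst h1
    exact ⟨i, j, congrArg (· ∘ Sum.inr) h⟩
  · rintro ⟨i, j, rfl⟩
    exact ⟨⟨l, i, j⟩, rfl⟩

theorem isDense_isWord (l : Fin 𝒟.m) : IsDense C.isWord (C.code l) :=
  isDense_prodWord (𝒟.dL_pos l) (𝒟.dR_pos l) (C.dL_le l) (C.dR_le l) (C.isWord_iff l)

/-- The ideal unitary carries the span of the encoded inputs exactly onto the span of the code
words. Recognizing code words therefore reduces to recognizing inputs, which is a comparison with
`D`. This uses `Z` and `Zᴴ` once each, so the error is `6 * δ`. -/
theorem exists_unitary (h0 : 0 < D) (hD : D ≤ 2 ^ n) (hδ : 0 ≤ δ) (hδ1 : δ < 1) :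
    ∃ Z : Matrix (Fin C.N → Bool) (Fin C.N → Bool) ℂ,
      (∀ q, Z *ᵥ ket (C.src q) = ∑ s, 𝒟.U s q • ket (pad C.out (C.word s))) ∧
      (∀ s, Zᴴ *ᵥ ket (pad C.out (C.word s)) = ∑ x, star (𝒟.U s x) • ket (C.src x)) ∧
      (∀ s, Zᴴ.map (starRingEnd ℂ) *ᵥ ket (pad C.out (C.word s)) =
        ∑ y, 𝒟.U s y • ket (C.src y)) ∧
      Approx C.W.length (3 * δ) Z ∧ Approx C.W.length (3 * δ) Zᴴ ∧
      Approx C.W.length (3 * δ) (Zᴴ.map (starRingEnd ℂ)) ∧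
      Approx (7 * C.N + 2 * C.W.length + 3) (6 * δ) (encode (flipMap C.isWord)) := by
  classical
  let wd : 𝒟.Idx → Fin C.N → Bool := fun s => pad C.out (C.word s)
  have hwd : Function.Injective wd := (pad_injective C.out).comp C.word_injective
  have hwd' := encode_conjTranspose_mul hwd
  have hsrc := encode_conjTranspose_mul (C.src_injective hD)
  have hT : (encode wd * 𝒟.U)ᴴ * (encode wd * 𝒟.U) = 1 := by
    rw [Matrix.conjTranspose_mul, Matrix.mul_assoc, ← Matrix.mul_assoc (encode wd)ᴴ, hwd',
      Matrix.one_mul, 𝒟.conjTranspose_mul_self]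
  have hap : ApproxMaps C.W (encode C.src) (encode wd * 𝒟.U) δ := C.approx
  obtain ⟨Z, hZ, h1, h2, h3⟩ := hap.exists_unitary hsrc hT hδ hδ1
  have hZZ := Matrix.mem_unitaryGroup_iff'.mp h1.1
  rw [Matrix.star_eq_conjTranspose] at hZZ
  have hZ' : Zᴴ * encode wd = encode C.src * 𝒟.Uᴴ := by
    calc Zᴴ * encode wd = Zᴴ * (encode wd * 𝒟.U) * 𝒟.Uᴴ := by
          rw [Matrix.mul_assoc, Matrix.mul_assoc, 𝒟.mul_conjTranspose_self, Matrix.mul_one]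
      _ = _ := by rw [← hZ, ← Matrix.mul_assoc, hZZ, Matrix.one_mul]
  refine ⟨Z, fun q => ?_, fun s => ?_, fun s => ?_, h1, h2, h3, ?_⟩
  · rw [← encode_ket C.src, Matrix.mulVec_mulVec, hZ]
    exact encode_mul_mulVec_ket wd 𝒟.U q
  · rw [show ket (pad C.out (C.word s)) = encode wd *ᵥ ket s from (encode_ket wd s).symm,
      Matrix.mulVec_mulVec, hZ', encode_mul_mulVec_ket]
    rfl
  · rw [show ket (pad C.out (C.word s)) = encode wd *ᵥ ket s from (encode_ket wd s).symm,
      Matrix.mulVec_mulVec, ← encode_map_conj wd, ← Matrix.map_mul, hZ', Matrix.map_mul,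
      encode_map_conj, encode_mul_mulVec_ket]
    refine Finset.sum_congr rfl fun x _ => ?_
    simp
  · have h4 := (Approx.flip_src h0 hD C.inp).flip_conj 
      (Q := fun y => @decide (∃ s, y = wd s) (Classical.propDecidable _)) h1 h2 ?_
    · refine (h4.flip_code C.out C.word).mono ?_ (by linarith)
      have := Fintype.card_le_of_embedding C.out
      rw [Fintype.card_fin] at this ⊢
      omega
    · have h5 := encode_mul_conjTranspose (C.src_injective hD)
      have h6 := encode_mul_conjTranspose hwd
      have hd : ∀ p q : (Fin C.N → Bool) → Bool, (∀ y, p y = true ↔ q y = true) →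
          diagProj p = diagProj q := fun p q h => by
        rw [show p = q from funext fun y => Bool.eq_iff_iff.mpr (h y)]
      have h7 : Z * (encode C.src * (encode C.src)ᴴ) * Zᴴ = encode wd * (encode wd)ᴴ := by
        calc _ = (Z * encode C.src) * (Z * encode C.src)ᴴ := by
              rw [Matrix.conjTranspose_mul]; simp only [Matrix.mul_assoc]
          _ = encode wd * (𝒟.U * 𝒟.Uᴴ) * (encode wd)ᴴ := by
              rw [hZ, Matrix.conjTranspose_mul]; simp only [Matrix.mul_assoc]
          _ = _ := by rw [𝒟.mul_conjTranspose_self, Matrix.mul_one]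
      rw [h5, h6] at h7
      refine ((congrArg (fun X => Z * X * Zᴴ) (hd _ _ fun y => ?_)).trans h7).trans
        (hd _ _ fun y => ?_)
      · simp only [decide_eq_true_iff]; rfl
      · simp only [decide_eq_true_iff]

end DecompositionCircuit

namespace BasisChangeCircuit
variable {D n n' : ℕ} {V : Matrix (Fin n' → Bool) (Fin D) ℂ} {δ : ℝ} (B : BasisChangeCircuit V n δ)

theorem exists_unitary (hD : D ≤ 2 ^ n) (hV : Vᴴ * V = 1) (hδ : 0 ≤ δ) (hδ1 : δ < 1) :
    ∃ Z : Matrix (Fin B.N → Bool) (Fin B.N → Bool) ℂ,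
      (∀ x : Fin D, Z *ᵥ ket (pad B.inp (binary n x)) = ∑ z, V z x • ket (pad B.out z)) ∧
      Approx B.W.length (3 * δ) Z := by
  have hinj : Function.Injective fun x : Fin D => pad B.inp (binary n x) := fun x y h =>
    Fin.ext (binary_inj (x.2.trans_le hD) (y.2.trans_le hD) (pad_injective B.inp h))
  have hT : (encode (pad B.out) * V)ᴴ * (encode (pad B.out) * V) = 1 := by
    rw [Matrix.conjTranspose_mul, Matrix.mul_assoc, ← Matrix.mul_assoc (encode _)ᴴ,
      encode_conjTranspose_mul (pad_injective _), Matrix.one_mul, hV]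
  have hap : ApproxMaps B.W (encode fun x : Fin D => pad B.inp (binary n x))
    (encode (pad B.out) * V) δ := B.approx
  obtain ⟨Z, hZ, h1, -, -⟩ := hap.exists_unitary (encode_conjTranspose_mul hinj) hT hδ hδ1
  refine ⟨Z, fun x => ?_, h1⟩
  rw [← encode_mul_mulVec_ket, ← hZ, ← Matrix.mulVec_mulVec, encode_ket]

end BasisChangeCircuit

/-! ### Copying bits -/

section Copy
variable {κ κ' ω : Type} [Fintype κ] [DecidableEq κ] [Fintype κ'] [DecidableEq κ'] [Fintype ω]
  [DecidableEq ω]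

/-- Adding the bits on the wires `f` to the bits on the wires `e`. -/
def copyMap (e : κ ↪ ω) (f : κ → ω) (x : ω → Bool) : ω → Bool :=
  Function.extend e (fun t => xor (x (e t)) (x (f t))) x

theorem Approx.copy (e : κ ↪ ω) (f : κ → ω) (h : ∀ s t, f s ≠ e t) :
    Approx (Fintype.card κ) 0 (encode (copyMap e f)) := by
  have h1 := Approx.xor_local e (fun x t => x (f t))
    (fun x y hxy => funext fun t => hxy _ (by rintro ⟨s, hs⟩; exact h t s hs.symm)) f f
    (fun t => h t t) (fun t => h t t) fun t x y hxy _ => hxy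
  convert h1 using 2
  ext x v
  by_cases hv : v ∈ Set.range e
  · obtain ⟨t, rfl⟩ := hv
    rw [xorMap_pad_apply, copyMap, e.injective.extend_apply]
  · rw [xorMap_pad_off _ _ _ hv, copyMap, extend_off _ _ _ hv]

theorem extend_trans (f : κ ↪ κ') (e : κ' ↪ ω) (w : κ → Bool) (x : ω → Bool) :
    Function.extend (f.trans e) w x = Function.extend e (Function.extend f w (x ∘ e)) x := by
  symm
  refine eq_extend_iff.mpr ⟨?_, fun i hi => ?_⟩
  · rw [Function.Embedding.coe_trans, ← Function.comp_assoc, extend_comp, extend_comp]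
  · by_cases h : i ∈ Set.range e
    · obtain ⟨t, rfl⟩ := h
      rw [e.injective.extend_apply, extend_off]
      · rfl
      · rintro ⟨s, rfl⟩; exact hi ⟨s, rfl⟩
    · rw [extend_off _ _ _ h]

theorem extend_trans_pad (f : κ ↪ κ') (e : κ' ↪ ω) (w : κ → Bool) (x : κ' → Bool) :
    Function.extend (f.trans e) w (pad e x) = pad e (Function.extend f w x) := by
  rw [extend_trans, pad_comp, pad, pad, extend_extend]

theorem pad_false (e : κ ↪ ω) : pad e (fun _ => false) = fun _ => false := by
  symm
  exact eq_extend_iff.mpr ⟨rfl, fun _ _ => rfl⟩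

theorem extend_inl (w a : κ → Bool) (b : κ' → Bool) :
    Function.extend (Function.Embedding.inl : κ ↪ κ ⊕ κ') w (Sum.elim a b) = Sum.elim w b := by
  symm
  refine eq_extend_iff.mpr ⟨rfl, ?_⟩
  rintro (v | v) hv
  · exact (hv ⟨v, rfl⟩).elim
  · rfl

theorem extend_inr (w b : κ → Bool) (a : κ' → Bool) :
    Function.extend (Function.Embedding.inr : κ ↪ κ' ⊕ κ) w (Sum.elim a b) = Sum.elim a w := by
  symm
  refine eq_extend_iff.mpr ⟨rfl, ?_⟩
  rintro (v | v) hv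
  · rfl
  · exact (hv ⟨v, rfl⟩).elim

theorem liftOp_ket_eq {ι : Type*} [Fintype ι] (e : κ ↪ ω) {M : Matrix (κ → Bool) (κ → Bool) ℂ}
    {x : ω → Bool} {c : ι → ℂ} {f : ι → κ → Bool}
    (h : M *ᵥ ket (x ∘ e) = ∑ i, c i • ket (f i)) :
    liftOp e M *ᵥ ket x = ∑ i, c i • ket (Function.extend e (f i) x) := by
  have h1 : ∀ w, M w (x ∘ e) = ∑ i, c i * (ket (f i) : (κ → Bool) → ℂ) w := fun w => by
    have := congrFun h w
    rw [Matrix.mulVec_single_one] at this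
    simpa [Finset.sum_apply] using this
  rw [liftOp_ket]
  simp only [h1, Finset.sum_smul]
  rw [Finset.sum_comm]
  refine Finset.sum_congr rfl fun i _ => ?_
  rw [Finset.sum_eq_single (f i)]
  · simp
  · intro w _ hw; simp [hw]
  · simp

end Copy

/-! ### The registers of the circuit -/

section Registers
variable {α μ χ ν ν' κ σ : Type} [Fintype α] [DecidableEq α] [Fintype μ] [DecidableEq μ]
  [Fintype χ] [DecidableEq χ] [Fintype ν] [DecidableEq ν] [Fintype ν'] [DecidableEq ν']
  [Fintype κ] [DecidableEq κ] [Fintype σ] [DecidableEq σ]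

/-- The wires of five registers. -/
abbrev Wires (ν ν' χ κ : Type) : Type := ν ⊕ (ν ⊕ (ν' ⊕ (χ ⊕ κ)))

instance : DecidableEq (Wires ν ν' χ κ) := instDecidableEqSum

instance : Fintype (Wires ν ν' χ κ) := instFintypeSum _ _

/-- The contents of five registers. -/
def st (m r : ν → Bool) (b : ν' → Bool) (z : χ → Bool) (k : κ → Bool) : Wires ν ν' χ κ → Bool :=
  Sum.elim m (Sum.elim r (Sum.elim b (Sum.elim z k)))

/-- The first register. -/
def reg₁ : ν ↪ Wires ν ν' χ κ := Function.Embedding.inl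
/-- The second register. -/
def reg₂ : ν ↪ Wires ν ν' χ κ := Function.Embedding.inl.trans Function.Embedding.inr
/-- The third register. -/
def reg₃ : ν' ↪ Wires ν ν' χ κ :=
  (Function.Embedding.inl.trans Function.Embedding.inr).trans Function.Embedding.inr
/-- The fourth register. -/
def reg₄ : χ ↪ Wires ν ν' χ κ :=
  ((Function.Embedding.inl.trans Function.Embedding.inr).trans Function.Embedding.inr).trans
    Function.Embedding.inr
/-- The fifth register. -/
def reg₅ : κ ↪ Wires ν ν' χ κ :=
  ((Function.Embedding.inr.trans Function.Embedding.inr).trans Function.Embedding.inr).trans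
    Function.Embedding.inr

variable (m r : ν → Bool) (b : ν' → Bool) (z : χ → Bool) (k : κ → Bool)

theorem st_comp₁ : st m r b z k ∘ reg₁ = m := rfl
theorem st_comp₂ : st m r b z k ∘ reg₂ = r := rfl

theorem extend_reg₁ (w : ν → Bool) : Function.extend reg₁ w (st m r b z k) = st w r b z k := by
  symm
  refine eq_extend_iff.mpr ⟨rfl, ?_⟩
  rintro (v | v | v | v | v) hv <;> first | rfl | exact (hv ⟨v, rfl⟩).elim

theorem pad_reg₁ : pad (reg₁ : ν ↪ Wires ν ν' χ κ) m =
    st m (fun _ => false) (fun _ => false) (fun _ => false) fun _ => false := by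
  symm
  refine eq_extend_iff.mpr ⟨rfl, ?_⟩
  rintro (v | v | v | v | v) hv <;> first | rfl | exact (hv ⟨v, rfl⟩).elim

theorem extend_reg₂ (w : ν → Bool) : Function.extend reg₂ w (st m r b z k) = st m w b z k := by
  symm
  refine eq_extend_iff.mpr ⟨rfl, ?_⟩
  rintro (v | v | v | v | v) hv <;> first | rfl | exact (hv ⟨v, rfl⟩).elim

theorem extend_reg₃ (w : ν' → Bool) : Function.extend reg₃ w (st m r b z k) = st m r w z k := by
  symm
  refine eq_extend_iff.mpr ⟨rfl, ?_⟩
  rintro (v | v | v | v | v) hv <;> first | rfl | exact (hv ⟨v, rfl⟩).elim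

theorem extend_reg₄ (w : χ → Bool) : Function.extend reg₄ w (st m r b z k) = st m r b w k := by
  symm
  refine eq_extend_iff.mpr ⟨rfl, ?_⟩
  rintro (v | v | v | v | v) hv <;> first | rfl | exact (hv ⟨v, rfl⟩).elim

/-- The first part of the first register, the second part of the second one, and the fifth one. -/
def mixed (out : α ⊕ μ ↪ ν) : α ⊕ (μ ⊕ κ) ↪ Wires ν ν' χ κ :=
  ⟨Sum.elim (fun t => reg₁ (out (Sum.inl t)))
    (Sum.elim (fun t => reg₂ (out (Sum.inr t))) fun t => reg₅ t), by
      rintro (v | v | v) (v' | v' | v') h <;> simp [reg₁, reg₂, reg₅] at h ⊢ <;> exact h⟩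

variable (out : α ⊕ μ ↪ ν)

theorem extend_mixed (a : α → Bool) (u : μ → Bool) (w : κ → Bool) :
    Function.extend (mixed out) (Sum.elim a (Sum.elim u w)) (st m r b z k) =
      st (Function.extend (Function.Embedding.inl.trans out) a m)
        (Function.extend (Function.Embedding.inr.trans out) u r) b z w := by
  symm
  refine eq_extend_iff.mpr ⟨?_, ?_⟩
  · ext (v | v | v)
    · exact (Function.Embedding.inl.trans out).injective.extend_apply _ _ v
    · exact (Function.Embedding.inr.trans out).injective.extend_apply _ _ v
    · rfl
  · rintro (v | v | v | v | v) hv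
    · exact extend_off _ _ _ (by rintro ⟨t, rfl⟩; exact hv ⟨Sum.inl t, rfl⟩)
    · exact extend_off _ _ _ (by rintro ⟨t, rfl⟩; exact hv ⟨Sum.inr (Sum.inl t), rfl⟩)
    · rfl
    · rfl
    · exact (hv ⟨Sum.inr (Sum.inr v), rfl⟩).elim

theorem mixed_pad (a a' : α → Bool) (u u' p : μ → Bool) (w : κ → Bool) :
    Function.extend (mixed out) (Sum.elim a (Sum.elim u w))
      (st (pad out (Sum.elim a' p)) (pad out (Sum.elim (fun _ => false) u')) b z k) =
      st (pad out (Sum.elim a p)) (pad out (Sum.elim (fun _ => false) u)) b z w := by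
  rw [extend_mixed, extend_trans_pad, extend_trans_pad, extend_inl, extend_inr]

end Registers

section Steps
variable {α β γ ν ν' κ σ : Type} [Fintype α] [DecidableEq α] [Fintype β] [DecidableEq β]
  [Fintype γ] [DecidableEq γ] [Fintype ν] [DecidableEq ν] [Fintype ν'] [DecidableEq ν']
  [Fintype κ] [DecidableEq κ] [Fintype σ] [DecidableEq σ]
  (out : α ⊕ (β ⊕ γ) ↪ ν) (inp : σ ↪ ν) (inp' : σ ↪ ν')
  (a : α → Bool) (u u' : β → Bool) (v v' : γ → Bool) (m r : ν → Bool) (b : ν' → Bool)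
  (z : α ⊕ (β ⊕ γ) → Bool) (k : κ → Bool)

/-- Copying the first part of a code word to the second register. -/
def copy₁ : (Wires ν ν' (α ⊕ (β ⊕ γ)) κ → Bool) → Wires ν ν' (α ⊕ (β ⊕ γ)) κ → Bool :=
  copyMap ((Function.Embedding.inl.trans out).trans reg₂) fun t => reg₁ (out (Sum.inl t))

theorem approx_copy₁ :
    Approx (Fintype.card α) 0 (encode (copy₁ (ν' := ν') (κ := κ) out)) :=
  Approx.copy _ _ fun s t h => by simp [reg₁, reg₂] at h

theorem copy₁_st (p q : β ⊕ γ → Bool) :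
    copy₁ out (st (pad out (Sum.elim a p)) (pad out (Sum.elim (fun _ => false) q)) b z k) =
      st (pad out (Sum.elim a p)) (pad out (Sum.elim a q)) b z k := by
  rw [copy₁, copyMap, extend_trans, st_comp₂, extend_trans_pad, extend_inl, extend_reg₂]
  congr 3
  ext t
  change xor (pad out _ (out (Sum.inl t))) (pad out _ (out (Sum.inl t))) = _
  rw [pad_apply, pad_apply]
  simp

/-- The wires that hold the first two parts of the word in the first register, and the last part of
the word in the second register. -/
def labelWires : α ⊕ (β ⊕ γ) → Wires ν ν' (α ⊕ (β ⊕ γ)) κ :=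
  Sum.elim (fun t => reg₁ (out (Sum.inl t))) (Sum.elim (fun t => reg₁ (out (Sum.inr (Sum.inl t))))
    fun t => reg₂ (out (Sum.inr (Sum.inr t))))

/-- Recording the label of a Kraus operator. -/
def copy₂ : (Wires ν ν' (α ⊕ (β ⊕ γ)) κ → Bool) → Wires ν ν' (α ⊕ (β ⊕ γ)) κ → Bool :=
  copyMap reg₄ (labelWires out)

theorem approx_copy₂ :
    Approx (Fintype.card (α ⊕ (β ⊕ γ))) 0 (encode (copy₂ (ν' := ν') (κ := κ) out)) :=
  Approx.copy _ _ fun s t h => by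
    rcases s with s | s | s <;> simp [labelWires, reg₁, reg₂, reg₄] at h

theorem copy₂_st :
    copy₂ out (st (pad out (Sum.elim a (Sum.elim u v))) (pad out (Sum.elim a (Sum.elim u' v'))) b
      (fun _ => false) k) =
      st (pad out (Sum.elim a (Sum.elim u v))) (pad out (Sum.elim a (Sum.elim u' v'))) b
        (Sum.elim a (Sum.elim u v')) k := by
  rw [copy₂, copyMap, extend_reg₄]
  congr 1
  ext t
  change xor false _ = _
  rw [Bool.false_xor]
  rcases t with t | t | t
  · exact pad_apply out _ (Sum.inl t)
  · exact pad_apply out _ (Sum.inr (Sum.inl t))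
  · exact pad_apply out _ (Sum.inr (Sum.inr t))

/-- The wires that hold the second part of the word in the first register. -/
def midWires : β ↪ Wires ν ν' (α ⊕ (β ⊕ γ)) κ :=
  ((Function.Embedding.inl.trans Function.Embedding.inr).trans out).trans reg₁

/-- Removing the second part of the word in the first register. -/
def copy₃ : (Wires ν ν' (α ⊕ (β ⊕ γ)) κ → Bool) → Wires ν ν' (α ⊕ (β ⊕ γ)) κ → Bool :=
  copyMap (midWires out) fun t => reg₄ (Sum.inr (Sum.inl t))

theorem approx_copy₃ :
    Approx (Fintype.card β) 0 (encode (copy₃ (ν' := ν') (κ := κ) out)) :=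
  Approx.copy _ _ fun s t h => by simp [midWires, reg₁, reg₄] at h

theorem extend_midWires (w : β → Bool) :
    Function.extend (midWires out) w (st (pad out (Sum.elim a (Sum.elim u v))) r b z k) =
      st (pad out (Sum.elim a (Sum.elim w v))) r b z k := by
  rw [midWires, extend_trans, st_comp₁, extend_trans_pad, extend_trans, extend_reg₁]
  congr 2
  rw [show (Sum.elim a (Sum.elim u v)) ∘ (Function.Embedding.inr : β ⊕ γ ↪ α ⊕ (β ⊕ γ)) =
    Sum.elim u v from rfl, extend_inl, extend_inr]

theorem copy₃_st :
    copy₃ out (st (pad out (Sum.elim a (Sum.elim u v))) r b (Sum.elim a (Sum.elim u v')) k) =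
      st (pad out (Sum.elim a (Sum.elim (fun _ => false) v))) r b
        (Sum.elim a (Sum.elim u v')) k := by
  rw [copy₃, copyMap, extend_midWires]
  congr 4
  ext t
  change xor (pad out _ (out (Sum.inr (Sum.inl t)))) (u t) = false
  rw [pad_apply]
  simp

/-- Replacing the second part of the word in the first register. -/
def copy₄ : (Wires ν ν' (α ⊕ (β ⊕ γ)) κ → Bool) → Wires ν ν' (α ⊕ (β ⊕ γ)) κ → Bool :=
  copyMap (midWires out) fun t => reg₂ (out (Sum.inr (Sum.inl t)))

theorem approx_copy₄ :
    Approx (Fintype.card β) 0 (encode (copy₄ (ν' := ν') (κ := κ) out)) :=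
  Approx.copy _ _ fun s t h => by simp [midWires, reg₁, reg₂] at h

theorem copy₄_st (a' : α → Bool) :
    copy₄ out (st (pad out (Sum.elim a (Sum.elim (fun _ => false) v)))
      (pad out (Sum.elim a' (Sum.elim u' v'))) b z k) =
      st (pad out (Sum.elim a (Sum.elim u' v))) (pad out (Sum.elim a' (Sum.elim u' v'))) b z k := by
  rw [copy₄, copyMap, extend_midWires]
  congr 4
  ext t
  change xor (pad out _ (out (Sum.inr (Sum.inl t)))) (pad out _ (out (Sum.inr (Sum.inl t)))) = u' t
  rw [pad_apply, pad_apply]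
  simp

/-- Copying the second register to the third one. -/
def copy₅ : (Wires ν ν' (α ⊕ (β ⊕ γ)) κ → Bool) → Wires ν ν' (α ⊕ (β ⊕ γ)) κ → Bool :=
  copyMap (inp'.trans reg₃) fun t => reg₂ (inp t)

theorem approx_copy₅ : Approx (Fintype.card σ) 0
    (encode (copy₅ (α := α) (β := β) (γ := γ) (κ := κ) inp inp')) :=
  Approx.copy _ _ fun s t h => by simp [reg₂, reg₃] at h

theorem copy₅_st (y : σ → Bool) :
    copy₅ inp inp' (st m (pad inp y) (fun _ => false) z k) =
      st m (pad inp y) (pad inp' y) z k := by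
  rw [copy₅, copyMap, extend_trans, extend_reg₃]
  congr 1
  change pad inp' _ = pad inp' y
  congr 1
  ext t
  change xor false (pad inp y (inp t)) = y t
  rw [pad_apply, Bool.false_xor]

/-- Cleaning the second register. -/
def copy₆ : (Wires ν ν' (α ⊕ (β ⊕ γ)) κ → Bool) → Wires ν ν' (α ⊕ (β ⊕ γ)) κ → Bool :=
  copyMap (inp.trans reg₂) fun t => reg₃ (inp' t)

theorem approx_copy₆ : Approx (Fintype.card σ) 0
    (encode (copy₆ (α := α) (β := β) (γ := γ) (κ := κ) inp inp')) :=
  Approx.copy _ _ fun s t h => by simp [reg₂, reg₃] at h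

theorem copy₆_st (y : σ → Bool) :
    copy₆ inp inp' (st m (pad inp y) (pad inp' y) z k) =
      st m (fun _ => false) (pad inp' y) z k := by
  rw [copy₆, copyMap, extend_trans, extend_reg₂, st_comp₂, pad, extend_extend]
  congr 1
  refine Eq.trans ?_ (pad_false inp)
  change pad inp _ = _
  congr 1
  ext t
  change xor (pad inp y (inp t)) (pad inp' y (inp' t)) = false
  rw [pad_apply, pad_apply, Bool.xor_self]

end Steps

/-! ### The circuit -/

theorem sum_rotate {E a b c d e : Type*} [AddCommMonoid E] [Fintype a] [Fintype b] [Fintype c]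
    [Fintype d] [Fintype e] (f : a → b → c → d → e → E) :
    ∑ i, ∑ x, ∑ y, ∑ z, ∑ w, f i x y z w = ∑ x, ∑ y, ∑ z, ∑ w, ∑ i, f i x y z w := by
  rw [Finset.sum_comm]
  refine Finset.sum_congr rfl fun x _ => ?_
  rw [Finset.sum_comm]
  refine Finset.sum_congr rfl fun y _ => ?_
  rw [Finset.sum_comm]
  refine Finset.sum_congr rfl fun z _ => ?_
  rw [Finset.sum_comm]

theorem mul_mulVec_ket {l m n : Type*} [Fintype m] [DecidableEq m] [Fintype n] [DecidableEq n]
    (M : Matrix l m ℂ) (K : Matrix m n ℂ) (q : n) :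
    (M * K) *ᵥ ket q = ∑ p, K p q • M *ᵥ ket p := by
  ext y
  simp [Matrix.mul_apply, Finset.sum_apply, mul_comm]

theorem encode_mul_storeOut {ω : Type*} [DecidableEq ω] {D n n' : ℕ}
    (V : Matrix (Fin n' → Bool) (Fin D) ℂ) (f : (Fin n ⊕ Fin n' → Bool) → ω) (x y : Fin D) :
    (encode f * storeOut n V) *ᵥ ket (x, y) =
      ∑ z, V z y • ket (f (Sum.elim (binary n x) z)) := by
  rw [encode_mul_mulVec_ket, sum_arrow_sum, Finset.sum_eq_single (binary n x)]
  · simp [storeOut, Sum.elim_comp_inl, Sum.elim_comp_inr]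
  · intro w _ hw
    simp [storeOut, Sum.elim_comp_inl, hw]
  · simp

section CircuitOp
variable {α β γ ν ν' κ σ : Type} [Fintype α] [DecidableEq α] [Fintype β] [DecidableEq β]
  [Fintype γ] [DecidableEq γ] [Fintype ν] [DecidableEq ν] [Fintype ν'] [DecidableEq ν']
  [Fintype κ] [DecidableEq κ] [Fintype σ] [DecidableEq σ]
  (out : α ⊕ (β ⊕ γ) ↪ ν) (inp : σ ↪ ν) (inp' : σ ↪ ν')
  (W W' W'' : Matrix (ν → Bool) (ν → Bool) ℂ) (Y : Matrix (ν' → Bool) (ν' → Bool) ℂ)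
  (Z : Matrix (α ⊕ ((β ⊕ γ) ⊕ κ) → Bool) (α ⊕ ((β ⊕ γ) ⊕ κ) → Bool) ℂ)

/-- The circuit, built from its components. -/
def circuitOp : Matrix (Wires ν ν' (α ⊕ (β ⊕ γ)) κ → Bool)
    (Wires ν ν' (α ⊕ (β ⊕ γ)) κ → Bool) ℂ :=
  liftOp reg₃ Y * (encode (copy₆ inp inp') * (encode (copy₅ inp inp') * (liftOp reg₂ W'' *
    (liftOp reg₁ W' * (encode (copy₄ out) * (encode (copy₃ out) * (encode (copy₂ out) *
      (encode (copy₁ out) * (liftOp (mixed out) Z * liftOp reg₁ W)))))))))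

theorem approx_circuitOp {c₁ c₂ c₃ c₄ c₅ : ℕ} {ε₁ ε₂ ε₃ ε₄ ε₅ : ℝ} (h₁ : Approx c₁ ε₁ W)
    (h₂ : Approx c₂ ε₂ Z) (h₃ : Approx c₃ ε₃ W') (h₄ : Approx c₄ ε₄ W'') (h₅ : Approx c₅ ε₅ Y) :
    Approx (c₁ + c₂ + c₃ + c₄ + c₅ + (Fintype.card α + (Fintype.card α + (Fintype.card β +
      Fintype.card γ)) + 2 * Fintype.card β + 2 * Fintype.card σ)) (ε₁ + ε₂ + ε₃ + ε₄ + ε₅)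
      (circuitOp out inp inp' W W' W'' Y Z) := by
  have h := ((((((((((h₁.lift reg₁).mul (h₂.lift (mixed out))).mul (approx_copy₁ out)).mul
    (approx_copy₂ out)).mul (approx_copy₃ out)).mul (approx_copy₄ out)).mul (h₃.lift reg₁)).mul
    (h₄.lift reg₂)).mul (approx_copy₅ inp inp')).mul (approx_copy₆ inp inp')).mul (h₅.lift reg₃)
  refine h.mono ?_ (by linarith)
  rw [Fintype.card_sum, Fintype.card_sum]
  omega

variable {out inp inp' W W' W'' Y Z}

/-- The five registers hold the input space, the second copy of the block space, the purifying
space, the label, and the ancillas of the preparation. `Z` prepares the new `(i', j')` in the second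
register while reading `a` from the first. The label keeps `(a, i, j')`, which permits erasing `i`
from the first register and writing `i'` in its place. Finally the second register is moved to the
third and cleaned, so that nothing outside of label and ancillas is correlated with the output. -/
theorem circuitOp_ket {S X R : Type*} {T : S → Type*} [Fintype S] [∀ s, Fintype (T s)]
    [Fintype X] [Fintype R]
    {m₀ : ν → Bool} {u : S → ℂ} {a : S → α → Bool} {i : S → β → Bool} {j : S → γ → Bool}
    {c : ∀ s, T s → ℂ} {i' : ∀ s, T s → β → Bool} {j' : ∀ s, T s → γ → Bool}
    {k : ∀ s, T s → κ → Bool} {u' u'' : ∀ s, T s → X → ℂ} {m : X → ν → Bool} {d : X → σ → Bool} {v : X → R → ℂ}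
    {b : R → ν' → Bool}
    (hW : W *ᵥ ket m₀ = ∑ s, u s • ket (pad out (Sum.elim (a s) (Sum.elim (i s) (j s)))))
    (hZ : ∀ s, Z *ᵥ ket (Sum.elim (a s) fun _ => false) =
      ∑ t, c s t • ket (Sum.elim (a s) (Sum.elim (Sum.elim (i' s t) (j' s t)) (k s t))))
    (hW' : ∀ s t, W' *ᵥ ket (pad out (Sum.elim (a s) (Sum.elim (i' s t) (j s)))) =
      ∑ x, u' s t x • ket (m x))
    (hW'' : ∀ s t, W'' *ᵥ ket (pad out (Sum.elim (a s) (Sum.elim (i' s t) (j' s t)))) =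
      ∑ y, u'' s t y • ket (pad inp (d y)))
    (hY : ∀ y, Y *ᵥ ket (pad inp' (d y)) = ∑ z, v y z • ket (b z)) :
    circuitOp out inp inp' W W' W'' Y Z *ᵥ ket (st m₀ (fun _ => false) (fun _ => false)
      (fun _ => false) fun _ => false) =
      ∑ s, u s • ∑ t, c s t • ∑ x, u' s t x • ∑ y, u'' s t y • ∑ z, v y z •
        ket (st (m x) (fun _ => false) (b z) (Sum.elim (a s) (Sum.elim (i s) (j' s t)))
          (k s t)) := by
  have e1 : liftOp reg₁ W *ᵥ ket (st m₀ (fun _ => false) (fun _ => false) (fun _ => false)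
      fun _ => false : Wires ν ν' (α ⊕ (β ⊕ γ)) κ → Bool) = _ := liftOp_ket_eq reg₁ hW
  have e2 : ∀ s, liftOp (mixed out) Z *ᵥ ket (st (pad out (Sum.elim (a s) (Sum.elim (i s) (j s))))
      (fun _ => false) (fun _ => false) (fun _ => false) fun _ => false :
        Wires ν ν' (α ⊕ (β ⊕ γ)) κ → Bool) =
      ∑ t, c s t • ket (st (pad out (Sum.elim (a s) (Sum.elim (i s) (j s))))
        (pad out (Sum.elim (fun _ => false) (Sum.elim (i' s t) (j' s t)))) (fun _ => false)
        (fun _ => false) (k s t)) := fun s => by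
    have hz : (fun _ : ν => false) = pad out (Sum.elim (fun _ => false) fun _ => false) :=
      (pad_false out).symm.trans (congrArg _ (by ext (t | t) <;> rfl))
    have hc : (st (pad out (Sum.elim (a s) (Sum.elim (i s) (j s)))) (fun _ => false)
        (fun _ => false) (fun _ => false) fun _ => false : Wires ν ν' (α ⊕ (β ⊕ γ)) κ → Bool) ∘
          mixed out = Sum.elim (a s) fun _ => false := by
      ext (t | t | t)
      · exact pad_apply out _ (Sum.inl t)
      · rfl
      · rfl
    have h1 := hZ s
    rw [← hc] at h1
    rw [liftOp_ket_eq (mixed out) h1, hz]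
    simp only [mixed_pad]
  have e3 : ∀ s t z k', liftOp reg₁ W' *ᵥ ket (st (pad out (Sum.elim (a s) (Sum.elim (i' s t)
      (j s)))) (pad out (Sum.elim (a s) (Sum.elim (i' s t) (j' s t)))) (fun _ => false) z k' :
        Wires ν ν' (α ⊕ (β ⊕ γ)) κ → Bool) = _ := fun s t z k' => liftOp_ket_eq reg₁ (hW' s t)
  have e4 : ∀ s t x z k', liftOp reg₂ W'' *ᵥ ket (st (m x)
      (pad out (Sum.elim (a s) (Sum.elim (i' s t) (j' s t)))) (fun _ => false) z k' :
        Wires ν ν' (α ⊕ (β ⊕ γ)) κ → Bool) = _ := fun s t x z k' => liftOp_ket_eq reg₂ (hW'' s t)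
  have e5 : ∀ x y z k', liftOp reg₃ Y *ᵥ ket (st (m x) (fun _ => false) (pad inp' (d y)) z k' :
        Wires ν ν' (α ⊕ (β ⊕ γ)) κ → Bool) = _ := fun x y z k' => liftOp_ket_eq reg₃ (hY y)
  simp only [extend_reg₁, extend_reg₂, extend_reg₃] at e1 e3 e4 e5
  simp only [circuitOp, ← Matrix.mulVec_mulVec, e1, Matrix.mulVec_sum, Matrix.mulVec_smul, e2,
    encode_ket, copy₁_st, copy₂_st, copy₃_st, copy₄_st, e3, e4, copy₅_st, copy₆_st, e5]

end CircuitOp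

section Circuit
variable {D : ℕ} {A : StarSubalgebra ℂ (Matrix (Fin D) (Fin D) ℂ)} {𝒟 : Decomposition A} {n n' : ℕ}
  {δ : ℝ} {V : Matrix (Fin n' → Bool) (Fin D) ℂ}

/-- The state of the wires at the beginning of the circuit. -/
def initState {κ : Type} (C : DecompositionCircuit 𝒟 n δ) (B : BasisChangeCircuit V n δ)
    (q : Fin D) : Wires (Fin C.N) (Fin B.N) (Fin C.a ⊕ (Fin C.b ⊕ Fin C.c)) κ → Bool :=
  st (C.src q) (fun _ => false) (fun _ => false) (fun _ => false) fun _ => false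

/-- The state of the wires at the end of the circuit, given the contents of the output wires, the
label of a Kraus operator, and the contents of the ancillas. -/
def outState {κ : Type} (C : DecompositionCircuit 𝒟 n δ) (B : BasisChangeCircuit V n δ)
    (t : 𝒟.Idx) (k : κ → Bool) (w : Fin n ⊕ Fin n' → Bool) :
    Wires (Fin C.N) (Fin B.N) (Fin C.a ⊕ (Fin C.b ⊕ Fin C.c)) κ → Bool :=
  st (pad C.inp (w ∘ Sum.inl)) (fun _ => false) (pad B.out (w ∘ Sum.inr)) (C.word t) k

/-- The circuit applies the Kraus operators, recording which one, and leaves the ancillas in the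
states `τ`. -/
def Purifies {κ : Type} [Fintype κ] [DecidableEq κ] (C : DecompositionCircuit 𝒟 n δ)
    (B : BasisChangeCircuit V n δ)
    (F : Matrix (Wires (Fin C.N) (Fin B.N) (Fin C.a ⊕ (Fin C.b ⊕ Fin C.c)) κ → Bool)
      (Wires (Fin C.N) (Fin B.N) (Fin C.a ⊕ (Fin C.b ⊕ Fin C.c)) κ → Bool) ℂ)
    (τ : Fin 𝒟.m → (κ → Bool) → ℂ) : Prop :=
  ∀ q, F *ᵥ ket (initState C B q) = (∑ p : 𝒟.Idx × (κ → Bool), encode (outState C B p.1 p.2) *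
    (τ p.1.1 p.2 • (storeOut n V * 𝒟.kraus p.1))) *ᵥ ket q

/-- The amplitudes of the circuit are regrouped by the recorded label `(l, i, j')`. The sums left
over, over `i'` and `j`, are exactly those in the definition of `kraus`. -/
theorem sum_kraus_ket {E : Type*} [AddCommMonoid E] [Module ℂ E] {κ : Type} [Fintype κ]
    (τ : Fin 𝒟.m → κ → ℂ) (f : 𝒟.Idx → κ → Fin D → Fin D → E) (q : Fin D) :
    (∑ s : 𝒟.Idx, 𝒟.U s q • ∑ t : Fin (𝒟.dL s.1) × Fin (𝒟.dR s.1) × κ,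
      (((Real.sqrt (𝒟.dL s.1 * 𝒟.dR s.1))⁻¹ : ℂ) * τ s.1 t.2.2) •
        ∑ x, star (𝒟.U ⟨s.1, (t.1, s.2.2)⟩ x) • ∑ y, 𝒟.U ⟨s.1, (t.1, t.2.1)⟩ y •
          f ⟨s.1, (s.2.1, t.2.1)⟩ t.2.2 x y) =
      ∑ p : 𝒟.Idx × κ, τ p.1.1 p.2 • ∑ v : Fin D × Fin D, 𝒟.kraus p.1 v q •
        f p.1 p.2 v.1 v.2 := by
  simp only [Fintype.sum_prod_type, Fintype.sum_sigma, Decomposition.kraus, Matrix.of_apply,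
    Finset.smul_sum, Finset.mul_sum, Finset.sum_smul, smul_smul]
  refine Finset.sum_congr rfl fun l _ => Finset.sum_congr rfl fun i _ => ?_
  calc _ = ∑ j, ∑ j', ∑ k, ∑ x, ∑ y, ∑ i', _ :=
        Finset.sum_congr rfl fun j _ => sum_rotate _
    _ = ∑ j', ∑ k, ∑ x, ∑ y, ∑ j, ∑ i', _ := sum_rotate _
    _ = _ := by
      refine Finset.sum_congr rfl fun j' _ => Finset.sum_congr rfl fun k _ =>
        Finset.sum_congr rfl fun x _ => Finset.sum_congr rfl fun y _ => ?_
      rw [Finset.sum_comm]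
      refine Finset.sum_congr rfl fun i' _ => Finset.sum_congr rfl fun j _ => ?_
      congr 1
      ring

/-- The components of `circuitOp` are the ideal unitary for `U`, its adjoint, the conjugate of its
adjoint, the basis change and the preparation. With these ideal components the identity for the
output is exact, and all imprecision sits in `Approx`: `12 * δ` from the first four and the rest
from the preparation. -/
theorem exists_exact (C : DecompositionCircuit 𝒟 n δ) (B : BasisChangeCircuit V n δ) (h0 : 0 < D)
    (hD : D ≤ 2 ^ n) (hV : Vᴴ * V = 1) (hδ : 0 ≤ δ) (hδ1 : δ < 1) (r : ℕ) {η : ℝ} (hη : 0 ≤ η)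
    (hη1 : 2 * η < 1) (hr : (3 / 4) ^ r ≤ η ^ 2) :
    ∃ (κ : Type) (_ : Fintype κ) (_ : DecidableEq κ)
      (F : Matrix (Wires (Fin C.N) (Fin B.N) (Fin C.a ⊕ (Fin C.b ⊕ Fin C.c)) κ → Bool)
        (Wires (Fin C.N) (Fin B.N) (Fin C.a ⊕ (Fin C.b ⊕ Fin C.c)) κ → Bool) ℂ)
      (τ : Fin 𝒟.m → (κ → Bool) → ℂ),
      Fintype.card κ = r * (2 * (C.b + C.c) + 1) ∧
      Approx (3 * C.W.length + B.W.length + r * ((C.b + C.c) *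
          (7 * C.N + 2 * C.W.length + 3 + 6) + (7 * C.N + 2 * C.W.length + 3)) +
          (C.a + (C.a + (C.b + C.c)) + 2 * C.b + 2 * n))
        (12 * δ + (r * ((C.b + C.c + 1) * (6 * δ)) + 6 * η)) F ∧
      (∀ l, nsq (τ l) = 1) ∧
      Purifies C B F τ := by
  obtain ⟨W, hW, hW', hW'', a1, a2, a3, aP⟩ := C.exists_unitary h0 hD hδ hδ1
  obtain ⟨Y, hY, aY⟩ := B.exists_unitary hD hV hδ hδ1
  obtain ⟨κ, _, _, Z, τ, hκ, aZ, hτ, hZ⟩ :=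
    exists_prep aP C.code.injective C.isDense_isWord r hη hη1 hr
  have hZ' : ∀ l, Z *ᵥ ket (Sum.elim (C.code l) fun _ => false) =
      ∑ i : Fin (𝒟.dL l) × Fin (𝒟.dR l) × (κ → Bool),
        (((Real.sqrt (𝒟.dL l * 𝒟.dR l))⁻¹ : ℂ) * τ l i.2.2) •
          ket (Sum.elim (C.code l) (Sum.elim (prodWord C.b C.c i.1 i.2.1) i.2.2)) := by
    intro l
    rw [hZ, unif_apply (C.dL_le l) (C.dR_le l) (C.isWord_iff l)]
    ext x
    have hτ' : τ l (x ∘ Sum.inr ∘ Sum.inr) =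
        ∑ k, τ l k * (ket k : (κ → Bool) → ℂ) (x ∘ Sum.inr ∘ Sum.inr) := by
      simp [Pi.single_apply]
    rw [hτ']
    simp only [Finset.sum_apply, Pi.smul_apply, smul_eq_mul, Fintype.sum_prod_type,
      ket_elim_apply, Finset.sum_mul, Finset.mul_sum]
    rw [Finset.sum_comm]
    refine Finset.sum_congr rfl fun i _ => ?_
    rw [Finset.sum_comm]
    refine Finset.sum_congr rfl fun j _ => Finset.sum_congr rfl fun k _ => ?_
    simp only [Function.comp_assoc]
    ring
  refine ⟨κ, inferInstance, inferInstance,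
    circuitOp C.out C.inp B.inp W Wᴴ (Wᴴ.map (starRingEnd ℂ)) Y Z, τ, ?_, ?_, hτ, ?_⟩
  · rw [hκ, Fintype.card_sum, Fintype.card_fin, Fintype.card_fin]
  · refine (approx_circuitOp C.out C.inp B.inp W Wᴴ (Wᴴ.map (starRingEnd ℂ)) Y Z a1 aZ a2 a3
      aY).mono ?_ ?_
    · simp only [Fintype.card_sum, Fintype.card_fin]
      omega
    · simp only [Fintype.card_sum, Fintype.card_fin, Nat.cast_add]
      linarith
  · intro q
    rw [initState, circuitOp_ket (hW q) (fun s => hZ' s.1)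
        (fun s t => hW' ⟨s.1, (t.1, s.2.2)⟩) (fun s t => hW'' ⟨s.1, (t.1, t.2.1)⟩) hY,
      Matrix.sum_mulVec]
    refine (sum_kraus_ket τ (fun t k x y => ∑ z, V z y • ket (st (C.src x) (fun _ => false)
      (pad B.out z) (C.word t) k)) q).trans ?_
    refine Finset.sum_congr rfl fun p _ => ?_
    rw [Matrix.mul_smul, Matrix.smul_mulVec, ← Matrix.mul_assoc, mul_mulVec_ket]
    refine congrArg _ (Finset.sum_congr rfl fun v _ => congrArg _ ?_)
    exact (encode_mul_storeOut V (outState C B p.1 p.2) v.1 v.2).symm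

end Circuit

/-! ### Programs -/

theorem conjMap_mul {l m n : Type*} [Fintype m] [Fintype n] (M : Matrix l m ℂ)
    (N : Matrix m n ℂ) : conjMap (M * N) = conjMap M ∘ₗ conjMap N := by
  refine LinearMap.ext fun X => ?_
  change M * N * X * (M * N)ᴴ = M * (N * X * Nᴴ) * Mᴴ
  rw [Matrix.conjTranspose_mul]
  simp only [Matrix.mul_assoc]

theorem conjMap_smul {m n : Type*} [Fintype m] (c : ℂ) (M : Matrix n m ℂ) :
    conjMap (c • M) = (c * star c) • conjMap M := by
  refine LinearMap.ext fun X => ?_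
  change c • M * X * (c • M)ᴴ = (c * star c) • (M * X * Mᴴ)
  rw [Matrix.conjTranspose_smul, Matrix.smul_mul, Matrix.smul_mul, Matrix.mul_smul, smul_smul]

/-- The program that applies a list of gates. -/
def ofCircuit {N : ℕ} : List (Gate N) → Prog N
  | [] => .skip
  | g :: gs => .seq (.gate g) (ofCircuit gs)

theorem size_ofCircuit {N : ℕ} (W : List (Gate N)) : (ofCircuit W).size = W.length := by
  induction W with
  | nil => rfl
  | cons g gs ih => rw [ofCircuit, Prog.size, ih, Prog.size, List.length_cons, add_comm]

theorem eval_ofCircuit {N : ℕ} (W : List (Gate N)) :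
    (ofCircuit W).eval = conjMap (circuitMatrix W) := by
  induction W with
  | nil =>
    refine LinearMap.ext fun X => ?_
    change X = 1 * X * 1ᴴ
    rw [Matrix.conjTranspose_one, Matrix.one_mul, Matrix.mul_one]
  | cons g gs ih =>
    rw [ofCircuit, Prog.eval, ih, circuitMatrix, conjMap_mul]
    rfl

section Channel
variable {D : ℕ} {A : StarSubalgebra ℂ (Matrix (Fin D) (Fin D) ℂ)} {𝒟 : Decomposition A} {n n' : ℕ}
  {δ : ℝ} {V : Matrix (Fin n' → Bool) (Fin D) ℂ}

theorem conjMap_storeOut_comp_purify (𝒟 : Decomposition A)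
    (V : Matrix (Fin n' → Bool) (Fin D) ℂ) :
    conjMap (storeOut n V) ∘ₗ 𝒟.purify = ∑ t, conjMap (storeOut n V * 𝒟.kraus t) := by
  simp only [conjMap_mul]
  refine LinearMap.ext fun X => ?_
  simp [Decomposition.purify]

theorem storeOut_isometry (hD : D ≤ 2 ^ n) (hV : Vᴴ * V = 1) :
    (storeOut n V)ᴴ * storeOut n V = 1 := by
  refine ext_ket fun p => ?_
  ext p'
  have h1 : (Vᴴ * V) p'.2 p.2 = if p'.2 = p.2 then 1 else 0 := by rw [hV, Matrix.one_apply]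
  rw [Matrix.mul_apply] at h1
  rw [Matrix.mulVec_single_one, Matrix.one_mulVec, Matrix.col_apply, Matrix.mul_apply,
    sum_arrow_sum]
  have h2 : ∀ w z, (storeOut n V)ᴴ p' (Sum.elim w z) * storeOut n V (Sum.elim w z) p =
      if w = binary n p'.1 ∧ w = binary n p.1 then Vᴴ p'.2 z * V z p.2 else 0 := by
    intro w z
    simp only [storeOut, Matrix.conjTranspose_apply, Matrix.of_apply, Sum.elim_comp_inl,
      Sum.elim_comp_inr]
    split_ifs <;> simp_all
  simp only [h2]
  rw [Finset.sum_eq_single (binary n p'.1)]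
  · by_cases h : p'.1 = p.1
    · simp only [h, true_and, and_self, if_true, h1, Pi.single_apply, Prod.ext_iff]
    · have h3 : binary n p'.1 ≠ binary n p.1 := fun h' =>
        h (Fin.ext (binary_inj (p'.1.2.trans_le hD) (p.1.2.trans_le hD) h'))
      simp [h3, Prod.ext_iff, h]
  · intro w _ hw
    simp [hw]
  · simp

theorem channel_eq {N : ℕ} {W : List (Gate N)} {inp : Fin n ↪ Fin N} {κ : Type} [Fintype κ]
    [DecidableEq κ] (out : κ ↪ Fin N) : (ofCircuit W).channel (D := D) inp out = readOut out ∘ₗ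
      conjMap (circuitMatrix W * encode fun x : Fin D => pad inp (binary n x)) := by
  rw [Prog.channel, eval_ofCircuit, conjMap_mul]
  rfl

/-- The empty program defines some channel, and that suffices when an error of `2` is permitted. -/
theorem diamondClose_skip (hD : D ≤ 2 ^ n) (hV : Vᴴ * V = 1) {N : ℕ} (inp : Fin n ↪ Fin N)
    (out : Fin n ⊕ Fin n' ↪ Fin N) :
    DiamondClose ((ofCircuit []).channel inp out) (conjMap (storeOut n V) ∘ₗ 𝒟.purify) 2 := by
  have hinj : Function.Injective fun x : Fin D => pad inp (binary n x) := fun x y h =>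
    Fin.ext (binary_inj (x.2.trans_le hD) (y.2.trans_le hD) (pad_injective inp h))
  rw [channel_eq, circuitMatrix, Matrix.one_mul, readOut_eq, conjMap_storeOut_comp_purify]
  have h1 : (∑ r : Rest out, conjMap (encode (fill out r))ᴴ) ∘ₗ
      conjMap (encode fun x : Fin D => pad inp (binary n x)) =
      ∑ r : Rest out, conjMap ((encode (fill out r))ᴴ *
        encode fun x : Fin D => pad inp (binary n x)) := by
    simp only [conjMap_mul]
    refine LinearMap.ext fun X => ?_
    simp
  rw [h1]
  refine diamondClose_two ?_ ?_
  · simp only [Matrix.conjTranspose_mul]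
    have h2 : ∀ r : Rest out, (encode fun x : Fin D => pad inp (binary n x))ᴴ *
        (encode (fill out r))ᴴᴴ * ((encode (fill out r))ᴴ *
          encode fun x : Fin D => pad inp (binary n x)) =
        (encode fun x : Fin D => pad inp (binary n x))ᴴ * ((encode (fill out r))ᴴᴴ *
          (encode (fill out r))ᴴ) * encode fun x : Fin D => pad inp (binary n x) := fun r => by
      simp only [Matrix.mul_assoc]
    simp only [h2]
    rw [← Matrix.sum_mul, ← Matrix.mul_sum, sum_fill, Matrix.mul_one,
      encode_conjTranspose_mul hinj]
  · have h2 : ∀ t, (storeOut n V * 𝒟.kraus t)ᴴ * (storeOut n V * 𝒟.kraus t) =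
        (𝒟.kraus t)ᴴ * 𝒟.kraus t := fun t => by
      rw [Matrix.conjTranspose_mul, Matrix.mul_assoc, ← Matrix.mul_assoc (storeOut n V)ᴴ,
        storeOut_isometry hD hV, Matrix.one_mul]
    simp only [h2]
    exact 𝒟.sum_kraus

end Channel

open scoped Matrix.Norms.L2Operator in
-- The wires and the ancillas are numbered, which gives a gate list on `Fin N`. The two operators
-- compared are contractions, as `diamondClose_of_norm_sub_le` requires.
theorem Approx.exists_circuit {ω : Type} [Fintype ω] [DecidableEq ω] {c : ℕ} {ε : ℝ}
    {F : Matrix (ω → Bool) (ω → Bool) ℂ} (hF : Approx c ε F) {D : ℕ} {s : Fin D → ω → Bool}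
    (hs : Function.Injective s) :
    ∃ (N : ℕ) (E : ω ↪ Fin N) (W : List (Gate N)), N + W.length ≤ Fintype.card ω + 2 * c ∧
      ‖circuitMatrix W * encode (pad E ∘ s)‖ ≤ 1 ∧ ‖encode (pad E) * (F * encode s)‖ ≤ 1 ∧
      ‖circuitMatrix W * encode (pad E ∘ s) - encode (pad E) * (F * encode s)‖ ≤ ε := by
  obtain ⟨hFu, κ, _, _, c', M, hκ, hc', hM, hε⟩ := hF
  let q : ω ⊕ κ ↪ Fin (Fintype.card (ω ⊕ κ)) := (Fintype.equivFin _).toEmbedding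
  obtain ⟨W, hW, hWM⟩ := (hM.lift q).exists_circuit
  let E : ω ↪ Fin (Fintype.card (ω ⊕ κ)) := Function.Embedding.inl.trans q
  have hE : encode (pad E) = encode (pad q) * anc ω κ := by
    rw [anc, encode_mul_encode]
    congr 1
    ext1 x
    exact pad_trans _ _ _
  have h3 := norm_le_one_of_conjTranspose_mul (encode_conjTranspose_mul (pad_injective q))
  have h4 := norm_le_one_of_conjTranspose_mul (encode_conjTranspose_mul hs)
  have h5 := norm_le_one_of_conjTranspose_mul (encode_conjTranspose_mul (pad_injective E))
  refine ⟨_, E, W, ?_, ?_, ?_, ?_⟩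
  · rw [hW, Fintype.card_sum]
    omega
  · rw [hWM]
    exact (Matrix.l2_opNorm_mul _ _).trans (mul_mul_le_of_le_one
      (norm_le_one_of_mem_unitary (hM.lift q).mem_unitary) (norm_le_one_of_conjTranspose_mul
        (encode_conjTranspose_mul ((pad_injective E).comp hs))) (norm_nonneg _))
  · exact (Matrix.l2_opNorm_mul _ _).trans (mul_mul_le_of_le_one h5
      ((Matrix.l2_opNorm_mul _ _).trans (mul_mul_le_of_le_one
        (norm_le_one_of_mem_unitary hFu) h4 (norm_nonneg _))) (norm_nonneg _))
  · have h2 : circuitMatrix W * encode (pad E ∘ s) - encode (pad E) * (F * encode s) =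
        encode (pad q) * ((M * anc ω κ - anc ω κ * F) * encode s) := by
      rw [← encode_mul_encode, hE, hWM, ← Matrix.mul_assoc, ← Matrix.mul_assoc (liftOp q M),
        liftOp_mul_encode_pad]
      simp only [Matrix.mul_assoc, Matrix.sub_mul, Matrix.mul_sub]
    rw [h2]
    exact (Matrix.l2_opNorm_mul _ _).trans ((mul_comm _ _).trans_le (mul_mul_le_of_le_one
      ((Matrix.l2_opNorm_mul _ _).trans (mul_mul_le_of_le_one hε h4 (norm_nonneg _))) h3
      (norm_nonneg _)))

theorem mul_encode_eq {m n : Type*} [Fintype m] [DecidableEq m] [Fintype n] [DecidableEq n]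
    {F : Matrix m m ℂ} {s : n → m} {T : Matrix m n ℂ} (h : ∀ q, F *ᵥ ket (s q) = T *ᵥ ket q) :
    F * encode s = T :=
  ext_ket fun q => by rw [← Matrix.mulVec_mulVec, encode_ket, h]

/-! ### Discarding the label and the ancillas -/

section Machine
variable {D : ℕ} {A : StarSubalgebra ℂ (Matrix (Fin D) (Fin D) ℂ)} {𝒟 : Decomposition A} {n n' : ℕ}
  {δ : ℝ} {V : Matrix (Fin n' → Bool) (Fin D) ℂ} {κ κ' : Type} [Fintype κ] [DecidableEq κ]
  [Fintype κ'] [DecidableEq κ'] (C : DecompositionCircuit 𝒟 n δ) (B : BasisChangeCircuit V n δ)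

/-- The wires of the circuit for the random purification. -/
abbrev AllWires (κ : Type) : Type := Wires (Fin C.N) (Fin B.N) (Fin C.a ⊕ (Fin C.b ⊕ Fin C.c)) κ

/-- The output wires. -/
def outWires : Fin n ⊕ Fin n' ↪ AllWires C B κ :=
  ⟨Sum.elim (fun t => reg₁ (C.inp t)) fun t => reg₃ (B.out t), by
    rintro (v | v) (v' | v') h <;> simp [reg₁, reg₃] at h ⊢ <;> exact h⟩

variable {C B}

theorem outState_eq (t : 𝒟.Idx) (k : κ → Bool) (w : Fin n ⊕ Fin n' → Bool) :
    outState C B t k w =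
      Function.extend (outWires C B) w (outState C B t k fun _ => false) := by
  refine eq_extend_iff.mpr ⟨?_, ?_⟩
  · ext (v | v)
    · exact pad_apply C.inp _ v
    · exact pad_apply B.out _ v
  · rintro (v | v | v | v | v) hv
    · have h : v ∉ Set.range C.inp := by rintro ⟨s, rfl⟩; exact hv ⟨Sum.inl s, rfl⟩
      exact (pad_off _ _ h).trans (pad_off _ _ h).symm
    · rfl
    · have h : v ∉ Set.range B.out := by rintro ⟨s, rfl⟩; exact hv ⟨Sum.inr s, rfl⟩
      exact (pad_off _ _ h).trans (pad_off _ _ h).symm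
    · rfl
    · rfl

theorem outState_injective (w : Fin n ⊕ Fin n' → Bool) :
    Function.Injective fun p : 𝒟.Idx × (κ → Bool) => outState C B p.1 p.2 w := by
  rintro ⟨t, k⟩ ⟨t', k'⟩ h
  have h1 : C.word t = C.word t' := funext fun v => congrFun h (reg₄ v)
  have h2 : k = k' := funext fun v => congrFun h (reg₅ v)
  rw [C.word_injective h1, h2]

theorem outState_false (t : 𝒟.Idx) (k : κ → Bool) (v : Fin n ⊕ Fin n') :
    outState C B t k (fun _ => false) (outWires C B v) = false := by
  rcases v with v | v
  · exact pad_apply C.inp _ v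
  · exact pad_apply B.out _ v

variable {ω : Type} [Fintype ω] [DecidableEq ω] {N : ℕ}

theorem pad_extend (e : κ ↪ κ') (f : κ' ↪ ω) (w : κ → Bool) (x : κ' → Bool) :
    pad f (Function.extend e w x) = Function.extend (e.trans f) w (pad f x) :=
  (extend_trans_pad e f w x).symm

/-- Distinct pairs of label and ancilla content leave distinct bits on discarded wires, so
interference between them is lost and the channel is the sum of the individual Kraus maps. For a
fixed label the ancilla weights add up to `nsq (τ l) = 1`. -/
theorem readOut_outState (E : AllWires C B κ ↪ Fin N) {τ : Fin 𝒟.m → (κ → Bool) → ℂ}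
    (hτ : ∀ l, nsq (τ l) = 1) :
    readOut ((outWires C B).trans E) ∘ₗ conjMap (encode (pad E) *
      ∑ p : 𝒟.Idx × (κ → Bool), encode (outState C B p.1 p.2) *
        (τ p.1.1 p.2 • (storeOut n V * 𝒟.kraus p.1))) =
      conjMap (storeOut n V) ∘ₗ 𝒟.purify := by
  classical
  let ρ : 𝒟.Idx × (κ → Bool) → Rest ((outWires C B).trans E) := fun p =>
    ⟨pad E (outState C B p.1 p.2 fun _ => false), fun t => by
      change pad E _ (E (outWires C B t)) = false
      rw [pad_apply, outState_false]⟩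
  have hρ : Function.Injective ρ := fun p q h =>
    outState_injective _ (pad_injective E (congrArg Subtype.val h))
  have h1 : encode (pad E) * ∑ p : 𝒟.Idx × (κ → Bool), encode (outState C B p.1 p.2) *
      (τ p.1.1 p.2 • (storeOut n V * 𝒟.kraus p.1)) =
      ∑ p, encode (fill ((outWires C B).trans E) (ρ p)) *
        (τ p.1.1 p.2 • (storeOut n V * 𝒟.kraus p.1)) := by
    rw [Matrix.mul_sum]
    refine Finset.sum_congr rfl fun p _ => ?_
    rw [← Matrix.mul_assoc, encode_mul_encode]
    congr 2
    ext1 w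
    rw [Function.comp_apply, outState_eq, pad_extend]
    rfl
  rw [h1, readOut_conjMap_sum _ hρ, conjMap_storeOut_comp_purify, Fintype.sum_prod_type]
  refine Finset.sum_congr rfl fun t _ => ?_
  simp only [conjMap_smul]
  rw [← Finset.sum_smul]
  have h2 : ∑ k, τ t.1 k * star (τ t.1 k) = 1 := by
    have h3 := nsq_eq_dotProduct (τ t.1)
    rw [hτ, Complex.ofReal_one] at h3
    rw [h3, dotProduct]
    exact Finset.sum_congr rfl fun k _ => mul_comm _ _
  rw [h2, one_smul]

open scoped Matrix.Norms.L2Operator in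
theorem exists_program (hD : D ≤ 2 ^ n) {c : ℕ} {ε : ℝ}
    {F : Matrix (AllWires C B κ → Bool) (AllWires C B κ → Bool) ℂ} (hF : Approx c ε F)
    {τ : Fin 𝒟.m → (κ → Bool) → ℂ} (hτ : ∀ l, nsq (τ l) = 1) (h : Purifies C B F τ) :
    ∃ (N : ℕ) (Q : Prog N) (inp : Fin n ↪ Fin N) (out : Fin n ⊕ Fin n' ↪ Fin N),
      N + Q.size ≤ Fintype.card (AllWires C B κ) + 2 * c ∧
      DiamondClose (Q.channel inp out) (conjMap (storeOut n V) ∘ₗ 𝒟.purify) (2 * ε) := by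
  have hs : Function.Injective (initState (κ := κ) C B) := fun x y hxy =>
    C.src_injective hD (funext fun v => congrFun hxy (reg₁ v))
  obtain ⟨N, E, W, hN, h1, h2, h3⟩ := hF.exists_circuit hs
  rw [Purifies] at h
  have hF' := mul_encode_eq h
  have h4 := readOut_outState (V := V) E hτ
  rw [← hF'] at h4
  have hin : (fun x : Fin D => pad ((C.inp.trans reg₁).trans E) (binary n x)) =
      pad E ∘ initState C B := by
    ext1 x
    rw [pad_trans, pad_trans, pad_reg₁]
    rfl
  refine ⟨N, ofCircuit W, (C.inp.trans reg₁).trans E, (outWires C B).trans E, ?_, ?_⟩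
  · rwa [size_ofCircuit]
  · rw [channel_eq, ← h4, readOut_eq, hin]
    exact diamondClose_of_norm_sub_le (sum_fill _) h1 h2 h3

end Machine

/-! ### Cost and error estimates -/

section Bounds

/-- Every quantity is at most linear in `Y = X + 1`, and the largest term is rounds × word length ×
cost of one test, which is cubic. -/
theorem cost_bound {N L N' L' K n a b c X : ℕ} (hX : X = N + L + (N' + L') + K) (hn : n ≤ N)
    (habc : a + (b + c) ≤ N) :
    2 * N + N' + (a + (b + c)) + 5 * (K + 4) * (2 * (b + c) + 1) +
      2 * (3 * L + L' + 5 * (K + 4) * ((b + c) * (7 * N + 2 * L + 3 + 6) + (7 * N + 2 * L + 3)) +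
        (a + (a + (b + c)) + 2 * b + 2 * n)) ≤ 1000 * (X + 1) ^ 3 := by
  set Y := X + 1 with hY
  have h1 : 5 * (K + 4) ≤ 20 * Y := by omega
  have h2 : (b + c) * (7 * N + 2 * L + 3 + 6) ≤ Y * (9 * Y) := Nat.mul_le_mul (by omega) (by omega)
  have h3 : 5 * (K + 4) * ((b + c) * (7 * N + 2 * L + 3 + 6) + (7 * N + 2 * L + 3)) ≤
      20 * Y * (Y * (9 * Y) + 9 * Y) := Nat.mul_le_mul h1 (Nat.add_le_add h2 (by omega))
  have h4 : 5 * (K + 4) * (2 * (b + c) + 1) ≤ 20 * Y * (2 * Y) := Nat.mul_le_mul h1 (by omega)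
  have hY1 : 1 ≤ Y := by omega
  have h5 : Y * Y ≤ Y ^ 3 := by
    rw [← sq]; exact Nat.pow_le_pow_right hY1 (by norm_num)
  have h6 : Y ≤ Y ^ 3 := Nat.le_self_pow (by norm_num) Y
  have h7 : 20 * Y * (Y * (9 * Y) + 9 * Y) = 180 * Y ^ 3 + 180 * (Y * Y) := by ring
  have h8 : 20 * Y * (2 * Y) = 40 * (Y * Y) := by ring
  omega

/-- The coefficient of `δ` is `24 + 60 (K + 4)(b + 1)`, at most quadratic in `X + 1`. The remaining
term is `12 / 16` of `2^(-K)`; the shift from `K` to `K + 4` is made for this. -/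
theorem error_bound {K b X : ℕ} {δ : ℝ} (hδ : 0 ≤ δ) (hK : K ≤ X) (hb : b ≤ X) :
    2 * (12 * δ + (((5 * (K + 4) : ℕ) : ℝ) * ((b + 1) * (6 * δ)) + 6 * (1 / 2) ^ (K + 4))) ≤
      ((1000 * (X + 1) ^ 3 : ℕ) : ℝ) * δ + (1 / 2) ^ K := by
  set Y := X + 1 with hY
  have h1 : 24 + 60 * (K + 4) * (b + 1) ≤ 1000 * Y ^ 3 := by
    have hY1 : 1 ≤ Y := by omega
    have h2 : 60 * (K + 4) * (b + 1) ≤ 240 * Y * Y := Nat.mul_le_mul (by omega) (by omega)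
    have h5 : Y * Y ≤ Y ^ 3 := by
      rw [← sq]; exact Nat.pow_le_pow_right hY1 (by norm_num)
    have h6 : 1 ≤ Y ^ 3 := Nat.one_le_pow _ _ hY1
    rw [mul_assoc 240] at h2
    omega
  have h2 : ((24 + 60 * (K + 4) * (b + 1) : ℕ) : ℝ) * δ ≤ ((1000 * Y ^ 3 : ℕ) : ℝ) * δ :=
    mul_le_mul_of_nonneg_right (Nat.cast_le.mpr h1) hδ
  have h3 : (1 / 2 : ℝ) ^ (K + 4) = (1 / 2) ^ K / 16 := by rw [pow_add]; norm_num [div_eq_mul_inv]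
  have h4 : (0 : ℝ) ≤ (1 / 2) ^ K := by positivity
  rw [h3]
  push_cast at h2 ⊢
  linarith

end Bounds

theorem diamondClose_of_isEmpty {m n : Type*} [Fintype m] [Fintype n] [DecidableEq n] [IsEmpty m]
    (Φ Ψ : Matrix m m ℂ →ₗ[ℂ] Matrix n n ℂ) (ε : ℝ) : DiamondClose Φ Ψ ε := by
  intro k ρ hρ
  have h := hρ.2
  rw [Matrix.trace, Finset.univ_eq_empty, Finset.sum_empty] at h
  exact absurd h zero_ne_one

theorem DiamondClose.mono {m n : Type*} [Fintype m] [Fintype n] [DecidableEq n]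
    {Φ Ψ : Matrix m m ℂ →ₗ[ℂ] Matrix n n ℂ} {ε η : ℝ} (h : DiamondClose Φ Ψ ε) (hε : ε ≤ η) :
    DiamondClose Φ Ψ η :=
  fun k ρ hρ E hE hE' => (h k ρ hρ E hE hE').trans hε

/-- The random purification channel has efficient circuits. -/
theorem exists_efficient_program {D : ℕ} {A : StarSubalgebra ℂ (Matrix (Fin D) (Fin D) ℂ)}
    {𝒟 : Decomposition A} {n n' : ℕ} {δ : ℝ} {V : Matrix (Fin n' → Bool) (Fin D) ℂ}
    (C : DecompositionCircuit 𝒟 n δ) (B : BasisChangeCircuit V n δ) (hD : D ≤ 2 ^ n)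
    (hV : Vᴴ * V = 1) (K : ℕ) :
    ∃ (N : ℕ) (Q : Prog N) (inp : Fin n ↪ Fin N) (out : Fin n ⊕ Fin n' ↪ Fin N),
      N + Q.size ≤ 1000 * (C.cost + B.cost + K + 1) ^ 3 ∧
      DiamondClose (Q.channel inp out) (conjMap (storeOut n V) ∘ₗ 𝒟.purify)
        ((1000 * (C.cost + B.cost + K + 1) ^ 3 : ℕ) * δ + (1 / 2 : ℝ) ^ K) := by
  have hn : n ≤ C.N := by simpa using Fintype.card_le_of_embedding C.inp
  have hn' : n' ≤ B.N := by simpa using Fintype.card_le_of_embedding B.out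
  have habc : C.a + (C.b + C.c) ≤ C.N := by simpa using Fintype.card_le_of_embedding C.out
  have hX : C.cost + B.cost + K = C.N + C.W.length + (B.N + B.W.length) + K := rfl
  set X := C.cost + B.cost + K
  have htriv : ∃ (inp : Fin n ↪ Fin (n + n')) (out : Fin n ⊕ Fin n' ↪ Fin (n + n')),
      n + n' + (ofCircuit [] : Prog (n + n')).size ≤ 1000 * (X + 1) ^ 3 ∧
      DiamondClose ((ofCircuit []).channel inp out) (conjMap (storeOut n V) ∘ₗ 𝒟.purify) 2 := by
    refine ⟨(Fin.castAddEmb n'), finSumFinEquiv.toEmbedding, ?_, diamondClose_skip hD hV _ _⟩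
    have h1 : X + 1 ≤ (X + 1) ^ 3 := Nat.le_self_pow (by norm_num) _
    rw [size_ofCircuit, List.length_nil]
    omega
  -- In dimension zero there are no states, and `0 ≤ δ` could not be deduced from the circuit.
  rcases Nat.eq_zero_or_pos D with h0 | h0
  · subst h0
    obtain ⟨inp, out, h1, -⟩ := htriv
    exact ⟨_, _, inp, out, h1, diamondClose_of_isEmpty _ _ _⟩
  have hδ : 0 ≤ δ := ApproxMaps.nonneg h0 C.approx
  -- For `δ ≥ 1` the permitted error exceeds `2`. Below, `δ < 1` is needed to pass to ideal
  -- unitaries.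
  rcases le_or_gt 1 δ with hδ1 | hδ1
  · obtain ⟨inp, out, h1, h2⟩ := htriv
    refine ⟨_, _, inp, out, h1, h2.mono ?_⟩
    have h3 : 1 ≤ (X + 1) ^ 3 := Nat.one_le_pow _ _ (by omega)
    have h4 : (2 : ℝ) ≤ ((1000 * (X + 1) ^ 3 : ℕ) : ℝ) := by
      exact_mod_cast (by omega : 2 ≤ 1000 * (X + 1) ^ 3)
    have h5 : (0 : ℝ) ≤ (1 / 2) ^ K := by positivity
    nlinarith
  · have hη1 : 2 * (1 / 2 : ℝ) ^ (K + 4) < 1 := by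
      have : (1 / 2 : ℝ) ^ K ≤ 1 := pow_le_one₀ (by norm_num) (by norm_num)
      rw [pow_add]
      linarith
    -- Five rounds reduce the weight of failure below `1/4`, since `(3/4)^5 < 1/4`. With `5 * (K +
    -- 4)` rounds the amplitude is therefore at most `η = (1/2)^(K + 4)`.
    have hr : (3 / 4 : ℝ) ^ (5 * (K + 4)) ≤ ((1 / 2) ^ (K + 4)) ^ 2 := by
      rw [pow_mul, ← pow_mul _ (K + 4) 2, mul_comm (K + 4) 2, pow_mul _ 2]
      exact pow_le_pow_left₀ (by norm_num) (by norm_num) _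
    obtain ⟨κ, _, _, F, τ, hκ, hF, hτ, hFτ⟩ :=
      exists_exact C B h0 hD hV hδ hδ1 (5 * (K + 4)) (by positivity) hη1 hr
    obtain ⟨N, Q, inp, out, h1, h2⟩ := exists_program hD hF hτ hFτ
    refine ⟨N, Q, inp, out, h1.trans ((le_of_eq ?_).trans (cost_bound hX hn habc)), h2.mono ?_⟩
    · simp only [Fintype.card_sum, Fintype.card_fin, hκ]
      ring
    · have h3 := error_bound (K := K) (b := C.b + C.c) (X := X) hδ (by omega) (by omega)
      push_cast at h3 ⊢
      exact h3

end RandomPurification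
end

/-! ### The main theorem -/

open RandomPurification MeasureTheory in
theorem mainTheorem1 :
    ∃ p : Polynomial ℕ, ∀ (D : ℕ) (A : StarSubalgebra ℂ (Matrix (Fin D) (Fin D) ℂ)),
      ∃ P : Matrix (Fin D) (Fin D) ℂ →ₗ[ℂ] Matrix (Fin D × Fin D) (Fin D × Fin D) ℂ,
        IsChannel P ∧
        -- random purification of invariant states
        (∀ ρ : Matrix (Fin D) (Fin D) ℂ, IsState ρ → ρ ∈ commutant A →
          P ρ = idTensor (Fin D) (hsProj (transposeSubspace A)) (stdPurification ρ) ∧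
          ∀ G : Subgroup (Matrix.unitaryGroup (Fin D) ℂ), SpansCommutant A G →
            ∀ [MeasurableSpace G] [BorelSpace G] (μ : Measure G) [μ.IsHaarMeasure]
              [IsProbabilityMeasure μ],
              P ρ = Matrix.of fun i j => ∫ g : G,
                ((1 ⊗ₖ (g.1 : Matrix (Fin D) (Fin D) ℂ)ᵀ) * stdPurification ρ *
                  (1 ⊗ₖ (g.1 : Matrix (Fin D) (Fin D) ℂ).map (starRingEnd ℂ)) :
                  Matrix (Fin D × Fin D) (Fin D × Fin D) ℂ) i j ∂μ) ∧
        -- symmetry of the output states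
        (∀ ρ : Matrix (Fin D) (Fin D) ℂ, IsState ρ →
          (∀ v : Fin D × Fin D → ℂ, WithLp.toLp 2 (P ρ *ᵥ v) ∈ symmSubspace A) ∧
          ∀ G : Subgroup (Matrix.unitaryGroup (Fin D) ℂ), SpansCommutant A G → ∀ g ∈ G,
            Commute (P ρ) (1 ⊗ₖ (g : Matrix (Fin D) (Fin D) ℂ)ᵀ)) ∧
        -- the decomposition of the Hilbert space exists
        Nonempty (Decomposition A) ∧
        -- efficiency
        (∀ (𝒟 : Decomposition A) (n : ℕ), D ≤ 2 ^ n →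
          ∀ (n' : ℕ) (V : Matrix (Fin n' → Bool) (Fin D) ℂ), Vᴴ * V = 1 →
          ∀ (δ : ℝ) (C : DecompositionCircuit 𝒟 n δ) (B : BasisChangeCircuit V n δ) (K : ℕ),
            ∃ (N : ℕ) (Q : Prog N) (inp : Fin n ↪ Fin N) (out : Fin n ⊕ Fin n' ↪ Fin N),
              N + Q.size ≤ p.eval (C.cost + B.cost + K) ∧
              DiamondClose (Q.channel inp out) (conjMap (storeOut n V) ∘ₗ P)
                ((p.eval (C.cost + B.cost + K) : ℕ) * δ + (1 / 2 : ℝ) ^ K)) ∧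
        -- explicit formulas
        (∀ (𝒟 : Decomposition A) (ρ : Matrix (Fin D) (Fin D) ℂ), IsState ρ →
          P ρ = symmProj A * (ρ ⊗ₖ 𝒟.Omega) * symmProj A ∧
          P ρ = CFC.sqrt (P 1) * (ρ ⊗ₖ (1 : Matrix (Fin D) (Fin D) ℂ)) * CFC.sqrt (P 1)) := by
  refine ⟨Polynomial.C 1000 * (Polynomial.X + 1) ^ 3, fun D A => ?_⟩
  have hp : ∀ s : ℕ, (Polynomial.C 1000 * (Polynomial.X + 1) ^ 3 : Polynomial ℕ).eval s =
      1000 * (s + 1) ^ 3 := fun s => by simp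
  obtain ⟨𝒟₀⟩ := nonempty_decomposition A
  refine ⟨𝒟₀.purify, 𝒟₀.isChannel_purify, fun ρ hρ hρA => ?_, fun ρ _ => ?_, ⟨𝒟₀⟩, ?_, ?_⟩
  · have h := 𝒟₀.purify_of_mem_commutant hρ.1 hρA
    exact ⟨h, fun G hG _ _ μ _ _ => h.trans (Decomposition.idTensor_hsProj_eq_integral 𝒟₀ ρ G hG μ)⟩
  · refine ⟨𝒟₀.purify_mulVec_mem ρ, fun G hG g hg => 𝒟₀.commute_purify ρ ?_⟩
    have h : (g : Matrix (Fin D) (Fin D) ℂ) ∈ asSubspace (commutant A) :=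
      hG.2 ▸ Submodule.subset_span ⟨g, hg, rfl⟩
    exact h
  · intro 𝒟 n hD n' V hV δ C B K
    -- The channel was built from a fixed decomposition; the circuit may refer to a different one.
    rw [hp, 𝒟₀.purify_unique 𝒟]
    exact exists_efficient_program C B hD hV K
  · intro 𝒟 ρ _
    rw [𝒟₀.purify_unique 𝒟]
    exact ⟨𝒟.purify_eq ρ, 𝒟.purify_eq_sqrt ρ⟩
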